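/- Let $p$ be an odd prime and let $f\in\mathbb C_p[x]$ be a non-constant polynomial with distinct roots. Let $\pi\colon X^{\mathrm{an}}\to\mathbb P^{1,\mathrm{an}}$ be the analytification of the smooth proper hyperelliptic curve $y^2=f(x)$ over $\mathbb C_p$, with its map $x$ to the line. Let $W\subset X(\mathbb C_p)$ be the set of Weierstrass points (the fixed points of $y\mapsto -y$), and let $S_f\subset\mathbb P^1(\mathbb C_p)$ be the set of zeroes of $f$, together with $\infty$ if $\deg f$ is odd. **Coverings.** A finite admissible covering $\mathcal C$ of $\mathbb P^{1,\mathrm{an}}$ by distinct wide opens (complements of finitely many disjoint closed discs) is *semistable* if (1) for distinct $U,V,U'\in\mathcal C$, $U$ is disconnected from every component of $V\cap U'$; (2) for $U\in\mathcal C$, $U^\circ=U\setminus\bigcup_{V\ne U}V$ is a non-empty affinoid whose canonical reduction $\overline{U^\circ}$ is irreducible, reduced, and has no singularities except ordinary double points; (3) $g(\mathbb P^1)=\sum_{U} g(\overline{U^\circ})+b_1(\Gamma(\mathcal C))$. It is *good* with respect to $S$ if every point of $S$ lies in at most one element of $\mathcal C$ and, for every $U\in\mathcal C$, there is a linear fractional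 transformation $\iota$ of $\mathbb P^1$, compatible with the reduction of $U$ (i.e. $\iota(U^\circ)$ is the complement of finitely many residue discs of $\mathbb P^{1,\mathrm{an}}$), such that the points of $\iota(S\cap U)$ lie in distinct residue discs. **Dual graphs.** The dual graph $\Gamma(\mathcal C,S)$ of a covering has the elements of the covering as vertices, one edge between $U\neq V$ for each connected component of $U\cap V$, one self-edge at $U$ for each ordinary double point of the canonical reduction of $U^\circ=U\setminus\bigcup_{V\ne U}V$, and one half-open edge for each point of $S$, attached to the element containing it. The graph $\Gamma(\mathcal C)$ is $\Gamma(\mathcal C,\emptyset)$. **The graph $\Gamma$.** Let $\mathcal C$ be a semistable covering of $\mathbb P^{1,\mathrm{an}}$ that is good with respect to $S_f$, and let $T=\Gamma(\mathcal C,S_f)$ (a tree). Half-open edges of $T$ are odd; an edge of $T$, corresponding to an annulus $A$, is even if $\pi^{-1}(A)$ is disconnected and odd otherwise; a vertex is even if all its adjacent edges (half-open ones included) are even, and odd otherwise. Let $\Gamma$ be the graph with one vertex $\tilde v$ for each odd vertex $v$ of $T$ and two vertices $\tilde v_+,\tilde v_-$ for each even vertex $v$; one edge $\tilde e$ for each odd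 edge $e$, two edges $\tilde e_+,\tilde e_-$ for each even edge $e$, and one half-open edge $\tilde e$ for each half-open edge $e$. For adjacent $v,e$ in $T$: if $v,e$ are odd, $\tilde v$ and $\tilde e$ are adjacent (half-open $e$ included); if $v$ is odd and $e$ is even, $\tilde v$ is adjacent to $\tilde e_+$ and $\tilde e_-$; if $v,e$ are even, $\tilde v_\sigma$ is adjacent to $\tilde e_\sigma$ for $\sigma=\pm$. It has a natural projection $\Gamma\to T$. **Proposition.** Let $\mathcal D$ be the covering of $X^{\mathrm{an}}$ by the connected components of the sets $\pi^{-1}(U)$, $U\in\mathcal C$. Then the dual graph $\Gamma(\mathcal D,W)$ is equal to $\Gamma$: there is an isomorphism of graphs with half-open edges $\Gamma(\mathcal D,W)\cong\Gamma$ over $T$, i.e. such that for a vertex $Y$, an edge given by a component $Z$ of an intersection, and a half-open edge $w\in W$ of $\Gamma(\mathcal D,W)$, the images in $T$ are the vertex $\pi(Y)$, the edge of the annulus $\pi(Z)$, and the half-open edge $\pi(w)$. In particular $\Gamma(\mathcal D,W)$ has no self-edges. -/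

import Mathlib

open Polynomial
open scoped ENNReal

noncomputable section

namespace BerkovichCover

/-! ## Berkovich analytification of a smooth projective curve, via its function field -/

/-- The Berkovich analytification of the smooth projective curve over `K` with function field `F`.
A point `ξ` records the value `|g(ξ)| ∈ [0, ∞]` of every rational function `g`; it is multiplicative
(except on the undefined products `0 · ∞`), ultrametric and extends the absolute value of `K`.
Such a `ξ` is a valuation ring `{g | |g(ξ)| < ∞}` of `F / K` together with a multiplicative norm,
extending that of `K`, on its residue field: for the valuation ring `F` these are the points given
by absolute values on `F`, and for the discrete valuation ring of a place (with residue field `K`,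
when `K` is algebraically closed) one gets the classical points of the curve. -/
structure AnPoint (K F : Type) [NormedField K] [CommRing F] [Algebra K F] where
  /-- the value `|g(ξ)|` -/
  val : F → ℝ≥0∞
  val_const : ∀ c : K, val (algebraMap K F c) = ‖c‖ₑ
  val_add : ∀ g h : F, val (g + h) ≤ max (val g) (val h)
  val_mul : ∀ g h : F, ¬(val g = 0 ∧ val h = ⊤) → ¬(val g = ⊤ ∧ val h = 0) →
    val (g * h) = val g * val h

section General

variable {K F F' : Type} [NormedField K] [CommRing F] [Algebra K F] [CommRing F'] [Algebra K F']

/-- The coarsest topology for which all functions `ξ ↦ |g(ξ)| ∈ [0, ∞]` are continuous. It is the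
Berkovich topology: the latter is compact and finer, and this one is Hausdorff. -/
instance : TopologicalSpace (AnPoint K F) := TopologicalSpace.induced AnPoint.val inferInstance

/-- The morphism of analytifications induced by an inclusion `φ` of function fields. -/
def AnPoint.comap (φ : F →ₐ[K] F') (ξ : AnPoint K F') : AnPoint K F where
  val g := ξ.val (φ g)
  val_const c := by rw [AlgHom.commutes]; exact ξ.val_const c
  val_add g h := by rw [map_add]; exact ξ.val_add _ _
  val_mul g h h₁ h₂ := by rw [map_mul]; exact ξ.val_mul _ _ h₁ h₂

/-- The classical points (the `K`-points of the curve, for `K` algebraically closed): some nonzero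
rational function vanishes there. -/
def AnPoint.IsClassical (ξ : AnPoint K F) : Prop := ∃ g : F, g ≠ 0 ∧ ξ.val g = 0

/-- `Z` is a connected component of the subspace `A`. -/
def IsComponentOf {Y : Type} [TopologicalSpace Y] (Z A : Set Y) : Prop :=
  ∃ x ∈ A, Z = connectedComponentIn A x

/-- `U° = U \ ⋃_{V ≠ U} V`. -/
def core {Y : Type} (C : Set (Set Y)) (U : Set Y) : Set Y := U \ ⋃ V ∈ C \ {U}, V

end General

/-! ## Canonical reduction -/

section Reduction

variable (K : Type) [NormedField K] [IsUltrametricDist K]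

/-- The valuation ring of `K`. -/
def integers : Subring K where
  carrier := {c | ‖c‖ ≤ 1}
  zero_mem' := by simp
  one_mem' := by simp
  add_mem' := fun {a b} ha hb => (IsUltrametricDist.norm_add_le_max a b).trans (max_le ha hb)
  mul_mem' := fun {a b} ha hb => by
    have h : ‖a * b‖ = ‖a‖ * ‖b‖ := norm_mul a b
    simp only [Set.mem_ofPred_eq] at *
    rw [h]; exact mul_le_one₀ ha (norm_nonneg b) hb
  neg_mem' := fun {a} ha => by simpa using ha

variable {K} {F : Type} [CommRing F] [Algebra K F]

set_option linter.unusedSectionVars false in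
/-- Multiplicativity of a point at functions that are finite there. -/
theorem AnPoint.val_mul_of_ne_top (ξ : AnPoint K F) {g h : F} (hg : ξ.val g ≠ ⊤)
    (hh : ξ.val h ≠ ⊤) : ξ.val (g * h) = ξ.val g * ξ.val h :=
  ξ.val_mul g h (fun H => hh H.2) (fun H => hg H.1)

/-- The rational functions that are bounded by `1` on `Z`. -/
def unitBall (Z : Set (AnPoint K F)) : Subalgebra (integers K) F where
  carrier := {g | ∀ ξ ∈ Z, ξ.val g ≤ 1}
  mul_mem' := fun {a b} ha hb ξ hξ => by
    rw [ξ.val_mul_of_ne_top (ne_top_of_le_ne_top ENNReal.one_ne_top (ha ξ hξ))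
      (ne_top_of_le_ne_top ENNReal.one_ne_top (hb ξ hξ))]
    exact mul_le_one' (ha ξ hξ) (hb ξ hξ)
  add_mem' := fun {a b} ha hb ξ hξ => (ξ.val_add a b).trans (max_le (ha ξ hξ) (hb ξ hξ))
  algebraMap_mem' := fun c ξ _ => by
    have h : ξ.val (algebraMap K F (c : K)) ≤ 1 := by
      rw [ξ.val_const, ← ofReal_norm]
      exact ENNReal.ofReal_le_one.2 c.2
    exact h

/-- The topologically nilpotent rational functions on `Z`: those with `|g| < 1` at all points of
the (compact) set `Z`. -/
def nilBall (Z : Set (AnPoint K F)) : Ideal (unitBall Z) where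
  carrier := {g | ∀ ξ ∈ Z, ξ.val (g : F) < 1}
  zero_mem' := fun ξ _ => by
    have h := ξ.val_const 0
    rw [map_zero, enorm_zero] at h
    change ξ.val 0 < 1
    rw [h]; exact one_pos
  add_mem' := fun {a b} ha hb ξ hξ =>
    (ξ.val_add (a : F) (b : F)).trans_lt (max_lt (ha ξ hξ) (hb ξ hξ))
  smul_mem' := fun c g hg ξ hξ => by
    have hc : ξ.val (c : F) ≤ 1 := c.2 ξ hξ
    have hg' : ξ.val (g : F) < 1 := hg ξ hξ
    change ξ.val ((c : F) * (g : F)) < 1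
    rw [ξ.val_mul_of_ne_top (ne_top_of_le_ne_top ENNReal.one_ne_top hc) (ne_top_of_lt hg')]
    exact (mul_le_of_le_one_left' hc).trans_lt hg'

/-- The coordinate ring of the canonical reduction of an affinoid `Z`: functions of sup norm at most
`1` modulo functions of sup norm less than `1`. The rational functions without poles on `Z` are
dense in the ring of analytic functions on `Z`, so they compute it. -/
def Reduction (Z : Set (AnPoint K F)) : Type := unitBall Z ⧸ nilBall Z

instance (Z : Set (AnPoint K F)) : CommRing (Reduction Z) :=
  inferInstanceAs (CommRing (unitBall Z ⧸ nilBall Z))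

instance (Z : Set (AnPoint K F)) : Algebra (integers K) (Reduction Z) :=
  inferInstanceAs (Algebra (integers K) (unitBall Z ⧸ nilBall Z))

/-- The closed point `m` of `Spec A` is an ordinary double point: the completed local ring is
`k[[u, v]] / (u v)`, where `k` is the residue field. -/
def IsOrdinaryDoublePoint {A : Type} [CommRing A] (m : MaximalSpectrum A) : Prop :=
  Nonempty (AdicCompletion m.asIdeal A ≃+*
    (MvPowerSeries (Fin 2) (A ⧸ m.asIdeal) ⧸
      Ideal.span {(MvPowerSeries.X 0 * MvPowerSeries.X 1 :
        MvPowerSeries (Fin 2) (A ⧸ m.asIdeal))}))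

end Reduction

/-! ## Genus of a function field -/

section Genus

variable (R L : Type) [CommRing R] [CommRing L] [Algebra R L]

/-- The places of the function field `L` over the constants coming from `R`: its nontrivial
valuation rings that contain the image of `R`. -/
def Place : Type :=
  {O : Subalgebra R L // O ≠ ⊤ ∧ ∀ x : L, x ∈ O ∨ ∃ y ∈ O, x * y = 1}

/-- The repartitions (adeles) of `L`. -/
def repartitions : Submodule R (Place R L → L) where
  carrier := {r | {P : Place R L | r P ∉ P.1}.Finite}
  zero_mem' := by simp
  add_mem' := fun {a b} ha hb => (ha.union hb).subset fun P hP => by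
    by_contra h
    simp only [Set.mem_union, Set.mem_ofPred_eq, not_or, not_not] at h
    exact hP (P.1.add_mem h.1 h.2)
  smul_mem' := fun c r hr => hr.subset fun P hP h => hP (P.1.smul_mem h c)

/-- The constant families and the everywhere integral families. -/
def principalAddIntegral : Submodule R (Place R L → L) :=
  LinearMap.range (LinearMap.pi fun _ : Place R L => (LinearMap.id : L →ₗ[R] L)) ⊔
    Submodule.pi Set.univ fun P : Place R L => Subalgebra.toSubmodule P.1

/-- The genus of the smooth projective curve with function field `L` over the field of constants
which is the image of `R`: the dimension of the space of repartitions modulo principal and integral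
ones, that is, of `H¹` of the structure sheaf. (The length over `R` is the dimension over the image
of `R`.) -/
def genus : ℕ∞ :=
  Module.length R (repartitions R L ⧸ (principalAddIntegral R L).submoduleOf (repartitions R L))

end Genus

/-! ## Graphs with half-open edges -/

/-- A graph with vertices `V`, closed edges `E` (loops and multiple edges are allowed) and half-open
edges `H`, given by the incidence relations. A closed edge that is incident to only one vertex is
a loop. -/
structure HGraph where
  /-- vertices -/
  V : Type
  /-- closed edges -/
  E : Type
  /-- half-open edges -/
  H : Type
  inc : E → V → Prop
  hinc : H → V → Prop

namespace HGraph

/-- Isomorphisms of graphs with half-open edges. -/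
structure Iso (G G' : HGraph) where
  onV : G.V ≃ G'.V
  onE : G.E ≃ G'.E
  onH : G.H ≃ G'.H
  inc_iff : ∀ e v, G'.inc (onE e) (onV v) ↔ G.inc e v
  hinc_iff : ∀ h v, G'.hinc (onH h) (onV v) ↔ G.hinc h v

/-- The connected components of a graph. -/
def Components (G : HGraph) : Type := Quot fun v w : G.V => ∃ e, G.inc e v ∧ G.inc e w

/-- The first Betti number of a finite graph. -/
def bettiOne (G : HGraph) : ℕ∞ := ENat.card G.E + ENat.card G.Components - ENat.card G.V

variable (T : HGraph) (evenE : T.E → Prop)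

/-- A vertex is even when all its adjacent edges are even; half-open edges are odd. -/
def EvenVertex (v : T.V) : Prop := (∀ e, T.inc e v → evenE e) ∧ ∀ h, ¬ T.hinc h v

/-- The graph obtained from `T` by doubling the even vertices and the even edges (the two copies
are labelled by a sign in `Bool`) and keeping the odd vertices, the odd edges and the half-open
edges. -/
def double : HGraph where
  V := {v // ¬ T.EvenVertex evenE v} ⊕ ({v // T.EvenVertex evenE v} × Bool)
  E := {e // ¬ evenE e} ⊕ ({e // evenE e} × Bool)
  H := T.H
  inc
    | .inl e, .inl v => T.inc e.1 v.1
    | .inl _, .inr _ => False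
    | .inr (e, _), .inl v => T.inc e.1 v.1
    | .inr (e, σ), .inr (v, τ) => T.inc e.1 v.1 ∧ σ = τ
  hinc
    | h, .inl v => T.hinc h v.1
    | _, .inr _ => False

/-- The projection `Γ → T` on vertices. -/
def double.projV : (T.double evenE).V → T.V := Sum.elim (fun v => v.1) (fun v => v.1.1)

/-- The projection `Γ → T` on closed edges. -/
def double.projE : (T.double evenE).E → T.E := Sum.elim (fun e => e.1) (fun e => e.1.1)

/-- The projection `Γ → T` on half-open edges. -/
def double.projH : (T.double evenE).H → T.H := fun h => h

end HGraph

/-! ## The dual graph of a covering -/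

section DualGraph

variable {K F : Type} [NormedField K] [IsUltrametricDist K] [CommRing F] [Algebra K F]

/-- An edge between two distinct elements of `C`: an unordered pair `{U, V}` with `U ≠ V`, and
a connected component of `U ∩ V`. -/
def CrossEdge (C : Set (Set (AnPoint K F))) : Type :=
  {e : Sym2 C × Set (AnPoint K F) //
    ¬ e.1.IsDiag ∧ IsComponentOf e.2 (⋂ U ∈ e.1, (U : Set (AnPoint K F)))}

/-- A self-edge: an element `U` of `C` and an ordinary double point of the reduction of `U`. -/
def SelfEdge (C : Set (Set (AnPoint K F))) : Type :=
  Σ U : C, {m : MaximalSpectrum (Reduction (core C (U : Set (AnPoint K F)))) //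
    IsOrdinaryDoublePoint m}

/-- The dual graph of the covering `C` with respect to the set of points `S`. -/
def dualGraph (C : Set (Set (AnPoint K F))) (S : Set (AnPoint K F)) : HGraph where
  V := C
  E := CrossEdge C ⊕ SelfEdge C
  H := S
  inc
    | .inl e, U => U ∈ e.1.1
    | .inr e, U => U = e.1
  hinc s U := (s : AnPoint K F) ∈ (U : Set (AnPoint K F))

end DualGraph

/-! ## Good semistable coverings of the projective line -/

section Line

variable (K : Type) [NormedField K]

/-- The Berkovich projective line. -/
abbrev P1an : Type := AnPoint K (RatFunc K)

variable {K}

/-- The coordinates on the projective line: the linear fractional transformations. -/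
def IsCoordinate (t : RatFunc K) : Prop :=
  ∃ a b c d : K, a * d - b * c ≠ 0 ∧
    t = (RatFunc.C a * RatFunc.X + RatFunc.C b) / (RatFunc.C c * RatFunc.X + RatFunc.C d)

/-- Closed discs, with radius in `|Kˣ|`, around a point of the line (possibly `∞`). -/
def IsClosedDisc (D : Set (P1an K)) : Prop := ∃ t, IsCoordinate t ∧ D = {ξ | ξ.val t ≤ 1}

/-- Open discs, with radius in `|Kˣ|`, around a point of the line (possibly `∞`). -/
def IsOpenDisc (D : Set (P1an K)) : Prop := ∃ t, IsCoordinate t ∧ D = {ξ | ξ.val t < 1}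

/-- Wide open subspaces of the line: complements of finitely many disjoint closed discs. -/
def IsWideOpen (U : Set (P1an K)) : Prop :=
  ∃ 𝒟 : Set (Set (P1an K)), 𝒟.Finite ∧ (∀ D ∈ 𝒟, IsClosedDisc D) ∧ 𝒟.PairwiseDisjoint id ∧
    U = (⋃₀ 𝒟)ᶜ

/-- Connected affinoid subdomains of the line (if nonempty): complements of finitely many, at least
one, open discs. -/
def IsAffinoid (Z : Set (P1an K)) : Prop :=
  ∃ 𝒟 : Set (Set (P1an K)), 𝒟.Finite ∧ 𝒟.Nonempty ∧ (∀ D ∈ 𝒟, IsOpenDisc D) ∧ Z = (⋃₀ 𝒟)ᶜ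

/-- The residue discs of the good reduction model of the line given by the coordinate `t`. -/
def IsResidueDisc (t : RatFunc K) (D : Set (P1an K)) : Prop :=
  (∃ a : K, ‖a‖ ≤ 1 ∧ D = {ξ | ξ.val (t - RatFunc.C a) < 1}) ∨ D = {ξ | 1 < ξ.val t}

/-- Semistable coverings of the projective line. An open covering of the Berkovich line by finitely
many wide opens is the same as a finite admissible covering. -/
structure IsSemistableCovering [IsUltrametricDist K] (C : Set (Set (P1an K))) : Prop where
  finite : C.Finite
  wideOpen : ∀ U ∈ C, IsWideOpen U
  covers : ⋃₀ C = Set.univ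
  disconnected : ∀ U ∈ C, ∀ V ∈ C, ∀ W ∈ C, U ≠ V → V ≠ W → U ≠ W →
    ∀ Z, IsComponentOf Z (V ∩ W) → Disjoint U Z
  core_nonempty : ∀ U ∈ C, (core C U).Nonempty
  core_affinoid : ∀ U ∈ C, IsAffinoid (core C U)
  /-- the reduction is irreducible and reduced -/
  core_irreducible : ∀ U ∈ C, IsDomain (Reduction (core C U))
  /-- the reduction has no singularities except ordinary double points -/
  core_nodal : ∀ U ∈ C, ∀ m : MaximalSpectrum (Reduction (core C U)),
    IsRegularLocalRing (Localization.AtPrime m.asIdeal) ∨ IsOrdinaryDoublePoint m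
  genus_eq : genus K (RatFunc K) =
    (∑ᶠ U ∈ C, genus (integers K) (FractionRing (Reduction (core C U)))) +
      (dualGraph C ∅).bettiOne

/-- The covering `C` is good with respect to `S`: each point of `S` lies in at most one element of
`C`, and each `U ∈ C` has an embedding `t` into the line (a linear fractional transformation),
compatible with the reduction of `U` (the set `U°` is the complement of finitely many residue discs
of `t`), for which the points of `S ∩ U` lie in distinct residue discs. -/
def IsGood (C : Set (Set (P1an K))) (S : Set (P1an K)) : Prop :=
  (∀ s ∈ S, ∀ U ∈ C, ∀ V ∈ C, s ∈ U → s ∈ V → U = V) ∧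
  ∀ U ∈ C, ∃ t : RatFunc K, IsCoordinate t ∧
    (∃ 𝒟 : Set (Set (P1an K)), 𝒟.Finite ∧ (∀ D ∈ 𝒟, IsResidueDisc t D) ∧ core C U = (⋃₀ 𝒟)ᶜ) ∧
    ∀ D, IsResidueDisc t D → (S ∩ U ∩ D).Subsingleton

end Line

/-! ## Hyperelliptic coverings -/

section Hyperelliptic

variable {K : Type} [NormedField K] (f : K[X])

/-- The function field `K(x)[y] / (y² - f(x))` of the hyperelliptic curve `y² = f(x)`. -/
abbrev HypField : Type :=
  AdjoinRoot (X ^ 2 - C (algebraMap K[X] (RatFunc K) f) : (RatFunc K)[X])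

/-- The analytification of the proper smooth hyperelliptic curve `y² = f(x)`. -/
abbrev HypCurve : Type := AnPoint K (HypField f)

/-- The double cover `π`. -/
def hypProj : HypCurve f → P1an K :=
  AnPoint.comap (IsScalarTower.toAlgHom K (RatFunc K) (HypField f))

/-- The hyperelliptic involution `x ↦ x`, `y ↦ -y` on the function field. -/
def hypInvol : HypField f →ₐ[K] HypField f :=
  AdjoinRoot.liftAlgHom _ (IsScalarTower.toAlgHom K (RatFunc K) (HypField f))
    (-AdjoinRoot.root _) (by
      have h := AdjoinRoot.eval₂_root
        (X ^ 2 - C (algebraMap K[X] (RatFunc K) f) : (RatFunc K)[X])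
      simp only [eval₂_sub, eval₂_pow, eval₂_X, eval₂_C, neg_sq] at h ⊢
      exact h)

/-- The Weierstrass points: the classical points fixed by the hyperelliptic involution. -/
def weierstrassPoints : Set (HypCurve f) :=
  {ξ | ξ.IsClassical ∧ ξ.comap (hypInvol f) = ξ}

/-- The roots of `f` on the projective line: its zeroes, and `∞` if the degree is odd. -/
def rootSet : Set (P1an K) :=
  {ξ | ξ.val (algebraMap K[X] (RatFunc K) f) = 0 ∨ (Odd f.natDegree ∧ ξ.val RatFunc.X = ⊤)}

/-- The covering of the hyperelliptic curve by the connected components of the inverse images of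
the elements of `C`. -/
def inducedCovering (C : Set (Set (P1an K))) : Set (Set (HypCurve f)) :=
  {Y | ∃ U ∈ C, IsComponentOf Y (hypProj f ⁻¹' U)}

variable [IsUltrametricDist K]

/-- An edge of `T` is even when the inverse image of the corresponding annulus is disconnected. -/
def IsEvenEdge (C : Set (Set (P1an K))) : (dualGraph C (rootSet f)).E → Prop
  | .inl e => ¬ IsConnected (hypProj f ⁻¹' e.1.2)
  | .inr _ => False

/-- The combinatorial graph `Γ` attached to the tree `T = Γ(C, S_f)`. -/
def hypGraph (C : Set (Set (P1an K))) : HGraph :=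
  (dualGraph C (rootSet f)).double (IsEvenEdge f C)

end Hyperelliptic

end BerkovichCover

end

/-! The proof combines a topological statement about double covers of tree-like coverings with
several geometric inputs.

Topology. The map `π` is a closed surjection whose fibres are the orbits of the involution `σ`
(`isInvolutiveCover_hyp`). Hence the inverse image of a connected set `A` is either connected or has
exactly two components, which `σ` exchanges and each of which maps onto `A`. The components of
intersections upstairs are exactly the components of the inverse images of the annuli
(`isComponentOf_preimage_of_inter`, `exists_crossEdge`). So the vertices and edges of the dual graph
upstairs come in ones or twos over those of `T`, and it remains to label the two components by signs
so that containment of an edge in a vertex becomes equality of signs. Arbitrary choices of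
components produce an `𝔽₂`-valued discrepancy on the edges. Since the first Betti number is `0`, it
is a coboundary (`exists_coboundary`), and changing the labels by a cochain removes it
(`exists_signs`, `exists_iso_double`). The Betti number vanishes because it is a summand in the
genus formula and the line has genus `0`, which is the theorem on partial fractions
(`genus_ratFunc`).

Fibres. Norms extend along the quadratic extension at every non-classical point; Gauss points are
dense and the image of `π` is closed, so `π` is surjective. At a non-classical point the norm and
the trace determine the values of a function at a point and its conjugate, up to order. At a
classical point the parity of the order of `f` decides: even order gives two conjugate points, odd
order gives one fixed point. As `f` has simple roots, odd order means membership in `S_f`, so `W`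
maps bijectively to `S_f`.

Parity of vertices (`evenVertex_iff`). A splitting over `U` restricts to every adjacent annulus and
excludes fixed points over `U`, hence roots of `f` in `U`. Conversely, `U` is an open disc minus
closed discs (holes). Let `f` have no root in `U`, and remove from `f` a square so that a product of
distinct linear factors remains. If every hole contains evenly many of the zeros, replacing each
zero in a hole by the centre of the hole, and each factor with a zero outside the disc by a
constant, shows that `f = g² (1 + small)`. Because `|2| = 1`, the sets `y / g ≡ 1` and `y / g ≡ -1`
then separate the inverse image. If some hole contains oddly many zeros, `f` has odd slope at the
Gauss points just outside that hole; the points over them are fixed by `σ`, and the edge through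
them is odd (`exists_sq_or_exists_odd_edge`).

No self-edges. By goodness, `U°` is `{|t| ≤ 1, |t - b| ≥ 1}` with the roots of `f` in distinct
residue discs. The reduction of a component over it is either that of `U°` itself (split case) or is
generated by a square root of a function with simple zeros. In both cases a maximal ideal is
generated by one element modulo its square (`exists_le_span_sup_sq`), whereas an ordinary double
point needs two (`not_isOrdinaryDoublePoint`). -/

namespace BerkovichCover

open Topology Filter

/-! ### Calculus with points; compactness and Hausdorffness of the analytification -/

section Points

variable {K F F' : Type} [NormedField K] [Field F] [Algebra K F] [Field F'] [Algebra K F']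

namespace AnPoint

@[ext] theorem ext {ξ η : AnPoint K F} (h : ∀ g, ξ.val g = η.val g) : ξ = η := by
  cases ξ; cases η; congr; exact funext h

theorem val_injective : Function.Injective (AnPoint.val : AnPoint K F → F → ℝ≥0∞) :=
  fun _ _ h => ext (congrFun h)

variable (ξ : AnPoint K F)

@[simp] theorem val_zero : ξ.val 0 = 0 := by
  simpa using ξ.val_const 0

@[simp] theorem val_one : ξ.val 1 = 1 := by
  simpa using ξ.val_const 1

theorem const_ne_top (c : K) : ξ.val (algebraMap K F c) ≠ ⊤ := by
  rw [ξ.val_const]; exact enorm_ne_top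

theorem const_ne_zero {c : K} (hc : c ≠ 0) : ξ.val (algebraMap K F c) ≠ 0 := by
  rw [ξ.val_const]; simpa using hc

theorem val_const_mul {c : K} (hc : c ≠ 0) (g : F) :
    ξ.val (algebraMap K F c * g) = ‖c‖ₑ * ξ.val g := by
  rw [ξ.val_mul _ _ (fun h => ξ.const_ne_zero hc h.1) (fun h => ξ.const_ne_top c h.1), ξ.val_const]

@[simp] theorem val_neg (g : F) : ξ.val (-g) = ξ.val g := by
  have h := ξ.val_const_mul (c := -1) (by simp) g
  simpa using h

theorem val_sub (g h : F) : ξ.val (g - h) ≤ max (ξ.val g) (ξ.val h) := by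
  simpa [sub_eq_add_neg] using ξ.val_add g (-h)

theorem val_sub_comm (g h : F) : ξ.val (g - h) = ξ.val (h - g) := by
  rw [← ξ.val_neg, neg_sub]

theorem val_add_of_lt {g h : F} (hlt : ξ.val g < ξ.val h) : ξ.val (g + h) = ξ.val h := by
  refine le_antisymm ((ξ.val_add g h).trans (max_le hlt.le le_rfl)) ?_
  have h1 := ξ.val_sub (g + h) g
  rw [add_sub_cancel_left] at h1
  rcases le_max_iff.1 h1 with h2 | h2
  · exact h2
  · exact absurd h2 (not_le.2 hlt)

theorem val_eq_of_sub_lt {g h : F} (hlt : ξ.val (g - h) < ξ.val h) : ξ.val g = ξ.val h := by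
  simpa using ξ.val_add_of_lt hlt

theorem val_add_of_ne {g h : F} (hne : ξ.val g ≠ ξ.val h) :
    ξ.val (g + h) = max (ξ.val g) (ξ.val h) := by
  rcases lt_or_gt_of_ne hne with h1 | h1
  · rw [ξ.val_add_of_lt h1, max_eq_right h1.le]
  · rw [add_comm, ξ.val_add_of_lt h1, max_eq_left h1.le]

theorem val_inv (g : F) (hg : g ≠ 0) : ξ.val g⁻¹ = (ξ.val g)⁻¹ := by
  by_cases h1 : ξ.val g = 0 ∧ ξ.val g⁻¹ = ⊤
  · simp [h1.1, h1.2]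
  by_cases h2 : ξ.val g = ⊤ ∧ ξ.val g⁻¹ = 0
  · simp [h2.1, h2.2]
  have h := ξ.val_mul g g⁻¹ h1 h2
  rw [mul_inv_cancel₀ hg, val_one, mul_comm] at h
  exact ENNReal.eq_inv_of_mul_eq_one_left h.symm

theorem val_mul_of_left {g h : F} (h0 : ξ.val g ≠ 0) (h1 : ξ.val g ≠ ⊤) :
    ξ.val (g * h) = ξ.val g * ξ.val h :=
  ξ.val_mul g h (fun h => h0 h.1) (fun h => h1 h.1)

theorem val_mul_of_right {g h : F} (h0 : ξ.val h ≠ 0) (h1 : ξ.val h ≠ ⊤) :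
    ξ.val (g * h) = ξ.val g * ξ.val h :=
  ξ.val_mul g h (fun h => h1 h.2) (fun h => h0 h.2)

theorem val_pow (g : F) (n : ℕ) : ξ.val (g ^ n) = ξ.val g ^ n := by
  induction n with
  | zero => simp
  | succ n ih =>
    rw [pow_succ, pow_succ, ξ.val_mul, ih]
    · rintro ⟨h1, h2⟩; rw [ih] at h1
      rcases Nat.eq_zero_or_pos n with rfl | hn
      · simp at h1
      · simp [h2, hn.ne'] at h1
    · rintro ⟨h1, h2⟩; rw [ih] at h1
      rcases Nat.eq_zero_or_pos n with rfl | hn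
      · simp at h1
      · simp [h2, hn.ne'] at h1

theorem val_mul_of_finite {g h : F} (hg : ξ.val g ≠ ⊤) (hh : ξ.val h ≠ ⊤) :
    ξ.val (g * h) = ξ.val g * ξ.val h :=
  ξ.val_mul g h (fun H => hh H.2) (fun H => hg H.1)

theorem val_mul_lt_one {g h : F} (hg : ξ.val g ≤ 1) (hh : ξ.val h < 1) : ξ.val (g * h) < 1 := by
  rw [ξ.val_mul_of_finite (ne_top_of_le_ne_top ENNReal.one_ne_top hg) (ne_top_of_lt hh)]
  exact (mul_le_of_le_one_left' hg).trans_lt hh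

theorem val_mul_le_one {g h : F} (hg : ξ.val g ≤ 1) (hh : ξ.val h ≤ 1) : ξ.val (g * h) ≤ 1 := by
  rw [ξ.val_mul_of_finite (ne_top_of_le_ne_top ENNReal.one_ne_top hg)
    (ne_top_of_le_ne_top ENNReal.one_ne_top hh)]
  exact mul_le_one' hg hh

/-- `g` and `1 / g` have finite nonzero value together. -/
theorem val_div_of {g h : F} (h0 : ξ.val h ≠ 0) (h1 : ξ.val h ≠ ⊤) :
    ξ.val (g / h) = ξ.val g / ξ.val h := by
  have hh : h ≠ 0 := by rintro rfl; simp at h0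
  rw [div_eq_mul_inv, ξ.val_mul_of_right, ξ.val_inv _ hh, ENNReal.div_eq_inv_mul, mul_comm]
  · rw [ξ.val_inv _ hh]; simpa using h1
  · rw [ξ.val_inv _ hh]; simpa using h0

theorem isClassical_of_val_eq_top {g : F} (h : ξ.val g = ⊤) : ξ.IsClassical := by
  have hg : g ≠ 0 := by rintro rfl; simp at h
  exact ⟨g⁻¹, inv_ne_zero hg, by rw [ξ.val_inv _ hg, h]; simp⟩

variable {ξ}

theorem val_ne_zero_of_not_isClassical (h : ¬ ξ.IsClassical) {g : F} (hg : g ≠ 0) :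
    ξ.val g ≠ 0 := fun h0 => h ⟨g, hg, h0⟩

theorem val_ne_top_of_not_isClassical (h : ¬ ξ.IsClassical) (g : F) : ξ.val g ≠ ⊤ :=
  fun h0 => h (ξ.isClassical_of_val_eq_top h0)

theorem val_mul_of_not_isClassical (h : ¬ ξ.IsClassical) (g g' : F) :
    ξ.val (g * g') = ξ.val g * ξ.val g' :=
  ξ.val_mul_of_finite (val_ne_top_of_not_isClassical h g) (val_ne_top_of_not_isClassical h g')

theorem val_enorm_sub_of_val_sub_eq_zero {g : F} {a : K} (h : ξ.val (g - algebraMap K F a) = 0) :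
    ξ.val g = ‖a‖ₑ := by
  by_cases ha : a = 0
  · subst ha; simpa using h
  rw [← ξ.val_const]
  exact ξ.val_eq_of_sub_lt (by rw [h]; exact pos_iff_ne_zero.2 (ξ.const_ne_zero ha))

theorem continuous_val (g : F) : Continuous fun ξ : AnPoint K F => ξ.val g :=
  (continuous_apply g).comp continuous_induced_dom

theorem isInducing_val : IsInducing (AnPoint.val : AnPoint K F → F → ℝ≥0∞) := ⟨rfl⟩

theorem isEmbedding_val : IsEmbedding (AnPoint.val : AnPoint K F → F → ℝ≥0∞) :=
  ⟨isInducing_val, val_injective⟩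

instance : T2Space (AnPoint K F) := isEmbedding_val.t2Space

/-- Each axiom is a closed condition on the product of copies of `[0, ∞]`. For multiplicativity this
uses that the product on `[0, ∞]` is continuous away from `(0, ∞)` and `(∞, 0)`, exactly the pairs
that the axiom leaves out. Compactness of the space of points follows by Tychonoff. -/
theorem isClosed_range_val :
    IsClosed (Set.range (AnPoint.val : AnPoint K F → F → ℝ≥0∞)) := by
  have : Set.range (AnPoint.val : AnPoint K F → F → ℝ≥0∞) =
      (⋂ c : K, {v | v (algebraMap K F c) = ‖c‖ₑ}) ∩
      (⋂ g : F, ⋂ h : F, {v | v (g + h) ≤ max (v g) (v h)}) ∩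
      (⋂ g : F, ⋂ h : F, {v | ¬(v g = 0 ∧ v h = ⊤) → ¬(v g = ⊤ ∧ v h = 0) →
        v (g * h) = v g * v h}) := by
    ext v
    simp only [Set.mem_range, Set.mem_inter_iff, Set.mem_iInter, Set.mem_ofPred_eq]
    constructor
    · rintro ⟨ξ, rfl⟩
      exact ⟨⟨ξ.val_const, ξ.val_add⟩, ξ.val_mul⟩
    · rintro ⟨⟨h1, h2⟩, h3⟩
      exact ⟨⟨v, h1, h2, h3⟩, rfl⟩
  rw [this]
  refine ((isClosed_iInter fun c => ?_).inter (isClosed_iInter fun g => isClosed_iInter fun h => ?_)).inter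
    (isClosed_iInter fun g => isClosed_iInter fun h => ?_)
  · exact isClosed_eq (continuous_apply _) continuous_const
  · exact isClosed_le (continuous_apply _) ((continuous_apply g).max (continuous_apply h))
  · rw [← isOpen_compl_iff, isOpen_iff_mem_nhds]
    intro v hv
    simp only [Set.mem_compl_iff, Set.mem_ofPred_eq, Classical.not_imp] at hv
    obtain ⟨h1, h2, h3⟩ := hv
    have c1 : Tendsto (fun w : F → ℝ≥0∞ => w g) (𝓝 v) (𝓝 (v g)) := (continuous_apply g).tendsto v
    have c2 : Tendsto (fun w : F → ℝ≥0∞ => w h) (𝓝 v) (𝓝 (v h)) := (continuous_apply h).tendsto v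
    have c3 : Tendsto (fun w : F → ℝ≥0∞ => w (g * h)) (𝓝 v) (𝓝 (v (g * h))) :=
      (continuous_apply (g * h)).tendsto v
    have hm : Tendsto (fun w : F → ℝ≥0∞ => w g * w h) (𝓝 v) (𝓝 (v g * v h)) := by
      refine ENNReal.Tendsto.mul c1 ?_ c2 ?_
      · by_contra hc; push Not at hc; exact h1 hc
      · by_contra hc; push Not at hc; exact h2 ⟨hc.2, hc.1⟩
    have e1 : ∀ᶠ w : F → ℝ≥0∞ in 𝓝 v, ¬ (w g = 0 ∧ w h = ⊤) := by
      have : Tendsto (fun w : F → ℝ≥0∞ => (w g, w h)) (𝓝 v) (𝓝 (v g, v h)) := c1.prodMk_nhds c2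
      have := this.eventually_ne (b₂ := (0, ⊤)) (by simpa using h1)
      simpa using this
    have e2 : ∀ᶠ w : F → ℝ≥0∞ in 𝓝 v, ¬ (w g = ⊤ ∧ w h = 0) := by
      have : Tendsto (fun w : F → ℝ≥0∞ => (w g, w h)) (𝓝 v) (𝓝 (v g, v h)) := c1.prodMk_nhds c2
      have := this.eventually_ne (b₂ := (⊤, 0)) (by simpa using h2)
      simpa using this
    filter_upwards [e1, e2, (c3.prodMk_nhds hm).eventually
      (isClosed_diagonal.isOpen_compl.mem_nhds (x := (v (g * h), v g * v h)) h3)] with w w1 w2 w4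
    simp only [Set.mem_compl_iff, Set.mem_ofPred_eq, Classical.not_imp]
    exact ⟨w1, w2, w4⟩

instance : CompactSpace (AnPoint K F) :=
  (IsClosedEmbedding.mk isEmbedding_val isClosed_range_val).compactSpace

theorem continuous_comap (φ : F →ₐ[K] F') :
    Continuous (AnPoint.comap φ : AnPoint K F' → AnPoint K F) :=
  continuous_induced_rng.2 (continuous_pi fun g => continuous_val (φ g))

theorem isClosedMap_comap (φ : F →ₐ[K] F') :
    IsClosedMap (AnPoint.comap φ : AnPoint K F' → AnPoint K F) :=
  (continuous_comap φ).isClosedMap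

@[simp] theorem comap_val (φ : F →ₐ[K] F') (ξ : AnPoint K F') (g : F) :
    (ξ.comap φ).val g = ξ.val (φ g) := rfl

theorem tendsto_of_val {ι : Type*} {l : Filter ι} {u : ι → AnPoint K F} {ξ : AnPoint K F}
    (h : ∀ g, Tendsto (fun i => (u i).val g) l (𝓝 (ξ.val g))) : Tendsto u l (𝓝 ξ) :=
  isInducing_val.tendsto_nhds_iff.2 (tendsto_pi_nhds.2 h)

end AnPoint

end Points

end BerkovichCover

namespace BerkovichCover

open Topology Filter

/-! ### Connected components and covers whose fibres are orbits of an involution -/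

section Components

variable {Y : Type} [TopologicalSpace Y] {Z Z' A W : Set Y}

theorem IsComponentOf.subset (h : IsComponentOf Z A) : Z ⊆ A := by
  obtain ⟨x, _, rfl⟩ := h
  exact connectedComponentIn_subset A x

theorem IsComponentOf.isConnected (h : IsComponentOf Z A) : IsConnected Z := by
  obtain ⟨x, hx, rfl⟩ := h
  exact isConnected_connectedComponentIn_iff.2 hx

theorem IsComponentOf.subset_of_inter (h : IsComponentOf Z A) (hW : IsPreconnected W)
    (hWA : W ⊆ A) (hWZ : (W ∩ Z).Nonempty) : W ⊆ Z := by
  obtain ⟨x, hx, rfl⟩ := h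
  obtain ⟨w, hw, hwZ⟩ := hWZ
  rw [connectedComponentIn_eq hwZ]
  exact hW.subset_connectedComponentIn hw hWA

theorem IsComponentOf.eq_of_inter (h : IsComponentOf Z A) (h' : IsComponentOf Z' A)
    (hZ : (Z ∩ Z').Nonempty) : Z = Z' :=
  (h'.subset_of_inter h.isConnected.isPreconnected h.subset hZ).antisymm
    (h.subset_of_inter h'.isConnected.isPreconnected h'.subset (by rwa [Set.inter_comm]))

theorem isComponentOf_connectedComponentIn {x : Y} (hx : x ∈ A) :
    IsComponentOf (connectedComponentIn A x) A := ⟨x, hx, rfl⟩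

theorem IsComponentOf.exists_superset (h : IsComponentOf Z A) (hA : A ⊆ W) :
    ∃ Z', IsComponentOf Z' W ∧ Z ⊆ Z' := by
  obtain ⟨x, hx⟩ := h.isConnected.nonempty
  exact ⟨_, isComponentOf_connectedComponentIn (hA (h.subset hx)),
    h.isConnected.isPreconnected.subset_connectedComponentIn hx (h.subset.trans hA)⟩

theorem isComponentOf_self (h : IsConnected A) : IsComponentOf A A := by
  obtain ⟨x, hx⟩ := h.nonempty
  exact ⟨x, hx, (h.isPreconnected.connectedComponentIn hx).symm⟩

theorem IsComponentOf.eq_of_isConnected (h : IsComponentOf Z A) (hA : IsConnected A) : Z = A :=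
  h.eq_of_inter (isComponentOf_self hA) (by
    rw [Set.inter_eq_left.2 h.subset]; exact h.isConnected.nonempty)

end Components

/-- A closed surjection `π` whose fibres are the orbits of an involution `σ`. -/
structure IsInvolutiveCover {X B : Type} [TopologicalSpace X] [TopologicalSpace B]
    (π : X → B) (σ : X → X) : Prop where
  continuous : Continuous π
  isClosedMap : IsClosedMap π
  surjective : Function.Surjective π
  continuous_invol : Continuous σ
  invol : ∀ x, σ (σ x) = x
  proj_invol : ∀ x, π (σ x) = π x
  fiber : ∀ x y, π x = π y → y = x ∨ y = σ x

namespace IsInvolutiveCover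

variable {X B : Type} [TopologicalSpace X] [TopologicalSpace B] {π : X → B} {σ : X → X}
  (h : IsInvolutiveCover π σ) {A : Set B}
include h

/-- The union of an open set with its conjugate is open and saturated, so its closed complement is
saturated too, and `π` is closed. -/
theorem isOpenMap : IsOpenMap π := by
  intro O hO
  have : π '' O = (π '' (O ∪ σ ⁻¹' O)ᶜ)ᶜ := by
    ext b
    constructor
    · rintro ⟨x, hx, rfl⟩ ⟨y, hy, hyx⟩
      refine hy ?_
      rcases h.fiber x y hyx.symm with rfl | rfl
      · exact Or.inl hx
      · right; simpa [h.invol] using hx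
    · intro hb
      obtain ⟨x, rfl⟩ := h.surjective b
      by_contra hx
      refine hb ⟨x, ?_, rfl⟩
      rintro (h1 | h1)
      · exact hx ⟨x, h1, rfl⟩
      · exact hx ⟨σ x, h1, h.proj_invol x⟩
  rw [this, isOpen_compl_iff]
  exact h.isClosedMap _ (hO.union (hO.preimage h.continuous_invol)).isClosed_compl

/-- Both parts of a separation of `π⁻¹ A` map onto `A`. -/
theorem exists_mem_of_separation (hA : IsPreconnected A) {u v : Set X} (hu : IsOpen u)
    (hv : IsOpen v) (hcov : π ⁻¹' A ⊆ u ∪ v) (hdis : ¬ (π ⁻¹' A ∩ (u ∩ v)).Nonempty)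
    (hne : (π ⁻¹' A ∩ u).Nonempty) {b : B} (hb : b ∈ A) : ∃ x ∈ u, π x = b := by
  by_contra hcon
  push Not at hcon
  obtain ⟨x₀, hx₀A, hx₀⟩ := hne
  -- If the fibre over `b` misses `u`, then `A` is covered by two open sets: the image of `u`, and
  -- the set of points whose whole fibre lies in `v`. Both meet `A`, and a common point would have a
  -- fibre meeting `u ∩ v`.
  obtain ⟨c, hcA, ⟨x, hx, rfl⟩, hc⟩ := hA (π '' u) (π '' vᶜ)ᶜ (h.isOpenMap u hu)
    (h.isClosedMap _ hv.isClosed_compl).isOpen_compl (by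
      intro c hc
      by_cases hcv : c ∈ π '' vᶜ
      · obtain ⟨x, hx, rfl⟩ := hcv
        exact Or.inl ⟨x, (hcov hc).resolve_right hx, rfl⟩
      · exact Or.inr hcv) ⟨π x₀, hx₀A, x₀, hx₀, rfl⟩ ⟨b, hb, by
      rintro ⟨x, hx, rfl⟩
      exact hcon x ((hcov hb).resolve_right hx) rfl⟩
  refine hdis ⟨x, hcA, hx, ?_⟩
  by_contra hxv
  exact hc ⟨x, hxv, rfl⟩

/-- Both halves of a separation meet every fibre, and a fibre is a single orbit `{x, σ x}`. So each
half contains exactly one of the two points and `σ` exchanges the halves. -/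
theorem exists_of_not_isConnected (hA : IsConnected A) (hn : ¬ IsConnected (π ⁻¹' A)) :
    ∃ u v : Set X, IsOpen u ∧ IsOpen v ∧ π ⁻¹' A ⊆ u ∪ v ∧ ¬ (π ⁻¹' A ∩ (u ∩ v)).Nonempty ∧
      (∀ x ∈ π ⁻¹' A, x ∈ u → σ x ∈ v) ∧ (∀ x ∈ π ⁻¹' A, x ∈ v → σ x ∈ u) := by
  have hne : (π ⁻¹' A).Nonempty := hA.nonempty.preimage h.surjective
  have hn' : ¬ IsPreconnected (π ⁻¹' A) := fun hp => hn ⟨hne, hp⟩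
  unfold IsPreconnected at hn'
  push Not at hn'
  obtain ⟨u, v, hu, hv, hcov, hneu, hnev, hdis⟩ := hn'
  have hdis' : ¬ (π ⁻¹' A ∩ (u ∩ v)).Nonempty := by rw [hdis]; simp
  refine ⟨u, v, hu, hv, hcov, hdis', fun x hxA hx => ?_, fun x hxA hx => ?_⟩
  · obtain ⟨y, hy, hyx⟩ := h.exists_mem_of_separation hA.isPreconnected hv hu
      (by rwa [Set.union_comm]) (by rwa [Set.inter_comm v]) hnev hxA
    rcases h.fiber x y hyx.symm with rfl | rfl
    · exact absurd ⟨y, hxA, hx, hy⟩ hdis'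
    · exact hy
  · obtain ⟨y, hy, hyx⟩ := h.exists_mem_of_separation hA.isPreconnected hu hv hcov hdis' hneu hxA
    rcases h.fiber x y hyx.symm with rfl | rfl
    · exact absurd ⟨y, hxA, hy, hx⟩ hdis'
    · exact hy

theorem isConnected_of_fixed (hA : IsConnected A) {x : X} (hx : π x ∈ A) (hσ : σ x = x) :
    IsConnected (π ⁻¹' A) := by
  by_contra hn
  obtain ⟨u, v, -, -, hcov, hdis, h1, h2⟩ := h.exists_of_not_isConnected hA hn
  rcases hcov hx with hxu | hxv
  · exact hdis ⟨x, hx, hxu, hσ ▸ h1 x hx hxu⟩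
  · exact hdis ⟨x, hx, hσ ▸ h2 x hx hxv, hxv⟩

/-- A separation over `A` meets every fibre in both halves, so it still separates the inverse image
of any nonempty subset. -/
theorem not_isConnected_mono {A' : Set B} (hA : IsConnected A) (hn : ¬ IsConnected (π ⁻¹' A))
    (hA' : A'.Nonempty) (hsub : A' ⊆ A) : ¬ IsConnected (π ⁻¹' A') := by
  obtain ⟨u, v, hu, hv, hcov, hdis, h1, h2⟩ := h.exists_of_not_isConnected hA hn
  intro hc
  obtain ⟨b, hb⟩ := hA'
  obtain ⟨x, rfl⟩ := h.surjective b
  have hne : (π ⁻¹' A' ∩ u).Nonempty ∧ (π ⁻¹' A' ∩ v).Nonempty := by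
    have hσ : π (σ x) ∈ A' := by rwa [h.proj_invol]
    rcases hcov (hsub hb) with hxu | hxv
    · exact ⟨⟨x, hb, hxu⟩, σ x, hσ, h1 x (hsub hb) hxu⟩
    · exact ⟨⟨σ x, hσ, h2 x (hsub hb) hxv⟩, x, hb, hxv⟩
  obtain ⟨y, hy, hyuv⟩ := hc.isPreconnected u v hu hv
    ((Set.preimage_mono hsub).trans hcov) hne.1 hne.2
  exact hdis ⟨y, hsub hy, hyuv⟩

/-- A point or its conjugate lies in a given component, and not both unless the inverse image is
connected. -/
theorem component_dichotomy (hA : IsConnected A) (hn : ¬ IsConnected (π ⁻¹' A)) {Y : Set X}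
    (hY : IsComponentOf Y (π ⁻¹' A)) {x : X} (hx : π x ∈ A) : x ∈ Y ↔ σ x ∉ Y := by
  obtain ⟨u, v, hu, hv, hcov, hdis, h1, h2⟩ := h.exists_of_not_isConnected hA hn
  wlog hYu : (Y ∩ u).Nonempty generalizing u v
  · obtain ⟨y, hy⟩ := hY.isConnected.nonempty
    exact this v u hv hu (by rwa [Set.union_comm]) (by rwa [Set.inter_comm v]) h2 h1
      ⟨y, hy, (hcov (hY.subset hy)).resolve_left fun hyu => hYu ⟨y, hy, hyu⟩⟩
  have hYv : ∀ y ∈ Y, y ∉ v := fun y hy hyv => by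
    obtain ⟨z, hz, hzuv⟩ := hY.isConnected.isPreconnected u v hu hv (hY.subset.trans hcov) hYu
      ⟨y, hy, hyv⟩
    exact hdis ⟨z, hY.subset hz, hzuv⟩
  -- A half is connected: if it split again, each piece would be one side of a separation of `π⁻¹
  -- A`, hence would meet every fibre. Then some fibre would have two points in `u`, but the
  -- conjugate of a point of `u` lies in `v`.
  have hpre : IsPreconnected (π ⁻¹' A ∩ u) := by
    intro u₁ u₂ hu₁ hu₂ hc ⟨x₁, hx₁, hx₁u⟩ ⟨x₂, hx₂, hx₂u⟩
    by_contra hd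
    have key : ∀ (w₁ w₂ : Set X), IsOpen w₁ → IsOpen w₂ → π ⁻¹' A ∩ u ⊆ w₁ ∪ w₂ →
        ¬ ((π ⁻¹' A ∩ u) ∩ (w₁ ∩ w₂)).Nonempty → (π ⁻¹' A ∩ u ∩ w₁).Nonempty →
        ∃ x ∈ u ∩ w₁, π x = π x₁ := by
      intro w₁ w₂ hw₁ hw₂ hc hd ⟨z, hz, hzw⟩
      refine h.exists_mem_of_separation hA.isPreconnected (hu.inter hw₁) (hv.union (hu.inter hw₂))
        ?_ ?_ ⟨z, hz.1, hz.2, hzw⟩ hx₁.1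
      · intro a ha
        rcases hcov ha with hau | hav
        · rcases hc ⟨ha, hau⟩ with hw | hw
          · exact Or.inl ⟨hau, hw⟩
          · exact Or.inr (Or.inr ⟨hau, hw⟩)
        · exact Or.inr (Or.inl hav)
      · rintro ⟨a, ha, ⟨hau, haw⟩, hav | ⟨_, haw₂⟩⟩
        · exact hdis ⟨a, ha, hau, hav⟩
        · exact hd ⟨a, ⟨ha, hau⟩, haw, haw₂⟩
    obtain ⟨y₁, ⟨hy₁u, hy₁⟩, e₁⟩ := key u₁ u₂ hu₁ hu₂ hc hd ⟨x₁, hx₁, hx₁u⟩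
    obtain ⟨y₂, ⟨hy₂u, hy₂⟩, e₂⟩ := key u₂ u₁ hu₂ hu₁ (by rwa [Set.union_comm])
      (by rwa [Set.inter_comm u₂]) ⟨x₂, hx₂, hx₂u⟩
    have hyA : π y₁ ∈ A := e₁ ▸ hx₁.1
    rcases h.fiber y₁ y₂ (e₁.trans e₂.symm) with rfl | rfl
    · exact hd ⟨y₂, ⟨hyA, hy₁u⟩, hy₁, hy₂⟩
    · exact hdis ⟨σ y₁, by simpa [h.proj_invol] using hyA, hy₂u, h1 _ hyA hy₁u⟩
  have hYeq : Y = π ⁻¹' A ∩ u := by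
    refine Set.Subset.antisymm (fun y hy => ⟨hY.subset hy,
      (hcov (hY.subset hy)).resolve_right (hYv y hy)⟩) ?_
    obtain ⟨y, hy, hyu⟩ := hYu
    exact hY.subset_of_inter hpre Set.inter_subset_left ⟨y, ⟨hY.subset hy, hyu⟩, hy⟩
  subst hYeq
  have hxσ : π (σ x) ∈ A := by rwa [h.proj_invol]
  constructor
  · intro hxu hxσu
    exact hdis ⟨σ x, hxσ, hxσu.2, h1 x hx hxu.2⟩
  · intro hxσu
    refine ⟨hx, (hcov hx).resolve_right fun hxv => hxσu ⟨hxσ, h2 x hx hxv⟩⟩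

theorem component_image (hA : IsConnected A) {Y : Set X} (hY : IsComponentOf Y (π ⁻¹' A)) :
    π '' Y = A := by
  refine Set.Subset.antisymm (Set.image_subset_iff.2 hY.subset) fun b hb => ?_
  obtain ⟨x, rfl⟩ := h.surjective b
  by_cases hn : IsConnected (π ⁻¹' A)
  · exact ⟨x, by rw [hY.eq_of_isConnected hn]; exact hb, rfl⟩
  · by_cases hx : x ∈ Y
    · exact ⟨x, hx, rfl⟩
    · have := (h.component_dichotomy hA hn hY hb).not.1 hx
      exact ⟨σ x, not_not.1 this, h.proj_invol x⟩

/-- There are at most two components: for `x` in `Y`, every component other than `Y` must contain `σ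
x`. -/
theorem component_eq_of_not_mem (hA : IsConnected A) {Y Y' Y'' : Set X}
    (hn : ¬ IsConnected (π ⁻¹' A))
    (hY : IsComponentOf Y (π ⁻¹' A)) (hY' : IsComponentOf Y' (π ⁻¹' A))
    (hY'' : IsComponentOf Y'' (π ⁻¹' A)) (h' : Y' ≠ Y) (h'' : Y'' ≠ Y) : Y' = Y'' := by
  obtain ⟨x, hx⟩ := hY.isConnected.nonempty
  have hxA : π x ∈ A := hY.subset hx
  have mem : ∀ Z, IsComponentOf Z (π ⁻¹' A) → Z ≠ Y → σ x ∈ Z := by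
    intro Z hZ hne
    by_contra hσ
    exact hne (hZ.eq_of_inter hY ⟨x, (h.component_dichotomy hA hn hZ hxA).2 hσ, hx⟩)
  exact hY'.eq_of_inter hY'' ⟨σ x, mem _ hY' h', mem _ hY'' h''⟩

theorem exists_component_ne (hA : IsConnected A) {Y : Set X}
    (hn : ¬ IsConnected (π ⁻¹' A)) (hY : IsComponentOf Y (π ⁻¹' A)) :
    ∃ Y', IsComponentOf Y' (π ⁻¹' A) ∧ Y' ≠ Y := by
  obtain ⟨x, hx⟩ := hY.isConnected.nonempty
  have hxA : π x ∈ A := hY.subset hx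
  have hσ : π (σ x) ∈ A := by rwa [h.proj_invol]
  refine ⟨_, isComponentOf_connectedComponentIn (x := σ x) hσ, fun he => ?_⟩
  exact (h.component_dichotomy hA hn hY hxA).1 hx (he ▸ mem_connectedComponentIn hσ)

end IsInvolutiveCover

end BerkovichCover

/-! ### Cochains with coefficients in `𝔽₂` on a finite graph -/

namespace BerkovichCover

/-- On a finite graph with at most `|V| - |π₀|` edges, every `𝔽₂`-valued function on the edges is
a coboundary. -/
theorem exists_coboundary {V E : Type} [Finite V] [Finite E] (ends : E → Sym2 V)
    (hcard : Nat.card E + Nat.card (Quot fun v w : V => ∃ e, v ∈ ends e ∧ w ∈ ends e) ≤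
      Nat.card V) (d : E → ZMod 2) :
    ∃ s : V → ZMod 2, ∀ e, ∀ v w, ends e = s(v, w) → s v + s w = d e := by
  classical
  have := Fintype.ofFinite V
  have := Fintype.ofFinite E
  let r : V → V → Prop := fun v w => ∃ e, v ∈ ends e ∧ w ∈ ends e
  -- In characteristic two the coboundary is the sum over the ends, so no orientation of the edges
  -- is needed.
  let δ : (V → ZMod 2) →ₗ[ZMod 2] (E → ZMod 2) :=
    { toFun := fun s e => Sym2.lift ⟨fun v w => s v + s w, fun v w => add_comm _ _⟩ (ends e)
      map_add' := fun s t => by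
        funext e
        simp only [Pi.add_apply]
        induction ends e with
        | _ v w => simp; ring
      map_smul' := fun c s => by
        funext e
        simp only [Pi.smul_apply, RingHom.id_apply]
        induction ends e with
        | _ v w => simp; ring }
  let ψ : (Quot r → ZMod 2) →ₗ[ZMod 2] (V → ZMod 2) := LinearMap.funLeft _ _ (Quot.mk r)
  -- A cocycle of degree zero is constant on connected components. So the kernel has dimension at
  -- most `|π₀|`, the rank is at least `|V| - |π₀| ≥ |E|`, and `δ` is surjective.
  have hker : LinearMap.ker δ ≤ LinearMap.range ψ := by
    intro s hs
    have hs' : ∀ v w, r v w → s v = s w := by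
      rintro v w ⟨e, hv, hw⟩
      have he := congrFun (LinearMap.mem_ker.1 hs) e
      change Sym2.lift _ (ends e) = 0 at he
      obtain ⟨w', hw'⟩ := hv
      rw [hw'] at he hw
      simp only [Sym2.lift_mk] at he
      have h2 : s v = s w' := by
        have : s v = - s w' := eq_neg_of_add_eq_zero_left he
        rw [this, ZMod.neg_eq_self_mod_two]
      rcases Sym2.mem_iff.1 hw with rfl | rfl
      · rfl
      · exact h2
    exact ⟨Quot.lift s hs', rfl⟩
  have := Fintype.ofFinite (Quot r)
  have h1 : Module.finrank (ZMod 2) (LinearMap.ker δ) ≤ Nat.card (Quot r) := by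
    calc Module.finrank (ZMod 2) (LinearMap.ker δ)
        ≤ Module.finrank (ZMod 2) (LinearMap.range ψ) := Submodule.finrank_mono hker
      _ ≤ Module.finrank (ZMod 2) (Quot r → ZMod 2) := LinearMap.finrank_range_le ψ
      _ = Nat.card (Quot r) := by simp
  have h2 := LinearMap.finrank_range_add_finrank_ker δ
  have h3 : Module.finrank (ZMod 2) (V → ZMod 2) = Nat.card V := by simp
  have h4 : Module.finrank (ZMod 2) (E → ZMod 2) = Nat.card E := by simp
  have htop : LinearMap.range δ = ⊤ := by
    apply Submodule.eq_top_of_finrank_eq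
    refine le_antisymm (Submodule.finrank_le _) ?_
    change Nat.card E + Nat.card (Quot r) ≤ Nat.card V at hcard
    omega
  obtain ⟨s, hs⟩ := LinearMap.range_eq_top.1 htop d
  refine ⟨s, fun e v w he => ?_⟩
  rw [← hs]
  change _ = Sym2.lift _ (ends e)
  rw [he]; rfl

end BerkovichCover

/-! ### From an involutive cover of a tree-like covering to the doubled graph -/

namespace BerkovichCover

set_option linter.unusedSectionVars false

theorem decide_beq_decide_eq_iff (a b c d : Prop) [Decidable a] [Decidable b] [Decidable c]
    [Decidable d] :
    (decide a == decide b) = (decide c == decide d) ↔ ((a ↔ b) ↔ (c ↔ d)) := by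
  by_cases a <;> by_cases b <;> by_cases c <;> by_cases d <;> simp [*]

theorem iff_not_cases (p q : Prop) : ((¬ p ↔ q) ↔ ¬ (p ↔ q)) ∧ ((p ↔ ¬ q) ↔ ¬ (p ↔ q)) ∧
    ((¬ p ↔ ¬ q) ↔ ¬ ¬ (p ↔ q)) := by
  by_cases p <;> by_cases q <;> simp [*]

theorem iff_of_iff_iff_right {p q r : Prop} (h : (p ↔ r) ↔ (q ↔ r)) : p ↔ q := by
  by_cases p <;> by_cases q <;> by_cases r <;> simp_all

section Assembly

variable {K F L : Type} [NormedField K] [IsUltrametricDist K] [CommRing F] [Algebra K F]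
  [CommRing L] [Algebra K L]

/-- Used with `D A U` meaning that the chosen component over the edge `A` lies in the chosen
component over its end `U`. On each edge, the sum over both ends of the indicator of failure of `D`
is an `𝔽₂`-cochain; writing it as a coboundary gives the signs of the vertices. -/
theorem exists_signs {C : Set (Set (AnPoint K F))} (hC : C.Finite)
    (hb : (dualGraph C ∅).bettiOne = 0) (D : CrossEdge C → C → Prop) :
    ∃ (sV : C → ZMod 2) (sE : CrossEdge C → ZMod 2),
      ∀ A, ∀ U ∈ A.1.1, (D A U ↔ sE A = sV U) := by
  classical
  have : Finite C := hC
  let ends : (dualGraph C ∅).E → Sym2 C := Sum.elim (fun e => e.1.1) (fun e => s(e.1, e.1))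
  have hinc : ∀ (e : (dualGraph C ∅).E) (v : C), (dualGraph C ∅).inc e v ↔ v ∈ ends e := by
    rintro (e | e) v
    · exact Iff.rfl
    · simp [dualGraph, ends]
  -- The vanishing of a truncated difference gives just this inequality. It suffices, and it also
  -- forces the set of edges to be finite, since `C` is.
  have hle : ENat.card (dualGraph C ∅).E + ENat.card (dualGraph C ∅).Components ≤ ENat.card C :=
    tsub_eq_zero_iff_le.1 hb
  have hfin : ENat.card C ≠ ⊤ := by simpa using hC
  have hE : Finite (dualGraph C ∅).E := by
    by_contra hinf
    rw [not_finite_iff_infinite] at hinf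
    rw [ENat.card_eq_top_of_infinite, top_add, top_le_iff] at hle
    exact hfin hle
  have hr : (Quot fun v w : C => ∃ e, v ∈ ends e ∧ w ∈ ends e) = (dualGraph C ∅).Components := by
    unfold HGraph.Components
    congr 1
    funext v w
    exact propext (exists_congr fun e => and_congr (hinc e v).symm (hinc e w).symm)
  have : Finite (dualGraph C ∅).Components := by rw [← hr]; infer_instance
  have hcard : Nat.card (dualGraph C ∅).E +
      Nat.card (Quot fun v w : C => ∃ e, v ∈ ends e ∧ w ∈ ends e) ≤ Nat.card C := by
    rw [hr]
    rw [ENat.card_eq_coe_natCard, ENat.card_eq_coe_natCard, ENat.card_eq_coe_natCard] at hle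
    exact_mod_cast hle
  let d : CrossEdge C → C → ZMod 2 := fun A U => if D A U then 0 else 1
  let dE : (dualGraph C ∅).E → ZMod 2 := Sum.elim
    (fun A => Sym2.lift ⟨fun v w => d A v + d A w, fun v w => add_comm _ _⟩ A.1.1) (fun _ => 0)
  obtain ⟨s, hs⟩ := exists_coboundary ends hcard dE
  -- The sign of an edge can be computed from either end; the coboundary relation says that the two
  -- answers agree.
  have hpick : ∀ A : CrossEdge C, ∃ t : ZMod 2, ∀ U ∈ A.1.1, t = d A U + s U := by
    intro A
    have hA := hs (Sum.inl A)
    obtain ⟨U, V, hUV⟩ : ∃ U V, A.1.1 = s(U, V) := by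
      induction A.1.1 with
      | _ v w => exact ⟨v, w, rfl⟩
    have h1 := hA U V hUV
    simp only [dE, Sum.elim_inl, hUV, Sym2.lift_mk] at h1
    refine ⟨d A U + s U, fun W hW => ?_⟩
    rw [hUV] at hW
    rcases Sym2.mem_iff.1 hW with rfl | rfl
    · rfl
    · generalize d A U = a at *
      generalize d A W = b at *
      generalize s U = x at *
      generalize s W = y at *
      revert a b x y
      decide
  choose t ht using hpick
  refine ⟨s, t, fun A U hU => ?_⟩
  rw [ht A U hU]
  by_cases hD : D A U <;> simp [d, hD]

/-- The covering by the connected components of the inverse images. -/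
def pullbackCovering (π : AnPoint K L → AnPoint K F) (C : Set (Set (AnPoint K F))) :
    Set (Set (AnPoint K L)) := {Y | ∃ U ∈ C, IsComponentOf Y (π ⁻¹' U)}

variable {π : AnPoint K L → AnPoint K F} {σ : AnPoint K L → AnPoint K L}
  {C : Set (Set (AnPoint K F))}

theorem mem_iInter_sym2 {Y : Type} {C : Set (Set Y)} (U V : C) :
    (⋂ W ∈ s(U, V), (W : Set Y)) = (U : Set Y) ∩ V := by
  ext x; simp

theorem CrossEdge.ends (e : CrossEdge C) : ∃ U V : C, e.1.1 = s(U, V) ∧ U ≠ V ∧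
    IsComponentOf e.1.2 ((U : Set (AnPoint K F)) ∩ V) := by
  obtain ⟨⟨a, Z⟩, h1, h2⟩ := e
  induction a with
  | _ U V =>
    refine ⟨U, V, rfl, by simpa using h1, ?_⟩
    simpa only [mem_iInter_sym2] using h2

/-- The cross edge given by a component of an intersection. -/
def CrossEdge.mk' {U V : C} (hUV : U ≠ V) {Z : Set (AnPoint K F)}
    (hZ : IsComponentOf Z ((U : Set (AnPoint K F)) ∩ V)) : CrossEdge C :=
  ⟨(s(U, V), Z), by simpa using hUV, by simpa only [mem_iInter_sym2] using hZ⟩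

theorem CrossEdge.subset (e : CrossEdge C) {U : C} (hU : U ∈ e.1.1) :
    e.1.2 ⊆ (U : Set (AnPoint K F)) := by
  obtain ⟨A, B, h1, -, h2⟩ := e.ends
  rw [h1] at hU
  rcases Sym2.mem_iff.1 hU with rfl | rfl
  · exact h2.subset.trans Set.inter_subset_left
  · exact h2.subset.trans Set.inter_subset_right

theorem CrossEdge.isConnected (e : CrossEdge C) : IsConnected e.1.2 := e.2.2.isConnected

section Maps

variable (h : IsInvolutiveCover π σ) (hU : ∀ U ∈ C, IsConnected U)
include h hU

/-- The vertex below a vertex of the pulled back covering. -/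
theorem image_mem_covering (Y : pullbackCovering π C) :
    π '' Y.1 ∈ C ∧ IsComponentOf Y.1 (π ⁻¹' (π '' Y.1)) := by
  obtain ⟨U, hUC, hY⟩ := Y.2
  rw [h.component_image (hU U hUC) hY]
  exact ⟨hUC, hY⟩

/-- The vertex below a vertex of the pulled back covering. -/
def baseV (Y : pullbackCovering π C) : C := ⟨π '' Y.1, (image_mem_covering h hU Y).1⟩

theorem baseV_component (Y : pullbackCovering π C) :
    IsComponentOf Y.1 (π ⁻¹' (baseV h hU Y : Set (AnPoint K F))) :=
  (image_mem_covering h hU Y).2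

theorem baseV_eq {Y : Set (AnPoint K L)} {U : C}
    (hY : IsComponentOf Y (π ⁻¹' (U : Set (AnPoint K F)))) :
    baseV h hU ⟨Y, U.1, U.2, hY⟩ = U :=
  Subtype.ext (h.component_image (hU _ U.2) hY)

/-- Take the component `A` of `U ∩ V` through the image of a point `x` of `Z`. The component of `π⁻¹
A` through `x` is connected and meets `Y` and `Y'`, so it lies in both and hence in `Z`; conversely
`Z` maps into `A`. This makes edges upstairs independent of their ends. -/
theorem isComponentOf_preimage_of_inter {Y Y' : Set (AnPoint K L)} {U V : C}
    (hY : IsComponentOf Y (π ⁻¹' (U : Set (AnPoint K F))))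
    (hY' : IsComponentOf Y' (π ⁻¹' (V : Set (AnPoint K F)))) {Z : Set (AnPoint K L)}
    (hZ : IsComponentOf Z (Y ∩ Y')) :
    ∃ A, IsComponentOf A ((U : Set (AnPoint K F)) ∩ V) ∧ IsComponentOf Z (π ⁻¹' A) := by
  obtain ⟨x, hx⟩ := hZ.isConnected.nonempty
  have hxY := hZ.subset hx
  have hxUV : π x ∈ (U : Set (AnPoint K F)) ∩ V := ⟨hY.subset hxY.1, hY'.subset hxY.2⟩
  have hA := isComponentOf_connectedComponentIn hxUV
  refine ⟨_, hA, ?_⟩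
  set A := connectedComponentIn ((U : Set (AnPoint K F)) ∩ V) (π x)
  have hxA : x ∈ π ⁻¹' A := mem_connectedComponentIn hxUV
  have hZA : Z ⊆ π ⁻¹' A := by
    rw [← Set.image_subset_iff]
    refine hA.subset_of_inter (hZ.isConnected.isPreconnected.image _ h.continuous.continuousOn) ?_
      ⟨π x, ⟨x, hx, rfl⟩, hxA⟩
    rintro _ ⟨z, hz, rfl⟩
    exact ⟨hY.subset (hZ.subset hz).1, hY'.subset (hZ.subset hz).2⟩
  have hW := isComponentOf_connectedComponentIn (A := π ⁻¹' A) hxA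
  have hxW := mem_connectedComponentIn (F := π ⁻¹' A) hxA
  set W := connectedComponentIn (π ⁻¹' A) x
  have hAU : A ⊆ U := hA.subset.trans Set.inter_subset_left
  have hAV : A ⊆ V := hA.subset.trans Set.inter_subset_right
  have hWZ : W ⊆ Z := by
    refine hZ.subset_of_inter hW.isConnected.isPreconnected (Set.subset_inter ?_ ?_) ⟨x, hxW, hx⟩
    · exact hY.subset_of_inter hW.isConnected.isPreconnected
        (hW.subset.trans (Set.preimage_mono hAU)) ⟨x, hxW, hxY.1⟩
    · exact hY'.subset_of_inter hW.isConnected.isPreconnected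
        (hW.subset.trans (Set.preimage_mono hAV)) ⟨x, hxW, hxY.2⟩
  rwa [(hWZ.antisymm (hW.subset_of_inter hZ.isConnected.isPreconnected hZA ⟨x, hx, hxW⟩)).symm]

theorem baseE_spec (e : CrossEdge (pullbackCovering π C)) :
    (¬ (e.1.1.map (baseV h hU)).IsDiag ∧ IsComponentOf (π '' e.1.2)
      (⋂ U ∈ e.1.1.map (baseV h hU), (U : Set (AnPoint K F)))) ∧
      IsComponentOf e.1.2 (π ⁻¹' (π '' e.1.2)) := by
  obtain ⟨Y, Y', h1, hne, hZ⟩ := e.ends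
  obtain ⟨A, hA, hZA⟩ := isComponentOf_preimage_of_inter h hU (baseV_component h hU Y)
    (baseV_component h hU Y') hZ
  have him := h.component_image hA.isConnected hZA
  rw [h1, Sym2.map_mk, mem_iInter_sym2, him]
  refine ⟨⟨?_, hA⟩, hZA⟩
  simp only [Sym2.mk_isDiag_iff]
  intro he
  obtain ⟨x, hx⟩ := hZ.isConnected.nonempty
  have h2 := baseV_component h hU Y
  rw [he] at h2
  exact hne (Subtype.ext (h2.eq_of_inter (baseV_component h hU Y') ⟨x, hZ.subset hx⟩))

/-- The edge below an edge between distinct elements of the pulled back covering. -/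
def baseE (e : CrossEdge (pullbackCovering π C)) : CrossEdge C :=
  ⟨(e.1.1.map (baseV h hU), π '' e.1.2), (baseE_spec h hU e).1⟩

theorem baseE_component (e : CrossEdge (pullbackCovering π C)) :
    IsComponentOf e.1.2 (π ⁻¹' (baseE h hU e).1.2) := (baseE_spec h hU e).2

/-- Incidence upstairs is thereby split into incidence in `T`, which the projection controls, and a
containment, which the signs control. -/
theorem mem_ends_iff (e : CrossEdge (pullbackCovering π C)) (Y : pullbackCovering π C) :
    Y ∈ e.1.1 ↔ baseV h hU Y ∈ (baseE h hU e).1.1 ∧ e.1.2 ⊆ Y.1 := by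
  constructor
  · exact fun hY => ⟨Sym2.mem_map.2 ⟨Y, hY, rfl⟩, e.subset hY⟩
  · rintro ⟨hb, hs⟩
    obtain ⟨Y', hY', he⟩ := Sym2.mem_map.1 hb
    obtain ⟨x, hx⟩ := e.isConnected.nonempty
    have h2 := baseV_component h hU Y'
    rw [he] at h2
    have : Y' = Y := Subtype.ext (h2.eq_of_inter (baseV_component h hU Y)
      ⟨x, e.subset hY' hx, hs hx⟩)
    rwa [← this]

theorem crossEdge_ext {e e' : CrossEdge (pullbackCovering π C)}
    (hb : baseE h hU e = baseE h hU e') (hZ : e.1.2 = e'.1.2) : e = e' := by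
  refine Subtype.ext (Prod.ext ?_ hZ)
  have hsub : ∀ Y, Y ∈ e.1.1 ↔ Y ∈ e'.1.1 := fun Y => by
    rw [mem_ends_iff h hU, mem_ends_iff h hU, hb, hZ]
  exact Sym2.ext fun Y => hsub Y

/-- The set `Z` lies in a component over each end of `e'`. The component of the intersection of
these two that contains `Z` is again a component of the inverse image of the same annulus, so it is
`Z`. -/
theorem exists_crossEdge (e' : CrossEdge C) {Z : Set (AnPoint K L)}
    (hZ : IsComponentOf Z (π ⁻¹' e'.1.2)) :
    ∃ e : CrossEdge (pullbackCovering π C), baseE h hU e = e' ∧ e.1.2 = Z := by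
  obtain ⟨U, V, h1, hne, hA⟩ := e'.ends
  obtain ⟨x, hx⟩ := hZ.isConnected.nonempty
  have hsub : ∀ U : C, e'.1.2 ⊆ U → ∃ Y : pullbackCovering π C, baseV h hU Y = U ∧ Z ⊆ Y.1 := by
    intro U hAU
    obtain ⟨Y, hY, hZY⟩ := hZ.exists_superset (Set.preimage_mono hAU)
    exact ⟨⟨Y, U.1, U.2, hY⟩, baseV_eq h hU hY, hZY⟩
  obtain ⟨Y, hY, hZY⟩ := hsub U (hA.subset.trans Set.inter_subset_left)
  obtain ⟨Y', hY', hZY'⟩ := hsub V (hA.subset.trans Set.inter_subset_right)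
  have hYY : Y ≠ Y' := by rintro rfl; exact hne (hY.symm.trans hY')
  have hW := isComponentOf_connectedComponentIn (A := Y.1 ∩ Y'.1) ⟨hZY hx, hZY' hx⟩
  have hxW := mem_connectedComponentIn (F := Y.1 ∩ Y'.1) ⟨hZY hx, hZY' hx⟩
  set W := connectedComponentIn (Y.1 ∩ Y'.1) x
  have hZW : Z ⊆ W := hW.subset_of_inter hZ.isConnected.isPreconnected
    (Set.subset_inter hZY hZY') ⟨x, hx, hxW⟩
  obtain ⟨A, hA', hWA⟩ := isComponentOf_preimage_of_inter h hU (baseV_component h hU Y)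
    (baseV_component h hU Y') hW
  rw [hY, hY'] at hA'
  have hAA : A = e'.1.2 := hA'.eq_of_inter hA ⟨π x, hWA.subset hxW, hZ.subset hx⟩
  rw [hAA] at hWA
  have hWZ : W = Z := hWA.eq_of_inter hZ ⟨x, hxW, hx⟩
  refine ⟨CrossEdge.mk' hYY hW, ?_, hWZ⟩
  refine Subtype.ext (Prod.ext ?_ ?_)
  · change Sym2.map _ s(Y, Y') = _
    rw [Sym2.map_mk, hY, hY', h1]
  · change π '' W = _
    exact h.component_image e'.isConnected hWA

end Maps

set_option maxHeartbeats 1000000 in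
/-- The dual graph of the pulled back covering is obtained from the dual graph of a tree-like
covering by doubling the even vertices and edges. -/
theorem exists_iso_double (h : IsInvolutiveCover π σ) (hC : C.Finite)
    (hU : ∀ U ∈ C, IsConnected U)
    {S : Set (AnPoint K F)} {W : Set (AnPoint K L)} (evenE : (dualGraph C S).E → Prop)
    (hevenE : ∀ e : CrossEdge C, evenE (Sum.inl e) ↔ ¬ IsConnected (π ⁻¹' e.1.2))
    (hself : IsEmpty (SelfEdge C)) (hself' : IsEmpty (SelfEdge (pullbackCovering π C)))
    (hvert : ∀ U : C, (dualGraph C S).EvenVertex evenE U ↔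
      ¬ IsConnected (π ⁻¹' (U : Set (AnPoint K F))))
    (hW : Set.BijOn π W S) (hb : (dualGraph C ∅).bettiOne = 0) :
    ∃ φ : (dualGraph (pullbackCovering π C) W).Iso ((dualGraph C S).double evenE),
      (∀ Y : pullbackCovering π C, ∃ U : C,
        HGraph.double.projV _ _ (φ.onV Y) = U ∧ π '' Y.1 = U.1) ∧
      (∀ e : CrossEdge (pullbackCovering π C), ∃ e' : CrossEdge C,
        HGraph.double.projE _ _ (φ.onE (Sum.inl e)) = Sum.inl e' ∧ π '' e.1.2 = e'.1.2) ∧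
      (∀ w : W, ∃ s : S, HGraph.double.projH _ _ (φ.onH w) = s ∧ π w.1 = s.1) := by
  classical
  let T := dualGraph C S
  have hcompV : ∀ U : C, ∃ Y, IsComponentOf Y (π ⁻¹' (U : Set (AnPoint K F))) := fun U => by
    obtain ⟨b, hb⟩ := (hU U U.2).nonempty
    obtain ⟨x, rfl⟩ := h.surjective b
    exact ⟨_, isComponentOf_connectedComponentIn (x := x) hb⟩
  have hcompE : ∀ e : CrossEdge C, ∃ Z, IsComponentOf Z (π ⁻¹' e.1.2) := fun e => by
    obtain ⟨b, hb⟩ := e.isConnected.nonempty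
    obtain ⟨x, rfl⟩ := h.surjective b
    exact ⟨_, isComponentOf_connectedComponentIn (x := x) hb⟩
  choose P hP using hcompV
  choose Q hQ using hcompE
  -- `P U` and `Q A` are arbitrary reference components. A component is labelled by the sign of its
  -- base, flipped if it is not the reference component.
  obtain ⟨sV, sE, hs⟩ := exists_signs hC hb fun A U => Q A ⊆ P U
  -- labels
  let labV : pullbackCovering π C → Bool := fun Y =>
    decide (Y.1 = P (baseV h hU Y)) == decide (sV (baseV h hU Y) = 0)
  let labE : CrossEdge (pullbackCovering π C) → Bool := fun e =>
    decide (e.1.2 = Q (baseE h hU e)) == decide (sE (baseE h hU e) = 0)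
  -- The labels record containment. This needs the vertex to split; the edge then splits as well,
  -- and each component of the edge lies in exactly one of the two components of the vertex.
  have hlab : ∀ (e : CrossEdge (pullbackCovering π C)) (Y : pullbackCovering π C),
      baseV h hU Y ∈ (baseE h hU e).1.1 →
      ¬ IsConnected (π ⁻¹' (baseV h hU Y : Set (AnPoint K F))) →
      (labE e = labV Y ↔ e.1.2 ⊆ Y.1) := by
    intro e Y hmem hn
    have hY := baseV_component h hU Y
    have hZ := baseE_component h hU e
    have hAU : (baseE h hU e).1.2 ⊆ baseV h hU Y := (baseE h hU e).subset hmem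
    have hne := h.not_isConnected_mono (hU _ (baseV h hU Y).2) hn
      (baseE h hU e).isConnected.nonempty hAU
    have key := hs _ _ hmem
    have hPU := hP (baseV h hU Y)
    have hQA := hQ (baseE h hU e)
    -- exactly one of the two components of the vertex contains a component of the edge
    have one : ∀ Z, IsComponentOf Z (π ⁻¹' (baseE h hU e).1.2) → ∀ Y₁ Y₂,
        IsComponentOf Y₁ (π ⁻¹' (baseV h hU Y : Set (AnPoint K F))) →
        IsComponentOf Y₂ (π ⁻¹' (baseV h hU Y : Set (AnPoint K F))) → Y₁ ≠ Y₂ →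
        (Z ⊆ Y₁ ↔ ¬ Z ⊆ Y₂) := by
      intro Z hZ Y₁ Y₂ hY₁ hY₂ h12
      constructor
      · intro hz1 hz2
        obtain ⟨x, hx⟩ := hZ.isConnected.nonempty
        exact h12 (hY₁.eq_of_inter hY₂ ⟨x, hz1 hx, hz2 hx⟩)
      · intro hz2
        obtain ⟨Y₃, hY₃, hz3⟩ := hZ.exists_superset (Set.preimage_mono hAU)
        by_contra hz1
        have e31 : Y₃ ≠ Y₁ := by rintro rfl; exact hz1 hz3
        have e32 : Y₃ ≠ Y₂ := by rintro rfl; exact hz2 hz3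
        exact h12 (h.component_eq_of_not_mem (hU _ (baseV h hU Y).2) hn hY₃ hY₁ hY₂
          e31.symm e32.symm)
    -- exactly one of the two components of the edge lies in a component of the vertex
    have two : ∀ Z₁ Z₂, IsComponentOf Z₁ (π ⁻¹' (baseE h hU e).1.2) →
        IsComponentOf Z₂ (π ⁻¹' (baseE h hU e).1.2) → Z₁ ≠ Z₂ → ∀ Y₁,
        IsComponentOf Y₁ (π ⁻¹' (baseV h hU Y : Set (AnPoint K F))) →
        (Z₁ ⊆ Y₁ ↔ ¬ Z₂ ⊆ Y₁) := by
      intro Z₁ Z₂ hZ₁ hZ₂ h12 Y₁ hY₁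
      obtain ⟨x, hx⟩ := hZ₁.isConnected.nonempty
      have hxA : π x ∈ (baseE h hU e).1.2 := hZ₁.subset hx
      have hσA : π (σ x) ∈ (baseE h hU e).1.2 := by rwa [h.proj_invol]
      have hσ : σ x ∈ Z₂ := by
        by_contra hσ
        exact h12 (hZ₁.eq_of_inter hZ₂ ⟨x, hx, (h.component_dichotomy
          (baseE h hU e).isConnected hne hZ₂ hxA).2 hσ⟩)
      have d1 := h.component_dichotomy (hU _ (baseV h hU Y).2) hn hY₁ (hAU hxA)
      have i1 : Z₁ ⊆ Y₁ ↔ x ∈ Y₁ := ⟨fun hz => hz hx, fun hxY =>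
        hY₁.subset_of_inter hZ₁.isConnected.isPreconnected
          (hZ₁.subset.trans (Set.preimage_mono hAU)) ⟨x, hx, hxY⟩⟩
      have i2 : Z₂ ⊆ Y₁ ↔ σ x ∈ Y₁ := ⟨fun hz => hz hσ, fun hxY =>
        hY₁.subset_of_inter hZ₂.isConnected.isPreconnected
          (hZ₂.subset.trans (Set.preimage_mono hAU)) ⟨σ x, hσ, hxY⟩⟩
      rw [i1, i2, d1]
    simp only [labE, labV]
    have z2 : ∀ a b : ZMod 2, a = b ↔ (a = 0 ↔ b = 0) := by decide
    rw [z2] at key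
    rw [decide_beq_decide_eq_iff]
    -- For the reference components the claim is the defining property of the signs. Passing to the
    -- other component, over the vertex or over the edge, negates both the containment and the
    -- equality of labels.
    by_cases hYP : Y.1 = P (baseV h hU Y) <;> by_cases hZQ : e.1.2 = Q (baseE h hU e)
    · rw [hYP, hZQ, key]; simp
    · have t1 := two _ _ hZ hQA hZQ _ hY
      rw [t1, hYP, key]
      simp only [hZQ, false_iff, true_iff]
      exact (iff_not_cases _ _).1
    · have t1 := one _ hZ _ _ hY hPU hYP
      rw [t1, hZQ, key]; simp only [hYP, false_iff, true_iff]
      exact (iff_not_cases _ _).2.1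
    · have t1 := one _ hZ _ _ hY hPU hYP
      have t2 := two _ _ hZ hQA hZQ _ hPU
      rw [t1, t2, key]; simp only [hYP, hZQ, false_iff]
      exact (iff_not_cases _ _).2.2
  -- vertices
  let fV : pullbackCovering π C → (T.double evenE).V := fun Y =>
    if hY : T.EvenVertex evenE (baseV h hU Y) then Sum.inr (⟨baseV h hU Y, hY⟩, labV Y)
    else Sum.inl ⟨baseV h hU Y, hY⟩
  have fV_even : ∀ (Y) (hY : T.EvenVertex evenE (baseV h hU Y)),
      fV Y = Sum.inr (⟨baseV h hU Y, hY⟩, labV Y) := fun Y hY => dif_pos hY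
  have fV_odd : ∀ (Y) (hY : ¬ T.EvenVertex evenE (baseV h hU Y)),
      fV Y = Sum.inl ⟨baseV h hU Y, hY⟩ := fun Y hY => dif_neg hY
  have fV_proj : ∀ Y, HGraph.double.projV _ _ (fV Y) = baseV h hU Y := by
    intro Y
    by_cases hY : T.EvenVertex evenE (baseV h hU Y)
    · rw [fV_even Y hY]; rfl
    · rw [fV_odd Y hY]; rfl
  have hV : Function.Bijective fV := by
    constructor
    · intro Y Y' hYY
      have hb : baseV h hU Y = baseV h hU Y' := by rw [← fV_proj, hYY, fV_proj]
      have hcY := baseV_component h hU Y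
      have hcY' := baseV_component h hU Y'
      rw [hb] at hcY
      by_cases hY' : T.EvenVertex evenE (baseV h hU Y')
      · have hY : T.EvenVertex evenE (baseV h hU Y) := by rwa [hb]
        rw [fV_even Y hY, fV_even Y' hY'] at hYY
        have hl : labV Y = labV Y' := (Prod.ext_iff.1 (Sum.inr_injective hYY)).2
        simp only [labV, hb] at hl
        have hl' : Y.1 = P (baseV h hU Y') ↔ Y'.1 = P (baseV h hU Y') := by
          rw [decide_beq_decide_eq_iff] at hl
          exact iff_of_iff_iff_right hl
        apply Subtype.ext
        by_cases hp : Y.1 = P (baseV h hU Y')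
        · rw [hp, hl'.1 hp]
        · exact h.component_eq_of_not_mem (hU _ (baseV h hU Y').2) ((hvert _).1 hY')
            (hP (baseV h hU Y')) hcY hcY' hp (fun hq => hp (hl'.2 hq))
      · have hc : IsConnected (π ⁻¹' (baseV h hU Y' : Set (AnPoint K F))) := by
          by_contra hc; exact hY' ((hvert _).2 hc)
        exact Subtype.ext ((hcY.eq_of_isConnected hc).trans (hcY'.eq_of_isConnected hc).symm)
    · rintro (⟨U, hUo⟩ | ⟨⟨U, hUe⟩, τ⟩)
      · let Y : pullbackCovering π C := ⟨P U, U.1, U.2, hP U⟩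
        have hbY : baseV h hU Y = U := baseV_eq h hU (hP U)
        refine ⟨Y, ?_⟩
        rw [fV_odd Y (by rwa [hbY])]
        simp only [hbY]
        rfl
      · obtain ⟨Y', hY', hne⟩ := h.exists_component_ne (hU _ U.2) ((hvert U).1 hUe) (hP U)
        let Y₁ : pullbackCovering π C := ⟨P U, U.1, U.2, hP U⟩
        let Y₂ : pullbackCovering π C := ⟨Y', U.1, U.2, hY'⟩
        have hb1 : baseV h hU Y₁ = U := baseV_eq h hU (hP U)
        have hb2 : baseV h hU Y₂ = U := baseV_eq h hU hY'
        have l1 : labV Y₁ = decide (sV U = 0) := by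
          simp only [labV, hb1]; simp [Y₁]
        have l2 : labV Y₂ = !decide (sV U = 0) := by
          simp only [labV, hb2]; simp [Y₂, hne]
        have g1 : fV Y₁ = Sum.inr (⟨U, hUe⟩, decide (sV U = 0)) := by
          rw [fV_even Y₁ (by rwa [hb1]), l1]; simp only [hb1]; rfl
        have g2 : fV Y₂ = Sum.inr (⟨U, hUe⟩, !decide (sV U = 0)) := by
          rw [fV_even Y₂ (by rwa [hb2]), l2]; simp only [hb2]; rfl
        by_cases hτ : τ = decide (sV U = 0)
        · exact ⟨Y₁, by rw [g1, hτ]⟩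
        · exact ⟨Y₂, by rw [g2, Bool.eq_not.2 hτ]⟩
  -- edges
  let fE : (dualGraph (pullbackCovering π C) W).E → (T.double evenE).E := Sum.elim (fun e =>
    if he : evenE (Sum.inl (baseE h hU e)) then Sum.inr (⟨Sum.inl (baseE h hU e), he⟩, labE e)
    else Sum.inl ⟨Sum.inl (baseE h hU e), he⟩) (fun e => hself'.elim e)
  have fE_even : ∀ (e : CrossEdge (pullbackCovering π C)) (he : evenE (Sum.inl (baseE h hU e))),
      fE (Sum.inl e) = Sum.inr (⟨Sum.inl (baseE h hU e), he⟩, labE e) := fun e he => dif_pos he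
  have fE_odd : ∀ (e : CrossEdge (pullbackCovering π C)) (he : ¬ evenE (Sum.inl (baseE h hU e))),
      fE (Sum.inl e) = Sum.inl ⟨Sum.inl (baseE h hU e), he⟩ := fun e he => dif_neg he
  have fE_proj : ∀ e : CrossEdge (pullbackCovering π C),
      HGraph.double.projE _ _ (fE (Sum.inl e)) = Sum.inl (baseE h hU e) := by
    intro e
    by_cases he : evenE (Sum.inl (baseE h hU e))
    · rw [fE_even e he]; rfl
    · rw [fE_odd e he]; rfl
  have hE : Function.Bijective fE := by
    constructor
    · rintro (e | e) (e' | e') hee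
      rotate_left
      · exact hself'.elim e'
      · exact hself'.elim e
      · exact hself'.elim e
      have hb : baseE h hU e = baseE h hU e' :=
        Sum.inl_injective (by rw [← fE_proj, hee, fE_proj])
      have hc := baseE_component h hU e
      have hc' := baseE_component h hU e'
      rw [hb] at hc
      congr 1
      refine crossEdge_ext h hU hb ?_
      by_cases he' : evenE (Sum.inl (baseE h hU e'))
      · have he : evenE (Sum.inl (baseE h hU e)) := by rwa [hb]
        rw [fE_even e he, fE_even e' he'] at hee
        have hl : labE e = labE e' := (Prod.ext_iff.1 (Sum.inr_injective hee)).2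
        simp only [labE, hb] at hl
        have hl' : e.1.2 = Q (baseE h hU e') ↔ e'.1.2 = Q (baseE h hU e') := by
          rw [decide_beq_decide_eq_iff] at hl
          exact iff_of_iff_iff_right hl
        by_cases hp : e.1.2 = Q (baseE h hU e')
        · rw [hp, hl'.1 hp]
        · exact h.component_eq_of_not_mem (baseE h hU e').isConnected ((hevenE _).1 he')
            (hQ (baseE h hU e')) hc hc' hp (fun hq => hp (hl'.2 hq))
      · have hcn : IsConnected (π ⁻¹' (baseE h hU e').1.2) := by
          by_contra hcn; exact he' ((hevenE _).2 hcn)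
        exact (hc.eq_of_isConnected hcn).trans (hc'.eq_of_isConnected hcn).symm
    · rintro (⟨A | A, hAo⟩ | ⟨⟨A | A, hAe⟩, τ⟩)
      · obtain ⟨e, hbe, -⟩ := exists_crossEdge h hU A (hQ A)
        refine ⟨Sum.inl e, ?_⟩
        rw [fE_odd e (by rwa [hbe])]
        simp only [hbe]
        rfl
      · exact (hself.false A).elim
      · obtain ⟨Z', hZ', hne⟩ := h.exists_component_ne A.isConnected ((hevenE A).1 hAe) (hQ A)
        obtain ⟨e₁, hb1, hq1⟩ := exists_crossEdge h hU A (hQ A)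
        obtain ⟨e₂, hb2, hq2⟩ := exists_crossEdge h hU A hZ'
        have l1 : labE e₁ = decide (sE A = 0) := by
          simp only [labE, hb1, hq1]; simp
        have l2 : labE e₂ = !decide (sE A = 0) := by
          simp only [labE, hb2, hq2]; simp [hne]
        have g1 : fE (Sum.inl e₁) = Sum.inr (⟨Sum.inl A, hAe⟩, decide (sE A = 0)) := by
          rw [fE_even e₁ (by rwa [hb1]), l1]; simp only [hb1]; rfl
        have g2 : fE (Sum.inl e₂) = Sum.inr (⟨Sum.inl A, hAe⟩, !decide (sE A = 0)) := by
          rw [fE_even e₂ (by rwa [hb2]), l2]; simp only [hb2]; rfl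
        by_cases hτ : τ = decide (sE A = 0)
        · exact ⟨Sum.inl e₁, by rw [g1, hτ]⟩
        · exact ⟨Sum.inl e₂, by rw [g2, Bool.eq_not.2 hτ]⟩
      · exact (hself.false A).elim
  let fH : W → S := hW.mapsTo.restrict π W S
  have hH : Function.Bijective fH := hW.bijective
  refine ⟨⟨Equiv.ofBijective fV hV, Equiv.ofBijective fE hE, Equiv.ofBijective fH hH, ?_, ?_⟩,
    fun Y => ⟨baseV h hU Y, fV_proj Y, rfl⟩, fun e => ⟨baseE h hU e, fE_proj e, rfl⟩,
    fun w => ⟨fH w, rfl, rfl⟩⟩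
  · rintro (e | e) Y
    swap
    · exact hself'.elim e
    change (T.double evenE).inc (fE (Sum.inl e)) (fV Y) ↔ Y ∈ e.1.1
    have hm := mem_ends_iff h hU e Y
    have hinc : T.inc (Sum.inl (baseE h hU e)) (baseV h hU Y) ↔
      baseV h hU Y ∈ (baseE h hU e).1.1 := Iff.rfl
    by_cases hY : T.EvenVertex evenE (baseV h hU Y)
    · rw [fV_even Y hY]
      by_cases he : evenE (Sum.inl (baseE h hU e))
      · rw [fE_even e he]
        change T.inc _ _ ∧ labE e = labV Y ↔ _
        exact (and_congr_right fun hmem => hlab e Y hmem ((hvert _).1 hY)).trans hm.symm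
      · rw [fE_odd e he]
        change False ↔ _
        exact ⟨False.elim, fun hmem => he (hY.1 _ (hm.1 hmem).1)⟩
    · have hc : IsConnected (π ⁻¹' (baseV h hU Y : Set (AnPoint K F))) := by
        by_contra hc; exact hY ((hvert _).2 hc)
      have hYe := (baseV_component h hU Y).eq_of_isConnected hc
      have hfin : baseV h hU Y ∈ (baseE h hU e).1.1 ↔ Y ∈ e.1.1 := by
        refine (and_iff_left_of_imp fun hmem => ?_).symm.trans hm.symm
        rw [hYe]
        exact (baseE_component h hU e).subset.trans (Set.preimage_mono ((baseE h hU e).subset hmem))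
      rw [fV_odd Y hY]
      refine Iff.trans ?_ hfin
      by_cases he : evenE (Sum.inl (baseE h hU e))
      · rw [fE_even e he]; rfl
      · rw [fE_odd e he]; rfl
  · intro w Y
    change (T.double evenE).hinc (fH w) (fV Y) ↔ w.1 ∈ Y.1
    by_cases hY : T.EvenVertex evenE (baseV h hU Y)
    · rw [fV_even Y hY]
      exact ⟨False.elim, fun hmem => hY.2 (fH w) ⟨w.1, hmem, rfl⟩⟩
    · have hc : IsConnected (π ⁻¹' (baseV h hU Y : Set (AnPoint K F))) := by
        by_contra hc; exact hY ((hvert _).2 hc)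
      have hYe := (baseV_component h hU Y).eq_of_isConnected hc
      rw [fV_odd Y hY, hYe]
      rfl

end Assembly

end BerkovichCover

/-! ### The projective line has genus zero: partial fractions -/

namespace BerkovichCover

section GenusLine

variable {K : Type} [Field K]

namespace Place

variable {L : Type} [Field L] [Algebra K L] (P : Place K L)

theorem inv_mem_of_not_mem {x : L} (hx : x ∉ P.1) : x⁻¹ ∈ P.1 := by
  rcases P.2.2 x with h | ⟨y, hy, hxy⟩
  · exact absurd h hx
  · rwa [← eq_inv_of_mul_eq_one_right hxy]

theorem inv_sub_mem {z : L} (hz : z ∉ P.1) (α : K) : (z - algebraMap K L α)⁻¹ ∈ P.1 := by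
  refine P.inv_mem_of_not_mem fun h => hz ?_
  simpa using P.1.add_mem h (P.1.algebraMap_mem α)

/-- A non-constant polynomial in `z` has a pole wherever `z` does. Multiplying by `(z - α)⁻¹`, which
is regular there, strips off a linear factor, so by induction the quotient is a nonzero constant and
`z - α` itself would be regular. -/
theorem eq_C_of_aeval_mem [IsAlgClosed K] {z : L} (hz : z ∉ P.1) (n : ℕ) :
    ∀ q : K[X], q.natDegree ≤ n → aeval z q ∈ P.1 → q = C (q.coeff 0) := by
  induction n with
  | zero => exact fun q hq _ => eq_C_of_natDegree_le_zero hq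
  | succ n ih =>
    intro q hq hqP
    by_cases h0 : q.natDegree = 0
    · exact eq_C_of_natDegree_eq_zero h0
    obtain ⟨α, hα⟩ := IsAlgClosed.exists_root q
      (fun h => h0 (natDegree_eq_zero_iff_degree_le_zero.2 h.le))
    obtain ⟨q₁, rfl⟩ := dvd_iff_isRoot.2 hα
    have hq0 : q₁ ≠ 0 := by rintro rfl; simp at h0
    have hzα : z - algebraMap K L α ≠ 0 := fun h => hz (by
      rw [sub_eq_zero.1 h]; exact P.1.algebraMap_mem α)
    rw [natDegree_mul (X_sub_C_ne_zero α) hq0, natDegree_X_sub_C] at hq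
    have hev : aeval z ((X - C α) * q₁) = (z - algebraMap K L α) * aeval z q₁ := by simp
    rw [hev] at hqP
    have h1 : aeval z q₁ ∈ P.1 := by
      have := P.1.mul_mem (P.inv_sub_mem hz α) hqP
      rwa [inv_mul_cancel_left₀ hzα] at this
    have h2 := ih q₁ (by omega) h1
    exfalso
    have hc : q₁.coeff 0 ≠ 0 := fun h => hq0 (by rw [h2, h, C_0])
    rw [h2, aeval_C] at hqP
    have := P.1.mul_mem hqP (P.1.algebraMap_mem (q₁.coeff 0)⁻¹)
    rw [mul_assoc, ← map_mul, mul_inv_cancel₀ hc, map_one, mul_one] at this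
    apply hz
    simpa using P.1.add_mem this (P.1.algebraMap_mem α)

end Place

variable {L : Type} [Field L] [Algebra K L]

/-- The functions which are a polynomial in `z` plus a function that is regular where `z` has
a pole. -/
noncomputable def polyAddRegular (z : L) : Submodule K L :=
  LinearMap.range (aeval z : K[X] →ₐ[K] L).toLinearMap ⊔
    ⨅ Q : {Q : Place K L // z ∉ Q.1}, Subalgebra.toSubmodule Q.1.1

theorem mem_polyAddRegular {z g : L} : g ∈ polyAddRegular (K := K) z ↔
    ∃ q : K[X], ∀ Q : Place K L, z ∉ Q.1 → g - aeval z q ∈ Q.1 := by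
  unfold polyAddRegular
  rw [Submodule.mem_sup]
  constructor
  · rintro ⟨_, ⟨q, rfl⟩, j, hj, rfl⟩
    refine ⟨q, fun Q hQ => ?_⟩
    have := (Submodule.mem_iInf _).1 hj ⟨Q, hQ⟩
    simpa using this
  · rintro ⟨q, hq⟩
    refine ⟨aeval z q, ⟨q, rfl⟩, g - aeval z q, (Submodule.mem_iInf _).2 fun Q => hq Q.1 Q.2, ?_⟩
    ring

theorem aeval_mem_polyAddRegular (z : L) (q : K[X]) : aeval z q ∈ polyAddRegular (K := K) z :=
  mem_polyAddRegular.2 ⟨q, fun Q _ => by rw [sub_self]; exact Q.1.zero_mem⟩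

/-- Divide the polynomial part by `X - α` with remainder: the quotient is the new polynomial part,
and the remainder times `(z - α)⁻¹` is regular at the poles of `z`. -/
theorem mul_inv_mem_polyAddRegular {z g : L} (hg : g ∈ polyAddRegular (K := K) z) (α : K)
    (hα : z ≠ algebraMap K L α) :
    g * (z - algebraMap K L α)⁻¹ ∈ polyAddRegular (K := K) z := by
  obtain ⟨q, hq⟩ := mem_polyAddRegular.1 hg
  refine mem_polyAddRegular.2 ⟨q /ₘ (X - C α), fun Q hQ => ?_⟩
  have h0 : z - algebraMap K L α ≠ 0 := sub_ne_zero.2 hα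
  have hdiv := congrArg (aeval z) (modByMonic_add_div q (X - C α))
  rw [modByMonic_X_sub_C_eq_C_eval] at hdiv
  simp only [map_add, map_mul, aeval_C, aeval_X, map_sub] at hdiv
  have : g * (z - algebraMap K L α)⁻¹ - aeval z (q /ₘ (X - C α)) =
      (g - aeval z q) * (z - algebraMap K L α)⁻¹ +
        algebraMap K L (eval α q) * (z - algebraMap K L α)⁻¹ := by
    rw [← hdiv]; field_simp; ring
  rw [this]
  exact Q.1.add_mem (Q.1.mul_mem (hq Q hQ) (Q.inv_sub_mem hQ α))
    (Q.1.mul_mem (Q.1.algebraMap_mem _) (Q.inv_sub_mem hQ α))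

theorem mul_prod_mem {M : Submodule K L} (u : K → L) (s : Multiset K)
    (hu : ∀ β ∈ s, ∀ g ∈ M, g * u β ∈ M) {g : L} (hg : g ∈ M) : g * (s.map u).prod ∈ M := by
  induction s using Multiset.induction_on with
  | empty => simpa using hg
  | cons β s ih =>
    rw [Multiset.map_cons, Multiset.prod_cons, mul_comm (u β), ← mul_assoc]
    exact hu β (Multiset.mem_cons_self _ _) _
      (ih fun β' h' => hu β' (Multiset.mem_cons_of_mem h'))

/-- For `z = 1 / (X - a)` and `b = a - β` this expresses `1 / (X - β)` through `1 / (z - α)` with a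
constant `α`. -/
theorem inv_inv_add {b z : L} (hz : z ≠ 0) (hb : b ≠ 0) (h : z⁻¹ + b ≠ 0) :
    (z⁻¹ + b)⁻¹ = b⁻¹ + (z + b⁻¹)⁻¹ * (-(b⁻¹) ^ 2) := by
  have h1 : 1 + z * b ≠ 0 := by
    intro h0; apply h; field_simp; rw [h0, mul_zero]
  have e1 : z⁻¹ + b = (1 + z * b) / z := by field_simp
  have e2 : z + b⁻¹ = (1 + z * b) / b := by field_simp; ring
  rw [e1, e2, inv_div, inv_div]
  field_simp
  ring

set_option linter.unusedSectionVars false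

variable [IsAlgClosed K]

theorem ratFunc_eq_div (g : RatFunc K) : ∃ (p : K[X]) (s : Multiset K),
    g = algebraMap K[X] (RatFunc K) p *
      (s.map fun β => (RatFunc.X - RatFunc.C β : RatFunc K)⁻¹).prod := by
  refine ⟨g.num, g.denom.roots, ?_⟩
  have hd := (IsAlgClosed.splits g.denom).eq_prod_roots_of_monic g.monic_denom
  have h2 : algebraMap K[X] (RatFunc K) g.denom =
      (g.denom.roots.map fun β => (RatFunc.X - RatFunc.C β : RatFunc K)).prod := by
    conv_lhs => rw [hd]
    rw [map_multiset_prod, Multiset.map_map]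
    congr 1
    refine Multiset.map_congr rfl fun β _ => ?_
    simp
  conv_lhs => rw [← g.num_div_denom, h2, div_eq_mul_inv]
  rw [← Multiset.prod_map_inv']
  simp [Multiset.map_map]

theorem X_sub_C_ne_zero' (β : K) : (RatFunc.X - RatFunc.C β : RatFunc K) ≠ 0 := by
  have : (RatFunc.X - RatFunc.C β : RatFunc K) = algebraMap K[X] (RatFunc K) (X - C β) := by simp
  rw [this]
  exact (map_ne_zero_iff _ (RatFunc.algebraMap_injective K)).2 (X_sub_C_ne_zero β)

theorem algebraMap_mem_of_mul_X {M : Submodule K (RatFunc K)}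
    (hM : ∀ g ∈ M, g * RatFunc.X ∈ M) {g : RatFunc K} (hg : g ∈ M) (p : K[X]) :
    g * algebraMap K[X] (RatFunc K) p ∈ M := by
  induction p using Polynomial.induction_on' with
  | add p q hp hq => rw [map_add, mul_add]; exact M.add_mem hp hq
  | monomial n a =>
    have : ∀ n : ℕ, g * RatFunc.X ^ n ∈ M := fun n => by
      induction n with
      | zero => simpa using hg
      | succ n ih => rw [pow_succ, ← mul_assoc]; exact hM _ ih
    have h2 := M.smul_mem a (this n)
    rw [← C_mul_X_pow_eq_monomial]
    convert h2 using 1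
    simp only [map_mul, map_pow, RatFunc.algebraMap_X, RatFunc.algebraMap_C, Algebra.smul_def,
      RatFunc.algebraMap_eq_C]
    ring

theorem polyAddRegular_X : polyAddRegular (K := K) (RatFunc.X : RatFunc K) = ⊤ := by
  refine eq_top_iff.2 fun g _ => ?_
  obtain ⟨p, s, rfl⟩ := ratFunc_eq_div g
  refine mul_prod_mem _ _ (fun β _ g hg => ?_) ?_
  · exact mul_inv_mem_polyAddRegular hg β (sub_ne_zero.1 (X_sub_C_ne_zero' β))
  · have := aeval_mem_polyAddRegular (RatFunc.X : RatFunc K) p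
    rwa [← RatFunc.algebraMap_X, aeval_algebraMap_apply, aeval_X_left_apply] at this

/-- Powers of `1 / (X - a)` are polynomials in `z`. Multiplication by `X = 1 / z + a` and by `1 / (X
- β)` with `β ≠ a` reduces to division by functions `z - α`, which the submodule allows. These
operations generate all rational functions. -/
theorem polyAddRegular_inv (a : K) :
    polyAddRegular (K := K) ((RatFunc.X - RatFunc.C a)⁻¹ : RatFunc K) = ⊤ := by
  classical
  refine eq_top_iff.2 fun g _ => ?_
  obtain ⟨p, s, rfl⟩ := ratFunc_eq_div g
  set z : RatFunc K := (RatFunc.X - RatFunc.C a)⁻¹ with hz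
  set M := polyAddRegular (K := K) z
  have hz0 : z ≠ 0 := inv_ne_zero (X_sub_C_ne_zero' a)
  have hX : (RatFunc.X : RatFunc K) = z⁻¹ + RatFunc.C a := by rw [hz, inv_inv]; ring
  have hC : ∀ (c : K) (g), g ∈ M → g * RatFunc.C c ∈ M := fun c g hg => by
    have := M.smul_mem c hg
    rwa [Algebra.smul_def, mul_comm] at this
  have hinv : ∀ g ∈ M, ∀ α : K, z ≠ RatFunc.C α → g * (z - RatFunc.C α)⁻¹ ∈ M :=
    fun g hg α hα => mul_inv_mem_polyAddRegular hg α hα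
  have hMX : ∀ g ∈ M, g * RatFunc.X ∈ M := fun g hg => by
    rw [hX, mul_add]
    refine M.add_mem ?_ (hC a g hg)
    have := hinv g hg 0 (by simpa using hz0)
    simpa using this
  have hβ : ∀ β : K, β ≠ a → ∀ g ∈ M, g * (RatFunc.X - RatFunc.C β : RatFunc K)⁻¹ ∈ M := by
    intro β hne g hg
    have hab : a - β ≠ 0 := sub_ne_zero.2 hne.symm
    have hβ0 := X_sub_C_ne_zero' β
    have hα : z ≠ RatFunc.C (β - a)⁻¹ := by
      intro h
      have h1 := congrArg (·⁻¹) h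
      simp only [hz, inv_inv, map_inv₀, map_sub] at h1
      exact hβ0 (by linear_combination h1)
    have e : (RatFunc.X - RatFunc.C β : RatFunc K)⁻¹ = RatFunc.C (a - β)⁻¹ +
        (z - RatFunc.C (β - a)⁻¹)⁻¹ * RatFunc.C (-((a - β)⁻¹) ^ 2) := by
      have hc : (RatFunc.C (a - β) : RatFunc K) ≠ 0 := by
        exact (map_ne_zero_iff _ RatFunc.C.injective).2 hab
      have hβ1 : (β - a)⁻¹ = -(a - β)⁻¹ := by rw [← neg_sub, inv_neg]
      have hXβ : RatFunc.X - RatFunc.C β = z⁻¹ + RatFunc.C (a - β) := by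
        rw [hX, map_sub]; ring
      have := inv_inv_add hz0 hc (by rw [← hXβ]; exact hβ0)
      rw [hXβ, this, hβ1]
      simp only [map_neg, map_pow, map_inv₀, sub_neg_eq_add]
    rw [e, mul_add, ← mul_assoc]
    exact M.add_mem (hC _ _ hg) (hC _ _ (hinv g hg _ hα))
  have hs : s = Multiset.replicate (s.count a) a + s.filter (· ≠ a) := by
    rw [← Multiset.filter_eq', Multiset.filter_add_not]
  rw [hs, Multiset.map_add, Multiset.prod_add, ← mul_assoc]
  refine mul_prod_mem _ _ (fun β hβs g hg => hβ β (Multiset.mem_filter.1 hβs).2 g hg) ?_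
  rw [mul_comm]
  refine algebraMap_mem_of_mul_X hMX ?_ p
  rw [Multiset.map_replicate, Multiset.prod_replicate]
  have := aeval_mem_polyAddRegular (K := K) z (X ^ (s.count a))
  rwa [map_pow, aeval_X] at this

/-- A valuation ring containing `X` and all `1 / (X - a)` contains every rational function, so one
of these functions has a pole at `P`. -/
theorem Place.exists_pole (P : Place K (RatFunc K)) :
    ∃ z : RatFunc K, z ∉ P.1 ∧ polyAddRegular (K := K) z = ⊤ := by
  by_contra hcon
  push Not at hcon
  have hX : (RatFunc.X : RatFunc K) ∈ P.1 := by
    by_contra h; exact hcon _ h polyAddRegular_X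
  have hinv : ∀ a : K, (RatFunc.X - RatFunc.C a : RatFunc K)⁻¹ ∈ P.1 := fun a => by
    by_contra h; exact hcon _ h (polyAddRegular_inv a)
  refine P.2.1 (eq_top_iff.2 fun g _ => ?_)
  obtain ⟨p, s, rfl⟩ := ratFunc_eq_div g
  have := algebraMap_mem_of_mul_X (M := Subalgebra.toSubmodule P.1)
    (fun g hg => P.1.mul_mem hg hX) P.1.one_mem p
  rw [one_mul] at this
  exact mul_prod_mem (M := Subalgebra.toSubmodule P.1) _ s
    (fun β _ g hg => P.1.mul_mem hg (hinv β)) this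

/-- The function `z` has its pole at `P` only. If it also had one at `Q`, write `g` in the ring of
`P` as `q(z)` plus a function regular at both; then `q(z)` is regular at `P`, so `q` is constant and
`g` is regular at `Q`. Hence a polynomial in `z` serves as principal part. -/
theorem Place.exists_principal_part (P : Place K (RatFunc K)) (g : RatFunc K) :
    ∃ h : RatFunc K, g - h ∈ P.1 ∧ ∀ Q : Place K (RatFunc K), Q ≠ P → h ∈ Q.1 := by
  obtain ⟨z, hz, hM⟩ := P.exists_pole
  have hall : ∀ g : RatFunc K, ∃ q : K[X], ∀ Q : Place K (RatFunc K), z ∉ Q.1 →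
      g - aeval z q ∈ Q.1 := fun g => mem_polyAddRegular.1 (by rw [hM]; trivial)
  have hle : ∀ P Q : Place K (RatFunc K), z ∉ P.1 → z ∉ Q.1 → P.1 ≤ Q.1 := by
    intro P Q hP hQ g hg
    obtain ⟨q, hq⟩ := hall g
    have h1 : aeval z q ∈ P.1 := by simpa using P.1.sub_mem hg (hq P hP)
    have h2 := P.eq_C_of_aeval_mem hP _ q le_rfl h1
    have h3 := Q.1.add_mem (hq Q hQ) (Q.1.algebraMap_mem (q.coeff 0))
    rw [h2] at h3
    simpa using h3
  obtain ⟨q, hq⟩ := hall g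
  refine ⟨aeval z q, hq P hz, fun Q hQP => ?_⟩
  have hzQ : z ∈ Q.1 := by
    by_contra hzQ
    exact hQP (Subtype.ext ((hle Q P hzQ hz).antisymm (hle P Q hz hzQ)))
  exact Algebra.adjoin_le (Set.singleton_subset_iff.2 hzQ) (aeval_mem_adjoin_singleton K z)

/-- Subtracting from a repartition the sum of its principal parts at the finitely many places where
it is not integral leaves an integral one. -/
theorem genus_ratFunc : genus K (RatFunc K) = 0 := by
  classical
  unfold genus
  rw [Module.length_eq_zero_iff, Submodule.Quotient.subsingleton_iff, eq_top_iff]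
  rintro ⟨r, hr⟩ -
  change Set.Finite _ at hr
  choose h h1 h2 using fun P : Place K (RatFunc K) => P.exists_principal_part (r P)
  let H : RatFunc K := ∑ P ∈ hr.toFinset, h P
  have hsplit : r = (fun _ => H) + (r - fun _ => H) := by ext; simp
  change r ∈ principalAddIntegral K (RatFunc K)
  rw [hsplit]
  refine Submodule.add_mem_sup ⟨H, rfl⟩ ?_
  rw [Submodule.mem_pi]
  intro P _
  change r P - H ∈ P.1
  by_cases hP : P ∈ hr.toFinset
  · have : r P - H = (r P - h P) - ∑ Q ∈ hr.toFinset.erase P, h Q := by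
      simp only [H]
      rw [← Finset.add_sum_erase _ _ hP]; ring
    rw [this]
    exact P.1.sub_mem (h1 P) (P.1.sum_mem fun Q hQ => h2 Q P (Finset.ne_of_mem_erase hQ).symm)
  · refine P.1.sub_mem ?_ (P.1.sum_mem fun Q hQ => h2 Q P ?_)
    · simpa using hP
    · rintro rfl; exact hP hQ

end GenusLine

end BerkovichCover

/-! ### Linear fractional transformations, coordinates and Gauss points -/

namespace BerkovichCover

open Topology Filter
open scoped NNReal

set_option linter.unusedSectionVars false

/-- The point given by a valuation extending the absolute value of `K`. -/
noncomputable def AnPoint.ofValuation {K F : Type} [NormedField K] [CommRing F] [Algebra K F]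
    (v : Valuation F ℝ≥0) (hv : ∀ c : K, v (algebraMap K F c) = ‖c‖₊) : AnPoint K F where
  val g := v g
  val_const c := by rw [hv]; rfl
  val_add g h := by rw [← ENNReal.coe_max]; exact ENNReal.coe_le_coe.2 (v.map_add g h)
  val_mul g h _ _ := by rw [map_mul, ENNReal.coe_mul]

theorem AnPoint.val_zpow {K L : Type} [NormedField K] [Field L] [Algebra K L]
    (ξ : AnPoint K L) {g : L} (hg : g ≠ 0) (n : ℤ) : ξ.val (g ^ n) = ξ.val g ^ n := by
  cases n with
  | ofNat n => simpa using ξ.val_pow g n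
  | negSucc n =>
    rw [zpow_negSucc, zpow_negSucc, ξ.val_inv _ (pow_ne_zero _ hg), ξ.val_pow]

section Mobius

variable {K : Type} [Field K]

/-- `t` is a linear fractional transformation of `s`. -/
def IsMobius (s t : RatFunc K) : Prop :=
  ∃ a b c d : K, a * d - b * c ≠ 0 ∧ RatFunc.C c * s + RatFunc.C d ≠ 0 ∧
    t = (RatFunc.C a * s + RatFunc.C b) / (RatFunc.C c * s + RatFunc.C d)

theorem ratFunc_C_mul_X_add_C_ne_zero {c d : K} (h : c ≠ 0 ∨ d ≠ 0) :
    (RatFunc.C c * RatFunc.X + RatFunc.C d : RatFunc K) ≠ 0 := by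
  have : (RatFunc.C c * RatFunc.X + RatFunc.C d : RatFunc K) =
      algebraMap K[X] (RatFunc K) (C c * X + C d) := by simp
  rw [this, map_ne_zero_iff _ (RatFunc.algebraMap_injective K)]
  intro h0
  have h1 := congrArg (fun p => p.coeff 1) h0
  have h2 := congrArg (fun p => p.coeff 0) h0
  simp at h1 h2
  tauto

theorem ratFunc_C_ne_zero {c : K} (h : c ≠ 0) : (RatFunc.C c : RatFunc K) ≠ 0 :=
  (map_ne_zero_iff _ RatFunc.C.injective).2 h

theorem IsMobius.symm {s t : RatFunc K} (h : IsMobius s t) : IsMobius t s := by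
  obtain ⟨a, b, c, d, h0, h1, rfl⟩ := h
  have h0' : (RatFunc.C a * RatFunc.C d - RatFunc.C b * RatFunc.C c : RatFunc K) ≠ 0 := by
    simpa only [map_sub, map_mul] using ratFunc_C_ne_zero h0
  have e : RatFunc.C (-c) * ((RatFunc.C a * s + RatFunc.C b) / (RatFunc.C c * s + RatFunc.C d)) +
      RatFunc.C a = (RatFunc.C a * RatFunc.C d - RatFunc.C b * RatFunc.C c) /
        (RatFunc.C c * s + RatFunc.C d) := by
    rw [map_neg]; field_simp; ring
  refine ⟨d, -b, -c, a, by ring_nf at h0 ⊢; exact h0, ?_, ?_⟩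
  · rw [e]; exact div_ne_zero h0' h1
  · rw [e, map_neg, eq_div_iff (div_ne_zero h0' h1)]
    simp only [div_eq_mul_inv]
    linear_combination (-RatFunc.C b) * mul_inv_cancel₀ h1

theorem IsMobius.trans {r s t : RatFunc K} (h : IsMobius r s) (h' : IsMobius s t) :
    IsMobius r t := by
  obtain ⟨a, b, c, d, h0, h1, rfl⟩ := h
  obtain ⟨a', b', c', d', h0', h1', rfl⟩ := h'
  have e : RatFunc.C (c' * a + d' * c) * r + RatFunc.C (c' * b + d' * d) =
      (RatFunc.C c' * ((RatFunc.C a * r + RatFunc.C b) / (RatFunc.C c * r + RatFunc.C d)) +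
        RatFunc.C d') * (RatFunc.C c * r + RatFunc.C d) := by
    simp only [map_add, map_mul]; field_simp; ring
  have e' : RatFunc.C (a' * a + b' * c) * r + RatFunc.C (a' * b + b' * d) =
      (RatFunc.C a' * ((RatFunc.C a * r + RatFunc.C b) / (RatFunc.C c * r + RatFunc.C d)) +
        RatFunc.C b') * (RatFunc.C c * r + RatFunc.C d) := by
    simp only [map_add, map_mul]; field_simp; ring
  refine ⟨a' * a + b' * c, a' * b + b' * d, c' * a + d' * c, c' * b + d' * d, ?_, ?_, ?_⟩
  · have : (a' * a + b' * c) * (c' * b + d' * d) - (a' * b + b' * d) * (c' * a + d' * c) =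
      -((a * d - b * c) * (b' * c' - a' * d')) := by ring
    rw [this, neg_ne_zero]
    refine mul_ne_zero h0 ?_
    rw [← neg_ne_zero]; ring_nf at h0' ⊢; exact h0'
  · rw [e]; exact mul_ne_zero h1' h1
  · rw [e, e', mul_div_mul_right _ _ h1]

theorem IsMobius.ne_C {s t : RatFunc K} (h : IsMobius s t) (hs : ∀ c, s ≠ RatFunc.C c) (c : K) :
    t ≠ RatFunc.C c := by
  rintro rfl
  obtain ⟨a, b, c', d, h0, h1, h2⟩ := h.symm
  refine hs ((a * c + b) / (c' * c + d)) ?_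
  rw [h2, map_div₀]
  simp only [map_add, map_mul]

theorem ratFunc_X_ne_C (c : K) : (RatFunc.X : RatFunc K) ≠ RatFunc.C c := by
  have h := ratFunc_C_mul_X_add_C_ne_zero (K := K) (c := 1) (d := -c) (Or.inl one_ne_zero)
  intro h'
  apply h
  rw [h']; simp

end Mobius

section Coordinates

variable {K : Type} [NormedField K]

theorem isCoordinate_iff {t : RatFunc K} : IsCoordinate t ↔ IsMobius RatFunc.X t := by
  constructor
  · rintro ⟨a, b, c, d, h, rfl⟩
    refine ⟨a, b, c, d, h, ratFunc_C_mul_X_add_C_ne_zero ?_, rfl⟩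
    by_contra hcd
    push Not at hcd
    exact h (by rw [hcd.1, hcd.2]; ring)
  · rintro ⟨a, b, c, d, h, -, rfl⟩
    exact ⟨a, b, c, d, h, rfl⟩

variable {s t : RatFunc K}

theorem IsCoordinate.isMobius (hs : IsCoordinate s) (ht : IsCoordinate t) : IsMobius s t :=
  (isCoordinate_iff.1 hs).symm.trans (isCoordinate_iff.1 ht)

theorem IsCoordinate.of_isMobius (hs : IsCoordinate s) (h : IsMobius s t) : IsCoordinate t :=
  isCoordinate_iff.2 ((isCoordinate_iff.1 hs).trans h)

theorem isCoordinate_X : IsCoordinate (RatFunc.X : RatFunc K) :=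
  ⟨1, 0, 0, 1, by simp, by simp⟩

theorem IsCoordinate.ne_C (ht : IsCoordinate t) (c : K) : t ≠ RatFunc.C c :=
  (isCoordinate_iff.1 ht).ne_C ratFunc_X_ne_C c

theorem IsCoordinate.sub_C_ne_zero (ht : IsCoordinate t) (c : K) : t - RatFunc.C c ≠ 0 :=
  sub_ne_zero.2 (ht.ne_C c)

theorem IsCoordinate.ne_zero (ht : IsCoordinate t) : t ≠ 0 := by
  simpa using ht.sub_C_ne_zero 0

theorem IsCoordinate.sub_C (ht : IsCoordinate t) (c : K) : IsCoordinate (t - RatFunc.C c) :=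
  ht.of_isMobius ⟨1, -c, 0, 1, by simp, by simp, by simp [sub_eq_add_neg]⟩

theorem IsCoordinate.inv (ht : IsCoordinate t) : IsCoordinate t⁻¹ :=
  ht.of_isMobius ⟨0, 1, 1, 0, by simp, by simpa using ht.ne_zero, by simp⟩

variable [IsAlgClosed K]

/-- Multiplicative induction: every nonzero function is a product of constants, linear functions
of a coordinate, and inverses of such. -/
theorem IsCoordinate.induction (ht : IsCoordinate t) {P : RatFunc K → Prop}
    (hC : ∀ c : K, c ≠ 0 → P (RatFunc.C c)) (hlin : ∀ α, P (t - RatFunc.C α))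
    (hmul : ∀ g h, g ≠ 0 → h ≠ 0 → P g → P h → P (g * h)) (hinv : ∀ g, g ≠ 0 → P g → P g⁻¹)
    (g : RatFunc K) (hg : g ≠ 0) : P g := by
  have hlin2 : ∀ a b : K, RatFunc.C a * t + RatFunc.C b ≠ 0 →
      P (RatFunc.C a * t + RatFunc.C b) := by
    intro a b hab
    by_cases ha : a = 0
    · subst ha
      simp only [map_zero, zero_mul, zero_add] at hab ⊢
      exact hC b (by rintro rfl; simp at hab)
    · have e : RatFunc.C a * t + RatFunc.C b = RatFunc.C a * (t - RatFunc.C (-b / a)) := by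
        have := ratFunc_C_ne_zero ha
        rw [map_div₀, map_neg]; field_simp; ring
      rw [e]
      exact hmul _ _ (ratFunc_C_ne_zero ha) (ht.sub_C_ne_zero _) (hC a ha) (hlin _)
  have hX : ∀ β, P (RatFunc.X - RatFunc.C β) := by
    intro β
    obtain ⟨a, b, c, d, h0, h1, h2⟩ := ht.isMobius isCoordinate_X
    have e : RatFunc.X - RatFunc.C β = (RatFunc.C (a - β * c) * t + RatFunc.C (b - β * d)) *
        (RatFunc.C c * t + RatFunc.C d)⁻¹ := by
      rw [h2]
      simp only [map_sub, map_mul, div_eq_mul_inv]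
      linear_combination (RatFunc.C β) * mul_inv_cancel₀ h1
    have hne := X_sub_C_ne_zero' β
    rw [e] at hne ⊢
    have h3 := left_ne_zero_of_mul hne
    exact hmul _ _ h3 (inv_ne_zero h1) (hlin2 _ _ h3) (hinv _ h1 (hlin2 _ _ h1))
  have hprod : ∀ s : Multiset K, P (s.map fun β => (RatFunc.X - RatFunc.C β : RatFunc K)).prod ∧
      (s.map fun β => (RatFunc.X - RatFunc.C β : RatFunc K)).prod ≠ 0 := by
    intro s
    induction s using Multiset.induction_on with
    | empty => simpa using hC 1 one_ne_zero
    | cons β s ih =>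
      rw [Multiset.map_cons, Multiset.prod_cons]
      exact ⟨hmul _ _ (X_sub_C_ne_zero' β) ih.2 (hX β) ih.1, mul_ne_zero (X_sub_C_ne_zero' β) ih.2⟩
  obtain ⟨p, s, rfl⟩ := ratFunc_eq_div g
  have h1 := left_ne_zero_of_mul hg
  have h2 : (s.map fun β => (RatFunc.X - RatFunc.C β : RatFunc K)⁻¹).prod =
      ((s.map fun β => (RatFunc.X - RatFunc.C β : RatFunc K)).prod)⁻¹ := by
    rw [← Multiset.prod_map_inv]
  rw [h2]
  refine hmul _ _ h1 (inv_ne_zero (hprod s).2) ?_ (hinv _ (hprod s).2 (hprod s).1)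
  have hp0 : p ≠ 0 := by rintro rfl; simp at h1
  have e : algebraMap K[X] (RatFunc K) p = RatFunc.C p.leadingCoeff *
      (p.roots.map fun β => (RatFunc.X - RatFunc.C β : RatFunc K)).prod := by
    conv_lhs => rw [(IsAlgClosed.splits p).eq_prod_roots]
    rw [map_mul, map_multiset_prod, Multiset.map_map]
    simp only [Function.comp_def, map_sub, RatFunc.algebraMap_X, RatFunc.algebraMap_C]
  rw [e]
  have hl := leadingCoeff_ne_zero.2 hp0
  exact hmul _ _ (ratFunc_C_ne_zero hl) (hprod _).2 (hC _ hl) (hprod _).1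

/-- The substitution of a coordinate. -/
theorem IsCoordinate.exists_algHom (ht : IsCoordinate t) :
    ∃ φ : RatFunc K →ₐ[K] RatFunc K, φ RatFunc.X = t := by
  have hinj : Function.Injective (aeval t : K[X] →ₐ[K] RatFunc K) := by
    rw [injective_iff_map_eq_zero]
    intro p hp
    by_contra hp0
    rw [(IsAlgClosed.splits p).eq_prod_roots, map_mul, mul_eq_zero, aeval_C, map_multiset_prod,
      Multiset.map_map, Multiset.prod_eq_zero_iff, Multiset.mem_map] at hp
    rcases hp with hp | ⟨α, -, hα⟩
    · exact hp0 (leadingCoeff_eq_zero.1 ((map_eq_zero_iff _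
        (algebraMap K (RatFunc K)).injective).1 hp))
    · simp at hα
      exact ht.sub_C_ne_zero α hα
  refine ⟨RatFunc.liftAlgHom (aeval t)
    (nonZeroDivisors_le_comap_nonZeroDivisors_of_injective _ hinj), ?_⟩
  have := RatFunc.liftAlgHom_apply_div' (aeval t : K[X] →ₐ[K] RatFunc K)
    (nonZeroDivisors_le_comap_nonZeroDivisors_of_injective _ hinj) X 1
  simp at this
  exact this

end Coordinates

section Gauss

variable {K : Type} [NormedField K] [IsUltrametricDist K]

theorem P1an.val_C (ξ : P1an K) (c : K) : ξ.val (RatFunc.C c) = ‖c‖ₑ := ξ.val_const c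

theorem P1an.C_ne_top (ξ : P1an K) (c : K) : ξ.val (RatFunc.C c) ≠ ⊤ := ξ.const_ne_top c

/-- The Gauss norm of radius `r` is multiplicative on polynomials and vanishes only at `0`, so it
extends to a valuation of the field of rational functions. -/
theorem exists_gaussPt_X (r : ℝ≥0) (hr : 0 < r) :
    ∃ ξ : P1an K, ∀ α, ξ.val (RatFunc.X - RatFunc.C α) = max ‖α‖ₑ (r : ℝ≥0∞) := by
  have hna : IsNonarchimedean (NormedField.toAbsoluteValue K) :=
    fun x y => IsUltrametricDist.norm_add_le_max x y
  have hr' : (0 : ℝ) < r := hr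
  let w : K[X] → ℝ := gaussNorm (NormedField.toAbsoluteValue K) (r : ℝ)
  have w0 : ∀ p, 0 ≤ w p := fun p => gaussNorm_nonneg _ _ hr'.le
  let v : Valuation K[X] ℝ≥0 :=
    { toFun := fun p => ⟨w p, w0 p⟩
      map_zero' := by ext; exact gaussNorm_zero (NormedField.toAbsoluteValue K) (r : ℝ)
      map_one' := by
        ext
        change gaussNorm _ _ 1 = 1
        rw [← C_1, gaussNorm_C]; simp
      map_mul' := fun p q => by ext; exact gaussNorm_mul hna hr' p q
      map_add_le_max' := fun p q => isNonarchimedean_gaussNorm _ hna hr'.le p q }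
  have hS : nonZeroDivisors K[X] ≤ v.supp.primeCompl := by
    intro p hp hv
    have : w p = 0 := congrArg NNReal.toReal ((Valuation.mem_supp_iff v p).1 hv)
    exact nonZeroDivisors.ne_zero hp
      ((gaussNorm_eq_zero_iff _ _ (fun x hx => by simpa using hx) hr').1 this)
  let V : Valuation (RatFunc K) ℝ≥0 := v.extendToLocalization hS (RatFunc K)
  have hV : ∀ p : K[X], V (algebraMap K[X] (RatFunc K) p) = v p :=
    fun p => v.extendToLocalization_apply_map_apply hS (RatFunc K) p
  refine ⟨AnPoint.ofValuation V fun c => ?_, fun α => ?_⟩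
  · rw [IsScalarTower.algebraMap_apply K K[X] (RatFunc K), hV]
    ext
    change gaussNorm _ _ (C c) = ‖c‖
    rw [gaussNorm_C]; rfl
  · have e : (RatFunc.X - RatFunc.C α : RatFunc K) = algebraMap K[X] (RatFunc K) (X - C α) := by
      simp
    change ((V (RatFunc.X - RatFunc.C α : RatFunc K) : ℝ≥0) : ℝ≥0∞) = _
    rw [e, hV]
    have : v (X - C α) = max ‖α‖₊ r := by
      ext
      change gaussNorm (NormedField.toAbsoluteValue K) (r : ℝ) (X - C α) = max ‖α‖ r
      apply le_antisymm
      · rw [sub_eq_add_neg, ← C_neg]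
        refine (isNonarchimedean_gaussNorm _ hna hr'.le _ _).trans ?_
        rw [gaussNorm_C, ← monomial_one_one_eq_X, gaussNorm_monomial]
        rw [max_comm, map_neg_eq_map, map_one, one_mul, pow_one]
        exact le_rfl
      · apply max_le
        · have := le_gaussNorm (NormedField.toAbsoluteValue K) (X - C α) hr'.le 0
          simp only [coeff_sub, coeff_X_zero, coeff_C_zero, zero_sub, map_neg_eq_map, pow_zero,
            mul_one] at this
          exact this
        · have := le_gaussNorm (NormedField.toAbsoluteValue K) (X - C α) hr'.le 1
          simpa using this
    rw [this, ENNReal.coe_max]; rfl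

variable [IsAlgClosed K] {t : RatFunc K}

/-- Substituting the inverse linear fractional transformation turns `t - a` into `X`; the Gauss
point centred at `0` is pulled back along this substitution. -/
theorem IsCoordinate.exists_gaussPt (ht : IsCoordinate t) (a : K) (r : ℝ≥0) (hr : 0 < r) :
    ∃ ξ : P1an K, ∀ α, ξ.val (t - RatFunc.C α) = max ‖α - a‖ₑ (r : ℝ≥0∞) := by
  obtain ⟨ξ, hξ⟩ := exists_gaussPt_X (K := K) r hr
  obtain ⟨p, q, c, d, h0, h1, h2⟩ := (ht.sub_C a).isMobius isCoordinate_X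
  -- `s` is the inverse of `t - a`, seen as a function of `X`
  have hden : (RatFunc.C c * RatFunc.X + RatFunc.C d : RatFunc K) ≠ 0 := by
    refine ratFunc_C_mul_X_add_C_ne_zero ?_
    by_contra hcd
    push Not at hcd
    exact h0 (by rw [hcd.1, hcd.2]; ring)
  let s : RatFunc K := (RatFunc.C p * RatFunc.X + RatFunc.C q) /
    (RatFunc.C c * RatFunc.X + RatFunc.C d)
  have hs : IsMobius RatFunc.X s := ⟨p, q, c, d, h0, hden, rfl⟩
  obtain ⟨φ, hφ⟩ := (isCoordinate_iff.2 hs).exists_algHom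
  have hφC : ∀ c, φ (RatFunc.C c) = RatFunc.C c := fun c => φ.commutes c
  -- `t - a` is the corresponding function of `X`
  have key : φ (t - RatFunc.C a) = RatFunc.X := by
    have h3 := congrArg φ h2
    simp only [map_div₀, map_add, map_mul, hφC, hφ] at h3
    set u := φ (t - RatFunc.C a) with hu
    have hu1 : RatFunc.C c * u + RatFunc.C d ≠ 0 := by
      have := (map_ne_zero_iff φ φ.injective).2 h1
      simpa only [map_add, map_mul, hφC, ← hu] using this
    have h4 : (RatFunc.C p * RatFunc.X + RatFunc.C q) * (RatFunc.C c * u + RatFunc.C d) =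
        (RatFunc.C p * u + RatFunc.C q) * (RatFunc.C c * RatFunc.X + RatFunc.C d) :=
      (div_eq_div_iff hden hu1).1 h3
    have h5 : (RatFunc.C (p * d - q * c) : RatFunc K) * (u - RatFunc.X) = 0 := by
      simp only [map_sub, map_mul]; linear_combination -h4
    rcases mul_eq_zero.1 h5 with h6 | h6
    · exact absurd h6 (ratFunc_C_ne_zero h0)
    · exact sub_eq_zero.1 h6
  refine ⟨ξ.comap φ, fun α => ?_⟩
  rw [← hξ, AnPoint.comap_val]
  congr 1
  rw [map_sub, hφC] at key ⊢
  rw [map_sub, ← key]; ring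

/-- Radius `0` is replaced by the harmless default `1`, which makes `gaussPt` a total function of
the radius, so that its continuity can be stated. -/
theorem ite_pos_one (r : ℝ≥0) : 0 < (if 0 < r then r else 1) := by
  by_cases h : 0 < r
  · rwa [if_pos h]
  · rw [if_neg h]; exact one_pos

/-- The Gauss point of the disc with centre `a` and radius `r` (which has to be positive) in terms
of the coordinate `t`. -/
noncomputable def gaussPt (ht : IsCoordinate t) (a : K) (r : ℝ≥0) : P1an K :=
  (ht.exists_gaussPt a (if 0 < r then r else 1) (ite_pos_one r)).choose

theorem gaussPt_val (ht : IsCoordinate t) (a : K) {r : ℝ≥0} (hr : 0 < r) (α : K) :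
    (gaussPt ht a r).val (t - RatFunc.C α) = max ‖α - a‖ₑ (r : ℝ≥0∞) := by
  have := (ht.exists_gaussPt a (if 0 < r then r else 1)
    (ite_pos_one r)).choose_spec α
  exact this.trans (by rw [if_pos hr])

theorem gaussPt_val_self (ht : IsCoordinate t) (a : K) {r : ℝ≥0} (hr : 0 < r) :
    (gaussPt ht a r).val (t - RatFunc.C a) = r := by
  rw [gaussPt_val ht a hr]; simp

theorem gaussPt_val_coord (ht : IsCoordinate t) (a : K) {r : ℝ≥0} (hr : 0 < r) :
    (gaussPt ht a r).val t = max ‖a‖ₑ (r : ℝ≥0∞) := by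
  have := gaussPt_val ht a hr 0
  simpa using this

theorem AnPoint.finite_of_coord (ht : IsCoordinate t) {ξ : P1an K}
    (h : ∀ α, ξ.val (t - RatFunc.C α) ≠ 0) (h' : ξ.val t ≠ ⊤) (g : RatFunc K) (hg : g ≠ 0) :
    ξ.val g ≠ 0 ∧ ξ.val g ≠ ⊤ := by
  revert hg
  refine ht.induction (P := fun g => ξ.val g ≠ 0 ∧ ξ.val g ≠ ⊤) ?_ ?_ ?_ ?_ g
  · exact fun c hc => ⟨ξ.const_ne_zero hc, ξ.const_ne_top c⟩
  · refine fun α => ⟨h α, ne_top_of_le_ne_top ?_ (ξ.val_sub t (RatFunc.C α))⟩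
    exact (max_lt h'.lt_top (ξ.const_ne_top α).lt_top).ne
  · rintro g g' - - ⟨h1, h2⟩ ⟨h3, h4⟩
    rw [ξ.val_mul_of_finite h2 h4]
    exact ⟨mul_ne_zero h1 h3, ENNReal.mul_ne_top h2 h4⟩
  · rintro g hg ⟨h1, h2⟩
    rw [ξ.val_inv g hg]
    exact ⟨ENNReal.inv_ne_zero.2 h2, ENNReal.inv_ne_top.2 h1⟩

theorem not_isClassical_of_coord (ht : IsCoordinate t) {ξ : P1an K}
    (h : ∀ α, ξ.val (t - RatFunc.C α) ≠ 0) (h' : ξ.val t ≠ ⊤) : ¬ ξ.IsClassical := by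
  rintro ⟨g, hg, h0⟩
  exact (AnPoint.finite_of_coord ht h h' g hg).1 h0

theorem gaussPt_not_isClassical (ht : IsCoordinate t) (a : K) {r : ℝ≥0} (hr : 0 < r) :
    ¬ (gaussPt ht a r).IsClassical := by
  refine not_isClassical_of_coord ht (fun α => ?_) ?_
  · rw [gaussPt_val ht a hr]
    exact ((ENNReal.coe_pos.2 hr).trans_le (le_max_right _ _)).ne'
  · rw [gaussPt_val_coord ht a hr]
    exact (max_lt enorm_lt_top ENNReal.coe_lt_top).ne

/-- Local structure at a classical point: `t - α` is a uniformizer. -/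
theorem IsCoordinate.exists_zpow_mul (ht : IsCoordinate t) (α₀ : K) (g : RatFunc K) (hg : g ≠ 0) :
    ∃ (n : ℤ) (w : RatFunc K) (a : K), a ≠ 0 ∧ g = (t - RatFunc.C α₀) ^ n * w ∧
      ∀ ξ : P1an K, ξ.val (t - RatFunc.C α₀) = 0 → ξ.val (w - RatFunc.C a) = 0 := by
  revert hg
  have hτ := ht.sub_C_ne_zero α₀
  refine ht.induction (P := fun g => ∃ (n : ℤ) (w : RatFunc K) (a : K), a ≠ 0 ∧
    g = (t - RatFunc.C α₀) ^ n * w ∧ ∀ ξ : P1an K, ξ.val (t - RatFunc.C α₀) = 0 →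
      ξ.val (w - RatFunc.C a) = 0) ?_ ?_ ?_ ?_ g
  · exact fun c hc => ⟨0, RatFunc.C c, c, hc, by simp, fun ξ _ => by simp⟩
  · intro α
    by_cases hα : α = α₀
    · subst hα
      exact ⟨1, 1, 1, one_ne_zero, by simp, fun ξ _ => by simp⟩
    · refine ⟨0, t - RatFunc.C α, α₀ - α, sub_ne_zero.2 (Ne.symm hα), by simp, fun ξ hξ => ?_⟩
      rw [← hξ]; congr 1; rw [map_sub]; ring
  · rintro g g' - - ⟨n, w, a, ha, rfl, h⟩ ⟨n', w', a', ha', rfl, h'⟩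
    refine ⟨n + n', w * w', a * a', mul_ne_zero ha ha', by rw [zpow_add₀ hτ]; ring, fun ξ hξ => ?_⟩
    have e : w * w' - RatFunc.C (a * a') =
        w * (w' - RatFunc.C a') + RatFunc.C a' * (w - RatFunc.C a) := by rw [map_mul]; ring
    have hw := AnPoint.val_enorm_sub_of_val_sub_eq_zero (h ξ hξ)
    rw [e, ← nonpos_iff_eq_zero]
    refine (ξ.val_add _ _).trans (max_le ?_ ?_)
    · rw [ξ.val_mul_of_finite (by rw [hw]; exact enorm_ne_top) (by rw [h' ξ hξ]; simp), h' ξ hξ,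
        mul_zero]
    · rw [ξ.val_mul_of_finite (P1an.C_ne_top ξ a') (by rw [h ξ hξ]; simp), h ξ hξ, mul_zero]
  · rintro g hg ⟨n, w, a, ha, rfl, h⟩
    have hw0 := right_ne_zero_of_mul hg
    refine ⟨-n, w⁻¹, a⁻¹, inv_ne_zero ha, by rw [mul_inv, zpow_neg], fun ξ hξ => ?_⟩
    have hw := AnPoint.val_enorm_sub_of_val_sub_eq_zero (h ξ hξ)
    have hwn : ξ.val w⁻¹ ≠ ⊤ := by
      rw [ξ.val_inv w hw0, hw]; simpa using ha
    have e : w⁻¹ - RatFunc.C a⁻¹ = -(w⁻¹ * (RatFunc.C a⁻¹ * (w - RatFunc.C a))) := by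
      have := ratFunc_C_ne_zero ha
      rw [map_inv₀]; field_simp; ring
    have h2 : ξ.val (RatFunc.C a⁻¹ * (w - RatFunc.C a)) = 0 := by
      rw [ξ.val_mul_of_finite (P1an.C_ne_top ξ a⁻¹) (by rw [h ξ hξ]; simp), h ξ hξ, mul_zero]
    rw [e, ξ.val_neg, ξ.val_mul_of_finite hwn (by rw [h2]; simp), h2, mul_zero]

/-- Points of the line are determined by the values of the linear functions. -/
theorem AnPoint.ext_coord (ht : IsCoordinate t) {ξ η : P1an K} (hξ : ξ.val t ≠ ⊤)
    (h : ∀ α, ξ.val (t - RatFunc.C α) = η.val (t - RatFunc.C α)) : ξ = η := by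
  have hη : η.val t ≠ ⊤ := by
    have := h 0
    simp only [map_zero, sub_zero] at this
    rwa [← this]
  ext g
  by_cases hg : g = 0
  · rw [hg]; simp
  by_cases hc : ∃ α, ξ.val (t - RatFunc.C α) = 0
  · obtain ⟨α, hα⟩ := hc
    obtain ⟨n, w, a, ha, rfl, hw⟩ := ht.exists_zpow_mul α g hg
    have e1 := AnPoint.val_enorm_sub_of_val_sub_eq_zero (hw ξ hα)
    have e2 := AnPoint.val_enorm_sub_of_val_sub_eq_zero (hw η (by rw [← h]; exact hα))
    have ha' : ‖a‖ₑ ≠ 0 := by simpa using ha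
    rw [ξ.val_mul_of_right (by rw [e1]; exact ha') (by rw [e1]; exact enorm_ne_top),
      η.val_mul_of_right (by rw [e2]; exact ha') (by rw [e2]; exact enorm_ne_top), e1, e2,
      ξ.val_zpow (ht.sub_C_ne_zero α), η.val_zpow (ht.sub_C_ne_zero α), h]
  · push Not at hc
    have hc' : ∀ α, η.val (t - RatFunc.C α) ≠ 0 := fun α => by rw [← h]; exact hc α
    have f1 := AnPoint.finite_of_coord ht hc hξ
    have f2 := AnPoint.finite_of_coord ht hc' hη
    refine ht.induction (P := fun g => ξ.val g = η.val g) ?_ h ?_ ?_ g hg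
    · exact fun c _ => (ξ.val_const c).trans (η.val_const c).symm
    · intro g g' hg hg' e e'
      rw [ξ.val_mul_of_finite (f1 g hg).2 (f1 g' hg').2,
        η.val_mul_of_finite (f2 g hg).2 (f2 g' hg').2, e, e']
    · intro g hg e
      rw [ξ.val_inv g hg, η.val_inv g hg, e]

end Gauss

end BerkovichCover

/-! ### Density of Gauss points, connectedness and normal form of wide opens -/

namespace BerkovichCover

open Topology Filter
open scoped NNReal

set_option linter.unusedSectionVars false

section Gauss

variable {K : Type} [NormedField K] [IsUltrametricDist K] [IsAlgClosed K] {t : RatFunc K}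

/-- The values of linear functions are visibly continuous in the radius. Multiplicative induction
carries this to all functions, since their values at Gauss points are neither `0` nor `∞` and
products in `[0, ∞]` are continuous there. -/
theorem continuousAt_gaussPt (ht : IsCoordinate t) (a : K) {r : ℝ≥0} (hr : 0 < r) :
    ContinuousAt (gaussPt ht a) r := by
  have hcl := gaussPt_not_isClassical ht a hr
  have hpos : ∀ᶠ ρ in 𝓝 r, 0 < ρ := lt_mem_nhds hr
  refine AnPoint.tendsto_of_val fun g => ?_
  by_cases hg : g = 0
  · subst hg; simp
  refine ht.induction (P := fun g => Tendsto (fun ρ => (gaussPt ht a ρ).val g) (𝓝 r)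
    (𝓝 ((gaussPt ht a r).val g))) ?_ ?_ ?_ ?_ g hg
  · intro c _
    simp only [P1an.val_C]
    exact tendsto_const_nhds
  · intro α
    rw [gaussPt_val ht a hr]
    have : Tendsto (fun ρ : ℝ≥0 => max ‖α - a‖ₑ (ρ : ℝ≥0∞)) (𝓝 r)
        (𝓝 (max ‖α - a‖ₑ (r : ℝ≥0∞))) :=
      tendsto_const_nhds.max (ENNReal.continuous_coe.tendsto r)
    refine this.congr' ?_
    filter_upwards [hpos] with ρ hρ
    rw [gaussPt_val ht a hρ]
  · intro g h hg hh h1 h2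
    rw [AnPoint.val_mul_of_not_isClassical hcl]
    refine (ENNReal.Tendsto.mul h1 (Or.inl (AnPoint.val_ne_zero_of_not_isClassical hcl hg)) h2
      (Or.inl (AnPoint.val_ne_zero_of_not_isClassical hcl hh))).congr' ?_
    filter_upwards [hpos] with ρ hρ
    rw [AnPoint.val_mul_of_not_isClassical (gaussPt_not_isClassical ht a hρ)]
  · intro g hg h1
    simp only [AnPoint.val_inv _ g hg]
    exact h1.inv

theorem gaussPt_eq_of_le (ht : IsCoordinate t) {a b : K} {r : ℝ≥0} (hr : 0 < r)
    (h : ‖a - b‖ₑ ≤ r) : gaussPt ht a r = gaussPt ht b r := by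
  refine AnPoint.ext_coord ht (AnPoint.val_ne_top_of_not_isClassical
    (gaussPt_not_isClassical ht a hr) _) fun α => ?_
  rw [gaussPt_val ht a hr, gaussPt_val ht b hr]
  have key : ∀ a b : K, ‖a - b‖ₑ ≤ r → max ‖α - a‖ₑ (r : ℝ≥0∞) ≤ max ‖α - b‖ₑ (r : ℝ≥0∞) := by
    intro a b h
    refine max_le ?_ (le_max_right _ _)
    have e : α - a = (α - b) + (b - a) := by ring
    rw [← P1an.val_C (gaussPt ht a r), e, map_add]
    refine (AnPoint.val_add _ _ _).trans ?_
    rw [P1an.val_C, P1an.val_C]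
    refine max_le_max le_rfl ?_
    rw [← enorm_neg, neg_sub]; exact h
  exact le_antisymm (key a b h) (key b a (by rw [← enorm_neg, neg_sub]; exact h))

/-- Gauss points are dense. -/
theorem exists_gaussPt_mem (ht : IsCoordinate t) {ξ : P1an K} (hξ : ξ.val t ≠ ⊤)
    {O : Set (P1an K)} (hO : IsOpen O) (hmem : ξ ∈ O) :
    ∃ (a : K) (r : ℝ≥0), 0 < r ∧ gaussPt ht a r ∈ O := by
  have hfin : ∀ α, ξ.val (t - RatFunc.C α) ≠ ⊤ := fun α =>
    ne_top_of_le_ne_top (max_lt hξ.lt_top (P1an.C_ne_top ξ α).lt_top).ne (ξ.val_sub t (RatFunc.C α))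
  -- `δ` is the distance of `ξ` from the points of `K`. The infimum need not be attained, so centres
  -- are chosen whose distances approach it.
  let δ : ℝ≥0∞ := ⨅ a, ξ.val (t - RatFunc.C a)
  have hδ : δ ≠ ⊤ := ne_top_of_le_ne_top (hfin 0) (iInf_le _ 0)
  let ε : ℕ → ℝ≥0∞ := fun n => ((n : ℝ≥0∞) + 1)⁻¹
  have hε0 : ∀ n, ε n ≠ 0 := fun n => by simp [ε]
  have hε1 : ∀ n, ε n ≠ ⊤ := fun n => by simp [ε]
  have hεt : Tendsto ε atTop (𝓝 0) := by
    have := ENNReal.tendsto_inv_nat_nhds_zero.comp (tendsto_add_atTop_nat 1)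
    refine this.congr fun n => ?_
    simp [ε]
  have ha : ∀ n, ∃ a, ξ.val (t - RatFunc.C a) < δ + ε n := fun n =>
    iInf_lt_iff.1 (ENNReal.lt_add_right hδ (hε0 n))
  choose a ha using ha
  have hrt : ∀ n, ξ.val (t - RatFunc.C (a n)) + ε n ≠ ⊤ := fun n =>
    ENNReal.add_ne_top.2 ⟨hfin _, hε1 n⟩
  -- The extra `ε n` keeps the radius positive when `ξ` is a classical point.
  let r : ℕ → ℝ≥0 := fun n => (ξ.val (t - RatFunc.C (a n)) + ε n).toNNReal
  have hr : ∀ n, (r n : ℝ≥0∞) = ξ.val (t - RatFunc.C (a n)) + ε n := fun n =>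
    ENNReal.coe_toNNReal (hrt n)
  have hr0 : ∀ n, 0 < r n := fun n => by
    rw [← ENNReal.coe_pos, hr]
    exact (pos_iff_ne_zero.2 (hε0 n)).trans_le le_add_self
  have hlim : ∀ α, Tendsto (fun n => (gaussPt ht (a n) (r n)).val (t - RatFunc.C α)) atTop
      (𝓝 (ξ.val (t - RatFunc.C α))) := by
    intro α
    have hup : Tendsto (fun n => ξ.val (t - RatFunc.C α) + ε n + ε n) atTop
        (𝓝 (ξ.val (t - RatFunc.C α))) := by
      have := (tendsto_const_nhds (x := ξ.val (t - RatFunc.C α))).add hεt |>.add hεt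
      simpa using this
    refine tendsto_of_tendsto_of_tendsto_of_le_of_le tendsto_const_nhds hup ?_ ?_
    · intro n
      change _ ≤ (gaussPt ht (a n) (r n)).val (t - RatFunc.C α)
      rw [gaussPt_val ht _ (hr0 n), hr]
      have e : t - RatFunc.C α = (t - RatFunc.C (a n)) - RatFunc.C (α - a n) := by
        rw [map_sub]; ring
      rw [e]
      refine (ξ.val_sub _ _).trans ?_
      rw [P1an.val_C, max_comm]
      exact max_le_max le_rfl le_self_add
    · intro n
      change (gaussPt ht (a n) (r n)).val (t - RatFunc.C α) ≤ _
      rw [gaussPt_val ht _ (hr0 n), hr]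
      have h1 : ξ.val (t - RatFunc.C (a n)) + ε n ≤ ξ.val (t - RatFunc.C α) + ε n + ε n := by
        gcongr
        exact (ha n).le.trans (by gcongr; exact iInf_le _ α)
      refine max_le ?_ h1
      have e : RatFunc.C (α - a n) = (t - RatFunc.C (a n)) - (t - RatFunc.C α) := by
        rw [map_sub]; ring
      rw [← P1an.val_C ξ, e]
      refine (ξ.val_sub _ _).trans (max_le (le_self_add.trans h1) ?_)
      change _ ≤ ξ.val (t - RatFunc.C α) + ε n + ε n
      rw [add_assoc]; exact le_self_add
  -- Only the values of linear functions are known to converge. Compactness supplies a limit along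
  -- an ultrafilter, and `AnPoint.ext_coord` identifies it with `ξ`.
  let 𝒰 : Ultrafilter ℕ := Filter.hyperfilter ℕ
  have h𝒰 : (𝒰 : Filter ℕ) ≤ atTop := Nat.hyperfilter_le_atTop
  let η := (𝒰.map fun n => gaussPt ht (a n) (r n)).lim
  have hη : Tendsto (fun n => gaussPt ht (a n) (r n)) 𝒰 (𝓝 η) :=
    (𝒰.map fun n => gaussPt ht (a n) (r n)).le_nhds_lim
  have heq : ξ = η := by
    refine AnPoint.ext_coord ht hξ fun α => ?_
    exact tendsto_nhds_unique ((hlim α).mono_left h𝒰)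
      (((AnPoint.continuous_val _).tendsto η).comp hη)
  rw [← heq] at hη
  obtain ⟨n, hn⟩ := (hη.eventually (hO.mem_nhds hmem)).exists
  exact ⟨a n, r n, hr0 n, hn⟩

/-- A wide open in terms of a coordinate with pole outside: an open disc minus finitely many
closed discs. -/
def wideOpen (s : RatFunc K) (I : Finset (K × ℝ≥0)) : Set (P1an K) :=
  {ξ | ξ.val s < 1 ∧ ∀ i ∈ I, (i.2 : ℝ≥0∞) < ξ.val (s - RatFunc.C i.1)}

/-- The Gauss points in `U` are dense, and any two are joined by increasing their radii until their
discs coincide. Increasing a radius below `1` never leaves `U`, because it only increases the values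
`|s - aᵢ|`. -/
theorem isConnected_wideOpen {s : RatFunc K} (hs : IsCoordinate s) {I : Finset (K × ℝ≥0)}
    (hopen : IsOpen (wideOpen s I)) (hne : (wideOpen s I).Nonempty) :
    IsConnected (wideOpen s I) := by
  refine ⟨hne, ?_⟩
  set U := wideOpen s I with hU
  let G : Set (P1an K) := {η | ∃ (a : K) (r : ℝ≥0), 0 < r ∧ η = gaussPt hs a r ∧ η ∈ U}
  have hGU : G ⊆ U := by rintro _ ⟨a, r, -, -, h⟩; exact h
  have hUG : U ⊆ closure G := by
    intro ξ hξ
    rw [mem_closure_iff]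
    intro O hO hξO
    obtain ⟨a, r, hr, hmem⟩ := exists_gaussPt_mem hs (ne_top_of_lt hξ.1) (hO.inter hopen) ⟨hξO, hξ⟩
    exact ⟨_, hmem.1, a, r, hr, rfl, hmem.2⟩
  refine IsPreconnected.subset_closure ?_ hGU hUG
  have hlt : ∀ {a : K} {r : ℝ≥0}, 0 < r → gaussPt hs a r ∈ U → ‖a‖ₑ < 1 ∧ r < 1 := by
    intro a r hr h
    have := h.1
    rw [gaussPt_val_coord hs a hr, max_lt_iff] at this
    exact ⟨this.1, by exact_mod_cast this.2⟩
  have hup : ∀ {a : K} {r ρ : ℝ≥0}, 0 < r → gaussPt hs a r ∈ U → r ≤ ρ → ρ < 1 →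
      gaussPt hs a ρ ∈ G := by
    intro a r ρ hr h hρ hρ1
    have hρ0 := hr.trans_le hρ
    refine ⟨a, ρ, hρ0, rfl, ?_, fun i hi => ?_⟩
    · rw [gaussPt_val_coord hs a hρ0]
      exact max_lt (hlt hr h).1 (by exact_mod_cast hρ1)
    · rw [gaussPt_val hs a hρ0]
      refine (h.2 i hi).trans_le ?_
      rw [gaussPt_val hs a hr]
      exact max_le_max le_rfl (by exact_mod_cast hρ)
  have hpath : ∀ {a : K} {r m : ℝ≥0}, 0 < r → gaussPt hs a r ∈ U → r ≤ m → m < 1 →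
      gaussPt hs a '' Set.Icc r m ⊆ G ∧ IsPreconnected (gaussPt hs a '' Set.Icc r m) := by
    intro a r m hr h hrm hm
    refine ⟨?_, ?_⟩
    · rintro _ ⟨ρ, hρ, rfl⟩
      exact hup hr h hρ.1 (hρ.2.trans_lt hm)
    · exact isPreconnected_Icc.image _ fun ρ hρ =>
        (continuousAt_gaussPt hs a (hr.trans_le hρ.1)).continuousWithinAt
  refine isPreconnected_of_forall_pair ?_
  rintro _ ⟨a, r, hr, rfl, h⟩ _ ⟨b, q, hq, rfl, h'⟩
  obtain ⟨ha, hr1⟩ := hlt hr h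
  obtain ⟨hb, hq1⟩ := hlt hq h'
  have hab : ‖a - b‖₊ < 1 := by
    have : ‖a - b‖ₑ < 1 := by
      rw [← P1an.val_C (gaussPt hs a r), map_sub]
      refine (AnPoint.val_sub _ _ _).trans_lt ?_
      rw [P1an.val_C, P1an.val_C]; exact max_lt ha hb
    rw [enorm_eq_nnnorm] at this
    exact_mod_cast this
  -- With this radius the discs around `a` and `b` are equal, and it is still less than `1`.
  let m : ℝ≥0 := max ‖a - b‖₊ (max r q)
  have hm : m < 1 := max_lt hab (max_lt hr1 hq1)
  have hrm : r ≤ m := (le_max_left r q).trans (le_max_right _ _)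
  have hqm : q ≤ m := (le_max_right r q).trans (le_max_right _ _)
  obtain ⟨s1, p1⟩ := hpath hr h hrm hm
  obtain ⟨s2, p2⟩ := hpath hq h' hqm hm
  refine ⟨_, Set.union_subset s1 s2, Or.inl ⟨r, ⟨le_rfl, hrm⟩, rfl⟩,
    Or.inr ⟨q, ⟨le_rfl, hqm⟩, rfl⟩, ?_⟩
  refine p1.union (gaussPt hs a m) ⟨m, ⟨hrm, le_rfl⟩, rfl⟩ ⟨m, ⟨hqm, le_rfl⟩, ?_⟩ p2
  refine (gaussPt_eq_of_le hs (hr.trans_le hrm) ?_).symm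
  exact ENNReal.coe_le_coe.2 (le_max_left _ _)

theorem AnPoint.val_const_mul_le_iff {L : Type} [Field L] [Algebra K L] (ξ : AnPoint K L) {c d : K}
    (hc : c ≠ 0) (g : L) : ξ.val (algebraMap K L c * g) ≤ ‖d‖ₑ ↔ ξ.val g ≤ ‖d / c‖ₑ := by
  rw [ξ.val_const_mul hc, div_eq_mul_inv, enorm_mul, enorm_inv hc, ← div_eq_mul_inv,
    ENNReal.le_div_iff_mul_le (Or.inl (by simpa using hc)) (Or.inl enorm_ne_top), mul_comm]

/-- A closed disc is a disc around a finite point or a disc around infinity. -/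
theorem IsClosedDisc.normal_form {s : RatFunc K} (hs : IsCoordinate s) {Δ : Set (P1an K)}
    (hΔ : IsClosedDisc Δ) :
    (∃ (a : K) (r : ℝ≥0), 0 < r ∧ Δ = {ξ : P1an K | ξ.val (s - RatFunc.C a) ≤ r}) ∨
    (∃ (a : K) (r : ℝ≥0), 0 < r ∧ Δ = {ξ : P1an K | (r : ℝ≥0∞) ≤ ξ.val (s - RatFunc.C a)}) := by
  obtain ⟨t, ht, rfl⟩ := hΔ
  obtain ⟨A, B, C, D, h0, h1, h2⟩ := hs.isMobius ht
  by_cases hC : C = 0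
  · subst hC
    have hA : A ≠ 0 := by rintro rfl; simp at h0
    have hD : D ≠ 0 := by rintro rfl; simp at h0
    left
    refine ⟨-B / A, ‖1 / (A / D)‖₊, by simp [hA, hD], ?_⟩
    have e : t = RatFunc.C (A / D) * (s - RatFunc.C (-B / A)) := by
      have := ratFunc_C_ne_zero hA
      have := ratFunc_C_ne_zero hD
      rw [h2]; simp only [map_div₀, map_neg, map_zero, zero_mul, zero_add]; field_simp; ring
    ext ξ
    simp only [Set.mem_ofPred_eq]
    rw [e, ← enorm_eq_nnnorm, ← enorm_one (G := K)]
    exact ξ.val_const_mul_le_iff (div_ne_zero hA hD) _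
  -- Normal form `t = u + k / (s - β)`: here `u` is the value of `t` at `s = ∞` and `β` is the pole
  -- of `t`.
  · let u := A / C
    let k := (B * C - A * D) / C ^ 2
    let β := -D / C
    have hk : k ≠ 0 := by
      refine div_ne_zero ?_ (pow_ne_zero 2 hC)
      rw [← neg_ne_zero]; ring_nf at h0 ⊢; exact h0
    have hsβ := hs.sub_C_ne_zero β
    have hkC := ratFunc_C_ne_zero hk
    have e : t = RatFunc.C u + RatFunc.C k * (s - RatFunc.C β)⁻¹ := by
      have hC' := ratFunc_C_ne_zero hC
      have h3 : RatFunc.C C * s + RatFunc.C D = RatFunc.C C * (s - RatFunc.C β) := by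
        simp only [β, map_div₀, map_neg]; field_simp; ring
      rw [h2, h3]
      have h4 : RatFunc.C A * s + RatFunc.C B =
          RatFunc.C A * (s - RatFunc.C β) + RatFunc.C (B - A * D / C) := by
        simp only [β, map_div₀, map_neg, map_sub, map_mul]; field_simp; ring
      rw [h4]
      generalize s - RatFunc.C β = w at *
      simp only [u, k, map_div₀, map_sub, map_mul, map_pow]
      field_simp
    -- This asks whether `s = ∞` belongs to the disc `|t| ≤ 1`, so whether the disc is one around
    -- infinity.
    by_cases hu : ‖u‖ₑ ≤ 1
    · right
      refine ⟨β, ‖k‖₊, by simpa using hk, ?_⟩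
      ext ξ
      simp only [Set.mem_ofPred_eq]
      have e1 : ξ.val t ≤ 1 ↔ ξ.val (RatFunc.C k * (s - RatFunc.C β)⁻¹) ≤ 1 := by
        have e2 : RatFunc.C k * (s - RatFunc.C β)⁻¹ = t - RatFunc.C u := by rw [e]; ring
        constructor
        · intro h
          rw [e2]
          exact (ξ.val_sub _ _).trans (max_le h (by rwa [P1an.val_C]))
        · intro h
          rw [e]
          exact (ξ.val_add _ _).trans (max_le (by rwa [P1an.val_C]) h)
      rw [e1, ← enorm_one (G := K), ← RatFunc.algebraMap_eq_C, ξ.val_const_mul_le_iff hk,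
        RatFunc.algebraMap_eq_C, ξ.val_inv _ hsβ, one_div, enorm_inv hk, ENNReal.inv_le_inv,
        enorm_eq_nnnorm]
    · left
      push Not at hu
      have hu0 : u ≠ 0 := by intro h; rw [h] at hu; simp at hu
      have huC := ratFunc_C_ne_zero hu0
      -- The centre is the zero of `t = u (s - (β - k / u)) / (s - β)`. On the disc `|s - β|` is
      -- constantly `|k / u|`, which gives the radius.
      refine ⟨β - k / u, ‖k / u ^ 2‖₊, by simp [hk, hu0], ?_⟩
      have hlt : ‖k / u ^ 2‖ₑ < ‖k / u‖ₑ := by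
        have : k / u = u * (k / u ^ 2) := by field_simp
        rw [this, enorm_mul]
        have hne : ‖k / u ^ 2‖ₑ ≠ 0 := by simp [hk, hu0]
        calc ‖k / u ^ 2‖ₑ = 1 * ‖k / u ^ 2‖ₑ := (one_mul _).symm
          _ < _ := ENNReal.mul_lt_mul_left hne enorm_ne_top hu
      have h5 : RatFunc.C k * (s - RatFunc.C β)⁻¹ = t - RatFunc.C u := by rw [e]; ring
      have htu : t - RatFunc.C u ≠ 0 := ht.sub_C_ne_zero u
      ext ξ
      simp only [Set.mem_ofPred_eq]
      rw [← enorm_eq_nnnorm]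
      constructor
      · intro h
        have e1 : s - RatFunc.C (β - k / u) =
            RatFunc.C (k / u) * (t * (t - RatFunc.C u)⁻¹) := by
          have h6 : (s - RatFunc.C β) * (t - RatFunc.C u) = RatFunc.C k := by
            rw [← h5]; field_simp
          have h7 : s - RatFunc.C β = RatFunc.C k * (t - RatFunc.C u)⁻¹ := by
            rw [← h6, mul_inv_cancel_right₀ htu]
          have h8 : s - RatFunc.C (β - k / u) = (s - RatFunc.C β) + RatFunc.C (k / u) := by
            rw [map_sub]; ring
          rw [h8, h7]
          simp only [map_div₀]
          field_simp
          ring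
        have hval : ξ.val (t - RatFunc.C u) = ‖u‖ₑ := by
          rw [ξ.val_sub_comm, ← P1an.val_C ξ u]
          refine ξ.val_eq_of_sub_lt ?_
          rw [P1an.val_C]
          simpa using h.trans_lt hu
        have hv0 : ξ.val (t - RatFunc.C u) ≠ 0 := by rw [hval]; simpa using hu0
        have hv1 : ξ.val (t - RatFunc.C u) ≠ ⊤ := by rw [hval]; exact enorm_ne_top
        rw [e1, ← RatFunc.algebraMap_eq_C, ξ.val_const_mul_le_iff (div_ne_zero hk hu0),
          RatFunc.algebraMap_eq_C, ← div_eq_mul_inv, ξ.val_div_of hv0 hv1, hval]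
        have : k / u ^ 2 / (k / u) = u⁻¹ := by field_simp
        rw [this, enorm_inv hu0, ← one_div]
        gcongr
      · intro h
        have hβ : ξ.val (s - RatFunc.C β) = ‖k / u‖ₑ := by
          have h8 : s - RatFunc.C β = (s - RatFunc.C (β - k / u)) + (-RatFunc.C (k / u)) := by
            rw [map_sub]; ring
          rw [h8, ξ.val_add_of_lt, ξ.val_neg, P1an.val_C]
          rw [ξ.val_neg, P1an.val_C]
          exact h.trans_lt hlt
        have hv0 : ξ.val (s - RatFunc.C β) ≠ 0 := by rw [hβ]; simp [hk, hu0]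
        have hv1 : ξ.val (s - RatFunc.C β) ≠ ⊤ := by rw [hβ]; exact enorm_ne_top
        have e1 : t = RatFunc.C u * ((s - RatFunc.C (β - k / u)) / (s - RatFunc.C β)) := by
          have h8 : s - RatFunc.C (β - k / u) = (s - RatFunc.C β) + RatFunc.C (k / u) := by
            rw [map_sub]; ring
          rw [h8, e]
          generalize s - RatFunc.C β = w at *
          simp only [map_div₀]
          field_simp
        rw [e1, ← RatFunc.algebraMap_eq_C, ← enorm_one (G := K), ξ.val_const_mul_le_iff hu0,
          RatFunc.algebraMap_eq_C, ξ.val_div_of hv0 hv1, hβ,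
          ENNReal.div_le_iff (by simp [hk, hu0]) enorm_ne_top, ← enorm_mul]
        have : 1 / u * (k / u) = k / u ^ 2 := by field_simp
        rwa [this]

theorem IsWideOpen.isOpen {U : Set (P1an K)} (hU : IsWideOpen U) : IsOpen U := by
  obtain ⟨𝒟, hfin, hD, -, rfl⟩ := hU
  rw [isOpen_compl_iff]
  rw [Set.sUnion_eq_biUnion]
  refine hfin.isClosed_biUnion fun D hDD => ?_
  obtain ⟨t, -, rfl⟩ := hD D hDD
  exact isClosed_le (AnPoint.continuous_val t) continuous_const

/-- A wide open other than the line is an open disc minus finitely many disjoint closed discs. -/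
theorem IsWideOpen.exists_wideOpen {U : Set (P1an K)} (hU : IsWideOpen U) (hne : U ≠ Set.univ) :
    ∃ (s : RatFunc K) (_ : IsCoordinate s) (I : Finset (K × ℝ≥0)), U = wideOpen s I ∧
      (∀ i ∈ I, 0 < i.2 ∧ i.2 < 1 ∧ ‖i.1‖ₑ < 1) ∧
      (∀ i ∈ I, ∀ j ∈ I, i ≠ j → (j.2 : ℝ≥0∞) < max ‖j.1 - i.1‖ₑ i.2) := by
  classical
  obtain ⟨𝒟, hfin, hD, hdisj, rfl⟩ := hU
  have hne' : 𝒟.Nonempty := by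
    by_contra h
    rw [Set.not_nonempty_iff_eq_empty] at h
    subst h
    simp at hne
  obtain ⟨D₁, hD₁⟩ := hne'
  obtain ⟨t, ht, hDt⟩ := hD D₁ hD₁
  -- Inverting the coordinate of one removed disc moves that disc to infinity, where it becomes `|s|
  -- ≥ 1`.
  have hs := ht.inv
  set s := t⁻¹ with hst
  have hD₁s : ∀ ξ : P1an K, ξ ∈ D₁ ↔ 1 ≤ ξ.val s := fun ξ => by
    rw [hDt, hst, ξ.val_inv t ht.ne_zero, ENNReal.one_le_inv]; rfl
  have hform : ∀ D ∈ 𝒟, D ≠ D₁ → ∃ i : K × ℝ≥0, 0 < i.2 ∧ i.2 < 1 ∧ ‖i.1‖ₑ < 1 ∧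
      D = {ξ : P1an K | ξ.val (s - RatFunc.C i.1) ≤ i.2} := by
    intro D hDD hne
    have hdis : ∀ ξ ∈ D, ξ.val s < 1 := fun ξ hξ => by
      by_contra h
      exact Set.disjoint_left.1 (hdisj hDD hD₁ hne) hξ ((hD₁s ξ).2 (not_lt.1 h))
    rcases (hD D hDD).normal_form hs with ⟨a, r, hr, rfl⟩ | ⟨a, r, hr, rfl⟩
    · have := hdis (gaussPt hs a r) (by
        rw [Set.mem_ofPred_eq, gaussPt_val_self hs a hr])
      rw [gaussPt_val_coord hs a hr, max_lt_iff] at this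
      exact ⟨(a, r), hr, by exact_mod_cast this.2, this.1, rfl⟩
    -- A disc around infinity cannot be disjoint from `|s| ≥ 1`: both contain Gauss points of large
    -- radius.
    · exfalso
      have hm : 0 < max r 1 := hr.trans_le (le_max_left _ _)
      have := hdis (gaussPt hs a (max r 1)) (by
        rw [Set.mem_ofPred_eq, gaussPt_val_self hs a hm]; exact_mod_cast le_max_left r 1)
      rw [gaussPt_val_coord hs a hm, max_lt_iff] at this
      exact absurd this.2 (not_lt.2 (by exact_mod_cast le_max_right r 1))
  choose! i hi using hform
  let I : Finset (K × ℝ≥0) := (hfin.toFinset.erase D₁).image i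
  have hI : ∀ j ∈ I, ∃ D ∈ 𝒟, D ≠ D₁ ∧ i D = j := by
    intro j hj
    obtain ⟨D, hD, rfl⟩ := Finset.mem_image.1 hj
    rw [Finset.mem_erase, Set.Finite.mem_toFinset] at hD
    exact ⟨D, hD.2, hD.1, rfl⟩
  refine ⟨s, hs, I, ?_, ?_, ?_⟩
  · ext ξ
    simp only [Set.mem_compl_iff, Set.mem_sUnion, not_exists, not_and]
    constructor
    · intro h
      refine ⟨not_le.1 fun h1 => h D₁ hD₁ ((hD₁s ξ).2 h1), fun j hj => ?_⟩
      obtain ⟨D, hDD, hne, rfl⟩ := hI j hj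
      refine not_le.1 fun h1 => h D hDD ?_
      exact (Set.ext_iff.1 (hi D hDD hne).2.2.2 ξ).2 h1
    · rintro ⟨h1, h2⟩ D hDD hξ
      by_cases hne : D = D₁
      · subst hne
        exact absurd ((hD₁s ξ).1 hξ) (not_le.2 h1)
      · have h3 := h2 (i D) (Finset.mem_image_of_mem _ (by
          rw [Finset.mem_erase, Set.Finite.mem_toFinset]; exact ⟨hne, hDD⟩))
        exact absurd ((Set.ext_iff.1 (hi D hDD hne).2.2.2 ξ).1 hξ) (not_le.2 h3)
  · intro j hj
    obtain ⟨D, hDD, hne, rfl⟩ := hI j hj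
    obtain ⟨h1, h2, h3, -⟩ := hi D hDD hne
    exact ⟨h1, h2, h3⟩
  · intro j hj j' hj' hjj
    obtain ⟨D, hDD, hne, rfl⟩ := hI j hj
    obtain ⟨D', hDD', hne', rfl⟩ := hI j' hj'
    have hDne : D ≠ D' := by rintro rfl; exact hjj rfl
    have hmem : gaussPt hs (i D).1 (i D).2 ∈ D := by
      refine (Set.ext_iff.1 (hi D hDD hne).2.2.2 _).2 ?_
      rw [Set.mem_ofPred_eq, gaussPt_val_self hs _ (hi D hDD hne).1]
    have hnot := Set.disjoint_left.1 (hdisj hDD hDD' hDne) hmem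
    rw [id, Set.ext_iff.1 (hi D' hDD' hne').2.2.2, Set.mem_ofPred_eq] at hnot
    have := not_le.1 hnot
    rwa [gaussPt_val hs _ (hi D hDD hne).1] at this

end Gauss

end BerkovichCover

/-! ### Values in `K` and uniformizers at classical points -/

namespace BerkovichCover

open Topology Filter
open scoped NNReal

set_option linter.unusedSectionVars false

section Values

variable {K F : Type} [NormedField K] [IsUltrametricDist K] [Field F] [Algebra K F]

/-- The function `g` takes the value `a ∈ K` at the point `ξ`. -/
def AnPoint.HasValue (ξ : AnPoint K F) (g : F) (a : K) : Prop :=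
  ξ.val (g - algebraMap K F a) = 0

namespace AnPoint.HasValue

variable {ξ : AnPoint K F} {g h : F} {a b : K}

theorem val_eq (hg : ξ.HasValue g a) : ξ.val g = ‖a‖ₑ :=
  val_enorm_sub_of_val_sub_eq_zero hg

theorem val_ne_top (hg : ξ.HasValue g a) : ξ.val g ≠ ⊤ := by
  rw [hg.val_eq]; exact enorm_ne_top

theorem val_ne_zero (hg : ξ.HasValue g a) (ha : a ≠ 0) : ξ.val g ≠ 0 := by
  rw [hg.val_eq]; simpa using ha

theorem ne_zero (hg : ξ.HasValue g a) (ha : a ≠ 0) : g ≠ 0 := by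
  rintro rfl; exact hg.val_ne_zero ha ξ.val_zero

theorem of_val_eq_zero (hg : ξ.val g = 0) : ξ.HasValue g 0 := by
  simpa [HasValue] using hg

theorem eq_zero_iff (hg : ξ.HasValue g a) : ξ.val g = 0 ↔ a = 0 := by
  rw [hg.val_eq]; simp

theorem const (c : K) : ξ.HasValue (algebraMap K F c) c := by simp [HasValue]

theorem add (hg : ξ.HasValue g a) (hh : ξ.HasValue h b) : ξ.HasValue (g + h) (a + b) := by
  have e : g + h - algebraMap K F (a + b) =
      (g - algebraMap K F a) + (h - algebraMap K F b) := by rw [map_add]; ring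
  refine le_antisymm ?_ zero_le
  rw [e]
  exact (ξ.val_add _ _).trans (max_le hg.le hh.le)

theorem mul (hg : ξ.HasValue g a) (hh : ξ.HasValue h b) : ξ.HasValue (g * h) (a * b) := by
  have e : g * h - algebraMap K F (a * b) =
      (g - algebraMap K F a) * h + algebraMap K F a * (h - algebraMap K F b) := by
    rw [map_mul]; ring
  refine le_antisymm ?_ zero_le
  rw [e]
  refine (ξ.val_add _ _).trans (max_le ?_ ?_)
  · rw [ξ.val_mul_of_finite (by rw [hg]; exact ENNReal.zero_ne_top) hh.val_ne_top, hg, zero_mul]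
  · rw [ξ.val_mul_of_finite (ξ.const_ne_top a) (by rw [hh]; exact ENNReal.zero_ne_top), hh,
      mul_zero]

theorem neg (hg : ξ.HasValue g a) : ξ.HasValue (-g) (-a) := by
  have := (const (ξ := ξ) (-1)).mul hg
  simpa using this

theorem sub (hg : ξ.HasValue g a) (hh : ξ.HasValue h b) : ξ.HasValue (g - h) (a - b) := by
  simpa [sub_eq_add_neg] using hg.add hh.neg

theorem inv (hg : ξ.HasValue g a) (ha : a ≠ 0) : ξ.HasValue g⁻¹ a⁻¹ := by
  have hg0 := hg.ne_zero ha
  have haF : algebraMap K F a ≠ 0 := by simpa using ha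
  have e : g⁻¹ - algebraMap K F a⁻¹ = -((g - algebraMap K F a) / (g * algebraMap K F a)) := by
    rw [map_inv₀]; field_simp; ring
  have hm := hg.mul (const (ξ := ξ) a)
  have haa : a * a ≠ 0 := mul_ne_zero ha ha
  unfold HasValue
  rw [e, ξ.val_neg, ξ.val_div_of (hm.val_ne_zero haa) hm.val_ne_top, hg]
  simp

theorem unique (hg : ξ.HasValue g a) (hg' : ξ.HasValue g b) : a = b := by
  have := hg.sub hg'
  rw [sub_self] at this
  exact sub_eq_zero.1 (this.eq_zero_iff.1 ξ.val_zero)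

theorem pow (hg : ξ.HasValue g a) (n : ℕ) : ξ.HasValue (g ^ n) (a ^ n) := by
  induction n with
  | zero => simpa using const (ξ := ξ) 1
  | succ n ih => rw [pow_succ, pow_succ]; exact ih.mul hg

theorem zpow (hg : ξ.HasValue g a) (ha : a ≠ 0) (n : ℤ) : ξ.HasValue (g ^ n) (a ^ n) := by
  cases n with
  | ofNat n => simpa using hg.pow n
  | negSucc n => simpa using (hg.pow (n + 1)).inv (pow_ne_zero _ ha)

theorem aeval (hg : ξ.HasValue g a) (p : K[X]) : ξ.HasValue (Polynomial.aeval g p) (p.eval a) := by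
  induction p using Polynomial.induction_on' with
  | add p q hp hq => simpa using hp.add hq
  | monomial n c => simpa [aeval_monomial] using (const (ξ := ξ) c).mul (hg.pow n)

/-- The value of `h` with `h ^ 2 = g`, up to sign. -/
theorem of_sq (hg : ξ.HasValue (h ^ 2) (b ^ 2)) : ξ.HasValue h b ∨ ξ.HasValue h (-b) := by
  by_contra hcon
  push Not at hcon
  have e : h ^ 2 - algebraMap K F (b ^ 2) =
      (h - algebraMap K F b) * (h - algebraMap K F (-b)) := by simp; ring
  unfold HasValue at hg hcon
  rw [e, ξ.val_mul _ _ (fun H => hcon.1 H.1) (fun H => hcon.2 H.2), mul_eq_zero] at hg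
  exact hg.elim hcon.1 hcon.2

end AnPoint.HasValue

/-- The function `τ` is a uniformizer at all points of `Φ`, with values of functions that do not
depend on the point. -/
structure IsUniformizer (Φ : Set (AnPoint K F)) (τ : F) : Prop where
  ne_zero : τ ≠ 0
  val_eq : ∀ ξ ∈ Φ, ξ.val τ = 0
  exists_zpow_mul : ∀ g, g ≠ 0 → ∃ (n : ℤ) (w : F) (a : K), a ≠ 0 ∧ g = τ ^ n * w ∧
    ∀ ξ ∈ Φ, ξ.HasValue w a

namespace IsUniformizer

variable {Φ : Set (AnPoint K F)} {τ : F}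

theorem val_zpow_mul (h : IsUniformizer Φ τ) {ξ : AnPoint K F} (hξ : ξ ∈ Φ) (n : ℤ) {w : F} {a : K}
    (ha : a ≠ 0) (hw : ξ.HasValue w a) : ξ.val (τ ^ n * w) = 0 ^ n * ‖a‖ₑ := by
  rw [ξ.val_mul_of_right (hw.val_ne_zero ha) hw.val_ne_top, ξ.val_zpow h.ne_zero, h.val_eq ξ hξ,
    hw.val_eq]

theorem subsingleton (h : IsUniformizer Φ τ) : Φ.Subsingleton := by
  intro ξ hξ η hη
  ext g
  by_cases hg : g = 0
  · simp [hg]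
  obtain ⟨n, w, a, ha, rfl, hw⟩ := h.exists_zpow_mul g hg
  rw [h.val_zpow_mul hξ n ha (hw ξ hξ), h.val_zpow_mul hη n ha (hw η hη)]

theorem mono (h : IsUniformizer Φ τ) {Ψ : Set (AnPoint K F)} (hΨ : Ψ ⊆ Φ) : IsUniformizer Ψ τ where
  ne_zero := h.ne_zero
  val_eq ξ hξ := h.val_eq ξ (hΨ hξ)
  exists_zpow_mul g hg := by
    obtain ⟨n, w, a, ha, e, hw⟩ := h.exists_zpow_mul g hg
    exact ⟨n, w, a, ha, e, fun ξ hξ => hw ξ (hΨ hξ)⟩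

theorem exists_of_val_ne_top {ξ : AnPoint K F} (h : IsUniformizer {ξ} τ) {g : F}
    (hg : ξ.val g ≠ ⊤) : ∃ a, ξ.HasValue g a := by
  by_cases hg0 : g = 0
  · exact ⟨0, AnPoint.HasValue.of_val_eq_zero (by simp [hg0])⟩
  obtain ⟨n, w, a, ha, rfl, hw⟩ := h.exists_zpow_mul g hg0
  have hw := hw ξ rfl
  rcases lt_trichotomy n 0 with hn | rfl | hn
  · exfalso; apply hg
    rw [h.val_zpow_mul rfl n ha hw, ENNReal.zero_zpow_def, if_neg hn.ne, if_neg (not_lt.2 hn.le)]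
    exact ENNReal.top_mul (by simpa using ha)
  · exact ⟨a, by simpa using hw⟩
  · refine ⟨0, AnPoint.HasValue.of_val_eq_zero ?_⟩
    rw [h.val_zpow_mul rfl n ha hw, ENNReal.zero_zpow_def, if_neg hn.ne', if_pos hn, zero_mul]

theorem exists_mul_of_hasValue_zero {ξ : AnPoint K F} (h : IsUniformizer {ξ} τ) {g : F}
    (hg : ξ.HasValue g 0) : ∃ g' b, g = τ * g' ∧ ξ.HasValue g' b := by
  by_cases hg0 : g = 0
  · exact ⟨0, 0, by simp [hg0], AnPoint.HasValue.of_val_eq_zero (by simp)⟩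
  obtain ⟨n, w, a, ha, rfl, hw⟩ := h.exists_zpow_mul g hg0
  have hw := hw ξ rfl
  have hn : 0 < n := by
    by_contra hn
    have h0 := hg.val_eq
    rw [h.val_zpow_mul rfl n ha hw, ENNReal.zero_zpow_def, if_neg hn] at h0
    have ha' : ‖a‖ₑ ≠ 0 := by simpa using ha
    split_ifs at h0 <;> simp [ha'] at h0
  have e : τ ^ n * w = τ * (τ ^ (n - 1) * w) := by
    rw [← mul_assoc, ← zpow_one_add₀ h.ne_zero]; congr 2; ring
  obtain ⟨b, hb⟩ := h.exists_of_val_ne_top (g := τ ^ (n - 1) * w) (by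
    rw [h.val_zpow_mul rfl _ ha hw, ENNReal.zero_zpow_def]
    split_ifs with h1 h2
    · simp
    · simp
    · omega)
  exact ⟨_, b, e, hb⟩

/-- Two functions have a common largest power of the uniformizer as a factor. -/
theorem exists_zpow_mul_pair {ξ : AnPoint K F} (h : IsUniformizer {ξ} τ) {u v : F}
    (huv : u ≠ 0 ∨ v ≠ 0) : ∃ (j : ℤ) (u' v' : F) (a b : K), u = τ ^ j * u' ∧ v = τ ^ j * v' ∧
      ξ.HasValue u' a ∧ ξ.HasValue v' b ∧ (a ≠ 0 ∨ b ≠ 0) := by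
  have key : ∀ u v : F, u ≠ 0 → (v = 0 ∨ ∃ w : F, v = u * w ∧ ξ.val w ≠ ⊤) →
      ∃ (j : ℤ) (u' v' : F) (a b : K), u = τ ^ j * u' ∧ v = τ ^ j * v' ∧
      ξ.HasValue u' a ∧ ξ.HasValue v' b ∧ (a ≠ 0 ∨ b ≠ 0) := by
    intro u v hu hv
    obtain ⟨n, w, a, ha, rfl, hw⟩ := h.exists_zpow_mul u hu
    have hw := hw ξ rfl
    rcases hv with rfl | ⟨w', rfl, hw'⟩
    · exact ⟨n, w, 0, a, 0, rfl, by simp, hw, .of_val_eq_zero (by simp), Or.inl ha⟩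
    · obtain ⟨b, hb⟩ := h.exists_of_val_ne_top hw'
      exact ⟨n, w, w * w', a, a * b, rfl, by ring, hw, hw.mul hb, Or.inl ha⟩
  have swap : (∃ (j : ℤ) (u' v' : F) (a b : K), v = τ ^ j * u' ∧ u = τ ^ j * v' ∧
      ξ.HasValue u' a ∧ ξ.HasValue v' b ∧ (a ≠ 0 ∨ b ≠ 0)) →
      ∃ (j : ℤ) (u' v' : F) (a b : K), u = τ ^ j * u' ∧ v = τ ^ j * v' ∧
      ξ.HasValue u' a ∧ ξ.HasValue v' b ∧ (a ≠ 0 ∨ b ≠ 0) := by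
    rintro ⟨j, u', v', a, b, h1, h2, h3, h4, h5⟩
    exact ⟨j, v', u', b, a, h2, h1, h4, h3, h5.symm⟩
  by_cases hu : u = 0
  · exact swap (key v u (huv.resolve_left (not_not.2 hu)) (Or.inl hu))
  by_cases hv : v = 0
  · exact key u v hu (Or.inl hv)
  by_cases hq : ξ.val (v / u) = ⊤
  · refine swap (key v u hv (Or.inr ⟨u / v, by field_simp, ?_⟩))
    rw [← inv_div, ξ.val_inv _ (div_ne_zero hv hu), hq]; simp
  · exact key u v hu (Or.inr ⟨v / u, by field_simp, hq⟩)

end IsUniformizer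

end Values

/-! ### Points of a quadratic extension -/

section Quadratic

variable {K F L : Type} [NormedField K] [IsUltrametricDist K] [Field F] [Algebra K F] [Field L] [Algebra K L]

/-- The field `L` is `F(√f)`, with square root `y` and conjugation `σ`. -/
structure IsQuadratic (ι : F →ₐ[K] L) (σ : L →ₐ[K] L) (y : L) (f : F) : Prop where
  sq : y ^ 2 = ι f
  ne_zero : f ≠ 0
  invol_y : σ y = -y
  invol_ι : ∀ u, σ (ι u) = ι u
  exists_eq : ∀ g, ∃ u v, g = ι u + ι v * y

namespace IsQuadratic

variable {ι : F →ₐ[K] L} {σ : L →ₐ[K] L} {y : L} {f : F}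

/-- Changing `f` by a square does not change the extension. This normalises `f` to a unit or a
uniformizer times a unit near a classical point, and to a function close to `1` where the cover
splits. -/
theorem twist (hq : IsQuadratic ι σ y f) {h : F} (hh : h ≠ 0) :
    IsQuadratic ι σ (y / ι h) (f / h ^ 2) where
  sq := by rw [div_pow, hq.sq, map_div₀, map_pow]
  ne_zero := div_ne_zero hq.ne_zero (pow_ne_zero 2 hh)
  invol_y := by rw [map_div₀, hq.invol_y, hq.invol_ι, neg_div]
  invol_ι := hq.invol_ι
  exists_eq g := by
    obtain ⟨u, v, rfl⟩ := hq.exists_eq g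
    have : ι h ≠ 0 := by simpa using hh
    exact ⟨u, v * h, by rw [map_mul]; field_simp⟩

theorem y_ne_zero (hq : IsQuadratic ι σ y f) : y ≠ 0 := by
  rintro rfl
  have := hq.sq
  rw [zero_pow two_ne_zero, eq_comm, map_eq_zero] at this
  exact hq.ne_zero this

theorem invol_invol (hq : IsQuadratic ι σ y f) (g : L) : σ (σ g) = g := by
  obtain ⟨u, v, rfl⟩ := hq.exists_eq g
  simp [hq.invol_y, hq.invol_ι]

theorem exists_norm (hq : IsQuadratic ι σ y f) (g : L) : ∃ N, g * σ g = ι N := by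
  obtain ⟨u, v, rfl⟩ := hq.exists_eq g
  refine ⟨u ^ 2 - v ^ 2 * f, ?_⟩
  simp only [map_add, map_mul, map_sub, map_pow, hq.invol_y, hq.invol_ι, ← hq.sq]
  ring

theorem exists_trace (hq : IsQuadratic ι σ y f) (g : L) : ∃ T, g + σ g = ι T := by
  obtain ⟨u, v, rfl⟩ := hq.exists_eq g
  refine ⟨u + u, ?_⟩
  simp only [map_add, map_mul, hq.invol_y, hq.invol_ι]
  ring

theorem proj_invol (hq : IsQuadratic ι σ y f) (η : AnPoint K L) :
    (η.comap σ).comap ι = η.comap ι := by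
  ext g; simp [hq.invol_ι]

theorem invol_comap (hq : IsQuadratic ι σ y f) (η : AnPoint K L) :
    (η.comap σ).comap σ = η := by
  ext g; simp [hq.invol_invol]

/-- Let `g` vanish at `η`. If its conjugate is finite there, the norm of `g` vanishes below; if its
conjugate is infinite, the trace is infinite below. Either way the image is classical. -/
theorem isClassical_iff (hq : IsQuadratic ι σ y f) {η : AnPoint K L} :
    η.IsClassical ↔ (η.comap ι).IsClassical := by
  constructor
  · rintro ⟨g, hg, h0⟩
    by_contra hn
    obtain ⟨N, hN⟩ := hq.exists_norm g
    obtain ⟨T, hT⟩ := hq.exists_trace g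
    have hN0 : N ≠ 0 := by
      rintro rfl
      rw [map_zero, mul_eq_zero, map_eq_zero] at hN
      exact hg (hN.elim id id)
    by_cases htop : η.val (σ g) = ⊤
    · have h1 : η.val (ι T) = ⊤ := by
        rw [← hT, ← htop]
        exact η.val_add_of_lt (by rw [h0, htop]; exact ENNReal.zero_lt_top)
      exact AnPoint.val_ne_top_of_not_isClassical hn T h1
    · have h1 : η.val (ι N) = 0 := by
        rw [← hN, η.val_mul_of_finite (by rw [h0]; exact ENNReal.zero_ne_top) htop, h0, zero_mul]
      exact AnPoint.val_ne_zero_of_not_isClassical hn hN0 h1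
  · rintro ⟨g, hg, h0⟩
    exact ⟨ι g, by simpa using hg, h0⟩

/-- The values of a function and its conjugate are determined, as unordered pair, by the image. -/
theorem val_pair (hq : IsQuadratic ι σ y f) {η η' : AnPoint K L}
    (hcl : ¬ η.IsClassical) (h : η.comap ι = η'.comap ι) (g : L) (hg : g ≠ 0) :
    (η'.val g = η.val g ∧ η'.val (σ g) = η.val (σ g)) ∨
      (η'.val g = η.val (σ g) ∧ η'.val (σ g) = η.val g) := by
  have hcl' : ¬ η'.IsClassical := by rwa [hq.isClassical_iff, ← h, ← hq.isClassical_iff]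
  obtain ⟨N, hN⟩ := hq.exists_norm g
  obtain ⟨T, hT⟩ := hq.exists_trace g
  have eN : η.val g * η.val (σ g) = η'.val g * η'.val (σ g) := by
    rw [← AnPoint.val_mul_of_not_isClassical hcl, ← AnPoint.val_mul_of_not_isClassical hcl', hN]
    exact congrArg (fun ξ : AnPoint K F => ξ.val N) h
  have eT : η.val (g + σ g) = η'.val (g + σ g) := by
    rw [hT]; exact congrArg (fun ξ : AnPoint K F => ξ.val T) h
  have hσg : σ g ≠ 0 := by simpa using hg
  have p0 := AnPoint.val_ne_zero_of_not_isClassical hcl hg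
  have p1 := AnPoint.val_ne_top_of_not_isClassical hcl g
  have q0 := AnPoint.val_ne_zero_of_not_isClassical hcl hσg
  have q1 := AnPoint.val_ne_top_of_not_isClassical hcl (σ g)
  have p0' := AnPoint.val_ne_zero_of_not_isClassical hcl' hg
  have p1' := AnPoint.val_ne_top_of_not_isClassical hcl' g
  have q0' := AnPoint.val_ne_zero_of_not_isClassical hcl' hσg
  have q1' := AnPoint.val_ne_top_of_not_isClassical hcl' (σ g)
  -- If the two values differ, the value of the trace is their maximum. Together with their product,
  -- which is the value of the norm, it determines the unordered pair.
  have aT := fun H : η.val g ≠ η.val (σ g) => η.val_add_of_ne H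
  have aT' := fun H : η'.val g ≠ η'.val (σ g) => η'.val_add_of_ne H
  have bT := η.val_add g (σ g)
  have bT' := η'.val_add g (σ g)
  rw [← eT] at aT' bT'
  generalize η.val (g + σ g) = T' at *
  generalize η.val g = p at *
  generalize η.val (σ g) = q at *
  generalize η'.val g = p' at *
  generalize η'.val (σ g) = q' at *
  lift p to ℝ≥0 using p1
  lift q to ℝ≥0 using q1
  lift p' to ℝ≥0 using p1'
  lift q' to ℝ≥0 using q1'
  have hT1 : T' ≠ ⊤ := ne_top_of_le_ne_top (by simp) bT
  lift T' to ℝ≥0 using hT1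
  norm_cast at *
  have cancel : ∀ {a b c : ℝ≥0}, a ≠ 0 → a * b = a * c → b = c :=
    fun ha h => mul_left_cancel₀ ha h
  have sq_eq : ∀ {a b : ℝ≥0}, a * a = b * b → a = b := fun h => by
    have := congrArg NNReal.sqrt h
    simpa using this
  -- This excludes that the two values agree at one point and differ at the other.
  have no : ∀ {a b c : ℝ≥0}, 0 < a → 0 < b → a * b = c * c → max a b ≤ c → a = b := by
    intro a b c ha hb h1 h2
    obtain ⟨h3, h4⟩ := max_le_iff.1 h2
    have h5 : a = c := by
      refine le_antisymm h3 (not_lt.1 fun h6 => ?_)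
      have : a * b < c * c := mul_lt_mul h6 h4 hb zero_le
      exact this.ne h1
    subst h5
    exact (cancel ha.ne' h1).symm
  by_cases e : p = q
  · by_cases e' : p' = q'
    · subst e; subst e'
      have := sq_eq eN; subst this; exact Or.inl ⟨rfl, rfl⟩
    · subst e
      exact absurd (no (pos_iff_ne_zero.2 p0') (pos_iff_ne_zero.2 q0') eN.symm
        (by rw [← aT' e']; simpa using bT)) e'
  · by_cases e' : p' = q'
    · subst e'
      exact absurd (no (pos_iff_ne_zero.2 p0) (pos_iff_ne_zero.2 q0) eN
        (by rw [← aT e]; simpa using bT')) e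
    · have hm : max p q = max p' q' := by rw [← aT e, ← aT' e']
      rcases max_choice p q with h1 | h1 <;> rcases max_choice p' q' with h2 | h2 <;>
        rw [h1, h2] at hm <;> subst hm
      · exact Or.inl ⟨rfl, (cancel p0 eN).symm⟩
      · exact Or.inr ⟨(cancel p0 (eN.trans (mul_comm _ _))).symm, rfl⟩
      · exact Or.inr ⟨rfl, (cancel q0 ((mul_comm _ _).trans eN)).symm⟩
      · exact Or.inl ⟨(cancel q0 ((mul_comm _ _).trans (eN.trans (mul_comm _ _)))).symm, rfl⟩

/-- Suppose `g` tells `η'` from `η`, and `k` tells `η'` from the conjugate of `η`. By `val_pair`,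
`η'` takes the conjugate value at `g` and the unconjugated one at `k`. Neither alternative for the
product `g k` is then compatible with multiplicativity. -/
theorem fiber_of_not_isClassical (hq : IsQuadratic ι σ y f) {η η' : AnPoint K L}
    (hcl : ¬ η.IsClassical) (h : η.comap ι = η'.comap ι) : η' = η ∨ η' = η.comap σ := by
  by_contra hcon
  push Not at hcon
  obtain ⟨h1, h2⟩ := hcon
  have hcl' : ¬ η'.IsClassical := by rwa [hq.isClassical_iff, ← h, ← hq.isClassical_iff]
  have h1' : ∃ g, η'.val g ≠ η.val g := by
    by_contra hc; push Not at hc; exact h1 (AnPoint.ext hc)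
  have h2' : ∃ g, η'.val g ≠ η.val (σ g) := by
    by_contra hc; push Not at hc; exact h2 (AnPoint.ext hc)
  obtain ⟨g, hg⟩ := h1'
  obtain ⟨k, hk⟩ := h2'
  have hg0 : g ≠ 0 := by rintro rfl; simp at hg
  have hk0 : k ≠ 0 := by rintro rfl; simp at hk
  have eg := ((hq.val_pair hcl h g hg0).resolve_left fun H => hg H.1).1
  have ek := ((hq.val_pair hcl h k hk0).resolve_right fun H => hk H.1).1
  have hσg : σ g ≠ 0 := by simpa using hg0
  have hm := AnPoint.val_mul_of_not_isClassical hcl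
  have hm' := AnPoint.val_mul_of_not_isClassical hcl'
  have z := fun {a : L} (ha : a ≠ 0) => AnPoint.val_ne_zero_of_not_isClassical hcl ha
  have tp := AnPoint.val_ne_top_of_not_isClassical hcl
  rcases hq.val_pair hcl h (g * k) (mul_ne_zero hg0 hk0) with ⟨e, -⟩ | ⟨e, -⟩
  · rw [hm', hm, eg, ek] at e
    rw [eg] at hg
    exact hg ((ENNReal.mul_left_inj (z hk0) (tp k)).1 e)
  · rw [hm', map_mul, hm, eg, ek] at e
    rw [ek] at hk
    exact hk ((ENNReal.mul_right_inj (z hσg) (tp _)).1 e)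

/-- The points over a classical point at which `f` is a nonzero square. -/
theorem isUniformizer_of_hasValue_sq (hq : IsQuadratic ι σ y f) (h2 : (2 : K) ≠ 0)
    {ξ : AnPoint K F} {t : F} (ht : IsUniformizer {ξ} t) {c : K} (hc : c ≠ 0) :
    IsUniformizer {η : AnPoint K L | η.comap ι = ξ ∧ η.HasValue y c} (ι t) where
  ne_zero := by simpa using ht.ne_zero
  val_eq := by
    rintro η ⟨rfl, -⟩
    exact ht.val_eq _ rfl
  exists_zpow_mul g hg := by
    obtain ⟨u, v, rfl⟩ := hq.exists_eq g
    have hι : ∀ {η : AnPoint K L} {u : F} {a : K}, (η.comap ι).HasValue u a →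
        η.HasValue (ι u) a := by
      intro η u a h
      unfold AnPoint.HasValue at h ⊢
      simpa using h
    have huv : u ≠ 0 ∨ v ≠ 0 := by
      by_contra hc
      push Not at hc
      simp [hc.1, hc.2] at hg
    obtain ⟨j, u, v, a, b, rfl, rfl, hu, hv, hab⟩ := ht.exists_zpow_mul_pair huv
    have hval : ∀ η : AnPoint K L, η.comap ι = ξ ∧ η.HasValue y c →
        η.HasValue (ι u + ι v * y) (a + b * c) := by
      rintro η ⟨rfl, hy⟩
      exact (hι hu).add ((hι hv).mul hy)
    have hval' : ∀ η : AnPoint K L, η.comap ι = ξ ∧ η.HasValue y c →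
        η.HasValue (σ (ι u + ι v * y)) (a - b * c) := by
      rintro η ⟨rfl, hy⟩
      rw [map_add, map_mul, hq.invol_ι, hq.invol_ι, hq.invol_y, mul_neg, ← sub_eq_add_neg]
      exact (hι hu).sub ((hι hv).mul hy)
    have e : ι (t ^ j * u) + ι (t ^ j * v) * y = ι t ^ j * (ι u + ι v * y) := by
      simp only [map_mul, map_zpow₀]; ring
    -- If the leading value vanishes, the function is written as its norm divided by its conjugate.
    -- The conjugate has the value `a - b c`, which is then nonzero because `2 ≠ 0`, and the order
    -- of the norm is computed below.
    by_cases h0 : a + b * c = 0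
    · have hb : a - b * c ≠ 0 := by
        intro h1
        have h3 : 2 * a = 0 := by linear_combination h0 + h1
        have h4 : 2 * (b * c) = 0 := by linear_combination h0 - h1
        simp only [mul_eq_zero, h2, hc, or_false, false_or] at h3 h4
        exact hab.elim (fun h => h h3) (fun h => h h4)
      obtain ⟨N, hN⟩ := hq.exists_norm (ι u + ι v * y)
      have hg' : ι u + ι v * y ≠ 0 := by
        intro h
        rw [e, h, mul_zero] at hg
        exact hg rfl
      have hN0 : N ≠ 0 := by
        rintro rfl
        rw [map_zero, mul_eq_zero, map_eq_zero] at hN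
        exact hg' (hN.elim id id)
      obtain ⟨n, w, d, hd, hNe, hw⟩ := ht.exists_zpow_mul N hN0
      have hσ0 : σ (ι u + ι v * y) ≠ 0 := (map_ne_zero σ).2 hg'
      refine ⟨j + n, ι w * (σ (ι u + ι v * y))⁻¹, d * (a - b * c)⁻¹,
        mul_ne_zero hd (inv_ne_zero hb), ?_, ?_⟩
      · rw [zpow_add₀ (by simpa using ht.ne_zero), mul_assoc, ← mul_assoc (ι t ^ n), ← map_zpow₀,
          ← map_zpow₀, ← map_mul ι (t ^ n), ← hNe, ← hN, mul_inv_cancel_right₀ hσ0, e, map_zpow₀]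
      · rintro η hη
        have := hw ξ rfl
        rw [← hη.1] at this
        exact (hι this).mul ((hval' η hη).inv hb)
    · exact ⟨j, _, _, h0, e, hval⟩

/-- The point over a classical point at which `f` has a simple zero. -/
theorem isUniformizer_of_simple_zero (hq : IsQuadratic ι σ y f)
    {ξ : AnPoint K F} {t w : F} (ht : IsUniformizer {ξ} t) (hf : f = t * w) {a : K} (ha : a ≠ 0)
    (hw : ξ.HasValue w a) : IsUniformizer {η : AnPoint K L | η.comap ι = ξ} y := by
  have hι : ∀ {η : AnPoint K L} {u : F} {a : K}, (η.comap ι).HasValue u a →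
      η.HasValue (ι u) a := by
    intro η u a h
    unfold AnPoint.HasValue at h ⊢
    simpa using h
  have hy0 : ∀ η ∈ {η : AnPoint K L | η.comap ι = ξ}, η.HasValue y 0 := by
    rintro η rfl
    have h1 : η.val (y ^ 2) = 0 := by
      rw [hq.sq]
      change (η.comap ι).val f = 0
      have h2 := (AnPoint.HasValue.of_val_eq_zero (ht.val_eq _ rfl)).mul hw
      rw [hf, h2.val_eq]; simp
    rw [η.val_pow] at h1
    exact .of_val_eq_zero (pow_eq_zero_iff two_ne_zero |>.1 h1)
  have hy := hq.y_ne_zero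
  have hwι : ι w ≠ 0 := by simpa using hw.ne_zero ha
  have htι : ι t = y ^ 2 * (ι w)⁻¹ := by rw [hq.sq, hf, map_mul, mul_inv_cancel_right₀ hwι]
  refine ⟨hy, fun η hη => by simpa using (hy0 η hη).val_eq, fun g hg => ?_⟩
  obtain ⟨u, v, rfl⟩ := hq.exists_eq g
  have huv : u ≠ 0 ∨ v ≠ 0 := by
    by_contra hc
    push Not at hc
    simp [hc.1, hc.2] at hg
  obtain ⟨j, u, v, b, c, rfl, rfl, hu, hv, hbc⟩ := ht.exists_zpow_mul_pair huv
  have e : ι (t ^ j * u) + ι (t ^ j * v) * y =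
      y ^ (2 * j) * ((ι w) ^ (-j) * (ι u + ι v * y)) := by
    simp only [map_mul, map_zpow₀, htι, mul_zpow, inv_zpow, zpow_mul, zpow_neg]
    norm_cast; ring
  have hwv : ∀ η ∈ {η : AnPoint K L | η.comap ι = ξ}, η.HasValue (ι w ^ (-j)) (a ^ (-j)) := by
    rintro η rfl
    exact (hι hw).zpow ha _
  -- Now `y` has order one and `t` order two, so the terms from `u` and `v y` have orders of
  -- different parity and cannot cancel. The leading term comes from `u` if `b ≠ 0` and from `v y`
  -- otherwise.
  by_cases hb : b = 0
  · subst hb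
    obtain ⟨u', b', rfl, hu'⟩ := ht.exists_mul_of_hasValue_zero hu
    refine ⟨2 * j + 1, ι w ^ (-j) * (y * ((ι w)⁻¹ * ι u') + ι v), a ^ (-j) * (0 * (a⁻¹ * b') + c),
      ?_, ?_, ?_⟩
    · have hc : c ≠ 0 := hbc.resolve_left (not_not.2 rfl)
      rw [zero_mul, zero_add]
      exact mul_ne_zero (zpow_ne_zero _ ha) hc
    · rw [e, map_mul, htι, zpow_add₀ hy, zpow_one]; ring
    · rintro η hη
      have h1 := hwv η hη
      have h2 := hy0 η hη
      obtain rfl := hη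
      exact h1.mul ((h2.mul (((hι hw).inv ha).mul (hι hu'))).add (hι hv))
  · refine ⟨2 * j, _, a ^ (-j) * (b + c * 0), by
      rw [mul_zero, add_zero]; exact mul_ne_zero (zpow_ne_zero _ ha) hb, e, ?_⟩
    rintro η hη
    have h1 := hwv η hη
    have h2 := hy0 η hη
    obtain rfl := hη
    exact h1.mul ((hι hu).add ((hι hv).mul h2))

end IsQuadratic

end Quadratic

end BerkovichCover

/-! ### Extension of norms, local form of `f`, and fibres over classical points -/

namespace BerkovichCover

open Topology Filter
open scoped NNReal

set_option linter.unusedSectionVars false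

section Extension

theorem exists_ringHom_extension {F L Ω : Type} [Field F] [Field L] [Algebra F L]
    [Algebra.IsAlgebraic F L] [Field Ω] [IsAlgClosed Ω] (i : F →+* Ω) :
    ∃ j : L →+* Ω, ∀ x, j (algebraMap F L x) = i x := by
  let _ := i.toAlgebra
  exact ⟨(IsAlgClosed.lift : L →ₐ[F] Ω), AlgHom.commutes (IsAlgClosed.lift : L →ₐ[F] Ω)⟩

instance isUltrametricDist_completion {F : Type} [NormedField F] [IsUltrametricDist F] :
    IsUltrametricDist (UniformSpace.Completion F) := by
  refine IsUltrametricDist.isUltrametricDist_of_forall_norm_add_le_max_norm fun x y => ?_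
  induction x, y using UniformSpace.Completion.induction_on₂ with
  | hp =>
    exact isClosed_le (continuous_norm.comp continuous_add)
      ((continuous_norm.comp continuous_fst).max (continuous_norm.comp continuous_snd))
  | ih x y =>
    rw [← UniformSpace.Completion.coe_add]
    simp only [UniformSpace.Completion.norm_coe]
    exact IsUltrametricDist.norm_add_le_max x y

/-- Embed `L` over `F` into an algebraic closure of the completion of `F`, where the spectral norm
is multiplicative and ultrametric, and restrict. -/
theorem exists_mulNorm_extension {F L : Type} [NontriviallyNormedField F] [IsUltrametricDist F]
    [Field L] [Algebra F L] [Algebra.IsAlgebraic F L] :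
    ∃ N : L →*₀ ℝ, (∀ x, 0 ≤ N x) ∧ (∀ x y, N (x + y) ≤ max (N x) (N y)) ∧
      ∀ x, N (algebraMap F L x) = ‖x‖ := by
  let E := UniformSpace.Completion F
  let _ : NontriviallyNormedField E := NontriviallyNormedField.ofNormNeOne (by
    obtain ⟨x, hx⟩ := NormedField.exists_one_lt_norm F
    refine ⟨(x : E), ?_, by rw [UniformSpace.Completion.norm_coe]; exact hx.ne'⟩
    rw [← norm_ne_zero_iff, UniformSpace.Completion.norm_coe]
    exact (one_pos.trans hx).ne')
  let Ω := AlgebraicClosure E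
  obtain ⟨j, hj⟩ := exists_ringHom_extension (L := L)
    ((algebraMap E Ω).comp (UniformSpace.Completion.coeRingHom : F →+* E))
  let N := spectralMulAlgNorm E Ω
  refine ⟨⟨⟨fun x => N (j x), by simp⟩, by simp, fun x y => by simp⟩, fun x => apply_nonneg N _, fun x y => ?_, fun x => ?_⟩
  · change N (j (x + y)) ≤ max (N (j x)) (N (j y))
    rw [map_add]
    exact isNonarchimedean_spectralNorm (j x) (j y)
  · change N (j (algebraMap F L x)) = ‖x‖
    rw [hj]
    change spectralNorm E Ω (algebraMap E Ω (x : E)) = ‖x‖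
    rw [spectralNorm_extends, UniformSpace.Completion.norm_coe]

/-- A non-classical point is an honest ultrametric absolute value on `F`, nontrivial because it
extends that of `K`; an extension of it to `L` is a point above. -/
theorem AnPoint.exists_comap_eq {K F L : Type} [NontriviallyNormedField K] [Field F] [Algebra K F]
    [Field L] [Algebra K L] [Algebra F L] [IsScalarTower K F L] [Algebra.IsAlgebraic F L]
    {ξ : AnPoint K F} (hξ : ¬ ξ.IsClassical) :
    ∃ η : AnPoint K L, η.comap (IsScalarTower.toAlgHom K F L) = ξ := by
  have hfin := AnPoint.val_ne_top_of_not_isClassical hξ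
  have hmul := AnPoint.val_mul_of_not_isClassical hξ
  have hsub : ∀ x y : F, (ξ.val (x + y)).toReal ≤ max (ξ.val x).toReal (ξ.val y).toReal := by
    intro x y
    rw [← ENNReal.toReal_max (hfin x) (hfin y)]
    exact ENNReal.toReal_mono (by simp [hfin]) (ξ.val_add x y)
  let v : AbsoluteValue F ℝ :=
    { toFun := fun g => (ξ.val g).toReal
      map_mul' := fun g h => by rw [hmul, ENNReal.toReal_mul]
      nonneg' := fun g => ENNReal.toReal_nonneg
      eq_zero' := fun g => by
        rw [ENNReal.toReal_eq_zero_iff]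
        constructor
        · rintro (h | h)
          · by_contra hg
            exact AnPoint.val_ne_zero_of_not_isClassical hξ hg h
          · exact absurd h (hfin g)
        · rintro rfl; simp
      add_le' := fun x y => (hsub x y).trans
        (max_le_add_of_nonneg ENNReal.toReal_nonneg ENNReal.toReal_nonneg) }
  let nf : NormedField F := v.toNormedField
  have hnorm : ∀ g : F, ‖g‖ = (ξ.val g).toReal := fun g => rfl
  have _ : IsUltrametricDist F :=
    IsUltrametricDist.isUltrametricDist_of_forall_norm_add_le_max_norm hsub
  let _ : NontriviallyNormedField F := NontriviallyNormedField.ofNormNeOne (by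
    obtain ⟨c, hc⟩ := NormedField.exists_one_lt_norm K
    have hc' : ‖algebraMap K F c‖ = ‖c‖ := by
      rw [hnorm, ξ.val_const]; simp
    refine ⟨algebraMap K F c, ?_, by rw [hc']; exact hc.ne'⟩
    rw [← norm_ne_zero_iff, hc']
    exact (one_pos.trans hc).ne')
  obtain ⟨N, h0, h1, h2⟩ := exists_mulNorm_extension (F := F) (L := L)
  refine ⟨⟨fun g => ENNReal.ofReal (N g), fun c => ?_, fun g h => ?_, fun g h _ _ => ?_⟩, ?_⟩
  · rw [IsScalarTower.algebraMap_apply K F L, h2, hnorm, ENNReal.ofReal_toReal (hfin _), ξ.val_const]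
  · rw [← ENNReal.ofReal_max]
    exact ENNReal.ofReal_le_ofReal (h1 g h)
  · rw [map_mul, ENNReal.ofReal_mul (h0 g)]
  · ext g
    change ENNReal.ofReal (N (algebraMap F L g)) = ξ.val g
    rw [h2, hnorm, ENNReal.ofReal_toReal (hfin _)]

end Extension

theorem algebraMap_eq_aeval {K : Type} [Field K] (p : K[X]) :
    algebraMap K[X] (RatFunc K) p = aeval (RatFunc.X : RatFunc K) p := by
  rw [← RatFunc.algebraMap_X, aeval_algebraMap_apply, aeval_X_left_apply]

section Line

variable {K : Type} [NormedField K] [IsAlgClosed K] [IsUltrametricDist K]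

theorem IsCoordinate.isUniformizer {t : RatFunc K} (ht : IsCoordinate t) {ξ : P1an K}
    (hξ : ξ.val t = 0) : IsUniformizer {ξ} t where
  ne_zero := ht.ne_zero
  val_eq := by rintro _ rfl; exact hξ
  exists_zpow_mul g hg := by
    obtain ⟨n, w, a, ha, e, hw⟩ := ht.exists_zpow_mul 0 g hg
    simp only [map_zero, sub_zero] at e hw
    exact ⟨n, w, a, ha, e, by rintro _ rfl; exact hw _ hξ⟩

theorem exists_coordinate_of_isClassical {ξ : P1an K} (hξ : ξ.IsClassical) :
    (∃ α, ξ.HasValue RatFunc.X α) ∨ ξ.val RatFunc.X = ⊤ := by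
  by_contra hcon
  push Not at hcon
  exact not_isClassical_of_coord isCoordinate_X hcon.1 hcon.2 hξ

theorem isClassical_of_mem_rootSet {f : K[X]} (hf : f ≠ 0) {ξ : P1an K} (h : ξ ∈ rootSet f) :
    ξ.IsClassical := by
  rcases h with h | ⟨-, h⟩
  · exact ⟨_, by rwa [Ne, map_eq_zero_iff _ (RatFunc.algebraMap_injective K)], h⟩
  · exact ξ.isClassical_of_val_eq_top h

/-- The order of `f` at a classical point is odd exactly at the points of `rootSet f`. -/
theorem exists_localForm {f : K[X]} (hdeg : 0 < f.natDegree) (hroots : f.roots.Nodup) {ξ : P1an K}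
    (hξ : ξ.IsClassical) : ∃ (t : RatFunc K) (n : ℤ) (w : RatFunc K) (a : K), IsCoordinate t ∧
      ξ.val t = 0 ∧ algebraMap K[X] (RatFunc K) f = t ^ n * w ∧ a ≠ 0 ∧ ξ.HasValue w a ∧
      (Odd n ↔ ξ ∈ rootSet f) := by
  classical
  have hf0 : f ≠ 0 := by rintro rfl; simp at hdeg
  rcases exists_coordinate_of_isClassical hξ with ⟨α, hα⟩ | htop
  · have hval : ∀ p : K[X], ξ.HasValue (algebraMap K[X] (RatFunc K) p) (p.eval α) := fun p => by
      rw [algebraMap_eq_aeval]; exact hα.aeval p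
    have hroot : ξ ∈ rootSet f ↔ f.eval α = 0 := by
      rw [rootSet, Set.mem_ofPred_eq, (hval f).eq_zero_iff]
      simp [hα.val_ne_top]
    by_cases h0 : f.eval α = 0
    · obtain ⟨q, rfl⟩ := dvd_iff_isRoot.2 h0
      refine ⟨RatFunc.X - RatFunc.C α, 1, algebraMap K[X] (RatFunc K) q, q.eval α,
        isCoordinate_X.sub_C α, hα, by simp, ?_, hval q, by simp [hroot]⟩
      intro hq
      have hq0 : q ≠ 0 := by rintro rfl; simp at hf0
      -- The root is simple, so the cofactor does not vanish at `α`.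
      have hm := Multiset.nodup_iff_count_le_one.1 hroots α
      rw [count_roots, rootMultiplicity_mul hf0, rootMultiplicity_X_sub_C_self] at hm
      have := (rootMultiplicity_pos hq0).2 hq
      omega
    · exact ⟨RatFunc.X - RatFunc.C α, 0, _, _, isCoordinate_X.sub_C α, hα, by simp, h0, hval f,
        by simp [hroot, h0]⟩
  · have hX : (RatFunc.X : RatFunc K) ≠ 0 := isCoordinate_X.ne_zero
    have h0 : ξ.val (RatFunc.X : RatFunc K)⁻¹ = 0 := by rw [ξ.val_inv _ hX, htop]; simp
    -- At infinity `f = t ^ (-deg f)` times the reversed polynomial in `t = 1 / X`, whose value at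
    -- `t = 0` is the leading coefficient.
    refine ⟨RatFunc.X⁻¹, -f.natDegree, aeval (RatFunc.X : RatFunc K)⁻¹ f.reverse,
      f.reverse.eval 0, isCoordinate_X.inv, h0, ?_, ?_,
      (AnPoint.HasValue.of_val_eq_zero h0).aeval _, ?_⟩
    · let _ := invertibleOfNonzero hX
      have := eval₂_reverse_mul_pow (algebraMap K (RatFunc K)) RatFunc.X f
      rw [algebraMap_eq_aeval, aeval_def, ← this, invOf_eq_inv, aeval_def, mul_comm]
      simp
    · rw [← coeff_zero_eq_eval_zero, coeff_zero_reverse]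
      simpa using hf0
    · rw [odd_neg, Int.odd_coe_nat]
      have hv := (AnPoint.HasValue.of_val_eq_zero h0).aeval f.reverse
      constructor
      · intro h; exact Or.inr ⟨h, htop⟩
      · rintro (h | h)
        · exfalso
          rw [algebraMap_eq_aeval] at h
          have h3 : ξ.HasValue (aeval (RatFunc.X : RatFunc K) f * RatFunc.X⁻¹ ^ f.natDegree) 0 := by
            simpa [zero_pow hdeg.ne'] using (AnPoint.HasValue.of_val_eq_zero h).mul
              ((AnPoint.HasValue.of_val_eq_zero h0).pow f.natDegree)
          let _ := invertibleOfNonzero hX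
          have := eval₂_reverse_mul_pow (algebraMap K (RatFunc K)) RatFunc.X f
          rw [invOf_eq_inv, ← aeval_def, ← aeval_def] at this
          rw [← this, mul_assoc, ← mul_pow, mul_inv_cancel₀ hX, one_pow, mul_one] at h3
          have h4 := h3.unique hv
          rw [← coeff_zero_eq_eval_zero, coeff_zero_reverse, eq_comm, leadingCoeff_eq_zero] at h4
          exact hf0 h4
        · exact h.1

end Line

section Fibers

variable {K F L : Type} [NormedField K] [IsUltrametricDist K] [IsAlgClosed K] [Field F]
  [Algebra K F] [Field L] [Algebra K L]
  {ι : F →ₐ[K] L} {σ : L →ₐ[K] L} {y : L} {f : F}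

/-- After division by `t ^ k`, the square root has the value `c` or `-c` with `c² = a`. Each value
determines the point above, conjugation exchanges the values, and they differ because `2 ≠ 0`. -/
theorem IsQuadratic.fiber_of_even (hq : IsQuadratic ι σ y f) (h2 : (2 : K) ≠ 0) {ξ : AnPoint K F}
    {t w : F} (ht : IsUniformizer {ξ} t) {k : ℤ} (hf : f = t ^ (2 * k) * w) {a : K} (ha : a ≠ 0)
    (hw : ξ.HasValue w a) {η η' : AnPoint K L} (hη : η.comap ι = ξ) (hη' : η'.comap ι = ξ) :
    (η' = η ∨ η' = η.comap σ) ∧ η.comap σ ≠ η := by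
  obtain ⟨c, rfl⟩ := IsAlgClosed.exists_pow_nat_eq a two_pos
  have hc : c ≠ 0 := by rintro rfl; simp at ha
  have htk : t ^ k ≠ 0 := zpow_ne_zero _ ht.ne_zero
  have hq' := hq.twist htk
  have e : f / (t ^ k) ^ 2 = w := by
    rw [hf, mul_comm 2 k, zpow_mul]; norm_cast; field_simp
  rw [e] at hq'
  have hpm : ∀ {η : AnPoint K L}, η.comap ι = ξ → η.HasValue (y / ι (t ^ k)) c ∨
      η.HasValue (y / ι (t ^ k)) (-c) := by
    rintro η rfl
    refine AnPoint.HasValue.of_sq ?_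
    rw [hq'.sq]
    unfold AnPoint.HasValue at hw ⊢
    simpa using hw
  have hσ : ∀ {η : AnPoint K L} {b : K}, η.HasValue (y / ι (t ^ k)) b →
      (η.comap σ).HasValue (y / ι (t ^ k)) (-b) := by
    intro η b h
    have := h.neg
    rw [← hq'.invol_y] at this
    unfold AnPoint.HasValue at this ⊢
    simpa using this
  have huniq : ∀ {b : K}, b ≠ 0 → ∀ {η η' : AnPoint K L}, η.comap ι = ξ → η'.comap ι = ξ →
      η.HasValue (y / ι (t ^ k)) b → η'.HasValue (y / ι (t ^ k)) b → η' = η :=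
    fun hb η η' h1 h2' h3 h4 =>
      (hq'.isUniformizer_of_hasValue_sq h2 ht hb).subsingleton ⟨h2', h4⟩ ⟨h1, h3⟩
  have hησ : (η.comap σ).comap ι = ξ := by rw [hq.proj_invol, hη]
  refine ⟨?_, fun h => ?_⟩
  · rcases hpm hη with h | h <;> rcases hpm hη' with h' | h'
    · exact Or.inl (huniq hc hη hη' h h')
    · exact Or.inr (huniq (neg_ne_zero.2 hc) hησ hη' (hσ h) h')
    · refine Or.inr (huniq hc hησ hη' ?_ h')
      simpa using hσ h
    · exact Or.inl (huniq (neg_ne_zero.2 hc) hη hη' h h')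
  · have key : ∀ b : K, b ≠ 0 → ¬ η.HasValue (y / ι (t ^ k)) b := by
      intro b hb hv
      have := hσ hv
      rw [h] at this
      have h3 := hv.unique this
      have h4 : 2 * b = 0 := by linear_combination h3
      simp [h2, hb] at h4
    rcases hpm hη with h' | h'
    · exact key _ hc h'
    · exact key _ (neg_ne_zero.2 hc) h'

/-- After division by `t ^ k`, the square root is a uniformizer simultaneously at all points of the
fibre, with common values for the remaining factors. So the fibre has at most one point. -/
theorem IsQuadratic.fiber_of_odd (hq : IsQuadratic ι σ y f) {ξ : AnPoint K F}
    {t w : F} (ht : IsUniformizer {ξ} t) {k : ℤ} (hf : f = t ^ (2 * k + 1) * w) {a : K}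
    (ha : a ≠ 0) (hw : ξ.HasValue w a) {η η' : AnPoint K L} (hη : η.comap ι = ξ)
    (hη' : η'.comap ι = ξ) : η' = η := by
  have htk : t ^ k ≠ 0 := zpow_ne_zero _ ht.ne_zero
  have e : f / (t ^ k) ^ 2 = t * w := by
    rw [hf, zpow_add₀ ht.ne_zero, mul_comm 2 k, zpow_mul, zpow_one]; norm_cast; field_simp
  exact ((hq.twist htk).isUniformizer_of_simple_zero ht e ha hw).subsingleton hη' hη

end Fibers

/-! ### The hyperelliptic double cover and its Weierstrass points -/

section Hyp

variable {K : Type} [NontriviallyNormedField K] [IsAlgClosed K] (f : K[X])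

/-- A square root of `f` would be integral over `K[X]`, hence a polynomial, and then every root of
`f` would be multiple. -/
theorem irreducible_sq_sub (hdeg : 0 < f.natDegree) (hroots : f.roots.Nodup) :
    Irreducible (X ^ 2 - C (algebraMap K[X] (RatFunc K) f) : (RatFunc K)[X]) := by
  classical
  rw [X_pow_sub_C_irreducible_iff_of_prime Nat.prime_two]
  intro g hg
  have hint : IsIntegral K[X] g := by
    refine ⟨X ^ 2 - C f, monic_X_pow_sub_C f two_ne_zero, ?_⟩
    simp [hg]
  obtain ⟨q, rfl⟩ := IsIntegrallyClosed.isIntegral_iff.1 hint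
  rw [← map_pow] at hg
  have hfq := RatFunc.algebraMap_injective K hg
  obtain ⟨α, hα⟩ := IsAlgClosed.exists_root f (by
    intro h; rw [natDegree_eq_of_degree_eq_some h] at hdeg; exact lt_irrefl _ hdeg)
  have hf0 : f ≠ 0 := by rintro rfl; simp at hdeg
  have hm := Multiset.nodup_iff_count_le_one.1 hroots α
  rw [count_roots] at hm
  have hq0 : q ≠ 0 := by rintro rfl; apply hf0; rw [← hfq]; simp
  have hqα : 0 < rootMultiplicity α q := by
    rw [rootMultiplicity_pos hq0]
    rw [← hfq, IsRoot, eval_pow] at hα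
    exact pow_eq_zero_iff two_ne_zero |>.1 hα
  rw [← hfq, sq, rootMultiplicity_mul (mul_ne_zero hq0 hq0)] at hm
  omega

variable [Fact (Irreducible (X ^ 2 - C (algebraMap K[X] (RatFunc K) f) : (RatFunc K)[X]))]

/-- The inclusion of the function field of the line. -/
noncomputable abbrev hypIncl : RatFunc K →ₐ[K] HypField f :=
  IsScalarTower.toAlgHom K (RatFunc K) (HypField f)

/-- The function `y`. -/
noncomputable abbrev hypY : HypField f :=
  AdjoinRoot.root (X ^ 2 - C (algebraMap K[X] (RatFunc K) f) : (RatFunc K)[X])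

theorem isQuadratic_hyp (hf : f ≠ 0) :
    IsQuadratic (hypIncl f) (hypInvol f) (hypY f) (algebraMap K[X] (RatFunc K) f) where
  sq := by
    have h := AdjoinRoot.eval₂_root
      (X ^ 2 - C (algebraMap K[X] (RatFunc K) f) : (RatFunc K)[X])
    simp only [eval₂_sub, eval₂_pow, eval₂_X, eval₂_C] at h
    exact sub_eq_zero.1 h
  ne_zero := by
    rwa [Ne, map_eq_zero_iff _ (RatFunc.algebraMap_injective K)]
  invol_y := by simp [hypInvol]
  invol_ι u := by
    change AdjoinRoot.liftAlgHom _ _ _ _ (AdjoinRoot.of _ u) = _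
    rw [AdjoinRoot.liftAlgHom_of]
  exists_eq g := by
    induction g using AdjoinRoot.induction_on with
    | ih p =>
      set m : (RatFunc K)[X] := X ^ 2 - C (algebraMap K[X] (RatFunc K) f) with hm
      have hmon : m.Monic := monic_X_pow_sub_C _ two_ne_zero
      have hdeg : (p %ₘ m).natDegree ≤ 1 := by
        have h2 : m.natDegree = 2 := natDegree_X_pow_sub_C
        have := natDegree_modByMonic_lt p hmon (by rintro h; rw [h] at h2; simp at h2)
        omega
      obtain ⟨a, b, hab⟩ := exists_eq_X_add_C_of_natDegree_le_one hdeg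
      refine ⟨b, a, ?_⟩
      have e : AdjoinRoot.mk m p = AdjoinRoot.mk m (p %ₘ m) := by
        rw [AdjoinRoot.mk_eq_mk]
        refine ⟨p /ₘ m, ?_⟩
        have := modByMonic_add_div p m
        linear_combination -this
      rw [e, hab, map_add, map_mul, AdjoinRoot.mk_C, AdjoinRoot.mk_C, AdjoinRoot.mk_X, add_comm]
      rfl


variable {f} [IsUltrametricDist K]

/-- The image is closed and contains the Gauss points, over which the norm extends. These are dense
in each of the charts with coordinates `X` and `1 / X`. -/
theorem surjective_hypProj : Function.Surjective (hypProj f) := by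
  have hcl : IsClosed (Set.range (hypProj f)) :=
    (AnPoint.isClosedMap_comap (hypIncl f)).isClosed_range
  have halg : Algebra.IsAlgebraic (RatFunc K) (HypField f) := by
    have : Module.Finite (RatFunc K) (HypField f) :=
      (monic_X_pow_sub_C (algebraMap K[X] (RatFunc K) f) two_ne_zero).finite_adjoinRoot
    infer_instance
  have key : ∀ {t : RatFunc K}, IsCoordinate t → ∀ ξ : P1an K, ξ.val t ≠ ⊤ →
      ξ ∈ Set.range (hypProj f) := by
    intro t ht ξ hξ
    by_contra hcon
    obtain ⟨a, r, hr, h⟩ := exists_gaussPt_mem ht hξ hcl.isOpen_compl hcon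
    exact h (AnPoint.exists_comap_eq (gaussPt_not_isClassical ht a hr))
  intro ξ
  by_cases h : ξ.val RatFunc.X = ⊤
  · refine key isCoordinate_X.inv ξ ?_
    rw [ξ.val_inv _ isCoordinate_X.ne_zero, h]; simp
  · exact key isCoordinate_X ξ h

theorem isInvolutiveCover_hyp (h2 : (2 : K) ≠ 0) (hdeg : 0 < f.natDegree)
    (hroots : f.roots.Nodup) : IsInvolutiveCover (hypProj f) (AnPoint.comap (hypInvol f)) where
  continuous := AnPoint.continuous_comap _
  isClosedMap := AnPoint.isClosedMap_comap _
  surjective := surjective_hypProj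
  continuous_invol := AnPoint.continuous_comap _
  invol := (isQuadratic_hyp f (by rintro rfl; simp at hdeg)).invol_comap
  proj_invol := (isQuadratic_hyp f (by rintro rfl; simp at hdeg)).proj_invol
  fiber η η' h := by
    have hq := isQuadratic_hyp f (by rintro rfl; simp at hdeg)
    by_cases hcl : η.IsClassical
    · obtain ⟨t, n, w, a, ht, h0, e, ha, hw, -⟩ :=
        exists_localForm hdeg hroots (hq.isClassical_iff.1 hcl)
      rcases Int.even_or_odd' n with ⟨k, rfl | rfl⟩
      · exact (hq.fiber_of_even h2 (ht.isUniformizer h0) e ha hw rfl h.symm).1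
      · exact Or.inl (hq.fiber_of_odd (ht.isUniformizer h0) e ha hw rfl h.symm)
    · exact hq.fiber_of_not_isClassical hcl h

/-- A classical point is fixed by the involution exactly when `f` has odd order at its image, and
then it is alone in its fibre. -/
theorem bijOn_weierstrassPoints (h2 : (2 : K) ≠ 0) (hdeg : 0 < f.natDegree)
    (hroots : f.roots.Nodup) : Set.BijOn (hypProj f) (weierstrassPoints f) (rootSet f) := by
  have hf0 : f ≠ 0 := by rintro rfl; simp at hdeg
  have hq := isQuadratic_hyp f hf0
  refine ⟨?_, ?_, ?_⟩
  · rintro η ⟨hcl, hfix⟩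
    obtain ⟨t, n, w, a, ht, h0, e, ha, hw, hn⟩ :=
      exists_localForm hdeg hroots (hq.isClassical_iff.1 hcl)
    rcases Int.even_or_odd' n with ⟨k, rfl | rfl⟩
    · exact absurd hfix (hq.fiber_of_even h2 (ht.isUniformizer h0) e ha hw rfl rfl).2
    · exact hn.1 ⟨k, rfl⟩
  · rintro η ⟨-, hfix⟩ η' - h
    rcases (isInvolutiveCover_hyp h2 hdeg hroots).fiber η η' h with h | h
    · exact h.symm
    · rw [h, hfix]
  · intro ξ hξ
    have hcl := isClassical_of_mem_rootSet hf0 hξ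
    obtain ⟨η, rfl⟩ := surjective_hypProj (f := f) ξ
    refine ⟨η, ⟨hq.isClassical_iff.2 hcl, ?_⟩, rfl⟩
    obtain ⟨t, n, w, a, ht, h0, e, ha, hw, hn⟩ := exists_localForm hdeg hroots hcl
    obtain ⟨k, rfl⟩ := hn.2 hξ
    exact hq.fiber_of_odd (ht.isUniformizer h0) e ha hw rfl (hq.proj_invol η)

end Hyp

end BerkovichCover

/-! ### Square classes of functions and slopes at Gauss points -/

namespace BerkovichCover

open Topology Filter
open scoped NNReal

set_option linter.unusedSectionVars false

section SquareClass

variable {K : Type} [NormedField K] [IsAlgClosed K]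

/-- Every function is a square times a product of distinct linear functions of a coordinate. -/
theorem IsCoordinate.exists_sq_mul_prod {s : RatFunc K} (hs : IsCoordinate s) (g : RatFunc K)
    (hg : g ≠ 0) : ∃ (h : RatFunc K) (R : Finset K), h ≠ 0 ∧
      g = h ^ 2 * ∏ α ∈ R, (s - RatFunc.C α) := by
  classical
  refine hs.induction (P := fun g => ∃ (h : RatFunc K) (R : Finset K), h ≠ 0 ∧
      g = h ^ 2 * ∏ α ∈ R, (s - RatFunc.C α)) ?_ ?_ ?_ ?_ g hg
  · intro c hc
    obtain ⟨d, rfl⟩ := IsAlgClosed.exists_pow_nat_eq c two_pos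
    have hd : d ≠ 0 := by rintro rfl; simp at hc
    exact ⟨RatFunc.C d, ∅, ratFunc_C_ne_zero hd, by simp⟩
  · intro α
    exact ⟨1, {α}, one_ne_zero, by simp⟩
  · rintro _ _ - - ⟨h, R, hh, rfl⟩ ⟨h', R', hh', rfl⟩
    have hP : ∏ α ∈ R ∩ R', (s - RatFunc.C α) ≠ 0 :=
      Finset.prod_ne_zero_iff.2 fun α _ => hs.sub_C_ne_zero α
    -- Common linear factors occur twice and go into the square; the symmetric difference of the
    -- zero sets remains.
    refine ⟨h * h' * ∏ α ∈ R ∩ R', (s - RatFunc.C α), (R \ R') ∪ (R' \ R),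
      mul_ne_zero (mul_ne_zero hh hh') hP, ?_⟩
    rw [Finset.prod_union (Finset.disjoint_left.2 fun x hx hx' =>
      (Finset.mem_sdiff.1 hx').2 (Finset.mem_sdiff.1 hx).1)]
    rw [← Finset.prod_inter_mul_prod_sdiff R R', ← Finset.prod_inter_mul_prod_sdiff R' R,
      Finset.inter_comm R' R]
    ring
  · rintro _ hg ⟨h, R, hh, rfl⟩
    refine ⟨(h ^ 2 * ∏ α ∈ R, (s - RatFunc.C α))⁻¹ * h, R,
      mul_ne_zero (inv_ne_zero hg) hh, ?_⟩
    field_simp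

end SquareClass

section PrincipalUnit

variable {K F : Type} [NormedField K] [IsUltrametricDist K] [Field F] [Algebra K F]

theorem AnPoint.val_mul_sub_one_lt (ξ : AnPoint K F) {g h : F} (hg : ξ.val (g - 1) < 1)
    (hh : ξ.val (h - 1) < 1) : ξ.val (g * h - 1) < 1 := by
  have h1 : ξ.val h ≤ 1 := by
    have : h = (h - 1) + 1 := by ring
    rw [this]
    exact (ξ.val_add _ _).trans (max_le hh.le (by simp))
  have e : g * h - 1 = h * (g - 1) + (h - 1) := by ring
  rw [e]
  exact (ξ.val_add _ _).trans_lt (max_lt (ξ.val_mul_lt_one h1 hg) hh)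

theorem AnPoint.val_prod_sub_one_lt (ξ : AnPoint K F) {ι : Type} (s : Finset ι) (u : ι → F)
    (hu : ∀ i ∈ s, ξ.val (u i - 1) < 1) : ξ.val (∏ i ∈ s, u i - 1) < 1 := by
  classical
  induction s using Finset.induction_on with
  | empty => simp
  | insert i s hi ih =>
    rw [Finset.prod_insert hi]
    exact ξ.val_mul_sub_one_lt (hu i (Finset.mem_insert_self i s))
      (ih fun j hj => hu j (Finset.mem_insert_of_mem hj))

end PrincipalUnit

section Slopes

variable {K : Type} [NormedField K] [IsUltrametricDist K] [IsAlgClosed K] {s : RatFunc K}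

/-- The function `g` has slope `k` at the Gauss point of radius `ρ`, in the direction of larger
radii. -/
def HasSlope (hs : IsCoordinate s) (a : K) (ρ : ℝ≥0) (g : RatFunc K) (k : ℤ) : Prop :=
  ∃ c : ℝ≥0, c ≠ 0 ∧ ∀ᶠ x in 𝓝[>] ρ, (gaussPt hs a x).val g = ((c * x ^ k : ℝ≥0) : ℝ≥0∞)

variable {hs : IsCoordinate s} {a : K} {ρ : ℝ≥0} {g h : RatFunc K} {k m : ℤ}

theorem HasSlope.mul (hρ : 0 < ρ) (hg : HasSlope hs a ρ g k) (hh : HasSlope hs a ρ h m) :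
    HasSlope hs a ρ (g * h) (k + m) := by
  obtain ⟨c, hc, h1⟩ := hg
  obtain ⟨d, hd, h2⟩ := hh
  refine ⟨c * d, mul_ne_zero hc hd, ?_⟩
  filter_upwards [h1, h2, self_mem_nhdsWithin] with x h1 h2 hx
  have hx0 : 0 < x := hρ.trans hx
  rw [AnPoint.val_mul_of_not_isClassical (gaussPt_not_isClassical hs a hx0), h1, h2,
    ← ENNReal.coe_mul, zpow_add₀ hx0.ne']
  congr 1; ring

theorem HasSlope.inv (hg0 : g ≠ 0) (hρ : 0 < ρ) (hg : HasSlope hs a ρ g k) :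
    HasSlope hs a ρ g⁻¹ (-k) := by
  obtain ⟨c, hc, h1⟩ := hg
  refine ⟨c⁻¹, inv_ne_zero hc, ?_⟩
  filter_upwards [h1, self_mem_nhdsWithin] with x h1 hx
  have hx0 : 0 < x := hρ.trans hx
  rw [AnPoint.val_inv _ _ hg0, h1, ← ENNReal.coe_inv (mul_ne_zero hc (zpow_ne_zero _ hx0.ne')),
    mul_inv, zpow_neg]

theorem HasSlope.congr (hg : HasSlope hs a ρ g k)
    (hgh : ∀ᶠ x in 𝓝[>] ρ, (gaussPt hs a x).val g = (gaussPt hs a x).val h) :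
    HasSlope hs a ρ h k := by
  obtain ⟨c, hc, h1⟩ := hg
  refine ⟨c, hc, ?_⟩
  filter_upwards [h1, hgh] with x h1 h2
  rw [← h2, h1]

theorem HasSlope.unique (hρ : 0 < ρ) (hg : HasSlope hs a ρ g k) (hg' : HasSlope hs a ρ g m) :
    k = m := by
  obtain ⟨c, hc, h1⟩ := hg
  obtain ⟨d, hd, h2⟩ := hg'
  have h3 : ∀ᶠ x in 𝓝[>] ρ, ρ < x ∧ c * x ^ k = d * x ^ m := by
    filter_upwards [h1, h2, self_mem_nhdsWithin] with x h1 h2 hx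
    exact ⟨hx, by rw [h1] at h2; exact_mod_cast h2⟩
  obtain ⟨y, hy, hI⟩ := (mem_nhdsGT_iff_exists_Ioo_subset).1 h3
  obtain ⟨x₁, hx₁, hx₁y⟩ := exists_between (Set.mem_Ioi.1 hy)
  obtain ⟨x₂, hx₂, hx₂x₁⟩ := exists_between hx₁
  have e1 := (hI ⟨hx₁, hx₁y⟩).2
  have e2 := (hI ⟨hx₂, hx₂x₁.trans hx₁y⟩).2
  have p1 : x₁ ≠ 0 := (hρ.trans hx₁).ne'
  have p2 : x₂ ≠ 0 := (hρ.trans hx₂).ne'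
  have key : ∀ {x : ℝ≥0}, x ≠ 0 → c * x ^ k = d * x ^ m → x ^ (k - m) = d / c := by
    intro x hx e
    rw [zpow_sub₀ hx]
    have : x ^ m ≠ 0 := zpow_ne_zero _ hx
    field_simp
    rw [mul_comm, e, mul_comm]
  have e3 : x₁ ^ (k - m) = x₂ ^ (k - m) := (key p1 e1).trans (key p2 e2).symm
  by_contra hkm
  exact hx₂x₁.ne' ((zpow_left_inj₀ zero_le zero_le (sub_ne_zero.2 hkm)).1 e3)

theorem hasSlope_linear (hρ : 0 < ρ) (α : K) :
    HasSlope hs a ρ (s - RatFunc.C α) (if ‖α - a‖ₑ ≤ ρ then 1 else 0) := by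
  split_ifs with h
  · refine ⟨1, one_ne_zero, ?_⟩
    filter_upwards [self_mem_nhdsWithin] with x hx
    rw [gaussPt_val hs a (hρ.trans hx), max_eq_right (h.trans (by exact_mod_cast hx.le))]
    simp
  · push Not at h
    rw [enorm_eq_nnnorm, ENNReal.coe_lt_coe] at h
    refine ⟨‖α - a‖₊, (pos_iff_ne_zero.1 (hρ.trans h)), ?_⟩
    filter_upwards [self_mem_nhdsWithin, mem_nhdsWithin_of_mem_nhds (gt_mem_nhds h)] with x hx hx'
    rw [gaussPt_val hs a (hρ.trans hx), enorm_eq_nnnorm, max_eq_left (by exact_mod_cast hx'.le)]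
    simp

theorem hasSlope_one : HasSlope hs a ρ 1 0 :=
  ⟨1, one_ne_zero, Eventually.of_forall fun x => by simp⟩

theorem exists_hasSlope (hρ : 0 < ρ) (hg : g ≠ 0) : ∃ k, HasSlope hs a ρ g k := by
  refine hs.induction (P := fun g => ∃ k, HasSlope hs a ρ g k) ?_ ?_ ?_ ?_ g hg
  · intro c hc
    refine ⟨0, ‖c‖₊, by simpa using hc, Eventually.of_forall fun x => ?_⟩
    rw [P1an.val_C, enorm_eq_nnnorm]; simp
  · exact fun α => ⟨_, hasSlope_linear hρ α⟩
  · rintro g h - - ⟨k, hk⟩ ⟨m, hm⟩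
    exact ⟨_, hk.mul hρ hm⟩
  · rintro g hg ⟨k, hk⟩
    exact ⟨_, hk.inv hg hρ⟩

/-- The slope counts zeros: `|s - α|` grows like the radius if `α` lies in the closed disc of radius
`ρ` around `a`, and is locally constant otherwise. -/
theorem hasSlope_prod (hρ : 0 < ρ) (R : Finset K) :
    HasSlope hs a ρ (∏ α ∈ R, (s - RatFunc.C α)) (R.filter fun α => ‖α - a‖ₑ ≤ ρ).card := by
  classical
  induction R using Finset.induction_on with
  | empty => simpa using hasSlope_one
  | insert α R hα ih =>
    rw [Finset.prod_insert hα]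
    convert (hasSlope_linear hρ α).mul hρ ih using 1
    rw [Finset.filter_insert]
    split_ifs with h
    · rw [Finset.card_insert_of_notMem (by simp [hα])]; push_cast; ring
    · simp

/-- If `f` has odd slope at a Gauss point, the points over it are fixed by the conjugation. -/
theorem IsQuadratic.fixed_of_odd_slope {L : Type} [Field L] [Algebra K L]
    {ι : RatFunc K →ₐ[K] L} {σ : L →ₐ[K] L} {y : L} {f : RatFunc K}
    (hq : IsQuadratic ι σ y f) (h2 : ‖(2 : K)‖ = 1) (hρ : 0 < ρ) {n : ℤ} (hn : Odd n)
    (hf : HasSlope hs a ρ f n) {η : AnPoint K L} (hη : η.comap ι = gaussPt hs a ρ) :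
    η.comap σ = η := by
  have hcl : ¬ η.IsClassical := by
    rw [hq.isClassical_iff, hη]; exact gaussPt_not_isClassical hs a hρ
  have hmul := AnPoint.val_mul_of_not_isClassical hcl
  have h2' : ∀ g : L, η.val (2 * g) = η.val g := by
    intro g
    have h20 : (2 : K) ≠ 0 := by rw [← norm_ne_zero_iff, h2]; exact one_ne_zero
    have := η.val_const_mul h20 g
    rwa [map_ofNat (algebraMap K L), ← ofReal_norm, h2, ENNReal.ofReal_one, one_mul] at this
  -- a function with different values at the two points has the shape `u + y`, where `u` and `y`
  -- have the same value
  have key : ∀ u : RatFunc K, η.val (ι u + y) = η.val (ι u - y) := by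
    intro u
    by_contra hne
    have hlt : η.val ((ι u + y) * (ι u - y)) < η.val (ι u ^ 2) := by
      rw [hmul, pow_two, hmul]
      have hu : η.val (ι u) = max (η.val (ι u + y)) (η.val (ι u - y)) := by
        rw [← η.val_add_of_ne hne, ← h2']; congr 1; ring
      rcases lt_or_gt_of_ne hne with h | h
      · rw [max_eq_right h.le] at hu
        rw [hu, mul_comm]
        exact ENNReal.mul_lt_mul_right (ne_bot_of_gt h)
          (AnPoint.val_ne_top_of_not_isClassical hcl _) h
      · rw [max_eq_left h.le] at hu
        rw [hu]
        exact ENNReal.mul_lt_mul_right (ne_bot_of_gt h)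
          (AnPoint.val_ne_top_of_not_isClassical hcl _) h
    have e : (ι u + y) * (ι u - y) = ι (u ^ 2 - f) := by
      rw [map_sub, map_pow, ← hq.sq]; ring
    rw [e, ← map_pow] at hlt
    have hlt' : (gaussPt hs a ρ).val (u ^ 2 - f) < (gaussPt hs a ρ).val (u ^ 2) := by
      rw [← hη]; exact hlt
    have hu0 : u ≠ 0 := by
      rintro rfl
      rw [zero_pow two_ne_zero, AnPoint.val_zero] at hlt'
      exact not_lt_zero hlt'
    -- The strict inequality `|u² - f| < |u²|` persists at nearby radii, so there `|f|` equals the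
    -- absolute value of a square and has even slope.
    have hev : ∀ᶠ x in 𝓝[>] ρ, (gaussPt hs a x).val (u ^ 2) = (gaussPt hs a x).val f := by
      have c1 := ((AnPoint.continuous_val (u ^ 2 - f)).tendsto _).comp
        (continuousAt_gaussPt hs a hρ)
      have c2 := ((AnPoint.continuous_val (u ^ 2)).tendsto _).comp
        (continuousAt_gaussPt hs a hρ)
      filter_upwards [(c1.eventually_lt c2 hlt').filter_mono nhdsWithin_le_nhds] with x hx
      refine (AnPoint.val_eq_of_sub_lt _ ?_).symm
      rw [AnPoint.val_sub_comm]; exact hx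
    obtain ⟨k, hk⟩ := exists_hasSlope (hs := hs) (a := a) hρ hu0
    have h3 : HasSlope hs a ρ (u ^ 2) (k + k) := by rw [pow_two]; exact hk.mul hρ hk
    have h4 := (h3.congr hev).unique hρ hf
    exact (Int.not_even_iff_odd.2 hn) ⟨k, h4.symm⟩
  ext g
  obtain ⟨u, v, rfl⟩ := hq.exists_eq g
  rw [AnPoint.comap_val, map_add, map_mul, hq.invol_ι, hq.invol_ι, hq.invol_y]
  by_cases hv : v = 0
  · simp [hv]
  have hv' : ι v ≠ 0 := by simpa using hv
  have e1 : ι u + ι v * -y = ι v * (ι (u / v) - y) := by rw [map_div₀]; field_simp; ring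
  have e2 : ι u + ι v * y = ι v * (ι (u / v) + y) := by rw [map_div₀]; field_simp
  rw [e1, e2, hmul, hmul, key]

end Slopes

end BerkovichCover

/-! ### Even vertices are those with disconnected inverse image -/

namespace BerkovichCover

open Topology Filter
open scoped NNReal

set_option linter.unusedSectionVars false

theorem AnPoint.HasValue.prod {K F : Type} [NormedField K] [IsUltrametricDist K] [Field F]
    [Algebra K F] {ξ : AnPoint K F} {ι : Type} (s : Finset ι) {g : ι → F} {a : ι → K}
    (h : ∀ i ∈ s, ξ.HasValue (g i) (a i)) : ξ.HasValue (∏ i ∈ s, g i) (∏ i ∈ s, a i) := by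
  classical
  induction s using Finset.induction_on with
  | empty => simpa using AnPoint.HasValue.const (ξ := ξ) 1
  | insert i s hi ih =>
    rw [Finset.prod_insert hi, Finset.prod_insert hi]
    exact (h i (Finset.mem_insert_self i s)).mul
      (ih fun j hj => h j (Finset.mem_insert_of_mem hj))

section Line

variable {K : Type} [NormedField K] [IsUltrametricDist K] [IsAlgClosed K]

theorem IsAffinoid.ne_univ {Z : Set (P1an K)} (hZ : IsAffinoid Z) : Z ≠ Set.univ := by
  obtain ⟨𝒟, -, ⟨D, hD⟩, hopen, rfl⟩ := hZ
  obtain ⟨t, ht, rfl⟩ := hopen D hD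
  intro h
  have : gaussPt ht 0 (1 / 2) ∈ (⋃₀ 𝒟)ᶜ := h ▸ Set.mem_univ _
  refine this ⟨_, hD, ?_⟩
  rw [Set.mem_ofPred_eq, gaussPt_val_coord ht 0 (by simp)]
  simp only [enorm_zero, zero_le, sup_of_le_right]
  rw [← ENNReal.coe_one, ENNReal.coe_lt_coe]
  exact NNReal.half_lt_self one_ne_zero

/-- If the whole line belonged to `C`, any other element would have empty core; without other
elements, the core would be the whole line, which is not an affinoid. -/
theorem IsSemistableCovering.ne_univ {C : Set (Set (P1an K))} (hC : IsSemistableCovering C)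
    {U : Set (P1an K)} (hU : U ∈ C) : U ≠ Set.univ := by
  rintro rfl
  have h1 := (hC.core_affinoid _ hU).ne_univ
  apply h1
  rw [core]
  by_contra h
  have : ∃ V ∈ C, V ≠ Set.univ := by
    by_contra hcon
    push Not at hcon
    apply h
    have : C \ {Set.univ} = ∅ := by
      ext V
      simp only [Set.mem_sdiff, Set.mem_singleton_iff, Set.mem_empty_iff_false, iff_false, not_and,
        not_not]
      exact hcon V
    rw [this]; simp
  obtain ⟨V, hV, hne⟩ := this
  obtain ⟨x, -, hx⟩ := hC.core_nonempty V hV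
  refine hx (Set.mem_biUnion (x := Set.univ) ?_ (Set.mem_univ x))
  exact ⟨hU, fun h => hne h.symm⟩

/-- The classical point is obtained, by compactness, as a limit of Gauss points with centre `α` and
radii tending to `0`. -/
theorem IsCoordinate.exists_hasValue {s : RatFunc K} (hs : IsCoordinate s) (α : K) :
    ∃ ξ : P1an K, ξ.HasValue s α := by
  let r : ℕ → ℝ≥0 := fun n => (1 / 2) ^ n
  have hr : ∀ n, 0 < r n := fun n => pow_pos (by simp) n
  have hlim : Tendsto (fun n => (gaussPt hs α (r n)).val (s - RatFunc.C α)) atTop (𝓝 0) := by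
    have h1 : Tendsto r atTop (𝓝 0) :=
      NNReal.tendsto_pow_atTop_nhds_zero_of_lt_one (NNReal.half_lt_self one_ne_zero)
    have h3 := (ENNReal.continuous_coe.tendsto 0).comp h1
    rw [ENNReal.coe_zero] at h3
    refine h3.congr fun n => ?_
    rw [gaussPt_val_self hs α (hr n)]; rfl
  let 𝒰 : Ultrafilter ℕ := Filter.hyperfilter ℕ
  have hη : Tendsto (fun n => gaussPt hs α (r n)) 𝒰 (𝓝 (𝒰.map fun n => gaussPt hs α (r n)).lim) :=
    (𝒰.map fun n => gaussPt hs α (r n)).le_nhds_lim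
  exact ⟨_, tendsto_nhds_unique (((AnPoint.continuous_val _).tendsto _).comp hη)
    (hlim.mono_left Nat.hyperfilter_le_atTop)⟩

theorem IsWideOpen.isConnected {U : Set (P1an K)} (hU : IsWideOpen U) (hne : U.Nonempty)
    (hne' : U ≠ Set.univ) : IsConnected U := by
  have hopen := hU.isOpen
  obtain ⟨s, hs, I, rfl, -⟩ := hU.exists_wideOpen hne'
  exact isConnected_wideOpen hs hopen hne

end Line

section Squares

variable {K : Type} [NormedField K] [IsUltrametricDist K] [IsAlgClosed K]

/-- On the wide open `{|s| < 1, |s - aᵢ| > rᵢ}`, a product of linear functions without zeroes there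
is close to a square if it has evenly many zeroes in every hole `{|s - aᵢ| ≤ rᵢ}`. -/
theorem exists_sq_of_even {s : RatFunc K} (hs : IsCoordinate s) {I : Finset (K × ℝ≥0)}
    (hI : ∀ i ∈ I, ∀ j ∈ I, i ≠ j → (j.2 : ℝ≥0∞) < max ‖j.1 - i.1‖ₑ i.2) {R : Finset K}
    (hR : ∀ α ∈ R, 1 ≤ ‖α‖ₑ ∨ ∃ i ∈ I, ‖α - i.1‖ₑ ≤ i.2)
    (heven : ∀ i ∈ I, Even (R.filter fun α => ‖α - i.1‖ₑ ≤ i.2).card) :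
    ∃ g : RatFunc K, g ≠ 0 ∧
      ∀ ξ ∈ wideOpen s I, ξ.val ((∏ α ∈ R, (s - RatFunc.C α)) / g ^ 2 - 1) < 1 := by
  classical
  have hdisj : ∀ i ∈ I, ∀ j ∈ I, ∀ α : K, ‖α - i.1‖ₑ ≤ i.2 → ‖α - j.1‖ₑ ≤ j.2 → i = j := by
    have key : ∀ i ∈ I, ∀ j ∈ I, i.2 ≤ j.2 → ∀ α : K, ‖α - i.1‖ₑ ≤ i.2 → ‖α - j.1‖ₑ ≤ j.2 →
        i = j := by
      intro i hi j hj hij α h1 h2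
      by_contra hne
      have h3 := hI i hi j hj hne
      have h4 : ‖j.1 - i.1‖ₑ ≤ j.2 := by
        have e : j.1 - i.1 = (α - i.1) - (α - j.1) := by ring
        rw [e]
        have := (gaussPt hs 0 1).val_sub (RatFunc.C (α - i.1)) (RatFunc.C (α - j.1))
        rw [← map_sub, P1an.val_C, P1an.val_C, P1an.val_C] at this
        exact this.trans (max_le (h1.trans (by exact_mod_cast hij)) h2)
      exact absurd h3 (not_lt.2 (max_le h4 (by exact_mod_cast hij)))
    intro i hi j hj α h1 h2
    rcases le_total i.2 j.2 with h | h
    · exact key i hi j hj h α h1 h2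
    · exact (key j hj i hi h α h2 h1).symm
  -- The holes are disjoint, so a zero lies in at most one of them; `none` means that it lies in
  -- none, which for zeros in `R` forces `|α| ≥ 1`.
  let hole : K → Option (K × ℝ≥0) := fun α =>
    if h : ∃ i ∈ I, ‖α - i.1‖ₑ ≤ i.2 then some h.choose else none
  have hole_some : ∀ α i, i ∈ I → (hole α = some i ↔ ‖α - i.1‖ₑ ≤ i.2) := by
    intro α i hi
    constructor
    · intro h
      simp only [hole] at h
      split_ifs at h with h'
      obtain ⟨h1, h2⟩ := h'.choose_spec
      simp only [Option.some.injEq] at h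
      rw [h] at h2; exact h2
    · intro h
      have h' : ∃ i ∈ I, ‖α - i.1‖ₑ ≤ i.2 := ⟨i, hi, h⟩
      simp only [hole, dif_pos h', Option.some.injEq]
      exact hdisj _ h'.choose_spec.1 _ hi α h'.choose_spec.2 h
  have hole_mem : ∀ α i, hole α = some i → i ∈ I := by
    intro α i h
    simp only [hole] at h
    split_ifs at h with h'
    simp only [Option.some.injEq] at h
    rw [← h]; exact h'.choose_spec.1
  have hole_none : ∀ α ∈ R, hole α = none → 1 ≤ ‖α‖ₑ := by
    intro α hα h
    refine (hR α hα).resolve_right fun h' => ?_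
    simp only [hole] at h
    rw [dif_pos h'] at h
    simp at h
  -- On the wide open, `s - α` equals `s - aᵢ` or the constant `-α` up to a factor close to `1`,
  -- according to where `α` lies. The product of these approximations is a square, by the parity
  -- hypothesis and because constants have square roots.
  let b : K → RatFunc K := fun α => (hole α).elim (RatFunc.C (-α)) fun i => s - RatFunc.C i.1
  have hb0 : ∀ α ∈ R, b α ≠ 0 := by
    intro α hα
    rcases h : hole α with _ | i
    · simp only [b, h, Option.elim]
      refine ratFunc_C_ne_zero (neg_ne_zero.2 ?_)
      rintro rfl
      have := hole_none 0 hα h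
      simp at this
    · simp only [b, h, Option.elim]
      exact hs.sub_C_ne_zero _
  have hsq : IsSquare (∏ α ∈ R, b α) := by
    rw [← Finset.prod_fiberwise_of_maps_to (s := R) (t := R.image hole) (g := hole)
      (fun α hα => Finset.mem_image_of_mem _ hα)]
    refine Finset.isSquare_prod _ fun o ho => ?_
    rcases o with _ | i
    · refine Finset.isSquare_prod _ fun α hα => ?_
      obtain ⟨c, hc⟩ := IsAlgClosed.exists_pow_nat_eq (-α) two_pos
      refine ⟨RatFunc.C c, ?_⟩
      simp only [b, (Finset.mem_filter.1 hα).2, Option.elim]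
      rw [← hc, map_pow, sq]
    · obtain ⟨α₀, -, hα₀⟩ := Finset.mem_image.1 ho
      have hi := hole_mem _ _ hα₀
      have e : ∏ α ∈ R.filter (fun α => hole α = some i), b α =
          (s - RatFunc.C i.1) ^ (R.filter fun α => ‖α - i.1‖ₑ ≤ i.2).card := by
        have e1 : R.filter (fun α => hole α = some i) = R.filter fun α => ‖α - i.1‖ₑ ≤ i.2 :=
          Finset.filter_congr fun α _ => hole_some α i hi
        rw [← e1]
        refine Finset.prod_eq_pow_card fun α hα => ?_
        simp only [b, (Finset.mem_filter.1 hα).2, Option.elim]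
      rw [e]
      exact (heven i hi).isSquare_pow _
  obtain ⟨g, hg⟩ := hsq
  have hgg : ∏ α ∈ R, b α ≠ 0 := Finset.prod_ne_zero_iff.2 hb0
  have hg0 : g ≠ 0 := by rintro rfl; rw [hg] at hgg; simp at hgg
  refine ⟨g, hg0, fun ξ hξ => ?_⟩
  rw [sq, ← hg, ← Finset.prod_div_distrib]
  refine ξ.val_prod_sub_one_lt R _ fun α hα => ?_
  rcases h : hole α with _ | i
  · have h1 := hole_none α hα h
    have hα0 : α ≠ 0 := by rintro rfl; simp at h1
    have e : (s - RatFunc.C α) / b α - 1 = RatFunc.C (-α⁻¹) * s := by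
      have := ratFunc_C_ne_zero hα0
      simp only [b, h, Option.elim, map_neg, map_inv₀]
      field_simp; ring
    rw [e, ← RatFunc.algebraMap_eq_C, ξ.val_const_mul (by simpa using hα0), enorm_neg,
      enorm_inv hα0]
    refine lt_of_le_of_lt ?_ hξ.1
    exact mul_le_of_le_one_left' (ENNReal.inv_le_one.2 h1)
  · have hi := hole_mem _ _ h
    have h1 := (hole_some α i hi).1 h
    have h2 := hξ.2 i hi
    have hv0 : ξ.val (s - RatFunc.C i.1) ≠ 0 := (zero_le.trans_lt h2).ne'
    have hv1 : ξ.val (s - RatFunc.C i.1) ≠ ⊤ := by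
      refine ne_top_of_le_ne_top ?_ (ξ.val_sub _ _)
      rw [P1an.val_C]
      exact (max_lt (hξ.1.trans ENNReal.one_lt_top) enorm_lt_top).ne
    have e : (s - RatFunc.C α) / b α - 1 = RatFunc.C (i.1 - α) / (s - RatFunc.C i.1) := by
      have := hs.sub_C_ne_zero i.1
      simp only [b, h, Option.elim, map_sub]
      field_simp; ring
    rw [e, ξ.val_div_of hv0 hv1, P1an.val_C, ENNReal.div_lt_iff (Or.inl hv0) (Or.inl hv1), one_mul]
    refine lt_of_le_of_lt ?_ h2
    rw [← enorm_neg, neg_sub]; exact h1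

end Squares

section Sheets

variable {K F L : Type} [NormedField K] [IsUltrametricDist K] [Field F] [Algebra K F] [Field L]
  [Algebra K L] {ι : F →ₐ[K] L} {σ : L →ₐ[K] L} {y : L} {f : F}

/-- The product `(y - 1) (y + 1) = f - 1` is small, so one of its factors is. -/
theorem IsQuadratic.val_sub_one_or_add_one (hq : IsQuadratic ι σ y f) (η : AnPoint K L)
    (hf : (η.comap ι).val (f - 1) < 1) : η.val (y - 1) < 1 ∨ η.val (y + 1) < 1 := by
  by_contra hcon
  push Not at hcon
  have h1 : η.val ((y - 1) * (y + 1)) < 1 := by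
    have e : (y - 1) * (y + 1) = ι (f - 1) := by
      rw [map_sub, ← hq.sq, map_one]; ring
    rw [e]; exact hf
  rw [η.val_mul _ _ (fun H => absurd hcon.1 (by simp [H.1]))
    (fun H => absurd hcon.2 (by simp [H.2]))] at h1
  exact absurd h1 (not_lt.2 (one_le_mul hcon.1 hcon.2))

theorem IsQuadratic.val_invol_sub_one (hq : IsQuadratic ι σ y f) (η : AnPoint K L) :
    (η.comap σ).val (y - 1) = η.val (y + 1) := by
  rw [AnPoint.comap_val, map_sub, hq.invol_y, map_one, ← η.val_neg]
  congr 1; ring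

theorem IsQuadratic.val_invol_add_one (hq : IsQuadratic ι σ y f) (η : AnPoint K L) :
    (η.comap σ).val (y + 1) = η.val (y - 1) := by
  rw [AnPoint.comap_val, map_add, hq.invol_y, map_one, ← η.val_neg]
  congr 1; ring

theorem AnPoint.disjoint_val_sub_one_add_one (h2 : ‖(2 : K)‖ = 1) (y : L) :
    Disjoint {η : AnPoint K L | η.val (y - 1) < 1} {η : AnPoint K L | η.val (y + 1) < 1} := by
  rw [Set.disjoint_left]
  intro η h1 h3
  have e : algebraMap K L 2 = (y + 1) - (y - 1) := by rw [map_ofNat]; ring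
  have h4 := η.val_const 2
  rw [e] at h4
  have h5 := (η.val_sub (y + 1) (y - 1)).trans_lt (max_lt h3 h1)
  rw [h4, ← ofReal_norm, h2, ENNReal.ofReal_one] at h5
  exact lt_irrefl _ h5

end Sheets

section Parity

variable {K : Type} [NontriviallyNormedField K] [IsUltrametricDist K] [IsAlgClosed K] {f : K[X]}
  [Fact (Irreducible (X ^ 2 - C (algebraMap K[X] (RatFunc K) f) : (RatFunc K)[X]))]

/-- The factor `s - α` occurs to an odd power in total, so the fibre over `ξ` is a single fixed
point, that is, a Weierstrass point. -/
theorem mem_rootSet_of_hasValue (h2 : (2 : K) ≠ 0) (hdeg : 0 < f.natDegree)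
    (hroots : f.roots.Nodup) {s h : RatFunc K} (hs : IsCoordinate s) {R : Finset K} (hh : h ≠ 0)
    (hf : algebraMap K[X] (RatFunc K) f = h ^ 2 * ∏ α ∈ R, (s - RatFunc.C α)) {α : K}
    (hα : α ∈ R) {ξ : P1an K} (hξ : ξ.HasValue s α) : ξ ∈ rootSet f := by
  classical
  have hf0 : f ≠ 0 := by rintro rfl; simp at hdeg
  have hq := isQuadratic_hyp f hf0
  have ht := (hs.sub_C α).isUniformizer (ξ := ξ) hξ
  obtain ⟨k, w, a, ha, rfl, hw⟩ := ht.exists_zpow_mul h hh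
  have hP : ξ.HasValue (∏ β ∈ R.erase α, (s - RatFunc.C β)) (∏ β ∈ R.erase α, (α - β)) :=
    AnPoint.HasValue.prod _ fun β _ => hξ.sub (.const β)
  have hP0 : ∏ β ∈ R.erase α, (α - β) ≠ 0 := Finset.prod_ne_zero_iff.2 fun β hβ =>
    sub_ne_zero.2 (Finset.ne_of_mem_erase hβ).symm
  have e : algebraMap K[X] (RatFunc K) f = (s - RatFunc.C α) ^ (2 * k + 1) *
      (w ^ 2 * ∏ β ∈ R.erase α, (s - RatFunc.C β)) := by
    rw [hf, ← Finset.mul_prod_erase R _ hα, zpow_add₀ ht.ne_zero, zpow_one, mul_comm 2 k, zpow_mul]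
    norm_cast; ring
  obtain ⟨η, rfl⟩ := surjective_hypProj (f := f) ξ
  refine (bijOn_weierstrassPoints h2 hdeg hroots).1 ⟨hq.isClassical_iff.2 ⟨_, ht.ne_zero, hξ⟩, ?_⟩
  exact hq.fiber_of_odd ht e (mul_ne_zero (pow_ne_zero 2 ha) hP0) (((hw _ rfl).pow 2).mul hP) rfl
    (hq.proj_invol η)

/-- On an element `U` of the covering without roots of `f`, the function `f` is close to a square,
or some edge at `U` is odd. -/
theorem exists_sq_or_exists_odd_edge (h2 : ‖(2 : K)‖ = 1) (hdeg : 0 < f.natDegree)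
    (hroots : f.roots.Nodup) {C : Set (Set (P1an K))} (hC : IsSemistableCovering C)
    {U : Set (P1an K)} (hU : U ∈ C) (hS : ∀ ξ ∈ rootSet f, ξ ∉ U) :
    (∃ g : RatFunc K, g ≠ 0 ∧ ∀ ξ ∈ U, ξ.val (algebraMap K[X] (RatFunc K) f / g ^ 2 - 1) < 1) ∨
      ∃ V ∈ C, V ≠ U ∧ ∃ Z, IsComponentOf Z (U ∩ V) ∧ IsConnected (hypProj f ⁻¹' Z) := by
  classical
  have h20 : (2 : K) ≠ 0 := by rw [← norm_ne_zero_iff, h2]; exact one_ne_zero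
  have hf0 : f ≠ 0 := by rintro rfl; simp at hdeg
  have hq := isQuadratic_hyp f hf0
  have hUo := (hC.wideOpen U hU).isOpen
  obtain ⟨s, hs, I, hUe, hI0, hI⟩ := (hC.wideOpen U hU).exists_wideOpen (hC.ne_univ hU)
  obtain ⟨h, R, hh, hf⟩ := hs.exists_sq_mul_prod (algebraMap K[X] (RatFunc K) f) hq.ne_zero
  have hR : ∀ α ∈ R, 1 ≤ ‖α‖ₑ ∨ ∃ i ∈ I, ‖α - i.1‖ₑ ≤ i.2 := by
    intro α hα
    obtain ⟨ξ, hξ⟩ := hs.exists_hasValue α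
    have hmem := hS ξ (mem_rootSet_of_hasValue h20 hdeg hroots hs hh hf hα hξ)
    by_contra hcon
    push Not at hcon
    apply hmem
    rw [hUe]
    refine ⟨by rw [hξ.val_eq]; exact hcon.1, fun i hi => ?_⟩
    have := hξ.sub (.const i.1)
    rw [RatFunc.algebraMap_eq_C] at this
    rw [this.val_eq]
    exact hcon.2 i hi
  by_cases heven : ∀ i ∈ I, Even (R.filter fun α => ‖α - i.1‖ₑ ≤ i.2).card
  · left
    obtain ⟨g, hg, hgU⟩ := exists_sq_of_even hs hI hR heven
    refine ⟨h * g, mul_ne_zero hh hg, fun ξ hξ => ?_⟩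
    have e : algebraMap K[X] (RatFunc K) f / (h * g) ^ 2 =
        (∏ α ∈ R, (s - RatFunc.C α)) / g ^ 2 := by
      rw [hf]; field_simp
    rw [e]
    exact hgU ξ (hUe ▸ hξ)
  · right
    push Not at heven
    obtain ⟨i, hi, hodd⟩ := heven
    obtain ⟨hr0, hr1, ha1⟩ := hI0 i hi
    -- The Gauss point of a hole with oddly many zeros is not in `U`, so another element `V`
    -- contains it. Gauss points of slightly larger radius lie in `U ∩ V`, and `f` has odd slope
    -- there.
    have hmem : gaussPt hs i.1 i.2 ∈ ⋃₀ C := by rw [hC.covers]; trivial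
    obtain ⟨V, hV, hpV⟩ := hmem
    have hpU : gaussPt hs i.1 i.2 ∉ U := by
      rw [hUe]
      intro hp
      have := hp.2 i hi
      rw [gaussPt_val_self hs i.1 hr0] at this
      exact lt_irrefl _ this
    have hVU : V ≠ U := by rintro rfl; exact hpU hpV
    have ev1 : ∀ᶠ x in 𝓝[>] i.2, gaussPt hs i.1 x ∈ V :=
      ((continuousAt_gaussPt hs i.1 hr0).eventually
        ((hC.wideOpen V hV).isOpen.mem_nhds hpV)).filter_mono nhdsWithin_le_nhds
    have ev2 : ∀ᶠ x in 𝓝[>] i.2, x < 1 :=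
      (gt_mem_nhds hr1 : ∀ᶠ x in 𝓝 i.2, x < 1).filter_mono nhdsWithin_le_nhds
    -- The radius is taken so close to that of the hole that no further zero enters the disc, which
    -- keeps the slope odd.
    have ev3 : ∀ᶠ x : ℝ≥0 in 𝓝[>] i.2, ∀ α ∈ R, ‖α - i.1‖ₑ ≤ (x : ℝ≥0∞) → ‖α - i.1‖ₑ ≤ i.2 := by
      rw [Filter.eventually_all_finset]
      intro α _
      by_cases h : ‖α - i.1‖ₑ ≤ i.2
      · exact Eventually.of_forall fun x _ => h
      · rw [enorm_eq_nnnorm, ENNReal.coe_le_coe, not_le] at h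
        refine (gt_mem_nhds h : ∀ᶠ x in 𝓝 i.2, x < ‖α - i.1‖₊).filter_mono nhdsWithin_le_nhds
          |>.mono fun x hx hx' => ?_
        rw [enorm_eq_nnnorm, ENNReal.coe_le_coe] at hx'
        exact absurd hx (not_lt.2 hx')
    obtain ⟨ρ, ⟨⟨hρV, hρ1⟩, hρR⟩, hρr⟩ :=
      ((ev1.and ev2).and ev3 |>.and self_mem_nhdsWithin).exists
    have hρr : i.2 < ρ := hρr
    have hρ0 : 0 < ρ := hr0.trans hρr
    have hρU : gaussPt hs i.1 ρ ∈ U := by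
      rw [hUe]
      refine ⟨?_, fun j hj => ?_⟩
      · rw [gaussPt_val_coord hs i.1 hρ0]
        exact max_lt ha1 (by exact_mod_cast hρ1)
      · rw [gaussPt_val hs i.1 hρ0]
        by_cases hij : i = j
        · subst hij
          exact lt_max_of_lt_right (by exact_mod_cast hρr)
        · exact (hI i hi j hj hij).trans_le (max_le_max le_rfl (by exact_mod_cast hρr.le))
    have hZ := isComponentOf_connectedComponentIn (A := U ∩ V) ⟨hρU, hρV⟩
    refine ⟨V, hV, hVU, _, hZ, ?_⟩
    obtain ⟨η, hη⟩ := surjective_hypProj (f := f) (gaussPt hs i.1 ρ)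
    obtain ⟨m, hm⟩ := exists_hasSlope (hs := hs) (a := i.1) hρ0 hh
    have hslope : HasSlope hs i.1 ρ (algebraMap K[X] (RatFunc K) f)
        (m + m + (R.filter fun α => ‖α - i.1‖ₑ ≤ i.2).card) := by
      have e : R.filter (fun α => ‖α - i.1‖ₑ ≤ i.2) = R.filter fun α => ‖α - i.1‖ₑ ≤ ρ := by
        refine Finset.filter_congr fun α hα => ⟨fun h => ?_, hρR α hα⟩
        exact h.trans (by exact_mod_cast hρr.le)
      rw [hf, e, sq]
      exact (hm.mul hρ0 hm).mul hρ0 (hasSlope_prod hρ0 R)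
    have hfix := hq.fixed_of_odd_slope h2 hρ0 (n := m + m + _)
      (Even.add_odd ⟨m, rfl⟩ ((Int.odd_coe_nat _).2 (Nat.not_even_iff_odd.1 hodd))) hslope hη
    refine (isInvolutiveCover_hyp h20 hdeg hroots).isConnected_of_fixed hZ.isConnected (x := η) ?_
      hfix
    rw [hη]
    exact mem_connectedComponentIn ⟨hρU, hρV⟩

/-- The inverse image splits if `f` is close to a square. -/
theorem not_isConnected_of_sq (h2 : ‖(2 : K)‖ = 1) (hf0 : f ≠ 0) {U : Set (P1an K)}
    (hU : U.Nonempty) {g : RatFunc K} (hg : g ≠ 0)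
    (hgU : ∀ ξ ∈ U, ξ.val (algebraMap K[X] (RatFunc K) f / g ^ 2 - 1) < 1) :
    ¬ IsConnected (hypProj f ⁻¹' U) := by
  have h20 : (2 : K) ≠ 0 := by rw [← norm_ne_zero_iff, h2]; exact one_ne_zero
  have hq := (isQuadratic_hyp f hf0).twist hg
  set y := hypY f / hypIncl f g with hy
  have hprod : ∀ η ∈ hypProj f ⁻¹' U, η.val (y - 1) < 1 ∨ η.val (y + 1) < 1 :=
    fun η hη => hq.val_sub_one_or_add_one η (hgU _ hη)
  intro hconn
  obtain ⟨ξ, hξ⟩ := hU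
  obtain ⟨η, rfl⟩ := surjective_hypProj (f := f) ξ
  have hση : η.comap (hypInvol f) ∈ hypProj f ⁻¹' U := by
    change (η.comap (hypInvol f)).comap (hypIncl f) ∈ U
    rw [hq.proj_invol]; exact hξ
  have hne : ((hypProj f ⁻¹' U) ∩ {η | η.val (y - 1) < 1}).Nonempty ∧
      ((hypProj f ⁻¹' U) ∩ {η | η.val (y + 1) < 1}).Nonempty := by
    rcases hprod η hξ with h | h
    · exact ⟨⟨η, hξ, h⟩, ⟨_, hση, (hq.val_invol_add_one η).trans_lt h⟩⟩
    · exact ⟨⟨_, hση, (hq.val_invol_sub_one η).trans_lt h⟩, ⟨η, hξ, h⟩⟩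
  obtain ⟨η', -, h1, h3⟩ := hconn.isPreconnected {η | η.val (y - 1) < 1} {η | η.val (y + 1) < 1}
    (isOpen_lt (AnPoint.continuous_val _) continuous_const)
    (isOpen_lt (AnPoint.continuous_val _) continuous_const) hprod hne.1 hne.2
  exact Set.disjoint_left.1 (AnPoint.disjoint_val_sub_one_add_one h2 y) h1 h3

/-- At an even vertex there are neither roots nor odd edges, so `f` is close to a square on `U` and
the cover splits. Conversely, a splitting passes to the annuli in `U`, and a root in `U` would give
a fixed point, which makes the inverse image connected. -/
theorem evenVertex_iff (h2 : ‖(2 : K)‖ = 1) (hdeg : 0 < f.natDegree)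
    (hroots : f.roots.Nodup) {C : Set (Set (P1an K))} (hC : IsSemistableCovering C)
    (hself : IsEmpty (SelfEdge C)) (U : C) :
    (dualGraph C (rootSet f)).EvenVertex (IsEvenEdge f C) U ↔
      ¬ IsConnected (hypProj f ⁻¹' (U : Set (P1an K))) := by
  have h20 : (2 : K) ≠ 0 := by rw [← norm_ne_zero_iff, h2]; exact one_ne_zero
  have hf0 : f ≠ 0 := by rintro rfl; simp at hdeg
  have hcov := isInvolutiveCover_hyp h20 hdeg hroots
  have hUne : (U : Set (P1an K)).Nonempty := (hC.core_nonempty U U.2).mono Set.sdiff_subset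
  have hUc := (hC.wideOpen U U.2).isConnected hUne (hC.ne_univ U.2)
  constructor
  · rintro ⟨hE, hH⟩
    rcases exists_sq_or_exists_odd_edge h2 hdeg hroots hC U.2 (fun ξ hξ hU => hH ⟨ξ, hξ⟩ hU) with
      ⟨g, hg, hgU⟩ | ⟨V, hV, hVU, Z, hZ, hcon⟩
    · exact not_isConnected_of_sq h2 hf0 hUne hg hgU
    · exfalso
      have hne : U ≠ ⟨V, hV⟩ := fun h => hVU (congrArg Subtype.val h).symm
      refine hE (Sum.inl (CrossEdge.mk' hne hZ)) ?_ hcon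
      exact Sym2.mem_mk_left _ _
  · intro hn
    refine ⟨?_, fun s hs => ?_⟩
    · rintro (e | e) he
      · exact hcov.not_isConnected_mono hUc hn e.isConnected.nonempty (e.subset he)
      · exact hself.elim e
    · obtain ⟨η, hη, h⟩ := (bijOn_weierstrassPoints h20 hdeg hroots).2.2 s.2
      refine hn (hcov.isConnected_of_fixed hUc (x := η) ?_ hη.2)
      rw [h]; exact hs

end Parity

end BerkovichCover

/-! ### Ordinary double points have a two-dimensional cotangent space -/

namespace BerkovichCover

open Topology Filter
open scoped NNReal

set_option linter.unusedSectionVars false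

section DoublePoint

variable {A : Type} [CommRing A]

/-- Successive approximation: the hypothesis gives `m ^ (n + 1) ⊆ τ m ^ n + m ^ (n + 2)`, so the
error of `τ y` can be pushed one power further by a correction of `y` in `m ^ n`. -/
theorem exists_seq_approx {m : Ideal A} {τ : A} (hτ : m ≤ Ideal.span {τ} ⊔ m ^ 2) (a : ℕ → A)
    (ha1 : a 1 ∈ m) (ha : ∀ n, a (n + 1) - a n ∈ m ^ n) :
    ∃ y : ℕ → A, ∀ n, a (n + 1) - τ * y n ∈ m ^ (n + 1) ∧ y (n + 1) - y n ∈ m ^ n := by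
  have hpow : ∀ n, ∀ z ∈ m ^ (n + 1), ∃ d ∈ m ^ n, z - τ * d ∈ m ^ (n + 2) := by
    intro n z hz
    have h1 : m ^ (n + 1) ≤ Ideal.span {τ} * m ^ n ⊔ m ^ (n + 2) := by
      rw [pow_succ', show n + 2 = 2 + n by ring, pow_add m 2 n, ← Ideal.sup_mul]
      exact Ideal.mul_mono_left hτ
    obtain ⟨u, hu, v, hv, rfl⟩ := Submodule.mem_sup.1 (h1 hz)
    obtain ⟨d, hd, rfl⟩ := Ideal.mem_span_singleton_mul.1 hu
    exact ⟨d, hd, by simpa using hv⟩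
  have step : ∀ n, ∀ y : {y : A // a (n + 1) - τ * y ∈ m ^ (n + 1)},
      ∃ y' : {y : A // a (n + 2) - τ * y ∈ m ^ (n + 2)}, y'.1 - y.1 ∈ m ^ n := by
    rintro n ⟨y, hy⟩
    have h1 : a (n + 2) - τ * y ∈ m ^ (n + 1) := by
      have e : a (n + 2) - τ * y = (a (n + 2) - a (n + 1)) + (a (n + 1) - τ * y) := by ring
      rw [e]; exact add_mem (ha (n + 1)) hy
    obtain ⟨d, hd, h2⟩ := hpow n _ h1
    refine ⟨⟨y + d, ?_⟩, by simpa using hd⟩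
    have e : a (n + 2) - τ * (y + d) = a (n + 2) - τ * y - τ * d := by ring
    rw [e]; exact h2
  choose next hnext using step
  let y : ∀ n, {y : A // a (n + 1) - τ * y ∈ m ^ (n + 1)} := fun n =>
    Nat.rec ⟨0, by simpa using ha1⟩ (fun n y => next n y) n
  exact ⟨fun n => (y n).1, fun n => ⟨(y n).2, hnext n (y n)⟩⟩

theorem adicCompletion_dvd {m : Ideal A} {τ : A} (hτ : m ≤ Ideal.span {τ} ⊔ m ^ 2)
    (x : AdicCompletion m A) (hx : AdicCompletion.evalOneₐ m x = 0) :
    ∃ z : AdicCompletion m A, x = algebraMap A _ τ * z := by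
  induction x using AdicCompletion.induction_on with
  | _ a =>
    have hmem : ∀ n (z : A), z ∈ (m ^ n • ⊤ : Submodule A A) ↔ z ∈ m ^ n := fun n z => by
      rw [smul_eq_mul, Ideal.mul_top]
    have ha : ∀ n, a (n + 1) - a n ∈ m ^ n := fun n => by
      have := a.2 (Nat.le_succ n)
      rw [SModEq.sub_mem, hmem] at this
      rw [← neg_sub]; exact neg_mem this
    have ha1 : a 1 ∈ m := by
      rw [← AdicCompletion.factorₐ_evalₐ_one, AdicCompletion.evalₐ_mk, Ideal.Quotient.factor_mk,
        Ideal.Quotient.eq_zero_iff_mem] at hx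
      exact hx
    obtain ⟨y, hy⟩ := exists_seq_approx hτ a ha1 ha
    let Y : AdicCompletion.AdicCauchySequence m A := AdicCompletion.AdicCauchySequence.mk m A y
      fun n => by
        rw [SModEq.sub_mem, hmem, ← neg_sub]; exact neg_mem (hy n).2
    refine ⟨AdicCompletion.mk m A Y, AdicCompletion.ext_evalₐ fun n => ?_⟩
    rw [map_mul, AlgHom.commutes, AdicCompletion.evalₐ_mk, AdicCompletion.evalₐ_mk,
      Ideal.Quotient.algebraMap_eq, ← map_mul, Ideal.Quotient.eq]
    have e : a n - τ * y n = (a (n + 1) - τ * y n) - (a (n + 1) - a n) := by ring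
    change a n - τ * y n ∈ m ^ n
    rw [e]
    exact sub_mem (Ideal.pow_le_pow_right (Nat.le_succ n) (hy n).1) (ha n)

theorem coeff_single_one_mul {k : Type} [CommRing k] (i : Fin 2)
    (P Q : MvPowerSeries (Fin 2) k) :
    MvPowerSeries.coeff (Finsupp.single i 1) (P * Q) =
      MvPowerSeries.constantCoeff P * MvPowerSeries.coeff (Finsupp.single i 1) Q +
      MvPowerSeries.coeff (Finsupp.single i 1) P * MvPowerSeries.constantCoeff Q := by
  classical
  rw [MvPowerSeries.coeff_mul, Finsupp.antidiagonal_single, Finset.sum_map]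
  simp [Finset.Nat.antidiagonal_succ, MvPowerSeries.coeff_zero_eq_constantCoeff]

/-- A closed point whose maximal ideal is, modulo its square, generated by one element is not an
ordinary double point. -/
theorem not_isOrdinaryDoublePoint {M : MaximalSpectrum A} {τ : A} (hτM : τ ∈ M.asIdeal)
    (hτ : M.asIdeal ≤ Ideal.span {τ} ⊔ M.asIdeal ^ 2) : ¬ IsOrdinaryDoublePoint M := by
  rintro ⟨e⟩
  have hmax : M.asIdeal.IsMaximal := M.isMaximal
  have hbot : (⊥ : Ideal (A ⧸ M.asIdeal)).IsMaximal := Ideal.bot_quotient_isMaximal_iff _ |>.2 hmax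
  have hlock : IsLocalRing (A ⧸ M.asIdeal) := by
    refine IsLocalRing.of_unique_max_ideal ⟨⊥, hbot, fun I hI => ?_⟩
    exact ((hbot.eq_of_le hI.ne_top bot_le)).symm
  have hdom : IsDomain (A ⧸ M.asIdeal) := Ideal.Quotient.isDomain _
  set k := A ⧸ M.asIdeal
  set J : Ideal (MvPowerSeries (Fin 2) k) := Ideal.span {MvPowerSeries.X 0 * MvPowerSeries.X 1}
    with hJ
  -- The relation `u v` starts in degree two, so constant and linear coefficients are well defined
  -- modulo it; these are all that is compared.
  have hJ0 : ∀ P ∈ J, MvPowerSeries.constantCoeff P = 0 ∧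
      ∀ i, MvPowerSeries.coeff (Finsupp.single i 1) P = 0 := by
    intro P hP
    obtain ⟨D, rfl⟩ := Ideal.mem_span_singleton'.1 hP
    refine ⟨by simp, fun i => ?_⟩
    rw [coeff_single_one_mul, coeff_single_one_mul]; simp
  let c : (MvPowerSeries (Fin 2) k ⧸ J) →+* k :=
    Ideal.Quotient.lift J MvPowerSeries.constantCoeff fun P hP => (hJ0 P hP).1
  have hc : Function.Surjective c := fun a =>
    ⟨Ideal.Quotient.mk J (MvPowerSeries.C a), by simp [c]⟩
  have hnt : Nontrivial (MvPowerSeries (Fin 2) k ⧸ J) := c.domain_nontrivial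
  have hloc : IsLocalRing (MvPowerSeries (Fin 2) k ⧸ J) :=
    IsLocalRing.of_surjective' (Ideal.Quotient.mk J) Ideal.Quotient.mk_surjective
  let ev : AdicCompletion M.asIdeal A →+* k := (AdicCompletion.evalOneₐ M.asIdeal).toRingHom
  have hev : Function.Surjective ev := AdicCompletion.evalOneₐ_surjective M.asIdeal
  -- The isomorphism `e` need not respect the maps to the residue field, but both kernels are
  -- maximal ideals of a local ring and therefore agree.
  have hker : RingHom.ker c = RingHom.ker (ev.comp e.symm.toRingHom) := by
    have h1 : (RingHom.ker c).IsMaximal := Ideal.comap_isMaximal_of_surjective c hc (K := ⊥)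
    have h2 : (RingHom.ker (ev.comp e.symm.toRingHom)).IsMaximal :=
      Ideal.comap_isMaximal_of_surjective _ (fun x => by
        obtain ⟨z, rfl⟩ := hev x
        exact ⟨e z, congrArg ev (e.symm_apply_apply z)⟩) (K := ⊥)
    rw [IsLocalRing.eq_maximalIdeal h1, IsLocalRing.eq_maximalIdeal h2]
  obtain ⟨T, hT⟩ := Ideal.Quotient.mk_surjective (e (algebraMap A _ τ))
  have hT0 : MvPowerSeries.constantCoeff T = 0 := by
    have h1 : e (algebraMap A _ τ) ∈ RingHom.ker c := by
      rw [hker, RingHom.mem_ker]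
      change ev (e.symm (e _)) = 0
      rw [e.symm_apply_apply]
      exact Ideal.Quotient.eq_zero_iff_mem.2 hτM
    rw [← hT, RingHom.mem_ker] at h1
    exact h1
  have key : ∀ i : Fin 2, ∃ P : MvPowerSeries (Fin 2) k, MvPowerSeries.X i - T * P ∈ J := by
    intro i
    have h1 : Ideal.Quotient.mk J (MvPowerSeries.X i) ∈ RingHom.ker c := by
      rw [RingHom.mem_ker]; simp [c]
    rw [hker, RingHom.mem_ker] at h1
    obtain ⟨z, hz⟩ := adicCompletion_dvd hτ _ h1
    obtain ⟨P, hP⟩ := Ideal.Quotient.mk_surjective (e z)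
    refine ⟨P, ?_⟩
    rw [← Ideal.Quotient.eq, map_mul, hT, hP, ← map_mul, ← hz]
    exact (e.apply_symm_apply _).symm
  have hco : ∀ (i j : Fin 2) (P : MvPowerSeries (Fin 2) k), MvPowerSeries.X i - T * P ∈ J →
      MvPowerSeries.coeff (Finsupp.single j 1) T * MvPowerSeries.constantCoeff P =
        if j = i then 1 else 0 := by
    intro i j P hP
    have := (hJ0 _ hP).2 j
    rw [map_sub, coeff_single_one_mul, hT0, zero_mul, zero_add, sub_eq_zero] at this
    rw [← this, MvPowerSeries.coeff_X]
    simp [Finsupp.single_left_inj]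
  obtain ⟨P, hP⟩ := key 0
  obtain ⟨Q, hQ⟩ := key 1
  have h1 := hco 0 0 P hP
  have h2 := hco 0 1 P hP
  have h3 := hco 1 1 Q hQ
  simp only [if_true] at h1 h3
  rw [if_neg (by decide)] at h2
  -- Both variables are multiples of one series `T` modulo the relation, but their linear parts are
  -- not multiples of one linear form.
  rcases mul_eq_zero.1 h2 with h | h
  · rw [h] at h3; simp at h3
  · rw [h] at h1; simp at h1

end DoublePoint

end BerkovichCover

/-! ### Residue discs and standard affinoids -/

namespace BerkovichCover

open Topology Filter
open scoped NNReal

set_option linter.unusedSectionVars false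

theorem enorm_le_one_iff {K : Type} [NormedField K] (a : K) : ‖a‖ₑ ≤ 1 ↔ ‖a‖ ≤ 1 := by
  rw [← ofReal_norm, ENNReal.ofReal_le_one]

section ResidueDiscs

variable {K : Type} [NormedField K] [IsUltrametricDist K] [IsAlgClosed K] {t : RatFunc K}

theorem AnPoint.val_sub_lt_trans {F : Type} [Field F] [Algebra K F] (ξ : AnPoint K F) {g h k : F}
    {r : ℝ≥0∞} (h1 : ξ.val (g - h) < r) (h2 : ξ.val (h - k) < r) : ξ.val (g - k) < r := by
  have e : g - k = (g - h) + (h - k) := by ring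
  rw [e]
  exact (ξ.val_add _ _).trans_lt (max_lt h1 h2)

theorem IsResidueDisc.sub_C {D : Set (P1an K)} (hD : IsResidueDisc t D) {c : K} (hc : ‖c‖ ≤ 1) :
    IsResidueDisc (t - RatFunc.C c) D := by
  rcases hD with ⟨a, ha, rfl⟩ | rfl
  · refine Or.inl ⟨a - c, ?_, ?_⟩
    · rw [sub_eq_add_neg]
      exact (IsUltrametricDist.norm_add_le_max a (-c)).trans (max_le ha (by rwa [norm_neg]))
    · ext ξ
      simp only [Set.mem_ofPred_eq]
      rw [map_sub, sub_sub_sub_cancel_right]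
  · right
    ext ξ
    simp only [Set.mem_ofPred_eq]
    have hc' : ξ.val (RatFunc.C c) ≤ 1 := by rw [P1an.val_C]; exact (enorm_le_one_iff c).2 hc
    constructor
    · intro h
      rw [← ξ.val_neg, neg_sub, sub_eq_add_neg, ξ.val_add_of_lt, ξ.val_neg]
      · exact h
      · rw [ξ.val_neg]; exact hc'.trans_lt h
    · intro h
      by_contra h'
      exact absurd ((ξ.val_sub t _).trans (max_le (not_lt.1 h') hc')) (not_le.2 h)

theorem IsResidueDisc.inv (ht : t ≠ 0) {D : Set (P1an K)} (hD : IsResidueDisc t D) :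
    IsResidueDisc t⁻¹ D := by
  rcases hD with ⟨a, ha, rfl⟩ | rfl
  · by_cases ha1 : ‖a‖ₑ < 1
    · right
      ext ξ
      simp only [Set.mem_ofPred_eq]
      rw [ξ.val_inv t ht, ENNReal.one_lt_inv]
      have hC : ξ.val (RatFunc.C a) < 1 := by rwa [P1an.val_C]
      constructor
      · intro h
        have := ξ.val_sub_lt_trans (k := 0) h (by rwa [sub_zero])
        rwa [sub_zero] at this
      · intro h
        exact (ξ.val_sub _ _).trans_lt (max_lt h hC)
    · have ha1' : ‖a‖ₑ = 1 := le_antisymm ((enorm_le_one_iff a).2 ha) (not_lt.1 ha1)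
      have ha0 : a ≠ 0 := by rintro rfl; simp at ha1'
      left
      refine ⟨a⁻¹, ?_, ?_⟩
      · rw [← enorm_le_one_iff, enorm_inv ha0, ha1', inv_one]
      · have key : ∀ (ξ : P1an K) (s : RatFunc K) (b : K), s ≠ 0 → b ≠ 0 → ‖b‖ₑ = 1 →
            ξ.val (s - RatFunc.C b) < 1 → ξ.val (s⁻¹ - RatFunc.C b⁻¹) < 1 := by
          intro ξ s b hs hb0 hb h
          have hbC := ratFunc_C_ne_zero hb0
          have hv : ξ.val s = 1 := by
            rw [← hb, ← P1an.val_C ξ b]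
            refine ξ.val_eq_of_sub_lt ?_
            rw [P1an.val_C, hb]; exact h
          have hv' : ξ.val (s * RatFunc.C b) = 1 := by
            rw [ξ.val_mul_of_finite (by simp [hv]) (P1an.C_ne_top ξ b), hv, P1an.val_C, hb, one_mul]
          have e : s⁻¹ - RatFunc.C b⁻¹ = -((s - RatFunc.C b) / (s * RatFunc.C b)) := by
            rw [map_inv₀]; field_simp; ring
          rw [e, ξ.val_neg, ξ.val_div_of (by simp [hv']) (by simp [hv']), hv', div_one]
          exact h
        ext ξ
        simp only [Set.mem_ofPred_eq]
        refine ⟨key ξ t a ht ha0 ha1', fun h => ?_⟩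
        have := key ξ t⁻¹ a⁻¹ (inv_ne_zero ht) (inv_ne_zero ha0) (by rw [enorm_inv ha0, ha1', inv_one]) h
        rwa [inv_inv, inv_inv] at this
  · left
    refine ⟨0, by simp, ?_⟩
    ext ξ
    simp only [Set.mem_ofPred_eq]
    rw [map_zero, sub_zero, ξ.val_inv t ht, ENNReal.inv_lt_one]

/-- The affinoid `{|t| ≤ 1, |t - b| ≥ 1 for b ∈ B}`. -/
def stdAffinoid (t : RatFunc K) (B : Finset K) : Set (P1an K) :=
  {ξ | ξ.val t ≤ 1 ∧ ∀ b ∈ B, 1 ≤ ξ.val (t - RatFunc.C b)}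

theorem exists_stdAffinoid_of_mem {𝒟 : Set (Set (P1an K))} (hfin : 𝒟.Finite)
    (hD : ∀ D ∈ 𝒟, IsResidueDisc t D) (hinf : {ξ : P1an K | 1 < ξ.val t} ∈ 𝒟) :
    ∃ B : Finset K, (∀ b ∈ B, ‖b‖ₑ ≤ 1) ∧ (⋃₀ 𝒟)ᶜ = stdAffinoid t B := by
  classical
  have h1 : ∀ D : Set (P1an K), ∃ a : K, ‖a‖ ≤ 1 ∧ (D ∈ 𝒟 → D ≠ {ξ : P1an K | 1 < ξ.val t} →
      D = {ξ : P1an K | ξ.val (t - RatFunc.C a) < 1}) := by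
    intro D
    by_cases h : D ∈ 𝒟 ∧ D ≠ {ξ : P1an K | 1 < ξ.val t}
    · obtain ⟨a, ha, h3⟩ := (hD D h.1).resolve_right h.2
      exact ⟨a, ha, fun _ _ => h3⟩
    · exact ⟨0, by simp, fun h2 h3 => absurd ⟨h2, h3⟩ h⟩
  choose a ha h1 using h1
  refine ⟨(hfin.toFinset.erase {ξ : P1an K | 1 < ξ.val t}).image a, fun b hb => ?_, ?_⟩
  · obtain ⟨D, -, rfl⟩ := Finset.mem_image.1 hb
    exact (enorm_le_one_iff _).2 (ha D)
  · ext ξ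
    simp only [Set.mem_compl_iff, Set.mem_sUnion, not_exists, not_and]
    constructor
    · intro h
      refine ⟨not_lt.1 (h _ hinf), fun b hb => ?_⟩
      obtain ⟨D, hDm, rfl⟩ := Finset.mem_image.1 hb
      rw [Finset.mem_erase, Set.Finite.mem_toFinset] at hDm
      refine not_lt.1 fun h2 => h D hDm.2 ?_
      exact (Set.ext_iff.1 (h1 D hDm.2 hDm.1) ξ).2 h2
    · rintro ⟨h2, h3⟩ D hDm hξ
      by_cases hne : D = {ξ : P1an K | 1 < ξ.val t}
      · rw [hne] at hξ
        exact absurd hξ (not_lt.2 h2)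
      · have := h3 (a D) (Finset.mem_image_of_mem _ (by
          rw [Finset.mem_erase, Set.Finite.mem_toFinset]; exact ⟨hne, hDm⟩))
        exact absurd ((Set.ext_iff.1 (h1 D hDm hne) ξ).1 hξ) (not_lt.2 this)

/-- The complement of finitely many residue discs of a coordinate, in normal form. -/
theorem exists_stdAffinoid (ht : IsCoordinate t) {𝒟 : Set (Set (P1an K))} (hfin : 𝒟.Finite)
    (hD : ∀ D ∈ 𝒟, IsResidueDisc t D) (hne : 𝒟.Nonempty) :
    ∃ (s : RatFunc K) (_ : IsCoordinate s) (B : Finset K), (∀ b ∈ B, ‖b‖ₑ ≤ 1) ∧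
      (⋃₀ 𝒟)ᶜ = stdAffinoid s B ∧ ∀ D, IsResidueDisc s D → IsResidueDisc t D := by
  obtain ⟨D₀, hD₀⟩ := hne
  rcases hD D₀ hD₀ with ⟨c, hc, h⟩ | h
  -- Translation and inversion move one removed residue disc to infinity while permuting the residue
  -- discs, so the remaining affinoid lies in `|s| ≤ 1`.
  · have htc := ht.sub_C c
    have h0 := htc.ne_zero
    have hs := htc.inv
    obtain ⟨B, hB, hBe⟩ := exists_stdAffinoid_of_mem hfin
      (fun D hDm => ((hD D hDm).sub_C hc).inv h0) (by
        convert hD₀ using 1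
        rw [h]
        ext ξ
        simp only [Set.mem_ofPred_eq]
        rw [ξ.val_inv _ h0, ENNReal.one_lt_inv])
    refine ⟨_, hs, B, hB, hBe, fun D hDm => ?_⟩
    have h1 := hDm.inv hs.ne_zero
    rw [inv_inv] at h1
    have h2 := h1.sub_C (c := -c) (by rwa [norm_neg])
    rwa [map_neg, sub_neg_eq_add, sub_add_cancel] at h2
  · rw [h] at hD₀
    obtain ⟨B, hB, hBe⟩ := exists_stdAffinoid_of_mem hfin hD hD₀
    exact ⟨t, ht, B, hB, hBe, fun D hDm => hDm⟩

end ResidueDiscs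

section Factor

variable {K : Type} [NormedField K] [IsUltrametricDist K] [IsAlgClosed K] {t : RatFunc K}

theorem IsCoordinate.exists_factorization (ht : IsCoordinate t) (g : RatFunc K) (hg : g ≠ 0) :
    ∃ (c : K) (n : K →₀ ℤ), c ≠ 0 ∧ g = RatFunc.C c * n.prod fun α k => (t - RatFunc.C α) ^ k := by
  classical
  refine ht.induction (P := fun g => ∃ (c : K) (n : K →₀ ℤ), c ≠ 0 ∧
    g = RatFunc.C c * n.prod fun α k => (t - RatFunc.C α) ^ k) ?_ ?_ ?_ ?_ g hg
  · exact fun c hc => ⟨c, 0, hc, by simp⟩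
  · exact fun α => ⟨1, Finsupp.single α 1, one_ne_zero, by simp⟩
  · rintro _ _ - - ⟨c, n, hc, rfl⟩ ⟨d, m, hd, rfl⟩
    refine ⟨c * d, n + m, mul_ne_zero hc hd, ?_⟩
    rw [Finsupp.prod_add_index' (by simp) (fun α k l => zpow_add₀ (ht.sub_C_ne_zero α) k l), map_mul]
    ring
  · rintro _ - ⟨c, n, hc, rfl⟩
    refine ⟨c⁻¹, -n, inv_ne_zero hc, ?_⟩
    rw [Finsupp.prod_neg_index (by simp), mul_inv, map_inv₀]
    simp [Finsupp.prod, Finset.prod_inv_distrib]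

end Factor

end BerkovichCover

/-! ### Functions on a standard affinoid: factorization and the maximum principle -/

namespace BerkovichCover

open Topology Filter
open scoped NNReal

set_option linter.unusedSectionVars false

section ConstVal

variable {K F : Type} [NormedField K] [Field F] [Algebra K F]

/-- The function `w` has the same finite nonzero value at all points of `Z`. -/
def IsConstVal (Z : Set (AnPoint K F)) (w : F) : Prop :=
  ∃ c : ℝ≥0∞, c ≠ 0 ∧ c ≠ ⊤ ∧ ∀ ξ ∈ Z, ξ.val w = c

variable {Z : Set (AnPoint K F)} {w w' : F}

theorem IsConstVal.mul (hw : IsConstVal Z w) (hw' : IsConstVal Z w') : IsConstVal Z (w * w') := by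
  obtain ⟨c, h1, h2, h3⟩ := hw
  obtain ⟨d, h4, h5, h6⟩ := hw'
  refine ⟨c * d, mul_ne_zero h1 h4, ENNReal.mul_ne_top h2 h5, fun ξ hξ => ?_⟩
  rw [ξ.val_mul_of_finite (by rw [h3 ξ hξ]; exact h2) (by rw [h6 ξ hξ]; exact h5), h3 ξ hξ, h6 ξ hξ]

theorem IsConstVal.inv (hw0 : w ≠ 0) (hw : IsConstVal Z w) : IsConstVal Z w⁻¹ := by
  obtain ⟨c, h1, h2, h3⟩ := hw
  exact ⟨c⁻¹, by simpa using h2, by simpa using h1, fun ξ hξ => by rw [ξ.val_inv _ hw0, h3 ξ hξ]⟩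

theorem IsConstVal.const {c : K} (hc : c ≠ 0) : IsConstVal Z (algebraMap K F c) :=
  ⟨‖c‖ₑ, by simpa using hc, enorm_ne_top, fun ξ _ => ξ.val_const c⟩

theorem IsConstVal.one : IsConstVal Z (1 : F) :=
  ⟨1, one_ne_zero, ENNReal.one_ne_top, fun ξ _ => ξ.val_one⟩

theorem IsConstVal.prod {ι : Type} (s : Finset ι) {w : ι → F} (hw : ∀ i ∈ s, IsConstVal Z (w i)) :
    IsConstVal Z (∏ i ∈ s, w i) := by
  classical
  induction s using Finset.induction_on with
  | empty => simpa using IsConstVal.one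
  | insert i s hi ih =>
    rw [Finset.prod_insert hi]
    exact (hw i (Finset.mem_insert_self i s)).mul
      (ih fun j hj => hw j (Finset.mem_insert_of_mem hj))

theorem IsConstVal.pow (hw : IsConstVal Z w) (n : ℕ) : IsConstVal Z (w ^ n) := by
  simpa using IsConstVal.prod (Finset.range n) (w := fun _ => w) fun _ _ => hw

theorem IsConstVal.zpow (hw0 : w ≠ 0) (hw : IsConstVal Z w) (n : ℤ) : IsConstVal Z (w ^ n) := by
  cases n with
  | ofNat n => simpa using hw.pow n
  | negSucc n =>
    rw [zpow_negSucc]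
    exact (hw.pow (n + 1)).inv (pow_ne_zero _ hw0)

theorem AnPoint.val_prod_eq_one (ξ : AnPoint K F) {ι : Type} (s : Finset ι) {w : ι → F}
    (hw : ∀ i ∈ s, ξ.val (w i) = 1) : ξ.val (∏ i ∈ s, w i) = 1 := by
  classical
  induction s using Finset.induction_on with
  | empty => simp
  | insert i s hi ih =>
    have h1 := hw i (Finset.mem_insert_self i s)
    have h2 := ih fun j hj => hw j (Finset.mem_insert_of_mem hj)
    rw [Finset.prod_insert hi, ξ.val_mul_of_finite (by simp [h1]) (by simp [h2]), h1, h2, one_mul]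

theorem AnPoint.val_prod_le_one (ξ : AnPoint K F) {ι : Type} (s : Finset ι) {w : ι → F}
    (hw : ∀ i ∈ s, ξ.val (w i) ≤ 1) : ξ.val (∏ i ∈ s, w i) ≤ 1 := by
  classical
  induction s using Finset.induction_on with
  | empty => simp
  | insert i s hi ih =>
    rw [Finset.prod_insert hi]
    exact ξ.val_mul_le_one (hw i (Finset.mem_insert_self i s))
      (ih fun j hj => hw j (Finset.mem_insert_of_mem hj))

end ConstVal

section Standard

variable {K : Type} [NormedField K] [IsUltrametricDist K] [IsAlgClosed K] {t : RatFunc K}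
  {B : Finset K}

theorem stdAffinoid.val_linear_le {ξ : P1an K} (hξ : ξ ∈ stdAffinoid t B) {α : K}
    (hα : ‖α‖ₑ ≤ 1) : ξ.val (t - RatFunc.C α) ≤ 1 :=
  (ξ.val_sub _ _).trans (max_le hξ.1 (by rwa [P1an.val_C]))

theorem stdAffinoid.val_linear_of_near (hB : ∀ b ∈ B, ‖b‖ₑ ≤ 1) {ξ : P1an K}
    (hξ : ξ ∈ stdAffinoid t B) {α b : K} (hb : b ∈ B) (h : ‖α - b‖ₑ < 1) :
    ξ.val (t - RatFunc.C α) = 1 := by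
  have h1 : ξ.val (t - RatFunc.C b) = 1 :=
    le_antisymm (stdAffinoid.val_linear_le hξ (hB b hb)) (hξ.2 b hb)
  rw [← h1]
  refine ξ.val_eq_of_sub_lt ?_
  rw [h1, sub_sub_sub_cancel_left, ← map_sub, P1an.val_C, ← enorm_neg, neg_sub]
  exact h

theorem stdAffinoid.val_linear_of_large {ξ : P1an K} (hξ : ξ ∈ stdAffinoid t B) {α : K}
    (h : 1 < ‖α‖ₑ) : ξ.val (t - RatFunc.C α) = ‖α‖ₑ := by
  rw [ξ.val_sub_comm, ← P1an.val_C ξ α]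
  refine ξ.val_eq_of_sub_lt ?_
  rw [sub_sub_cancel_left, ξ.val_neg, P1an.val_C]
  exact hξ.1.trans_lt h

theorem gaussPt_mem_stdAffinoid (ht : IsCoordinate t) : gaussPt ht 0 1 ∈ stdAffinoid t B := by
  refine ⟨?_, fun b _ => ?_⟩
  · rw [gaussPt_val_coord ht 0 one_pos]; simp
  · rw [gaussPt_val ht 0 one_pos]; exact le_max_right _ _

theorem gaussPt_val_linear (ht : IsCoordinate t) {α : K} (hα : ‖α‖ₑ ≤ 1) :
    (gaussPt ht 0 1).val (t - RatFunc.C α) = 1 := by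
  rw [gaussPt_val ht 0 one_pos, sub_zero, ENNReal.coe_one, max_eq_right hα]

theorem AnPoint.HasValue.sub_C {ξ : P1an K} {a : K} (h : ξ.HasValue t a) (α : K) :
    ξ.HasValue (t - RatFunc.C α) (a - α) := by
  rw [← RatFunc.algebraMap_eq_C]; exact h.sub (.const α)

theorem mem_stdAffinoid_iff {ξ : P1an K} {a : K} (h : ξ.HasValue t a) :
    ξ ∈ stdAffinoid t B ↔ ‖a‖ₑ ≤ 1 ∧ ∀ b ∈ B, 1 ≤ ‖a - b‖ₑ := by
  simp only [stdAffinoid, Set.mem_ofPred_eq, h.val_eq, (h.sub_C _).val_eq]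

/-- A function that is finite on the affinoid is a product of linear functions and of a function
with constant absolute value. -/
theorem exists_prod_mul_constVal (ht : IsCoordinate t) (hB : ∀ b ∈ B, ‖b‖ₑ ≤ 1) {g : RatFunc K}
    (hg : g ≠ 0) (hfin : ∀ ξ ∈ stdAffinoid t B, ξ.val g ≠ ⊤) :
    ∃ (P : Finset K) (e : K → ℕ) (w : RatFunc K), (∀ α ∈ P, ‖α‖ₑ ≤ 1) ∧ w ≠ 0 ∧
      g = (∏ α ∈ P, (t - RatFunc.C α) ^ e α) * w ∧ IsConstVal (stdAffinoid t B) w := by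
  classical
  obtain ⟨c, n, hc, rfl⟩ := ht.exists_factorization g hg
  let p : K → Prop := fun α => ‖α‖ₑ ≤ 1 ∧ 0 < n α
  refine ⟨n.support.filter p, fun α => (n α).toNat,
    RatFunc.C c * ∏ α ∈ n.support.filter fun α => ¬ p α, (t - RatFunc.C α) ^ n α,
    fun α hα => (Finset.mem_filter.1 hα).2.1,
    mul_ne_zero (ratFunc_C_ne_zero hc) (Finset.prod_ne_zero_iff.2 fun α _ =>
      zpow_ne_zero _ (ht.sub_C_ne_zero α)), ?_, ?_⟩
  · rw [Finsupp.prod, ← Finset.prod_filter_mul_prod_filter_not n.support p]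
    have : ∏ α ∈ n.support.filter p, (t - RatFunc.C α) ^ n α =
        ∏ α ∈ n.support.filter p, (t - RatFunc.C α) ^ (n α).toNat := by
      refine Finset.prod_congr rfl fun α hα => ?_
      rw [← zpow_natCast, Int.toNat_of_nonneg (Finset.mem_filter.1 hα).2.2.le]
    rw [this]; ring
  · rw [← RatFunc.algebraMap_eq_C]
    refine (IsConstVal.const hc).mul (IsConstVal.prod _ fun α hα => ?_)
    refine IsConstVal.zpow (ht.sub_C_ne_zero α) ?_ _
    obtain ⟨hαs, hpα⟩ := Finset.mem_filter.1 hα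
    by_cases hα1 : ‖α‖ₑ ≤ 1
    · have hnα : n α < 0 := by
        have h1 : n α ≠ 0 := Finsupp.mem_support_iff.1 hαs
        have h2 : ¬ 0 < n α := fun h => hpα ⟨hα1, h⟩
        omega
      have hb : ∃ b ∈ B, ‖α - b‖ₑ < 1 := by
        by_contra hcon
        push Not at hcon
        obtain ⟨ξ, hξ⟩ := ht.exists_hasValue α
        refine hfin ξ ((mem_stdAffinoid_iff hξ).2 ⟨hα1, hcon⟩) ?_
        have hu := (ht.sub_C α).isUniformizer (ξ := ξ) hξ
        have hP : ξ.HasValue (algebraMap K (RatFunc K) c *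
            ∏ β ∈ n.support.erase α, (t - RatFunc.C β) ^ n β)
            (c * ∏ β ∈ n.support.erase α, (α - β) ^ n β) :=
          (AnPoint.HasValue.const c).mul (AnPoint.HasValue.prod _ fun β hβ =>
            (hξ.sub_C β).zpow (sub_ne_zero.2 (Finset.ne_of_mem_erase hβ).symm) _)
        have hP0 : c * ∏ β ∈ n.support.erase α, (α - β) ^ n β ≠ 0 :=
          mul_ne_zero hc (Finset.prod_ne_zero_iff.2 fun β hβ => zpow_ne_zero _
            (sub_ne_zero.2 (Finset.ne_of_mem_erase hβ).symm))
        have e : RatFunc.C c * (n.prod fun α k => (t - RatFunc.C α) ^ k) =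
            (t - RatFunc.C α) ^ n α * (algebraMap K (RatFunc K) c *
            ∏ β ∈ n.support.erase α, (t - RatFunc.C β) ^ n β) := by
          rw [Finsupp.prod, ← Finset.mul_prod_erase _ _ hαs, RatFunc.algebraMap_eq_C]; ring
        rw [e, hu.val_zpow_mul rfl _ hP0 hP, ENNReal.zero_zpow_def, if_neg hnα.ne,
          if_neg (not_lt.2 hnα.le)]
        exact ENNReal.top_mul (by simpa using hP0)
      obtain ⟨b, hbB, hb⟩ := hb
      exact ⟨1, one_ne_zero, ENNReal.one_ne_top, fun ξ hξ =>
        stdAffinoid.val_linear_of_near hB hξ hbB hb⟩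
    · push Not at hα1
      exact ⟨‖α‖ₑ, (one_pos.trans hα1).ne', enorm_ne_top, fun ξ hξ =>
        stdAffinoid.val_linear_of_large hξ hα1⟩

/-- The maximum principle. -/
theorem val_le_gaussPt_val (ht : IsCoordinate t) (hB : ∀ b ∈ B, ‖b‖ₑ ≤ 1) {g : RatFunc K}
    (hfin : ∀ ξ ∈ stdAffinoid t B, ξ.val g ≠ ⊤) {ξ : P1an K} (hξ : ξ ∈ stdAffinoid t B) :
    ξ.val g ≤ (gaussPt ht 0 1).val g := by
  by_cases hg : g = 0
  · simp [hg]
  -- The linear factors are at most `1` on the affinoid and equal to `1` at the Gauss point; the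
  -- remaining factor is constant.
  obtain ⟨P, e, w, hP, -, rfl, c, hc0, hc1, hc⟩ := exists_prod_mul_constVal ht hB hg hfin
  have h1 : ξ.val (∏ α ∈ P, (t - RatFunc.C α) ^ e α) ≤ 1 :=
    ξ.val_prod_le_one _ fun α hα => by
      rw [ξ.val_pow]
      exact pow_le_one₀ zero_le (stdAffinoid.val_linear_le hξ (hP α hα))
  have h2 : (gaussPt ht 0 1).val (∏ α ∈ P, (t - RatFunc.C α) ^ e α) = 1 :=
    AnPoint.val_prod_eq_one _ _ fun α hα => by
      rw [AnPoint.val_pow, gaussPt_val_linear ht (hP α hα), one_pow]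
  have h3 := hc ξ hξ
  have h4 := hc _ (gaussPt_mem_stdAffinoid ht)
  rw [ξ.val_mul_of_right (by rw [h3]; exact hc0) (by rw [h3]; exact hc1),
    AnPoint.val_mul_of_right _ (by rw [h4]; exact hc0) (by rw [h4]; exact hc1), h2, h3, h4]
  exact mul_le_mul_left h1 c

/-- A bounded function is its value at a point plus a multiple of the uniformizer. -/
theorem exists_eq_const_add_mul (ht : IsCoordinate t) (hB : ∀ b ∈ B, ‖b‖ₑ ≤ 1) {ξ : P1an K} {a : K}
    (hξ : ξ.HasValue t a) (hmem : ξ ∈ stdAffinoid t B) {p : RatFunc K}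
    (hp : p ∈ unitBall (stdAffinoid t B)) :
    ∃ (d : K) (q : RatFunc K), ‖d‖ₑ ≤ 1 ∧ q ∈ unitBall (stdAffinoid t B) ∧ ξ.HasValue p d ∧
      p = RatFunc.C d + (t - RatFunc.C a) * q := by
  have hu := (ht.sub_C a).isUniformizer (ξ := ξ) hξ
  obtain ⟨d, hd⟩ := hu.exists_of_val_ne_top (ne_top_of_le_ne_top ENNReal.one_ne_top (hp ξ hmem))
  have hd1 : ‖d‖ₑ ≤ 1 := by rw [← hd.val_eq]; exact hp ξ hmem
  have hpd : ξ.HasValue (p - RatFunc.C d) 0 := by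
    have := hd.sub (.const d)
    rwa [sub_self, RatFunc.algebraMap_eq_C] at this
  obtain ⟨q, q0, hq, hq0⟩ := hu.exists_mul_of_hasValue_zero hpd
  have hle : ∀ ζ ∈ stdAffinoid t B, ζ.val (p - RatFunc.C d) ≤ 1 := fun ζ hζ =>
    (ζ.val_sub _ _).trans (max_le (hp ζ hζ) (by rwa [P1an.val_C]))
  have hfin : ∀ ζ ∈ stdAffinoid t B, ζ.val q ≠ ⊤ := by
    intro ζ hζ
    by_cases h0 : ζ.val (t - RatFunc.C a) = 0
    · have : ζ = ξ := by
        have hut : IsUniformizer {η : P1an K | η.val (t - RatFunc.C a) = 0} (t - RatFunc.C a) := by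
          refine ⟨ht.sub_C_ne_zero a, fun η hη => hη, fun g hg => ?_⟩
          obtain ⟨n, w, b, hb, e, hw⟩ := ht.exists_zpow_mul a g hg
          exact ⟨n, w, b, hb, e, fun η hη => hw η hη⟩
        exact hut.subsingleton h0 hξ
      rw [this]; exact hq0.val_ne_top
    · intro htop
      have h1 := hle ζ hζ
      rw [hq, ζ.val_mul _ _ (fun H => h0 H.1) (fun H => by rw [htop] at H; simp at H), htop,
        ENNReal.mul_top h0] at h1
      simp at h1
  -- By the maximum principle `q` need only be bounded at the Gauss point, and there division by `t
  -- - a` changes nothing because `|t - a| = 1`.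
  refine ⟨d, q, hd1, fun ζ hζ => (val_le_gaussPt_val ht hB hfin hζ).trans ?_, hd, ?_⟩
  · have h1 := hle _ (gaussPt_mem_stdAffinoid ht)
    have ha1 : ‖a‖ₑ ≤ 1 := ((mem_stdAffinoid_iff hξ).1 hmem).1
    have h2 := gaussPt_val_linear ht ha1
    rwa [hq, AnPoint.val_mul_of_left _ (by simp [h2]) (by simp [h2]), h2, one_mul] at h1
  · rw [← hq]; ring

/-- There is a classical point of the affinoid with `|a - b| = 1` for all holes. -/
theorem exists_mem_stdAffinoid (ht : IsCoordinate t) (hB : ∀ b ∈ B, ‖b‖ₑ ≤ 1) :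
    ∃ (a : K) (ξ : P1an K), ξ.HasValue t a ∧ ξ ∈ stdAffinoid t B := by
  have key : ∃ a : K, ‖a‖ₑ ≤ 1 ∧ ∀ b ∈ B, 1 ≤ ‖a - b‖ₑ := by
    by_cases hBe : B = ∅
    · exact ⟨0, by simp, by simp [hBe]⟩
    obtain ⟨b₀, hb₀⟩ := Finset.nonempty_iff_ne_empty.2 hBe
    -- A solution `a` of `∏ (a - b) = 1` works: it is forced to have `|a| ≤ 1`, so all factors have
    -- absolute value at most `1`, and since their product is `1` none is smaller.
    let p : K[X] := ∏ b ∈ B, (X - C b)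
    have hdeg : 0 < (p - 1).degree := by
      have h1 : p.degree = B.card := by
        rw [degree_prod]; simp
      have h2 : 0 < p.degree := by
        rw [h1]; exact_mod_cast Finset.card_pos.2 ⟨b₀, hb₀⟩
      rwa [degree_sub_eq_left_of_degree_lt (by rwa [degree_one])]
    obtain ⟨a, ha⟩ := IsAlgClosed.exists_root (p - 1) hdeg.ne'
    have ha' : ∏ b ∈ B, (a - b) = 1 := by
      rw [IsRoot, eval_sub, eval_one, eval_prod, sub_eq_zero] at ha
      simpa using ha
    have hprod : ∏ b ∈ B, ‖a - b‖ = 1 := by rw [← norm_prod, ha', norm_one]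
    have hle : ∀ b ∈ B, ‖b‖ ≤ 1 := fun b hb => (enorm_le_one_iff b).1 (hB b hb)
    have ha1 : ‖a‖ ≤ 1 := by
      by_contra h
      push Not at h
      have h1 : ∀ b ∈ B, 1 < ‖a - b‖ := by
        intro b hb
        have h2 : ‖a‖ ≤ max ‖a - b‖ ‖b‖ := by
          have := IsUltrametricDist.norm_add_le_max (a - b) b
          rwa [sub_add_cancel] at this
        rcases le_max_iff.1 h2 with h3 | h3
        · exact h.trans_le h3
        · exact absurd (h3.trans (hle b hb)) (not_le.2 h)
      have := Finset.prod_lt_prod_of_nonempty (f := fun _ => (1 : ℝ)) (g := fun b => ‖a - b‖)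
        (fun _ _ => one_pos) h1 ⟨b₀, hb₀⟩
      rw [hprod] at this
      simp at this
    have h1 : ∀ b ∈ B, ‖a - b‖ ≤ 1 := fun b hb => by
      rw [sub_eq_add_neg]
      exact (IsUltrametricDist.norm_add_le_max _ _).trans (max_le ha1 (by
        rw [norm_neg]; exact hle b hb))
    refine ⟨a, (enorm_le_one_iff a).2 ha1, fun b hb => ?_⟩
    by_contra h
    push Not at h
    have h' : ‖a - b‖ < 1 := by
      rwa [← ofReal_norm, ENNReal.ofReal_lt_one] at h
    classical
    rw [← Finset.mul_prod_erase _ _ hb] at hprod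
    have h2 : ∏ x ∈ B.erase b, ‖a - x‖ ≤ 1 :=
      Finset.prod_le_one (fun _ _ => norm_nonneg _) fun x hx => h1 x (Finset.mem_of_mem_erase hx)
    have h3 : ‖a - b‖ * ∏ x ∈ B.erase b, ‖a - x‖ < 1 :=
      mul_lt_one_of_nonneg_of_lt_one_left (norm_nonneg _) h' h2
    exact h3.ne hprod
  obtain ⟨a, ha, hab⟩ := key
  obtain ⟨ξ, hξ⟩ := ht.exists_hasValue a
  exact ⟨a, ξ, hξ, (mem_stdAffinoid_iff hξ).2 ⟨ha, hab⟩⟩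

end Standard

end BerkovichCover

/-! ### Maximal ideals of the reduction of a double cover -/

namespace BerkovichCover

open Topology Filter
open scoped NNReal

set_option linter.unusedSectionVars false

section Nodes

variable {K : Type} [NormedField K] [IsUltrametricDist K] [IsAlgClosed K] {t : RatFunc K}
  {B : Finset K} {A : Type} [CommRing A]

theorem C_mem_unitBall {Z : Set (P1an K)} {d : K} (hd : ‖d‖ₑ ≤ 1) :
    RatFunc.C d ∈ unitBall Z := fun ξ _ => by rwa [P1an.val_C]

theorem linear_mem_unitBall {α : K} (hα : ‖α‖ₑ ≤ 1) :
    t - RatFunc.C α ∈ unitBall (stdAffinoid t B) := fun _ hξ => stdAffinoid.val_linear_le hξ hα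

theorem isUnit_of_val_eq_one {F : Type} [Field F] [Algebra K F] {Z : Set (AnPoint K F)} {g : F}
    (hg : g ∈ unitBall Z) (hg0 : g ≠ 0) (h : ∀ ξ ∈ Z, ξ.val g = 1) :
    IsUnit (⟨g, hg⟩ : unitBall Z) := by
  refine IsUnit.of_mul_eq_one ⟨g⁻¹, fun ξ hξ => ?_⟩ (Subtype.ext (mul_inv_cancel₀ hg0))
  rw [ξ.val_inv _ hg0, h ξ hξ, inv_one]

theorem enorm_eq_one_of_not_lt {d : K} (hd : ‖d‖ₑ ≤ 1) (h : ¬ ‖d‖ₑ < 1) : ‖d‖ₑ = 1 :=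
  le_antisymm hd (not_lt.1 h)

variable (ρ : unitBall (stdAffinoid t B) →+* A)
  (hρ : ∀ g ∈ nilBall (stdAffinoid t B), ρ g = 0) (m : Ideal A) [hm : m.IsMaximal]

include hm in
theorem not_mem_of_val_eq_one {g : RatFunc K} (hg : g ∈ unitBall (stdAffinoid t B)) (hg0 : g ≠ 0)
    (h : ∀ ξ ∈ stdAffinoid t B, ξ.val g = 1) : ρ ⟨g, hg⟩ ∉ m := fun hmem =>
  hm.ne_top (Ideal.eq_top_of_isUnit_mem _ hmem ((isUnit_of_val_eq_one hg hg0 h).map ρ))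

include hm in
theorem const_not_mem {d : K} (hd : ‖d‖ₑ = 1) : ρ ⟨RatFunc.C d, C_mem_unitBall hd.le⟩ ∉ m :=
  not_mem_of_val_eq_one ρ m _ (ratFunc_C_ne_zero (by rintro rfl; simp at hd))
    fun ξ _ => by rw [P1an.val_C, hd]

include hρ in
theorem const_eq_zero {d : K} (hd : ‖d‖ₑ < 1) : ρ ⟨RatFunc.C d, C_mem_unitBall hd.le⟩ = 0 :=
  hρ _ fun ξ _ => by
    change ξ.val (RatFunc.C d) < 1
    rwa [P1an.val_C]

include hρ hm in
/-- Maximal ideals lying over the reduction of the affinoid come from classical points. -/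
theorem exists_linear_mem (ht : IsCoordinate t) (hB : ∀ b ∈ B, ‖b‖ₑ ≤ 1) {y : A}
    {F' : unitBall (stdAffinoid t B)} (hy : y ^ 2 = ρ F')
    (hsurj : ∀ x, ∃ p q, x = ρ p + ρ q * y) :
    ∃ (α : K) (ξ : P1an K) (hα : ‖α‖ₑ ≤ 1), ξ.HasValue t α ∧ ξ ∈ stdAffinoid t B ∧
      ρ ⟨t - RatFunc.C α, linear_mem_unitBall hα⟩ ∈ m := by
  obtain ⟨a, ξ, hξ, hmem⟩ := exists_mem_stdAffinoid (B := B) ht hB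
  have ha := ((mem_stdAffinoid_iff hξ).1 hmem).1
  by_cases hT : ρ ⟨t - RatFunc.C a, linear_mem_unitBall ha⟩ ∈ m
  · exact ⟨a, ξ, ha, hξ, hmem, hT⟩
  obtain ⟨x, hx⟩ := hm.exists_inv hT
  obtain ⟨i, hi, hxi⟩ := hx
  obtain ⟨p, q, rfl⟩ := hsurj x
  set T : unitBall (stdAffinoid t B) := ⟨t - RatFunc.C a, linear_mem_unitBall ha⟩ with hTdef
  -- This is the norm of `1 - (p + q y) T`. It maps into `m` because `p + q y` inverts `T` modulo
  -- `m`, and it has value `1` at `ξ` because `T` vanishes there.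
  let g : unitBall (stdAffinoid t B) := 1 - 2 * p * T + (p ^ 2 - q ^ 2 * F') * T ^ 2
  have hgm : ρ g ∈ m := by
    have e : ρ g = ((ρ p + ρ q * y) * ρ T - 1) * ((ρ p - ρ q * y) * ρ T - 1) := by
      simp only [g, map_add, map_sub, map_mul, map_pow, map_one, map_ofNat]
      rw [← hy]; ring
    rw [e]
    refine Ideal.mul_mem_right _ _ ?_
    have : (ρ p + ρ q * y) * ρ T - 1 = -i := by rw [← hxi]; ring
    rw [this]; exact neg_mem hi
  have hgval : ξ.val ((g : RatFunc K) - 1) < 1 := by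
    have e : (g : RatFunc K) - 1 =
        (t - RatFunc.C a) * ((-(2 * p) + (p ^ 2 - q ^ 2 * F') * T : unitBall (stdAffinoid t B))) := by
      have hT' : (t - RatFunc.C a) = (T : RatFunc K) := rfl
      rw [hT', ← MulMemClass.coe_mul, ← OneMemClass.coe_one (unitBall (stdAffinoid t B)),
        ← AddSubgroupClass.coe_sub]
      congr 1
      simp only [g]; ring
    have h0 : ξ.val (t - RatFunc.C a) = 0 := hξ
    rw [e, ξ.val_mul_of_ne_top (by simp [h0])
      (ne_top_of_le_ne_top ENNReal.one_ne_top (Subtype.property (_ : unitBall _) ξ hmem)), h0,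
      zero_mul]
    exact one_pos
  have hg1 : ξ.val (g : RatFunc K) = 1 := by
    rw [← ξ.val_one]; exact ξ.val_eq_of_sub_lt (by rwa [ξ.val_one])
  have hg0 : (g : RatFunc K) ≠ 0 := by intro h; rw [h] at hg1; simp at hg1
  obtain ⟨P, e, w, hP, hw0, hgw, c, hc0, hc1, hc⟩ := exists_prod_mul_constVal ht hB hg0
    fun ζ hζ => ne_top_of_le_ne_top ENNReal.one_ne_top (g.2 ζ hζ)
  have hmemP : ∏ α ∈ P, (t - RatFunc.C α) ^ e α ∈ unitBall (stdAffinoid t B) :=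
    fun ζ hζ => ζ.val_prod_le_one _ fun α hα => by
      rw [ζ.val_pow]
      exact pow_le_one₀ zero_le (stdAffinoid.val_linear_le hζ (hP α hα))
  -- Since `|g(ξ)| = 1`, the factor of constant absolute value has absolute value `1`, so it is a
  -- unit. Hence a linear factor of `g` lies in the maximal ideal.
  have hc_eq : c = 1 := by
    have h3 := hc _ (gaussPt_mem_stdAffinoid (B := B) ht)
    have h1 := g.2 _ (gaussPt_mem_stdAffinoid (B := B) ht)
    have h2 : (gaussPt ht 0 1).val (∏ α ∈ P, (t - RatFunc.C α) ^ e α) = 1 :=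
      AnPoint.val_prod_eq_one _ _ fun α hα => by
        rw [AnPoint.val_pow, gaussPt_val_linear ht (hP α hα), one_pow]
    rw [hgw, AnPoint.val_mul_of_left _ (by simp [h2]) (by simp [h2]), h2, one_mul, h3] at h1
    refine le_antisymm h1 ?_
    have h4 := hc ξ hmem
    rw [hgw, ξ.val_mul_of_right (by rwa [h4]) (by rwa [h4]), h4] at hg1
    rw [← hg1]
    exact mul_le_of_le_one_left' (hmemP ξ hmem)
  have hwmem : w ∈ unitBall (stdAffinoid t B) := fun ζ hζ => by rw [hc ζ hζ, hc_eq]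
  have hprod : g = (∏ α ∈ P.attach, ⟨t - RatFunc.C α.1, linear_mem_unitBall (hP α.1 α.2)⟩ ^ e α.1) *
      ⟨w, hwmem⟩ := by
    apply Subtype.ext
    rw [hgw, MulMemClass.coe_mul, SubmonoidClass.coe_finsetProd, ← Finset.prod_attach]
    rfl
  rw [hprod, map_mul, map_prod] at hgm
  have h5 := (hm.isPrime.mem_or_mem hgm).resolve_right
    (not_mem_of_val_eq_one ρ m hwmem hw0 fun ζ hζ => by rw [hc ζ hζ, hc_eq])
  obtain ⟨α, -, hα⟩ := (hm.isPrime.prod_mem_iff).1 h5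
  rw [map_pow] at hα
  replace hα := hm.isPrime.mem_of_pow_mem _ hα
  obtain ⟨ζ, hζ⟩ := ht.exists_hasValue α.1
  refine ⟨α, ζ, hP α.1 α.2, hζ, (mem_stdAffinoid_iff hζ).2 ⟨hP α.1 α.2, ?_⟩, hα⟩
  by_contra hcon
  push Not at hcon
  obtain ⟨b, hb, hlt⟩ := hcon
  exact not_mem_of_val_eq_one ρ m _ (ht.sub_C_ne_zero _)
    (fun η hη => stdAffinoid.val_linear_of_near hB hη hb hlt) hα

/-- The function is a unit times a product of linear functions with distinct reductions. -/
def HasSimpleZeros (t : RatFunc K) (B : Finset K) (g : RatFunc K) : Prop :=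
  ∃ (R : Finset K) (w : RatFunc K), g = (∏ α ∈ R, (t - RatFunc.C α)) * w ∧ w ≠ 0 ∧
    (∀ α ∈ R, ‖α‖ₑ ≤ 1) ∧ (∀ α ∈ R, ∀ b ∈ B, 1 ≤ ‖α - b‖ₑ) ∧
    (∀ α ∈ R, ∀ β ∈ R, α ≠ β → 1 ≤ ‖α - β‖ₑ) ∧ ∀ ξ ∈ stdAffinoid t B, ξ.val w = 1

theorem HasSimpleZeros.mem_unitBall {g : RatFunc K} (hg : HasSimpleZeros t B g) :
    g ∈ unitBall (stdAffinoid t B) := by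
  obtain ⟨R, w, rfl, -, h1, -, -, h3⟩ := hg
  intro ξ hξ
  exact ξ.val_mul_le_one (ξ.val_prod_le_one _ fun α hα => stdAffinoid.val_linear_le hξ (h1 α hα))
    (h3 ξ hξ).le

/-- The zeros lie in distinct residue discs, so only one of the factors can be small at `ξ`. -/
theorem HasSimpleZeros.exists_eq_mul {g : RatFunc K}
    (hg : HasSimpleZeros t B g) {ξ : P1an K} {a : K}
    (hξ : ξ.HasValue t a) (hmem : ξ ∈ stdAffinoid t B) (hlt : ξ.val g < 1) :
    ∃ (β : K) (w : RatFunc K), ‖β‖ₑ ≤ 1 ∧ ‖a - β‖ₑ < 1 ∧ w ∈ unitBall (stdAffinoid t B) ∧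
      g = (t - RatFunc.C β) * w ∧ ξ.val w = 1 := by
  classical
  obtain ⟨R, w, rfl, hw0, h1, -, h2, h3⟩ := hg
  have hβ : ∃ β ∈ R, ‖a - β‖ₑ < 1 := by
    by_contra hcon
    push Not at hcon
    have h4 : ξ.val (∏ α ∈ R, (t - RatFunc.C α)) = 1 := ξ.val_prod_eq_one _ fun α hα =>
      le_antisymm (stdAffinoid.val_linear_le hmem (h1 α hα)) (by
        rw [(hξ.sub_C α).val_eq]; exact hcon α hα)
    rw [ξ.val_mul_of_left (by simp [h4]) (by simp [h4]), h4, h3 ξ hmem, one_mul] at hlt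
    exact lt_irrefl _ hlt
  obtain ⟨β, hβR, hβ⟩ := hβ
  refine ⟨β, (∏ α ∈ R.erase β, (t - RatFunc.C α)) * w, h1 β hβR, hβ, fun ζ hζ => ?_, ?_, ?_⟩
  · exact ζ.val_mul_le_one (ζ.val_prod_le_one _ fun α hα =>
      stdAffinoid.val_linear_le hζ (h1 α (Finset.mem_of_mem_erase hα))) (h3 ζ hζ).le
  · rw [← Finset.mul_prod_erase _ _ hβR, mul_assoc]
  · have h4 : ξ.val (∏ α ∈ R.erase β, (t - RatFunc.C α)) = 1 := ξ.val_prod_eq_one _ fun α hα => by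
      rw [(hξ.sub_C α).val_eq]
      obtain ⟨hne, hαR⟩ := Finset.mem_erase.1 hα
      refine le_antisymm ?_ ?_
      · rw [← (hξ.sub_C α).val_eq]; exact stdAffinoid.val_linear_le hmem (h1 α hαR)
      · by_contra hcon
        push Not at hcon
        have h5 : ‖α - β‖ₑ < 1 := by
          have h6 : ξ.val (t - RatFunc.C α) < 1 := by rwa [(hξ.sub_C α).val_eq]
          have h7 : ξ.val (t - RatFunc.C β) < 1 := by rwa [(hξ.sub_C β).val_eq]
          rw [ξ.val_sub_comm] at h6
          have := ξ.val_sub_lt_trans h6 h7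
          rwa [← map_sub, P1an.val_C] at this
        exact absurd (h2 α hαR β hβR hne) (not_le.2 h5)
    rw [ξ.val_mul_of_left (by simp [h4]) (by simp [h4]), h4, h3 ξ hmem, one_mul]

include hρ hm in
/-- The maximal ideals of the reduction of a double covering of the affinoid with equation
`y² = F'` are generated by one element modulo their square, if `F'` has simple zeros. -/
theorem exists_le_span_sup_sq (ht : IsCoordinate t) (hB : ∀ b ∈ B, ‖b‖ₑ ≤ 1) {y : A}
    {F' : unitBall (stdAffinoid t B)} (hy : y ^ 2 = ρ F')
    (hsurj : ∀ x, ∃ p q, x = ρ p + ρ q * y)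
    (hF : (y = 0 ∧ F' = 0) ∨ (‖(2 : K)‖ = 1 ∧ HasSimpleZeros t B F')) :
    ∃ τ ∈ m, m ≤ Ideal.span {τ} ⊔ m ^ 2 := by
  obtain ⟨α, ξ, hα, hξ, hmem, hT⟩ := exists_linear_mem ρ hρ m ht hB hy hsurj
  set T : unitBall (stdAffinoid t B) := ⟨t - RatFunc.C α, linear_mem_unitBall hα⟩ with hTdef
  have hval : ∀ p : unitBall (stdAffinoid t B), ∃ (d : K) (hd : ‖d‖ₑ ≤ 1)
      (q : unitBall (stdAffinoid t B)), ξ.HasValue (p : RatFunc K) d ∧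
        ρ p = ρ ⟨RatFunc.C d, C_mem_unitBall hd⟩ + ρ T * ρ q := by
    intro p
    obtain ⟨d, q, hd, hq, hpd, e⟩ := exists_eq_const_add_mul ht hB hξ hmem p.2
    refine ⟨d, hd, ⟨q, hq⟩, hpd, ?_⟩
    rw [← map_mul, ← map_add]
    congr 1
    exact Subtype.ext e
  have hspan : ∀ p, ρ p ∈ m → ρ p ∈ Ideal.span {ρ T} := by
    intro p hp
    obtain ⟨d, hd, q, -, e⟩ := hval p
    have hd1 : ‖d‖ₑ < 1 := by
      by_contra h
      refine const_not_mem ρ m (enorm_eq_one_of_not_lt hd h) ?_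
      have : ρ ⟨RatFunc.C d, C_mem_unitBall hd⟩ = ρ p - ρ T * ρ q := by rw [e]; ring
      rw [this]
      exact sub_mem hp (m.mul_mem_right _ hT)
    rw [e, const_eq_zero ρ hρ hd1, zero_add]
    exact Ideal.mul_mem_right _ _ (Ideal.mem_span_singleton_self _)
  -- Once the value of `y` modulo `m` is known to be `p₀`, the ideal is generated by `T` and `y -
  -- p₀`; one of these will be redundant modulo `m²`.
  have hle : ∀ p₀, y - ρ p₀ ∈ m → m ≤ Ideal.span {ρ T} ⊔ Ideal.span {y - ρ p₀} := by
    intro p₀ hp₀ x hx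
    obtain ⟨p, q, rfl⟩ := hsurj x
    have e : ρ p + ρ q * y = ρ (p + q * p₀) + ρ q * (y - ρ p₀) := by
      rw [map_add, map_mul]; ring
    have h1 : ρ (p + q * p₀) ∈ m := by
      have : ρ (p + q * p₀) = (ρ p + ρ q * y) - ρ q * (y - ρ p₀) := by rw [e]; ring
      rw [this]
      exact sub_mem hx (m.mul_mem_left _ hp₀)
    rw [e]
    exact add_mem (Ideal.mem_sup_left (hspan _ h1))
      (Ideal.mem_sup_right (Ideal.mul_mem_left _ _ (Ideal.mem_span_singleton_self _)))
  rcases hF with ⟨rfl, rfl⟩ | ⟨h2, hF⟩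
  · refine ⟨ρ T, hT, (hle 0 (by simp)).trans ?_⟩
    simp
  obtain ⟨d, hd, q, hFd, e⟩ := hval F'
  obtain ⟨c, hc⟩ := IsAlgClosed.exists_pow_nat_eq d (n := 2) two_pos
  have hcd : ‖c‖ₑ ^ 2 = ‖d‖ₑ := by rw [← hc, enorm_pow]
  have hc1 : ‖c‖ₑ ≤ 1 := by
    by_contra h
    push Not at h
    have : 1 < ‖c‖ₑ ^ 2 := one_lt_pow₀ h two_ne_zero
    rw [hcd] at this
    exact absurd hd (not_le.2 this)
  set γ : unitBall (stdAffinoid t B) := ⟨RatFunc.C c, C_mem_unitBall hc1⟩ with hγdef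
  have hγ2 : ρ γ ^ 2 = ρ ⟨RatFunc.C d, C_mem_unitBall hd⟩ := by
    rw [← map_pow]
    congr 1
    apply Subtype.ext
    simp [hγdef, ← hc]
  have hprod : (y - ρ γ) * (y + ρ γ) = ρ T * ρ q := by
    have : (y - ρ γ) * (y + ρ γ) = y ^ 2 - ρ γ ^ 2 := by ring
    rw [this, hy, e, hγ2]; ring
  have hpm : (y - ρ γ) * (y + ρ γ) ∈ m := by rw [hprod]; exact m.mul_mem_right _ hT
  -- A branch point of the reduction: here `y ∈ m` and `y² = T` times a function which is a unit at
  -- the point, so `T ∈ m²` and `y` alone generates. In the other case `y` has a nonzero value `±c`,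
  -- and `(y - c) (y + c) ∈ (T)` with `2 c` a unit, so `T` alone generates.
  by_cases hlt : ‖d‖ₑ < 1
  · have hclt : ‖c‖ₑ < 1 := by
      by_contra h
      rw [← hcd, enorm_eq_one_of_not_lt hc1 h, one_pow] at hlt
      exact lt_irrefl _ hlt
    have hγ0 : ρ γ = 0 := const_eq_zero ρ hρ hclt
    have hym : y ∈ m := by
      rw [hγ0, sub_zero, add_zero] at hpm
      exact (hm.isPrime.mem_or_mem hpm).elim id id
    obtain ⟨β, w, hβ, hαβ, hw, hFw, hw1⟩ := hF.exists_eq_mul hξ hmem (by rwa [hFd.val_eq])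
    obtain ⟨δ, hδ, r, hδv, eδ⟩ := hval ⟨w, hw⟩
    have hδ1 : ‖δ‖ₑ = 1 := by rw [← hδv.val_eq]; exact hw1
    have hFT : ρ F' = ρ T * ρ ⟨w, hw⟩ := by
      rw [← sub_eq_zero, ← map_mul, ← map_sub]
      refine hρ _ fun ζ hζ => ?_
      change ζ.val ((F' : RatFunc K) - (t - RatFunc.C α) * w) < 1
      rw [hFw, ← sub_mul, sub_sub_sub_cancel_left, ← map_sub]
      rw [mul_comm]
      refine ζ.val_mul_lt_one (hw ζ hζ) ?_
      rwa [P1an.val_C]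
    have hTm : ρ T ∈ m ^ 2 := by
      have h4 : ρ T * ρ ⟨RatFunc.C δ, C_mem_unitBall hδ⟩ ∈ m ^ 2 := by
        have : ρ T * ρ ⟨RatFunc.C δ, C_mem_unitBall hδ⟩ = y ^ 2 - ρ T ^ 2 * ρ r := by
          rw [hy, hFT, eδ]; ring
        rw [this]
        exact sub_mem (Ideal.pow_mem_pow hym 2) (Ideal.mul_mem_right _ _ (Ideal.pow_mem_pow hT 2))
      have hu := (isUnit_of_val_eq_one (Z := stdAffinoid t B) (C_mem_unitBall hδ)
        (ratFunc_C_ne_zero (by rintro rfl; simp at hδ1))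
        fun ζ _ => by rw [P1an.val_C, hδ1]).map ρ
      exact (Ideal.mul_unit_mem_iff_mem _ hu).1 h4
    refine ⟨y, hym, (hle 0 (by simpa using hym)).trans ?_⟩
    rw [map_zero, sub_zero]
    refine sup_le ?_ le_sup_left
    rw [Ideal.span_singleton_le_iff_mem]
    exact Ideal.mem_sup_right hTm
  · have hd1 := enorm_eq_one_of_not_lt hd hlt
    have hc1' : ‖c‖ₑ = 1 := by
      refine enorm_eq_one_of_not_lt hc1 fun h => hlt ?_
      rw [← hcd]
      exact pow_lt_one₀ zero_le h two_ne_zero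
    have key : ∀ ε : unitBall (stdAffinoid t B), IsUnit (ρ (2 * ε)) → y - ρ ε ∈ m →
        (y - ρ ε) * (y + ρ ε) = ρ T * ρ q → ∃ τ ∈ m, m ≤ Ideal.span {τ} ⊔ m ^ 2 := by
      intro ε hu hε hp
      refine ⟨ρ T, hT, (hle ε hε).trans (sup_le le_sup_left ?_)⟩
      rw [Ideal.span_singleton_le_iff_mem]
      have h4 : (y - ρ ε) * ρ (2 * ε) ∈ Ideal.span {ρ T} ⊔ m ^ 2 := by
        have : (y - ρ ε) * ρ (2 * ε) = ρ T * ρ q - (y - ρ ε) ^ 2 := by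
          rw [← hp, map_mul, map_ofNat]; ring
        rw [this]
        exact sub_mem (Ideal.mem_sup_left (Ideal.mul_mem_right _ _
          (Ideal.mem_span_singleton_self _))) (Ideal.mem_sup_right (Ideal.pow_mem_pow hε 2))
      exact (Ideal.mul_unit_mem_iff_mem _ hu).1 h4
    have hu : IsUnit (ρ (2 * γ)) := by
      have h2c : ‖2 * c‖ₑ = 1 := by
        rw [enorm_mul, hc1', mul_one, ← ofReal_norm, h2, ENNReal.ofReal_one]
      have := (isUnit_of_val_eq_one (Z := stdAffinoid t B) (C_mem_unitBall h2c.le)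
        (ratFunc_C_ne_zero (by intro h; simp [h] at h2c))
        fun ζ _ => by rw [P1an.val_C, h2c]).map ρ
      convert this using 2
      apply Subtype.ext
      simp only [hγdef, two_mul, map_add]
      rfl
    rcases hm.isPrime.mem_or_mem hpm with h | h
    · exact key γ hu h hprod
    · refine key (-γ) ?_ (by simpa using h) ?_
      · rw [show 2 * -γ = -(2 * γ) by ring, map_neg]; exact hu.neg
      · rw [map_neg, ← hprod]; ring

end Nodes

end BerkovichCover

/-! ### Bounded functions on the double cover of an affinoid -/

namespace BerkovichCover

open Topology Filter
open scoped NNReal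

set_option linter.unusedSectionVars false

section Sheets

variable {K L : Type} [NormedField K] [IsUltrametricDist K] [IsAlgClosed K] [Field L] [Algebra K L]
  {t : RatFunc K} {B : Finset K} {ι : RatFunc K →ₐ[K] L} {σ : L →ₐ[K] L} {y : L} {F' : RatFunc K}

theorem AnPoint.val_le_one_of_sq (η : AnPoint K L) {g : L} (h : η.val (g ^ 2) ≤ 1) :
    η.val g ≤ 1 := by
  by_contra h'
  rw [η.val_pow] at h
  exact absurd h (not_le.2 (one_lt_pow₀ (not_le.1 h') two_ne_zero))

theorem exists_isUniformizer_of_isClassical {ξ : P1an K} (hξ : ξ.IsClassical) :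
    ∃ τ, IsUniformizer {ξ} τ := by
  rcases exists_coordinate_of_isClassical hξ with ⟨α, hα⟩ | htop
  · exact ⟨_, (isCoordinate_X.sub_C α).isUniformizer hα⟩
  · refine ⟨_, isCoordinate_X.inv.isUniformizer (ξ := ξ) ?_⟩
    rw [ξ.val_inv _ isCoordinate_X.ne_zero, htop, ENNReal.inv_top]

/-- By `hsurj` the reduction of `Z'` is generated by `1` and `y` over that of the affinoid, so
`exists_le_span_sup_sq` applies. The choice `y = F' = 0` serves for sets with the same reduction
functions as the affinoid: the affinoid itself, and one sheet of a split cover. -/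
theorem not_isOrdinaryDoublePoint_of_double (ht : IsCoordinate t) (hB : ∀ b ∈ B, ‖b‖ₑ ≤ 1)
    (φ : RatFunc K →ₐ[K] L) {Z' : Set (AnPoint K L)} (hmaps : ∀ η ∈ Z', η.comap φ ∈ stdAffinoid t B)
    (hy : y ∈ unitBall Z') (hF' : F' ∈ unitBall (stdAffinoid t B)) (hyF : y ^ 2 = φ F')
    (hsurj : ∀ x ∈ unitBall Z', ∃ p ∈ unitBall (stdAffinoid t B), ∃ q ∈ unitBall (stdAffinoid t B),
      ∀ η ∈ Z', η.val (x - (φ p + φ q * y)) < 1)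
    (hF : (y = 0 ∧ F' = 0) ∨ (‖(2 : K)‖ = 1 ∧ HasSimpleZeros t B F'))
    (M : MaximalSpectrum (Reduction Z')) : ¬ IsOrdinaryDoublePoint M := by
  let mk : unitBall Z' →+* Reduction Z' := Ideal.Quotient.mk (nilBall Z')
  have hmk0 : ∀ x, mk x = 0 ↔ x ∈ nilBall Z' := fun x => Ideal.Quotient.eq_zero_iff_mem
  let res : unitBall (stdAffinoid t B) →+* unitBall Z' :=
    { toFun := fun g => ⟨φ g, fun η hη => g.2 _ (hmaps η hη)⟩
      map_one' := Subtype.ext (map_one φ)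
      map_zero' := Subtype.ext (map_zero φ)
      map_mul' := fun a b => Subtype.ext (map_mul φ (a : RatFunc K) b)
      map_add' := fun a b => Subtype.ext (map_add φ (a : RatFunc K) b) }
  have hM : M.asIdeal.IsMaximal := M.isMaximal
  obtain ⟨τ, hτ, hle⟩ := exists_le_span_sup_sq (mk.comp res) (fun g hg => (hmk0 _).2
    fun η hη => hg _ (hmaps η hη)) M.asIdeal ht hB (y := mk ⟨y, hy⟩) (F' := ⟨F', hF'⟩) (by
      rw [← map_pow]
      exact congrArg mk (Subtype.ext hyF)) (by
      intro x
      obtain ⟨x, rfl⟩ := Ideal.Quotient.mk_surjective x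
      obtain ⟨p, hp, q, hq, h⟩ := hsurj x x.2
      refine ⟨⟨p, hp⟩, ⟨q, hq⟩, ?_⟩
      change mk x = mk (res ⟨p, hp⟩) + mk (res ⟨q, hq⟩) * mk ⟨y, hy⟩
      rw [← map_mul, ← map_add, ← sub_eq_zero, ← map_sub]
      exact (hmk0 _).2 h) (by
      rcases hF with ⟨rfl, rfl⟩ | h
      · exact Or.inl ⟨map_zero mk, rfl⟩
      · exact Or.inr h)
  exact not_isOrdinaryDoublePoint hτ hle

variable (hq : IsQuadratic ι σ y F') (h2 : ‖(2 : K)‖ = 1)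
  (hsurj : ∀ ξ : P1an K, ∃ η : AnPoint K L, η.comap ι = ξ)

include hq h2 hsurj

/-- The part `p` is half the trace of `x`, and `x` is bounded by `1` at conjugate points too.
Dividing by `2` is harmless because `|2| = 1`. -/
theorem IsQuadratic.exists_half {Z : Set (P1an K)} {x : L}
    (hx : x ∈ unitBall (AnPoint.comap ι ⁻¹' Z)) : ∃ p ∈ unitBall Z, ∃ q, x = ι p + ι q * y ∧
      ∀ η ∈ AnPoint.comap ι ⁻¹' Z, η.val (ι q * y) ≤ 1 := by
  obtain ⟨u, v, rfl⟩ := hq.exists_eq x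
  have h20 : (2 : K) ≠ 0 := by rw [← norm_ne_zero_iff, h2]; exact one_ne_zero
  have h21 : ‖(2 : K)⁻¹‖ₑ = 1 := by rw [← ofReal_norm, norm_inv, h2, inv_one, ENNReal.ofReal_one]
  have hu : ∀ η ∈ AnPoint.comap ι ⁻¹' Z, η.val (ι u) ≤ 1 := by
    intro η hη
    have h1 := hx η hη
    have h3 : (η.comap σ).val (ι u + ι v * y) ≤ 1 := hx _ (by
      rw [Set.mem_preimage, hq.proj_invol]; exact hη)
    have e : ι u = algebraMap K L 2⁻¹ * ((ι u + ι v * y) + σ (ι u + ι v * y)) := by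
      simp only [map_add, map_mul, hq.invol_y, hq.invol_ι, map_inv₀, map_ofNat]
      have : (2 : L) ≠ 0 := by
        rw [← map_ofNat (algebraMap K L) 2]; exact (_root_.map_ne_zero _).2 h20
      field_simp; ring
    rw [e, η.val_const_mul (inv_ne_zero h20), h21, one_mul]
    exact (η.val_add _ _).trans (max_le h1 h3)
  refine ⟨u, fun ξ hξ => ?_, v, rfl, fun η hη => ?_⟩
  · obtain ⟨η, rfl⟩ := hsurj ξ
    exact hu η hξ
  · have e : ι v * y = (ι u + ι v * y) - ι u := by ring
    rw [e]
    exact (η.val_sub _ _).trans (max_le (hx η hη) (hu η hη))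

/-- If `F'` has simple zeros, the bounded functions on the double covering are `p + q y` with
bounded `p` and `q`. -/
theorem IsQuadratic.exists_of_hasSimpleZeros (ht : IsCoordinate t) (hB : ∀ b ∈ B, ‖b‖ₑ ≤ 1)
    (hF : HasSimpleZeros t B F') {x : L}
    (hx : x ∈ unitBall (AnPoint.comap ι ⁻¹' stdAffinoid t B)) :
    ∃ p ∈ unitBall (stdAffinoid t B), ∃ q ∈ unitBall (stdAffinoid t B), x = ι p + ι q * y := by
  obtain ⟨p, hp, q, rfl, hqy⟩ := hq.exists_half h2 hsurj hx
  refine ⟨p, hp, q, ?_, rfl⟩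
  have hysq : ∀ η : AnPoint K L, η.val y ^ 2 = (η.comap ι).val F' := fun η => by
    rw [← η.val_pow, hq.sq, AnPoint.comap_val]
  -- The function `q² F'` is bounded. A pole of `q` could only be compensated by a zero of `F'`, but
  -- that zero is simple while the pole of `q²` has order at least two.
  have hfin : ∀ ξ ∈ stdAffinoid t B, ξ.val q ≠ ⊤ := by
    intro ξ hξ htop
    obtain ⟨η, rfl⟩ := hsurj ξ
    have hle := hqy η hξ
    have hF0 : (η.comap ι).val F' = 0 := by
      by_contra h0
      have hy0 : η.val y ≠ 0 := fun h => h0 (by rw [← hysq, h]; simp)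
      have hyt : η.val y ≠ ⊤ := fun h => by
        have h3 := hF.mem_unitBall _ hξ
        rw [← hysq, h] at h3
        simp at h3
      have htop' : η.val (ι q) = ⊤ := htop
      rw [η.val_mul_of_right hy0 hyt, htop', ENNReal.top_mul hy0] at hle
      simp at hle
    have hcl := (η.comap ι).isClassical_of_val_eq_top htop
    obtain ⟨τ₀, hτ₀⟩ := exists_isUniformizer_of_isClassical hcl
    obtain ⟨a, ha⟩ := hτ₀.exists_of_val_ne_top (ne_top_of_le_ne_top ENNReal.one_ne_top hξ.1)
    obtain ⟨β, w, -, -, -, rfl, hw1⟩ := hF.exists_eq_mul ha hξ (by rw [hF0]; exact one_pos)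
    have hβ : (η.comap ι).val (t - RatFunc.C β) = 0 := by
      rwa [AnPoint.val_mul_of_right _ (by rw [hw1]; simp) (by rw [hw1]; simp), hw1, mul_one] at hF0
    have hτ := (ht.sub_C β).isUniformizer hβ
    obtain ⟨b, hb⟩ := hτ.exists_of_val_ne_top (g := w) (by rw [hw1]; simp)
    have hb0 : b ≠ 0 := by
      rintro rfl
      rw [hb.val_eq] at hw1
      simp at hw1
    have hq0 : q ≠ 0 := by rintro rfl; simp at htop
    obtain ⟨n, v, c, hc, rfl, hv⟩ := hτ.exists_zpow_mul q hq0
    have hv := hv _ rfl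
    have hn : n < 0 := by
      by_contra hn
      rw [hτ.val_zpow_mul rfl n hc hv] at htop
      refine ENNReal.mul_ne_top ?_ enorm_ne_top htop
      rw [ENNReal.zero_zpow_def]
      split_ifs with h6 h7
      exacts [ENNReal.one_ne_top, ENNReal.zero_ne_top, absurd (by omega : 0 < n) h7]
    have h5 : (η.comap ι).val (((t - RatFunc.C β) ^ n * v) ^ 2 * ((t - RatFunc.C β) * w)) ≤ 1 := by
      rw [AnPoint.comap_val, map_mul, map_pow, ← hq.sq, ← mul_pow, η.val_pow]
      exact pow_le_one₀ zero_le hle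
    have e : ((t - RatFunc.C β) ^ n * v) ^ 2 * ((t - RatFunc.C β) * w) =
        (t - RatFunc.C β) ^ (2 * n + 1) * (v ^ 2 * w) := by
      rw [zpow_add₀ hτ.ne_zero, zpow_one, mul_comm 2 n, zpow_mul]
      norm_cast; ring
    rw [e, hτ.val_zpow_mul rfl _ (mul_ne_zero (pow_ne_zero 2 hc) hb0) ((hv.pow 2).mul hb),
      ENNReal.zero_zpow_def, if_neg (by omega), if_neg (by omega),
      ENNReal.top_mul (by simpa using ⟨hc, hb0⟩)] at h5
    simp at h5
  intro ξ hξ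
  refine (val_le_gaussPt_val ht hB hfin hξ).trans ?_
  obtain ⟨η, hη⟩ := hsurj (gaussPt ht 0 1)
  -- By the maximum principle the bound on `q` is needed only at the Gauss point, where `|y| = 1`
  -- and the bound on `q y` is one on `q`.
  have hG : (gaussPt ht 0 1).val F' = 1 := by
    obtain ⟨R, w, rfl, -, h1, -, -, h3⟩ := hF
    have h4 : (gaussPt ht 0 1).val (∏ α ∈ R, (t - RatFunc.C α)) = 1 :=
      AnPoint.val_prod_eq_one _ _ fun α hα => gaussPt_val_linear ht (h1 α hα)
    rw [AnPoint.val_mul_of_left _ (by simp [h4]) (by simp [h4]), h4,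
      h3 _ (gaussPt_mem_stdAffinoid ht), one_mul]
  have hy1 : η.val y = 1 := by
    have := hysq η
    rw [hη, hG] at this
    refine le_antisymm (η.val_le_one_of_sq (by rw [η.val_pow, this])) (not_lt.1 fun h => ?_)
    exact absurd this (pow_lt_one₀ zero_le h two_ne_zero).ne
  have := hqy η (by rw [Set.mem_preimage, hη]; exact gaussPt_mem_stdAffinoid ht)
  rwa [η.val_mul_of_right (by simp [hy1]) (by simp [hy1]), hy1, mul_one, ← AnPoint.comap_val,
    hη] at this

omit hsurj in
/-- Near a point of the other sheet, a function that is close to `1` on the sheet `y ≡ 1` and small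
on the other one bounds a given function. -/
theorem IsQuadratic.exists_local_multiplier {Z : Set (P1an K)}
    (hF : ∀ ξ ∈ Z, ξ.val (F' - 1) < 1) (x : L) {η₀ : AnPoint K L} (hη₀ : η₀.comap ι ∈ Z)
    (hη₀' : η₀.val (y + 1) < 1) :
    ∃ E : L, (∀ η : AnPoint K L, η.val (y - 1) < 1 → η.val (E - 1) < 1) ∧
      (∀ η : AnPoint K L, η.val (y + 1) < 1 → η.val E ≤ 1) ∧ η₀.val (x * E) < 1 := by
  have h20 : (2 : K) ≠ 0 := by rw [← norm_ne_zero_iff, h2]; exact one_ne_zero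
  have h21 : ‖(2 : K)⁻¹‖ₑ = 1 := by rw [← ofReal_norm, norm_inv, h2, inv_one, ENNReal.ofReal_one]
  -- An approximate idempotent: close to `1` on the sheet `y ≡ 1` and small on the sheet `y ≡ -1`.
  set e : L := algebraMap K L 2⁻¹ * (y + 1) with he
  have he1 : ∀ η : AnPoint K L, η.val (y - 1) < 1 → η.val (e - 1) < 1 := by
    intro η hη
    have : e - 1 = algebraMap K L 2⁻¹ * (y - 1) := by
      have : (2 : L) ≠ 0 := by
        rw [← map_ofNat (algebraMap K L) 2]; exact (_root_.map_ne_zero _).2 h20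
      rw [he, map_inv₀, map_ofNat]; field_simp; ring
    rw [this, η.val_const_mul (inv_ne_zero h20), h21, one_mul]
    exact hη
  have he2 : ∀ η : AnPoint K L, η.val (y + 1) < 1 → η.val e < 1 := by
    intro η hη
    rwa [he, η.val_const_mul (inv_ne_zero h20), h21, one_mul]
  have hpow : ∀ (E : L) (N : ℕ), (∀ η : AnPoint K L, η.val (y - 1) < 1 → η.val (E - 1) < 1) →
      ∀ η : AnPoint K L, η.val (y - 1) < 1 → η.val (E ^ N - 1) < 1 := by
    intro E N hE η hη
    have := η.val_prod_sub_one_lt (Finset.range N) (fun _ => E) fun _ _ => hE η hη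
    simpa using this
  -- If `x` is finite at `η₀`, a high power of `e` makes the product small. At a pole of `x` an
  -- actual zero is needed, so the value `e0` of `e` at `η₀` is subtracted and the difference is
  -- renormalised to stay close to `1` on the sheet `y ≡ 1`.
  by_cases htop : η₀.val x = ⊤
  · obtain ⟨τ, hτ⟩ := exists_isUniformizer_of_isClassical
      (hq.isClassical_iff.1 (η₀.isClassical_of_val_eq_top htop))
    have hF1 : (η₀.comap ι).val F' = 1 := by
      rw [← AnPoint.val_one (η₀.comap ι)]
      exact AnPoint.val_eq_of_sub_lt _ (by rw [AnPoint.val_one]; exact hF _ hη₀)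
    obtain ⟨d, hd⟩ := hτ.exists_of_val_ne_top (g := F') (by rw [hF1]; simp)
    obtain ⟨b, rfl⟩ := IsAlgClosed.exists_pow_nat_eq d two_pos
    have hb0 : b ≠ 0 := by
      rintro rfl
      rw [hd.val_eq] at hF1
      simp at hF1
    have hyb : ∃ c : K, c ≠ 0 ∧ η₀.HasValue y c := by
      have h3 : η₀.HasValue (y ^ 2) (b ^ 2) := by
        rw [hq.sq]
        unfold AnPoint.HasValue at hd ⊢
        rwa [AnPoint.comap_val, map_sub, AlgHom.commutes] at hd
      rcases h3.of_sq with h | h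
      exacts [⟨b, hb0, h⟩, ⟨-b, neg_ne_zero.2 hb0, h⟩]
    obtain ⟨c, hc0, hc⟩ := hyb
    have hu : IsUniformizer {η₀} (ι τ) :=
      (hq.isUniformizer_of_hasValue_sq h20 hτ hc0).mono (by rintro _ rfl; exact ⟨rfl, hc⟩)
    have hx0 : x ≠ 0 := by rintro rfl; simp at htop
    obtain ⟨n, w, a, ha, rfl, hw⟩ := hu.exists_zpow_mul x hx0
    have hw := hw _ rfl
    have hn : n < 0 := by
      by_contra hn
      rw [hu.val_zpow_mul rfl n ha hw] at htop
      refine ENNReal.mul_ne_top ?_ enorm_ne_top htop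
      rw [ENNReal.zero_zpow_def]
      split_ifs with h6 h7
      exacts [ENNReal.one_ne_top, ENNReal.zero_ne_top, absurd (by omega : 0 < n) h7]
    have hev : η₀.HasValue e (2⁻¹ * (c + 1)) := by
      have := (AnPoint.HasValue.const (ξ := η₀) (2 : K)⁻¹).mul
        (hc.add (AnPoint.HasValue.const (1 : K)))
      rwa [map_one] at this
    set e0 : K := 2⁻¹ * (c + 1) with he0
    have he0' : ‖e0‖ₑ < 1 := by rw [← hev.val_eq]; exact he2 _ hη₀'
    have hne : ‖1 - e0‖ₑ = 1 := by
      have h4 : η₀.val (algebraMap K L (1 - e0)) = η₀.val (1 : L) := by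
        refine η₀.val_eq_of_sub_lt ?_
        rw [map_sub, map_one, sub_sub_cancel_left, η₀.val_neg, η₀.val_const, η₀.val_one]
        exact he0'
      rwa [η₀.val_const, η₀.val_one] at h4
    have hne0 : 1 - e0 ≠ 0 := by intro h; rw [h] at hne; simp at hne
    have hk : ‖(1 - e0)⁻¹‖ₑ = 1 := by rw [enorm_inv hne0, hne, inv_one]
    obtain ⟨g', b', hg', hb'⟩ := hu.exists_mul_of_hasValue_zero (g := e - algebraMap K L e0) (by
      have := hev.sub (.const e0)
      rwa [sub_self] at this)
    set k : L := algebraMap K L (1 - e0)⁻¹ with hkdef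
    -- The exponent exceeds the pole order of `x` by one, so that the product vanishes at `η₀`.
    refine ⟨(k * (e - algebraMap K L e0)) ^ ((-n).toNat + 1), hpow _ _ fun η hη => ?_,
      fun η hη => ?_, ?_⟩
    · have e1 : k * (e - algebraMap K L e0) - 1 = k * (e - 1) := by
        have : algebraMap K L (1 - e0) ≠ 0 := (_root_.map_ne_zero _).2 hne0
        rw [hkdef, map_inv₀]
        rw [map_sub, map_one] at this ⊢
        field_simp; ring
      rw [e1, hkdef, η.val_const_mul (inv_ne_zero hne0), hk, one_mul]
      exact he1 η hη
    · rw [η.val_pow, hkdef, η.val_const_mul (inv_ne_zero hne0), hk, one_mul]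
      refine pow_le_one₀ zero_le ((η.val_sub _ _).trans (max_le (he2 η hη).le ?_))
      rw [η.val_const]; exact he0'.le
    · have e1 : ι τ ^ n * w * (k * (e - algebraMap K L e0)) ^ ((-n).toNat + 1) =
          ι τ * (k ^ ((-n).toNat + 1) * (g' ^ ((-n).toNat + 1) * w)) := by
        have h4 : ι τ ^ n * ι τ ^ ((-n).toNat + 1) = ι τ := by
          rw [← zpow_natCast, ← zpow_add₀ hu.ne_zero]
          have : n + (((-n).toNat + 1 : ℕ) : ℤ) = 1 := by omega
          rw [this, zpow_one]
        rw [hg', mul_pow, mul_pow]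
        linear_combination (k ^ ((-n).toNat + 1) * g' ^ ((-n).toNat + 1) * w) * h4
      have h5 : η₀.val (k ^ ((-n).toNat + 1) * (g' ^ ((-n).toNat + 1) * w)) ≠ ⊤ :=
        (((AnPoint.HasValue.const _).pow _).mul ((hb'.pow _).mul hw)).val_ne_top
      rw [e1, η₀.val_mul_of_finite (by rw [hu.val_eq _ rfl]; simp) h5, hu.val_eq _ rfl, zero_mul]
      exact one_pos
  · have h3 : Tendsto (fun N : ℕ => η₀.val x * η₀.val e ^ N) atTop (𝓝 (η₀.val x * 0)) :=
      ENNReal.Tendsto.const_mul (ENNReal.tendsto_pow_atTop_nhds_zero_of_lt_one (he2 _ hη₀'))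
        (Or.inr htop)
    rw [mul_zero] at h3
    obtain ⟨N, hN⟩ := (h3.eventually (gt_mem_nhds one_pos)).exists
    refine ⟨e ^ N, hpow e N he1, fun η hη => ?_, ?_⟩
    · rw [η.val_pow]; exact pow_le_one₀ zero_le (he2 η hη).le
    · rw [η₀.val_mul_of_finite htop, η₀.val_pow]
      · exact hN
      · rw [η₀.val_pow]; exact ENNReal.pow_ne_top (ne_top_of_lt (he2 _ hη₀'))

/-- If `F'` is close to `1`, every bounded function on the sheet `y ≡ 1` is close to a bounded
function on the line. -/
theorem IsQuadratic.exists_of_sheet {Z : Set (P1an K)} (hZ : IsClosed Z)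
    (hF : ∀ ξ ∈ Z, ξ.val (F' - 1) < 1) {x : L}
    (hx : x ∈ unitBall {η : AnPoint K L | η.comap ι ∈ Z ∧ η.val (y - 1) < 1}) :
    ∃ p ∈ unitBall Z, ∀ η : AnPoint K L, η.comap ι ∈ Z → η.val (y - 1) < 1 →
      η.val (x - ι p) < 1 := by
  -- The part of the inverse image on the other sheet is compact, so the product of finitely many
  -- local multipliers works on all of it; multiplying by further ones does no harm, as they are
  -- bounded by `1` there.
  obtain ⟨E, hE1, hE2, hE3⟩ : ∃ E : L, (∀ η : AnPoint K L, η.val (y - 1) < 1 → η.val (E - 1) < 1) ∧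
      (∀ η : AnPoint K L, η.val (y + 1) < 1 → η.val E ≤ 1) ∧
      ∀ η ∈ {η : AnPoint K L | η.comap ι ∈ Z ∧ 1 ≤ η.val (y - 1)}, η.val (y + 1) < 1 →
        η.val (x * E) ≤ 1 := by
    have hcl : IsClosed {η : AnPoint K L | η.comap ι ∈ Z ∧ 1 ≤ η.val (y - 1)} :=
      (hZ.preimage (AnPoint.continuous_comap ι)).inter
        (isClosed_le continuous_const (AnPoint.continuous_val _))
    refine hcl.isCompact.induction_on (p := fun O => ∃ E : L,
      (∀ η : AnPoint K L, η.val (y - 1) < 1 → η.val (E - 1) < 1) ∧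
      (∀ η : AnPoint K L, η.val (y + 1) < 1 → η.val E ≤ 1) ∧
      ∀ η ∈ O, η.val (y + 1) < 1 → η.val (x * E) ≤ 1) ?_ ?_ ?_ ?_
    · exact ⟨1, by simp, by simp, by simp⟩
    · rintro O O' h ⟨E, h1, h3, h4⟩
      exact ⟨E, h1, h3, fun η hη => h4 η (h hη)⟩
    · rintro O O' ⟨E, h1, h3, h4⟩ ⟨E', h1', h3', h4'⟩
      refine ⟨E * E', fun η hη => η.val_mul_sub_one_lt (h1 η hη) (h1' η hη),
        fun η hη => η.val_mul_le_one (h3 η hη) (h3' η hη), ?_⟩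
      rintro η (hη | hη) hη'
      · rw [← mul_assoc]; exact η.val_mul_le_one (h4 η hη hη') (h3' η hη')
      · rw [mul_left_comm]; exact η.val_mul_le_one (h3 η hη') (h4' η hη hη')
    · rintro η₀ ⟨hη₀, hη₀'⟩
      obtain ⟨E, h1, h3, h4⟩ := hq.exists_local_multiplier h2 hF x hη₀
        ((hq.val_sub_one_or_add_one η₀ (hF _ hη₀)).resolve_left (not_lt.2 hη₀'))
      refine ⟨{η | η.val (x * E) < 1}, mem_nhdsWithin_of_mem_nhds
        ((isOpen_lt (AnPoint.continuous_val _) continuous_const).mem_nhds h4), E, h1, h3,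
        fun η hη _ => le_of_lt hη⟩
  have hEx : x * E ∈ unitBall (AnPoint.comap ι ⁻¹' Z) := by
    intro η hη
    by_cases h : η.val (y - 1) < 1
    · refine η.val_mul_le_one (hx η ⟨hη, h⟩) ?_
      rw [← η.val_one]
      exact (η.val_eq_of_sub_lt (by rw [η.val_one]; exact hE1 η h)).le
    · exact hE3 η ⟨hη, not_lt.1 h⟩ ((hq.val_sub_one_or_add_one η (hF _ hη)).resolve_left h)
  obtain ⟨p, hp, q, e, hqy⟩ := hq.exists_half h2 hsurj hEx
  have hqb : ∀ η : AnPoint K L, η.comap ι ∈ Z → η.val (ι q) ≤ 1 := by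
    intro η hη
    have hy1 : η.val y = 1 := by
      rcases hq.val_sub_one_or_add_one η (hF _ hη) with h | h
      · rw [← η.val_one]
        exact η.val_eq_of_sub_lt (by rwa [η.val_one])
      · rw [← η.val_one, ← η.val_neg 1]
        exact η.val_eq_of_sub_lt (by rwa [η.val_neg, η.val_one, sub_neg_eq_add])
    have := hqy η hη
    rwa [η.val_mul_of_right (by simp [hy1]) (by simp [hy1]), hy1, mul_one] at this
  -- The product `x E = p + q y` is bounded over all of `Z`. On the given sheet `E ≡ 1` and `y ≡ 1`,
  -- whence `x ≡ p + q`.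
  refine ⟨p + q, fun ξ hξ => (ξ.val_add _ _).trans (max_le (hp ξ hξ) ?_), fun η hη hη1 => ?_⟩
  · obtain ⟨η, rfl⟩ := hsurj ξ
    exact hqb η hξ
  · have e1 : x - ι (p + q) = -(x * (E - 1)) + ι q * (y - 1) := by
      rw [map_add]; linear_combination e
    rw [e1]
    refine (η.val_add _ _).trans_lt (max_lt ?_ (η.val_mul_lt_one (hqb η hη) hη1))
    rw [η.val_neg]
    exact η.val_mul_lt_one (hx η ⟨hη, hη1⟩) (hE1 η hη1)

end Sheets

end BerkovichCover

/-! ### Absence of self-edges, and the conclusion -/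

namespace BerkovichCover

open Topology Filter
open scoped NNReal

set_option linter.unusedSectionVars false

section Cores

variable {K F L : Type} [NormedField K] [IsUltrametricDist K] [Field F] [Algebra K F] [Field L]
  [Algebra K L] {π : AnPoint K L → AnPoint K F} {σ : AnPoint K L → AnPoint K L}
  {C : Set (Set (AnPoint K F))}

/-- Another component over the same `U` is disjoint from `Y`, so only the sets over other elements
of the covering are removed from `Y`. -/
theorem core_pullbackCovering (h : IsInvolutiveCover π σ) (hC : ∀ U ∈ C, IsConnected U)
    {U : Set (AnPoint K F)} (hU : U ∈ C) {Y : Set (AnPoint K L)} (hY : IsComponentOf Y (π ⁻¹' U)) :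
    core (pullbackCovering π C) Y = Y ∩ π ⁻¹' core C U := by
  ext η
  simp only [core, Set.mem_sdiff, Set.mem_iUnion, Set.mem_inter_iff, Set.mem_preimage,
    Set.mem_singleton_iff, exists_prop, not_exists, not_and]
  refine and_congr_right fun hη => ⟨fun h1 => ⟨hY.subset hη, ?_⟩, ?_⟩
  · rintro V ⟨hV, hVU⟩ hηV
    have hY' := isComponentOf_connectedComponentIn (A := π ⁻¹' V) (x := η) hηV
    refine h1 _ ⟨⟨V, hV, hY'⟩, ?_⟩ (mem_connectedComponentIn hηV)
    intro e
    apply hVU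
    rw [← h.component_image (hC V hV) hY', ← h.component_image (hC U hU) hY, e]
  · rintro ⟨-, h1⟩ Y' ⟨⟨V, hV, hY'⟩, hne⟩ hηY'
    refine h1 V ⟨hV, ?_⟩ (hY'.subset hηY')
    rintro rfl
    exact hne (hY'.eq_of_inter hY ⟨η, hηY', hη⟩)

end Cores

section Line

variable {K : Type} [NormedField K] [IsUltrametricDist K] [IsAlgClosed K] {t : RatFunc K}
  {B : Finset K} {C : Set (Set (P1an K))} {S : Set (P1an K)}

theorem isClosed_stdAffinoid : IsClosed (stdAffinoid t B) := by
  have e : stdAffinoid t B = {ξ : P1an K | ξ.val t ≤ 1} ∩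
      ⋂ b ∈ B, {ξ : P1an K | 1 ≤ ξ.val (t - RatFunc.C b)} := by
    ext ξ; simp [stdAffinoid]
  rw [e]
  exact (isClosed_le (AnPoint.continuous_val _) continuous_const).inter
    (isClosed_biInter fun b _ => isClosed_le continuous_const (AnPoint.continuous_val _))

theorem IsGood.exists_core_eq (hgood : IsGood C S) (hC : IsSemistableCovering C) {U : Set (P1an K)}
    (hU : U ∈ C) : ∃ (t : RatFunc K) (_ : IsCoordinate t) (B : Finset K), (∀ b ∈ B, ‖b‖ₑ ≤ 1) ∧
      core C U = stdAffinoid t B ∧ ∀ D, IsResidueDisc t D → (S ∩ U ∩ D).Subsingleton := by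
  obtain ⟨t, ht, ⟨𝒟, hfin, hD, he⟩, hS⟩ := hgood.2 U hU
  have hne : 𝒟.Nonempty := by
    by_contra h
    rw [Set.not_nonempty_iff_eq_empty] at h
    apply (hC.core_affinoid U hU).ne_univ
    rw [he, h, Set.sUnion_empty, Set.compl_empty]
  obtain ⟨s, hs, B, hB, he', hDs⟩ := exists_stdAffinoid ht hfin hD hne
  exact ⟨s, hs, B, hB, he.trans he', fun D hD => hS D (hDs D hD)⟩

theorem IsGood.isEmpty_selfEdge (hgood : IsGood C S) (hC : IsSemistableCovering C) :
    IsEmpty (SelfEdge C) := by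
  refine ⟨fun e => ?_⟩
  obtain ⟨⟨U, hU⟩, M, hM⟩ := e
  obtain ⟨t, ht, B, hB, he, -⟩ := hgood.exists_core_eq hC hU
  refine not_isOrdinaryDoublePoint_of_double (y := 0) (F' := 0) ht hB (AlgHom.id K (RatFunc K))
    (fun η hη => he ▸ hη) (zero_mem _) (fun ξ _ => by simp) (by simp) (fun x hx => ?_)
    (Or.inl ⟨rfl, rfl⟩) M hM
  exact ⟨x, he ▸ hx, 0, fun ξ _ => by simp, fun η _ => by simp⟩

/-- After scaling by a constant, a product of linear functions has simple zeros on the affinoid, if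
the zeros in the affinoid lie in distinct residue discs. -/
theorem exists_hasSimpleZeros (ht : IsCoordinate t) (hB : ∀ b ∈ B, ‖b‖ₑ ≤ 1) (R : Finset K)
    (hR : ∀ α ∈ R, ∀ β ∈ R, ‖α‖ₑ ≤ 1 → ‖β‖ₑ ≤ 1 → (∀ b ∈ B, 1 ≤ ‖α - b‖ₑ) →
      (∀ b ∈ B, 1 ≤ ‖β - b‖ₑ) → α ≠ β → 1 ≤ ‖α - β‖ₑ) :
    ∃ k : K, k ≠ 0 ∧
      HasSimpleZeros t B ((∏ α ∈ R, (t - RatFunc.C α)) * RatFunc.C k ^ 2) := by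
  classical
  let p : K → Prop := fun α => ‖α‖ₑ ≤ 1 ∧ ∀ b ∈ B, 1 ≤ ‖α - b‖ₑ
  have hk : ∀ α, ∃ k : K, k ≠ 0 ∧ (¬ p α → ∀ ξ ∈ stdAffinoid t B,
      ξ.val ((t - RatFunc.C α) * RatFunc.C k) = 1) := by
    intro α
    by_cases hα : ‖α‖ₑ ≤ 1
    · refine ⟨1, one_ne_zero, fun hp ξ hξ => ?_⟩
      have : ∃ b ∈ B, ‖α - b‖ₑ < 1 := by
        by_contra hcon
        push Not at hcon
        exact hp ⟨hα, hcon⟩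
      obtain ⟨b, hb, h⟩ := this
      rw [map_one, mul_one, stdAffinoid.val_linear_of_near hB hξ hb h]
    · push Not at hα
      have hα0 : α ≠ 0 := by rintro rfl; simp at hα
      refine ⟨α⁻¹, inv_ne_zero hα0, fun _ ξ hξ => ?_⟩
      have h1 := stdAffinoid.val_linear_of_large hξ hα
      have h3 : ‖α‖ₑ ≠ 0 := by simpa using hα0
      rw [ξ.val_mul_of_left (by rwa [h1]) (by rw [h1]; exact enorm_ne_top), h1, P1an.val_C,
        enorm_inv hα0, ENNReal.mul_inv_cancel h3 enorm_ne_top]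
  choose κ hκ0 hκ using hk
  -- The constants that normalise the factors without zeros on the affinoid are collected into a
  -- square, so that the scaling can be absorbed into `y`.
  obtain ⟨k, hk⟩ := IsAlgClosed.exists_pow_nat_eq (∏ α ∈ R.filter fun α => ¬ p α, κ α) two_pos
  refine ⟨k, ?_, R.filter p, ∏ α ∈ R.filter fun α => ¬ p α, ((t - RatFunc.C α) * RatFunc.C (κ α)),
    ?_, ?_, ?_, ?_, ?_, ?_⟩
  · rintro rfl
    rw [zero_pow two_ne_zero, eq_comm, Finset.prod_eq_zero_iff] at hk
    obtain ⟨α, -, h⟩ := hk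
    exact hκ0 α h
  · rw [← map_pow, hk, map_prod, Finset.prod_mul_distrib, ← Finset.prod_filter_mul_prod_filter_not R p]
    ring
  · exact Finset.prod_ne_zero_iff.2 fun α _ =>
      mul_ne_zero (ht.sub_C_ne_zero α) (ratFunc_C_ne_zero (hκ0 α))
  · exact fun α hα => (Finset.mem_filter.1 hα).2.1
  · exact fun α hα => (Finset.mem_filter.1 hα).2.2
  · intro α hα β hβ hne
    obtain ⟨h1, h3, h4⟩ := Finset.mem_filter.1 hα
    obtain ⟨h1', h3', h4'⟩ := Finset.mem_filter.1 hβ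
    exact hR α h1 β h1' h3 h3' h4 h4' hne
  · exact fun ξ hξ => ξ.val_prod_eq_one _ fun α hα => hκ α (Finset.mem_filter.1 hα).2 ξ hξ

end Line

section Hyp

variable {K : Type} [NontriviallyNormedField K] [IsUltrametricDist K] [IsAlgClosed K] {f : K[X]}
  [Fact (Irreducible (X ^ 2 - C (algebraMap K[X] (RatFunc K) f) : (RatFunc K)[X]))]
  {C : Set (Set (P1an K))}

/-- If the inverse image of `U` splits, its components are the two sheets of the square root. -/
theorem exists_component_eq_sheet (h2 : ‖(2 : K)‖ = 1) (hdeg : 0 < f.natDegree)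
    (hroots : f.roots.Nodup) {U : Set (P1an K)} (hU : IsConnected U)
    (hn : ¬ IsConnected (hypProj f ⁻¹' U)) {Y : Set (HypCurve f)}
    (hY : IsComponentOf Y (hypProj f ⁻¹' U)) {g : RatFunc K} (hg : g ≠ 0)
    (hgU : ∀ ξ ∈ U, ξ.val (algebraMap K[X] (RatFunc K) f / g ^ 2 - 1) < 1) :
    ∃ g' : RatFunc K, g' ≠ 0 ∧
      (∀ ξ ∈ U, ξ.val (algebraMap K[X] (RatFunc K) f / g' ^ 2 - 1) < 1) ∧
      ∀ η, η ∈ Y ↔ hypProj f η ∈ U ∧ η.val (hypY f / hypIncl f g' - 1) < 1 := by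
  have h20 : (2 : K) ≠ 0 := by rw [← norm_ne_zero_iff, h2]; exact one_ne_zero
  have hf0 : f ≠ 0 := by rintro rfl; simp at hdeg
  have hcov := isInvolutiveCover_hyp h20 hdeg hroots
  have key : ∀ g : RatFunc K, g ≠ 0 →
      (∀ ξ ∈ U, ξ.val (algebraMap K[X] (RatFunc K) f / g ^ 2 - 1) < 1) →
      Y ⊆ {η | η.val (hypY f / hypIncl f g - 1) < 1} →
      ∀ η, η ∈ Y ↔ hypProj f η ∈ U ∧ η.val (hypY f / hypIncl f g - 1) < 1 := by
    intro g hg hgU hsub η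
    refine ⟨fun h => ⟨hY.subset h, hsub h⟩, fun ⟨h1, h3⟩ => ?_⟩
    rw [hcov.component_dichotomy hU hn hY h1]
    intro h4
    have h5 : (η.comap (hypInvol f)).val (hypY f / hypIncl f g - 1) < 1 := hsub h4
    rw [((isQuadratic_hyp f hf0).twist hg).val_invol_sub_one] at h5
    exact Set.disjoint_left.1 (AnPoint.disjoint_val_sub_one_add_one h2 _) h3 h5
  have hq := (isQuadratic_hyp f hf0).twist hg
  rcases hY.isConnected.isPreconnected.subset_or_subset
    (isOpen_lt (AnPoint.continuous_val _) continuous_const)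
    (isOpen_lt (AnPoint.continuous_val _) continuous_const)
    (AnPoint.disjoint_val_sub_one_add_one h2 (hypY f / hypIncl f g))
    (fun η hη => hq.val_sub_one_or_add_one η (hgU _ (hY.subset hη))) with h | h
  · exact ⟨g, hg, hgU, key g hg hgU h⟩
  -- On the sheet `y / g ≡ -1` the square root `g` is replaced by `-g`.
  · have hgU' : ∀ ξ ∈ U, ξ.val (algebraMap K[X] (RatFunc K) f / (-g) ^ 2 - 1) < 1 := by
      simpa using hgU
    refine ⟨-g, neg_ne_zero.2 hg, hgU', key (-g) (neg_ne_zero.2 hg) hgU' fun η hη => ?_⟩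
    have h1 : η.val (hypY f / hypIncl f g + 1) < 1 := h hη
    rw [Set.mem_ofPred_eq, ← η.val_neg]
    have e : -(hypY f / hypIncl f (-g) - 1) = hypY f / hypIncl f g + 1 := by
      rw [map_neg, div_neg]; ring
    exact (congrArg η.val e).trans_lt h1

/-- If the inverse image of `U` is connected, goodness makes `f`, up to a square, a function with
simple zeros on the core. If it splits, the component is a sheet, and its bounded functions are
close to functions from the line. -/
theorem isEmpty_selfEdge_pullbackCovering (h2 : ‖(2 : K)‖ = 1) (hdeg : 0 < f.natDegree)
    (hroots : f.roots.Nodup) (hC : IsSemistableCovering C) (hgood : IsGood C (rootSet f)) :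
    IsEmpty (SelfEdge (pullbackCovering (hypProj f) C)) := by
  classical
  refine ⟨fun e => ?_⟩
  obtain ⟨⟨Y, U, hU, hY⟩, M, hM⟩ := e
  have h20 : (2 : K) ≠ 0 := by rw [← norm_ne_zero_iff, h2]; exact one_ne_zero
  have hf0 : f ≠ 0 := by rintro rfl; simp at hdeg
  have hq := isQuadratic_hyp f hf0
  have hcov := isInvolutiveCover_hyp h20 hdeg hroots
  have hconn : ∀ U ∈ C, IsConnected U := fun U hU => (hC.wideOpen U hU).isConnected
    ((hC.core_nonempty U hU).mono Set.sdiff_subset) (hC.ne_univ hU)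
  obtain ⟨t, ht, B, hB, he, hS⟩ := hgood.exists_core_eq hC hU
  have hcore := core_pullbackCovering hcov hconn hU hY
  rw [he] at hcore
  have hZU : stdAffinoid t B ⊆ U := he ▸ Set.sdiff_subset
  change MaximalSpectrum (Reduction (core (pullbackCovering (hypProj f) C) Y)) at M
  change IsOrdinaryDoublePoint M at hM
  have hsurj : ∀ ξ : P1an K, ∃ η : HypCurve f, η.comap (hypIncl f) = ξ := surjective_hypProj
  by_cases hn : IsConnected (hypProj f ⁻¹' U)
  · have hcore' : core (pullbackCovering (hypProj f) C) Y =
        AnPoint.comap (hypIncl f) ⁻¹' stdAffinoid t B := by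
      rw [hcore, hY.eq_of_isConnected hn]
      exact Set.inter_eq_right.2 (Set.preimage_mono hZU)
    obtain ⟨h, R, hh, hf⟩ := ht.exists_sq_mul_prod (algebraMap K[X] (RatFunc K) f) hq.ne_zero
    -- Zeros of odd order of `f` in the core are points of `S_f`, and two of them in one residue
    -- disc would contradict goodness.
    obtain ⟨k, hk, hF⟩ := exists_hasSimpleZeros ht hB R (by
      intro α hα β hβ hα1 hβ1 hαB hβB hne
      by_contra hlt
      push Not at hlt
      obtain ⟨ξ, hξ⟩ := ht.exists_hasValue α
      obtain ⟨ζ, hζ⟩ := ht.exists_hasValue β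
      have hD : IsResidueDisc t {η : P1an K | η.val (t - RatFunc.C β) < 1} :=
        Or.inl ⟨β, (enorm_le_one_iff β).1 hβ1, rfl⟩
      have h3 : ξ = ζ := hS _ hD
        ⟨⟨mem_rootSet_of_hasValue h20 hdeg hroots ht hh hf hα hξ,
          hZU ((mem_stdAffinoid_iff hξ).2 ⟨hα1, hαB⟩)⟩, by
          rw [Set.mem_ofPred_eq, (hξ.sub_C β).val_eq]; exact hlt⟩
        ⟨⟨mem_rootSet_of_hasValue h20 hdeg hroots ht hh hf hβ hζ,
          hZU ((mem_stdAffinoid_iff hζ).2 ⟨hβ1, hβB⟩)⟩, by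
          rw [Set.mem_ofPred_eq, (hζ.sub_C β).val_eq]; simp⟩
      rw [h3] at hξ
      exact hne (hξ.unique hζ))
    have hkC := ratFunc_C_ne_zero hk
    have hq' := hq.twist (div_ne_zero hh hkC)
    have eF : algebraMap K[X] (RatFunc K) f / (h / RatFunc.C k) ^ 2 =
        (∏ α ∈ R, (t - RatFunc.C α)) * RatFunc.C k ^ 2 := by
      rw [hf]; field_simp
    rw [eF] at hq'
    refine not_isOrdinaryDoublePoint_of_double ht hB (hypIncl f) (fun η hη => ?_) (fun η hη => ?_)
      hF.mem_unitBall hq'.sq (fun x hx => ?_) (Or.inr ⟨h2, hF⟩) M hM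
    · rw [hcore'] at hη; exact hη
    · rw [hcore'] at hη
      refine η.val_le_one_of_sq ?_
      rw [hq'.sq]
      exact hF.mem_unitBall _ hη
    · rw [hcore'] at hx
      obtain ⟨p, hp, q, hq, rfl⟩ := hq'.exists_of_hasSimpleZeros h2 hsurj ht hB hF hx
      exact ⟨p, hp, q, hq, fun η _ => by simp⟩
  · have hSU : ∀ ξ ∈ rootSet f, ξ ∉ U := by
      intro ξ hξ hξU
      obtain ⟨η, hη, rfl⟩ := (bijOn_weierstrassPoints h20 hdeg hroots).2.2 hξ
      exact hn (hcov.isConnected_of_fixed (hconn U hU) hξU hη.2)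
    rcases exists_sq_or_exists_odd_edge h2 hdeg hroots hC hU hSU with
      ⟨g, hg, hgU⟩ | ⟨V, -, -, Z, hZ, hcon⟩
    · obtain ⟨g, hg, hgU, hYg⟩ := exists_component_eq_sheet h2 hdeg hroots (hconn U hU) hn hY hg hgU
      have hcore' : core (pullbackCovering (hypProj f) C) Y =
          {η | η.comap (hypIncl f) ∈ stdAffinoid t B ∧ η.val (hypY f / hypIncl f g - 1) < 1} := by
        rw [hcore]
        ext η
        rw [Set.mem_inter_iff, hYg, Set.mem_preimage, Set.mem_ofPred_eq]
        exact ⟨fun h => ⟨h.2, h.1.2⟩, fun h => ⟨⟨hZU h.1, h.2⟩, h.1⟩⟩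
      refine not_isOrdinaryDoublePoint_of_double (y := 0) (F' := 0) ht hB (hypIncl f)
        (fun η hη => ?_) (zero_mem _) (fun ξ _ => by simp) (by simp) (fun x hx => ?_)
        (Or.inl ⟨rfl, rfl⟩) M hM
      · rw [hcore'] at hη; exact hη.1
      · rw [hcore'] at hx
        obtain ⟨p, hp, h⟩ := (hq.twist hg).exists_of_sheet h2 hsurj isClosed_stdAffinoid
          (fun ξ hξ => hgU ξ (hZU hξ)) hx
        refine ⟨p, hp, 0, fun ξ _ => by simp, fun η hη => ?_⟩
        rw [hcore'] at hη
        rw [mul_zero, add_zero]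
        exact h η hη.1 hη.2
    · exact hcov.not_isConnected_mono (hconn U hU) hn hZ.isConnected.nonempty
        (hZ.subset.trans Set.inter_subset_left) hcon

end Hyp

end BerkovichCover

theorem mainTheorem10 (p : ℕ) [Fact p.Prime] (hp : p ≠ 2)
    (f : ℂ_[p][X]) (hdeg : 0 < f.natDegree) (hroots : f.roots.Nodup)
    (C : Set (Set (BerkovichCover.P1an ℂ_[p])))
    (hC : BerkovichCover.IsSemistableCovering C)
    (hgood : BerkovichCover.IsGood C (BerkovichCover.rootSet f)) :
    ∃ φ : (BerkovichCover.dualGraph (BerkovichCover.inducedCovering f C)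
        (BerkovichCover.weierstrassPoints f)).Iso (BerkovichCover.hypGraph f C),
      (∀ Y : ↥(BerkovichCover.inducedCovering f C), ∃ U : ↥C,
        BerkovichCover.HGraph.double.projV _ _ (φ.onV Y) = U ∧
          BerkovichCover.hypProj f '' Y.1 = U.1) ∧
      (∀ e : BerkovichCover.CrossEdge (BerkovichCover.inducedCovering f C),
        ∃ e' : BerkovichCover.CrossEdge C,
          BerkovichCover.HGraph.double.projE _ _ (φ.onE (Sum.inl e)) = Sum.inl e' ∧
            BerkovichCover.hypProj f '' e.1.2 = e'.1.2) ∧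
      (∀ w : ↥(BerkovichCover.weierstrassPoints f), ∃ s : ↥(BerkovichCover.rootSet f),
        BerkovichCover.HGraph.double.projH _ _ (φ.onH w) = s ∧
          BerkovichCover.hypProj f w.1 = s.1) := by
  -- This is where `p` being odd enters: it makes the two sheets of a square root distinguishable in
  -- the reduction.
  have h2 : ‖(2 : ℂ_[p])‖ = 1 := by
    have h := PadicComplex.norm_extends' p (2 : ℚ_[p])
    have e : algebraMap ℚ_[p] ℂ_[p] 2 = 2 := map_ofNat _ 2
    have h3 := (Padic.norm_natCast_eq_one_iff (p := p) (n := 2)).2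
      ((Nat.coprime_primes Fact.out Nat.prime_two).2 hp)
    rw [← e]
    refine Eq.trans h ?_
    exact_mod_cast h3
  have h20 : (2 : ℂ_[p]) ≠ 0 := by rw [← norm_ne_zero_iff, h2]; exact one_ne_zero
  have : Fact (Irreducible (X ^ 2 - Polynomial.C (algebraMap ℂ_[p][X] (RatFunc ℂ_[p]) f) :
    (RatFunc ℂ_[p])[X])) := ⟨BerkovichCover.irreducible_sq_sub f hdeg hroots⟩
  have hself := hgood.isEmpty_selfEdge hC
  -- The genus formula writes `0` as a sum of non-negative terms, one of which is the Betti number.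
  have hb : (BerkovichCover.dualGraph C ∅).bettiOne = 0 := by
    have h := hC.genus_eq
    rw [BerkovichCover.genus_ratFunc, eq_comm, add_eq_zero] at h
    exact h.2
  exact BerkovichCover.exists_iso_double (BerkovichCover.isInvolutiveCover_hyp h20 hdeg hroots)
    hC.finite (fun U hU => (hC.wideOpen U hU).isConnected
      ((hC.core_nonempty U hU).mono Set.sdiff_subset) (hC.ne_univ hU))
    (BerkovichCover.IsEvenEdge f C) (fun e => Iff.rfl) hself
    (BerkovichCover.isEmpty_selfEdge_pullbackCovering h2 hdeg hroots hC hgood)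
    (BerkovichCover.evenVertex_iff h2 hdeg hroots hC hself)
    (BerkovichCover.bijOn_weierstrassPoints h20 hdeg hroots) hb
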